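/- Let $n,r,s,t,k\ge 1$ be integers, let $A_1,\dots,A_n\in\mathbb Z^{r\times t}$ and $B_1,\dots,B_n\in\mathbb Z^{s\times t}$, and let $\mathcal A$ be the $n$-fold matrix $$\mathcal A=\begin{pmatrix}A_1&A_2&\cdots&A_n\\ B_1&0&\cdots&0\\ 0&B_2&\cdots&0\\ \vdots&\vdots&\ddots&\vdots\\ 0&0&\cdots&B_n\end{pmatrix}.$$ Let $\Delta\ge 2$ be an upper bound on the absolute values of the entries of $\mathcal A$, and let $c\in\mathbb Z^{nt}$. The $nt$ variables are divided into $n$ consecutive bricks of length $t$. Fix a partition $P$ of the $n$ bricks into $k^2$ disjoint sets $P_1,\dots,P_{k^2}$, some of which may be empty. For bounds $\bar\ell\in\mathbb Z_{\le 0}^{nt}$ and $\bar u\in\mathbb Z_{\ge 0}^{nt}$, a *$(P,k)$-best step* is a vector that maximizes $c^Tx$ among all $x\in\mathbb Z^{nt}$ with $\mathcal Ax=0$ and $\bar\ell\le x\le\bar u$ such that, for every nonempty $P_j$, there is a brick $B_j\in P_j$ with $\sum_{i\in B_j}|x_i|\le k$ and with $x_i=0$ for all variables $i$ in the other bricks of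 $P_j$. Consider the problem of maintaining a $(P,k)$-best step while the bounds $\bar\ell,\bar u$ change, on a random access machine with integer cells on which every memory access, addition, subtraction and comparison of integers takes one step. There are one initialization program, one update program and one absolute constant $C$ such that the following holds for all such $n,r,s,t,k,\Delta,\mathcal A,c,P$ and all initial bounds. Given the input, the initialization program computes a $(P,k)$-best step (as the list of its nonzero entries) within $$k^{Cr}\cdot\Delta^{C(r^2+s^2)}\cdot nt$$ steps. Afterwards, for every sequence of changes, each of which replaces the lower and the upper bound of a single variable, every run of the update program (one after each change, on the memory left by the run before) computes a $(P,k)$-best step for the current bounds, as the list of its nonzero entries, within $$k^{Cr}\cdot\Delta^{C(r^2+s^2)}\cdot(\lfloor\log_2(nt)\rfloor+1)$$ steps. In short: time $k^{O(r)}\Delta^{O(r^2+s^2)}\cdot nt$ initially and $k^{O(r)}\Delta^{O(r^2+s^2)}\cdot\log(nt)$ per update. -/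

import Mathlib

open scoped Matrix

/-! ### The machine model: a random access machine with a step count -/

/-- The memory of the machine: countably many arrays of integer cells. `μ a z` is the content of
cell `z` of array `a`. A program names its arrays explicitly, so it uses only finitely many of
them (an array of which only cell `0` is used is a register), but it computes cell indices. -/
abbrev RamMemory : Type := ℕ → ℤ → ℤ

/-- `μ.write a z v` is the memory `μ` with `v` stored in cell `z` of array `a`. -/
def RamMemory.write (μ : RamMemory) (a : ℕ) (z v : ℤ) : RamMemory :=
  fun a' z' => if a' = a ∧ z' = z then v else μ a' z'

/-- Expressions: integer constants, indirect reads, addition and subtraction. -/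
inductive RamExpr : Type where
  | lit (v : ℤ) : RamExpr
  | load (a : ℕ) (index : RamExpr) : RamExpr
  | add (e₁ e₂ : RamExpr) : RamExpr
  | sub (e₁ e₂ : RamExpr) : RamExpr

/-- The value of an expression. -/
def RamExpr.eval (μ : RamMemory) : RamExpr → ℤ
  | .lit v => v
  | .load a e => μ a (e.eval μ)
  | .add e₁ e₂ => e₁.eval μ + e₂.eval μ
  | .sub e₁ e₂ => e₁.eval μ - e₂.eval μ

/-- The number of steps that evaluating an expression takes: one for every constant, every memory
access and every arithmetic operation. -/
def RamExpr.cost : RamExpr → ℕ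
  | .lit _ => 1
  | .load _ e => e.cost + 1
  | .add e₁ e₂ => e₁.cost + e₂.cost + 1
  | .sub e₁ e₂ => e₁.cost + e₂.cost + 1

/-- Programs: `store a e₁ e₂` is the assignment `a[e₁] := e₂`; the test of
`ite e₁ e₂ p q` (`if e₁ ≤ e₂ then p else q`) and of `loop e₁ e₂ p` (`while e₁ ≤ e₂ do p`)
is a comparison of two integers. -/
inductive RamProg : Type where
  | skip : RamProg
  | store (a : ℕ) (e₁ e₂ : RamExpr) : RamProg
  | seq (p q : RamProg) : RamProg
  | ite (e₁ e₂ : RamExpr) (p q : RamProg) : RamProg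
  | loop (e₁ e₂ : RamExpr) (p : RamProg) : RamProg

/-- `RamExec p μ T μ'`: started on the memory `μ`, the program `p` halts after exactly `T` steps
and leaves the memory `μ'`. Assignments, tests and `skip` take one step each, in addition to the
evaluation of their expressions. -/
inductive RamExec : RamProg → RamMemory → ℕ → RamMemory → Prop where
  | skip (μ : RamMemory) : RamExec .skip μ 1 μ
  | store (μ : RamMemory) (a : ℕ) (e₁ e₂ : RamExpr) :
      RamExec (.store a e₁ e₂) μ (e₁.cost + e₂.cost + 1) (μ.write a (e₁.eval μ) (e₂.eval μ))
  | seq {p q : RamProg} {μ μ' μ'' : RamMemory} {T T' : ℕ} :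
      RamExec p μ T μ' → RamExec q μ' T' μ'' → RamExec (.seq p q) μ (T + T') μ''
  | ite_true {e₁ e₂ : RamExpr} {p q : RamProg} {μ μ' : RamMemory} {T : ℕ} :
      e₁.eval μ ≤ e₂.eval μ → RamExec p μ T μ' →
      RamExec (.ite e₁ e₂ p q) μ (e₁.cost + e₂.cost + 1 + T) μ'
  | ite_false {e₁ e₂ : RamExpr} {p q : RamProg} {μ μ' : RamMemory} {T : ℕ} :
      ¬ e₁.eval μ ≤ e₂.eval μ → RamExec q μ T μ' →
      RamExec (.ite e₁ e₂ p q) μ (e₁.cost + e₂.cost + 1 + T) μ'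
  | loop_true {e₁ e₂ : RamExpr} {p : RamProg} {μ μ' μ'' : RamMemory} {T T' : ℕ} :
      e₁.eval μ ≤ e₂.eval μ → RamExec p μ T μ' → RamExec (.loop e₁ e₂ p) μ' T' μ'' →
      RamExec (.loop e₁ e₂ p) μ (e₁.cost + e₂.cost + 1 + T + T') μ''
  | loop_false {e₁ e₂ : RamExpr} {p : RamProg} {μ : RamMemory} :
      ¬ e₁.eval μ ≤ e₂.eval μ →
      RamExec (.loop e₁ e₂ p) μ (e₁.cost + e₂.cost + 1) μ

/-- The machine is deterministic: the number of steps and the final memory are determined by the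
program and the initial memory. -/
theorem RamExec.deterministic {p : RamProg} {μ μ₁ : RamMemory} {T₁ : ℕ}
    (h₁ : RamExec p μ T₁ μ₁) :
    ∀ {T₂ : ℕ} {μ₂ : RamMemory}, RamExec p μ T₂ μ₂ → T₁ = T₂ ∧ μ₁ = μ₂ := by
  induction h₁ with
  | skip => intro _ _ h; cases h; exact ⟨rfl, rfl⟩
  | store => intro _ _ h; cases h; exact ⟨rfl, rfl⟩
  | seq _ _ ih ih' =>
    intro _ _ h
    cases h with
    | seq g g' =>
      obtain ⟨rfl, rfl⟩ := ih g
      obtain ⟨rfl, rfl⟩ := ih' g'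
      exact ⟨rfl, rfl⟩
  | ite_true t _ ih =>
    intro _ _ h
    cases h with
    | ite_true _ g => obtain ⟨rfl, rfl⟩ := ih g; exact ⟨rfl, rfl⟩
    | ite_false f _ => exact absurd t f
  | ite_false t _ ih =>
    intro _ _ h
    cases h with
    | ite_true f _ => exact absurd f t
    | ite_false _ g => obtain ⟨rfl, rfl⟩ := ih g; exact ⟨rfl, rfl⟩
  | loop_true t _ _ ih ih' =>
    intro _ _ h
    cases h with
    | loop_true _ g g' =>
      obtain ⟨rfl, rfl⟩ := ih g
      obtain ⟨rfl, rfl⟩ := ih' g'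
      exact ⟨rfl, rfl⟩
    | loop_false f => exact absurd t f
  | loop_false t =>
    intro _ _ h
    cases h with
    | loop_true f _ _ => exact absurd f t
    | loop_false _ => exact ⟨rfl, rfl⟩

/-! ### `n`-folds and best steps -/

/-- The `n`-fold matrix with blocks `A₁, …, Aₙ` next to each other in the first `r` rows and
`B₁, …, Bₙ` along the diagonal underneath. Its columns (the variables) are indexed by pairs of a
brick and a position in that brick. -/
def nFoldMatrix {n r s t : ℕ} (A : Fin n → Matrix (Fin r) (Fin t) ℤ)
    (B : Fin n → Matrix (Fin s) (Fin t) ℤ) :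
    Matrix (Fin r ⊕ Fin n × Fin s) (Fin n × Fin t) ℤ :=
  fun row col =>
    match row with
    | .inl p => A col.1 p col.2
    | .inr (i, p) => if i = col.1 then B i p col.2 else 0

/-- The part of the data that stays fixed: the blocks of an `n`-fold, an objective `c`, and a
partition of the `n` bricks into `k²` disjoint (possibly empty) sets, given by the map `P` that
sends a brick to the index of its set. -/
structure NFoldInstance (n r s t k : ℕ) where
  A : Fin n → Matrix (Fin r) (Fin t) ℤ
  B : Fin n → Matrix (Fin s) (Fin t) ℤ
  c : Fin n × Fin t → ℤ
  P : Fin n → Fin (k ^ 2)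

/-- Lower bounds `≤ 0` and upper bounds `≥ 0` on the variables. -/
structure StepBounds (n t : ℕ) where
  lo : Fin n × Fin t → ℤ
  up : Fin n × Fin t → ℤ
  lo_nonpos : ∀ v, lo v ≤ 0
  up_nonneg : ∀ v, 0 ≤ up v

/-- A change to the bounds of the single variable `var`. -/
structure BoundChange (n t : ℕ) where
  var : Fin n × Fin t
  lo : ℤ
  up : ℤ
  lo_nonpos : lo ≤ 0
  up_nonneg : 0 ≤ up

/-- The bounds after a change. -/
def StepBounds.change {n t : ℕ} (b : StepBounds n t) (w : BoundChange n t) : StepBounds n t where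
  lo := Function.update b.lo w.var w.lo
  up := Function.update b.up w.var w.up
  lo_nonpos := by
    intro v
    rcases eq_or_ne v w.var with rfl | h
    · simpa using w.lo_nonpos
    · simpa [Function.update_of_ne h] using b.lo_nonpos v
  up_nonneg := by
    intro v
    rcases eq_or_ne v w.var with rfl | h
    · simpa using w.up_nonneg
    · simpa [Function.update_of_ne h] using b.up_nonneg v

namespace NFoldInstance

variable {n r s t k : ℕ}

/-- The feasible solutions of the `(P, k)`-best step problem: integral `x` with `𝒜 x = 0`, within
the bounds, such that every nonempty set of the partition has a brick `i` on which `x` has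
`ℓ₁`-norm at most `k`, while `x` vanishes on all the other bricks of that set. -/
def IsStep (I : NFoldInstance n r s t k) (b : StepBounds n t) (x : Fin n × Fin t → ℤ) : Prop :=
  nFoldMatrix I.A I.B *ᵥ x = 0 ∧
  (∀ j : Fin (k ^ 2), (∃ i, I.P i = j) →
    ∃ i, I.P i = j ∧ ∑ q, |x (i, q)| ≤ (k : ℤ) ∧
      ∀ i', I.P i' = j → i' ≠ i → ∀ q, x (i', q) = 0) ∧
  ∀ v, b.lo v ≤ x v ∧ x v ≤ b.up v

/-- A `(P, k)`-best step: a feasible solution that maximizes `cᵀx`. -/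
def IsBestStep (I : NFoldInstance n r s t k) (b : StepBounds n t) (x : Fin n × Fin t → ℤ) :
    Prop :=
  I.IsStep b x ∧ ∀ y, I.IsStep b y → I.c ⬝ᵥ y ≤ I.c ⬝ᵥ x

/-! ### Input and output conventions

The arrays `0, …, 6` hold the input of the initial computation: the parameters, the blocks `Aᵢ`
and `Bᵢ` (row by row), the objective, the partition and the bounds. Array `7` receives the
changes of the bounds. The arrays `8, …, 11` hold the output. -/

/-- The memory holds the input, and every array that is not an input array is filled with `0`.
(Nothing is assumed about cells outside the ranges that the input occupies in its arrays.) -/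
structure IsInput (I : NFoldInstance n r s t k) (b : StepBounds n t) (μ : RamMemory) : Prop where
  n_eq : μ 0 0 = n
  r_eq : μ 0 1 = r
  s_eq : μ 0 2 = s
  t_eq : μ 0 3 = t
  k_eq : μ 0 4 = k
  A_eq : ∀ (i : Fin n) (p : Fin r) (q : Fin t),
    μ 1 (((i : ℤ) * r + (p : ℤ)) * t + (q : ℤ)) = I.A i p q
  B_eq : ∀ (i : Fin n) (p : Fin s) (q : Fin t),
    μ 2 (((i : ℤ) * s + (p : ℤ)) * t + (q : ℤ)) = I.B i p q
  c_eq : ∀ (i : Fin n) (q : Fin t), μ 3 ((i : ℤ) * t + (q : ℤ)) = I.c (i, q)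
  P_eq : ∀ i : Fin n, μ 4 (i : ℤ) = ((I.P i : ℕ) : ℤ)
  lo_eq : ∀ (i : Fin n) (q : Fin t), μ 5 ((i : ℤ) * t + (q : ℤ)) = b.lo (i, q)
  up_eq : ∀ (i : Fin n) (q : Fin t), μ 6 ((i : ℤ) * t + (q : ℤ)) = b.up (i, q)
  zero_eq : ∀ a : ℕ, 7 ≤ a → ∀ z : ℤ, μ a z = 0

end NFoldInstance

/-- The memory after the change `w` has been announced to the machine: array `7` receives the brick
and the position of the variable and its new bounds; nothing else is touched. -/
def RamMemory.announce {n t : ℕ} (μ : RamMemory) (w : BoundChange n t) : RamMemory :=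
  (((μ.write 7 0 (w.var.1 : ℤ)).write 7 1 (w.var.2 : ℤ)).write 7 2 w.lo).write 7 3 w.up

/-- The memory shows the vector `x` as output: cell `0` of array `8` is the number of nonzero
entries of `x`, and the arrays `9`, `10`, `11` list their bricks, positions and values, every
nonzero entry once. -/
def RamMemory.Shows {n t : ℕ} (μ : RamMemory) (x : Fin n × Fin t → ℤ) : Prop :=
  ∃ L : List (Fin n × Fin t), L.Nodup ∧ (∀ v, v ∈ L ↔ x v ≠ 0) ∧
    μ 8 0 = L.length ∧
    ∀ (m : ℕ) (hm : m < L.length),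
      μ 9 (m : ℤ) = ((L[m].1 : ℕ) : ℤ) ∧ μ 10 (m : ℤ) = ((L[m].2 : ℕ) : ℤ) ∧
        μ 11 (m : ℤ) = x L[m]

/-- `I.Maintains upd T b μ ws`: on a machine with memory `μ`, at the time when the bounds are `b`,
let the changes in the list `ws` arrive one after the other, each followed by a run of the program
`upd` on the memory left by the previous run. Then every run halts within `T` steps and shows a
`(P, k)`-best step for the bounds that are current at that time. -/
def NFoldInstance.Maintains {n r s t k : ℕ} (I : NFoldInstance n r s t k) (upd : RamProg) (T : ℕ) :
    StepBounds n t → RamMemory → List (BoundChange n t) → Prop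
  | _, _, [] => True
  | b, μ, w :: ws => ∃ (T' : ℕ) (μ' : RamMemory),
      RamExec upd (μ.announce w) T' μ' ∧ T' ≤ T ∧
      (∃ x, I.IsBestStep (b.change w) x ∧ μ'.Shows x) ∧
      I.Maintains upd T (b.change w) μ' ws

/-!
A step is a multiset of *units*, each of which adds `1` or `-1` to a single variable. The number of
units of a partial solution and its row sums are the digits of one integer, its `code` in a base
`M`, so that adding a unit adds the code of its column. The programs maximize the gain by dynamic
programming over codes, that is, over the paths `KPath` of a knapsack whose states are the codes of
vectors in a box. As `M` is large compared with the box, there are no carries on such a path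
(`KPath.digits`): a path to a state whose digits vanish is a solution of the linear system.

**Within a brick** there are at most `k` units, and the rows of its block `B i` sum up to `0`. Units
with the same code are interchangeable except for their gains, so that only the best ones of each
code matter. A box for the sums over arbitrary partial solutions would have about `k ^ (r + s)`
points, and the running time has no room for `k ^ s`. It depends on the order in which units are
added: stage `(a, y)` of the knapsack may add only unit number `ordf L a` of type `y`, where `ordf`
lists the numbers below `2 ^ L`, `L = ⌈log₂ k⌉`, evens first, recursively. Every initial segment of
this order contains nearly the same fraction of each `{0, …, m - 1}`, up to an error of `L`
(`abs_ordCount_sub_le`). As the total vanishes, a partial sum is a sum of such errors over the at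
most `(2 * δ + 1) ^ (r + s)` types that occur (`Brick.abs_partial_le`). This is `digitBound`, in
which `k` enters only through `L`, and `(L + 1) ^ s ≤ 2 ^ s ^ 2 * 2 ^ (L + 1)` (`pow_self_le`). So
the paths yield the best solutions of the brick for each number of units and each value of the first
`r` rows (`Brick.sound`, `Brick.complete`), which make up the table of the brick.

**Over all bricks**, only the best brick matters for each set of the partition and each such value.
A second knapsack with one stage per set selects at most one brick from every set; all of its
partial sums are in the box, since there are at most `k ^ 2` sets (`path_isStep`, `isStep_path`).

**Updates.** The best units of each brick and code are kept at the root of a merge tree over the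
variables (`full`), and the best brick of each set and value at the root of a merge tree over the
bricks. A change of one variable changes two leaves of each of the first trees of its brick, then
one table, and then one leaf of each of the second trees of its set. Every changed leaf affects a
single path to a root, which is where the logarithm comes from; the second knapsack does not depend
on `n` and `t` at all.

**Time.** All running times are stated as `Q ^ e` or `Q ^ e * X` with one number `Q`, a constant
times the number of codes, and `numCodes_le` bounds `Q`. A multiplication is a repeated addition
with at most `Q` rounds, and the number of a state is looked up in an array that is indexed by
codes. The programs do not know `Δ`; they use the largest absolute value `δ` of an entry (at least
`2`), which is at most `Δ`.
-/

/-! ### Reasoning about programs -/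

@[simp]
theorem RamMemory.write_apply (μ : RamMemory) (a : ℕ) (z v : ℤ) (a' : ℕ) :
    (μ.write a z v) a' = if a' = a then Function.update (μ a) z v else μ a' := by
  funext z'
  unfold RamMemory.write
  split_ifs with h1 h2 h2
  · obtain ⟨rfl, rfl⟩ := h1; simp
  · exact absurd h1.1 h2
  · subst h2
    have : z' ≠ z := fun h => h1 ⟨rfl, h⟩
    simp [this]
  · rfl

theorem RamMemory.write_of_ne (μ : RamMemory) {a a' : ℕ} (z v : ℤ) (h : a' ≠ a) :
    (μ.write a z v) a' = μ a' := by simp [h]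

/-- The arrays that a program may write to. -/
def RamProg.mods : RamProg → List ℕ
  | .skip => []
  | .store a _ _ => [a]
  | .seq p q => p.mods ++ q.mods
  | .ite _ _ p q => p.mods ++ q.mods
  | .loop _ _ p => p.mods

theorem RamExec.frame {p : RamProg} {μ μ' : RamMemory} {T : ℕ} (h : RamExec p μ T μ') :
    ∀ a, a ∉ p.mods → μ' a = μ a := by
  induction h with
  | skip => intro _ _; rfl
  | store μ b e₁ e₂ =>
    intro a ha
    exact RamMemory.write_of_ne _ _ _ (by simpa [RamProg.mods] using ha)
  | seq _ _ ih ih' =>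
    intro a ha
    simp only [RamProg.mods, List.mem_append, not_or] at ha
    rw [ih' a ha.2, ih a ha.1]
  | ite_true _ _ ih =>
    intro a ha
    simp only [RamProg.mods, List.mem_append, not_or] at ha
    exact ih a ha.1
  | ite_false _ _ ih =>
    intro a ha
    simp only [RamProg.mods, List.mem_append, not_or] at ha
    exact ih a ha.2
  | loop_true _ _ _ ih ih' =>
    intro a ha
    rw [ih' a ha, ih a ha]
  | loop_false _ => intro _ _; rfl

/-- `Runs p μ T Q`: started on `μ`, the program `p` halts within `T` steps on a memory that
satisfies `Q`. -/
def Runs (p : RamProg) (μ : RamMemory) (T : ℕ) (Q : RamMemory → Prop) : Prop :=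
  ∃ T' μ', RamExec p μ T' μ' ∧ T' ≤ T ∧ Q μ'

/-- `μ'` agrees with `μ` on all arrays that `p` does not write to. -/
def RamProg.Frame (p : RamProg) (μ μ' : RamMemory) : Prop :=
  ∀ a, a ∉ p.mods → μ' a = μ a

/-- The side condition is decidable for concrete programs. -/
theorem RamProg.Frame.eq {p : RamProg} {μ μ' : RamMemory} (h : p.Frame μ μ') (a : ℕ)
    (ha : a ∉ p.mods := by decide) : μ' a = μ a := h a ha

section Rules

variable {p q : RamProg} {μ : RamMemory} {T T₁ T₂ : ℕ} {R R' : RamMemory → Prop}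

theorem Runs.mono (h : Runs p μ T₁ R) (hT : T₁ ≤ T₂) (hR : ∀ μ', p.Frame μ μ' → R μ' → R' μ') :
    Runs p μ T₂ R' := by
  obtain ⟨T', μ', h1, h2, h3⟩ := h
  exact ⟨T', μ', h1, h2.trans hT, hR _ h1.frame h3⟩

theorem Runs.post (h : Runs p μ T R) (hR : ∀ μ', p.Frame μ μ' → R μ' → R' μ') : Runs p μ T R' :=
  h.mono le_rfl hR

theorem Runs.seq (h₁ : Runs p μ T₁ R') (h₂ : ∀ μ', p.Frame μ μ' → R' μ' → Runs q μ' T₂ R) :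
    Runs (.seq p q) μ (T₁ + T₂) R := by
  obtain ⟨T', μ', h1, h2, h3⟩ := h₁
  obtain ⟨T'', μ'', h1', h2', h3'⟩ := h₂ _ h1.frame h3
  exact ⟨_, _, .seq h1 h1', add_le_add h2 h2', h3'⟩

theorem Runs.ite {e₁ e₂ : RamExpr} (h₁ : e₁.eval μ ≤ e₂.eval μ → Runs p μ T R)
    (h₂ : ¬ e₁.eval μ ≤ e₂.eval μ → Runs q μ T R) :
    Runs (.ite e₁ e₂ p q) μ (e₁.cost + e₂.cost + 1 + T) R := by
  by_cases h : e₁.eval μ ≤ e₂.eval μ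
  · obtain ⟨T', μ', h1, h2, h3⟩ := h₁ h
    exact ⟨_, _, .ite_true h h1, by omega, h3⟩
  · obtain ⟨T', μ', h1, h2, h3⟩ := h₂ h
    exact ⟨_, _, .ite_false h h1, by omega, h3⟩

end Rules

/-- Programs without loops. -/
def RamProg.loopFree : RamProg → Bool
  | .skip => true
  | .store _ _ _ => true
  | .seq p q => p.loopFree && q.loopFree
  | .ite _ _ p q => p.loopFree && q.loopFree
  | .loop _ _ _ => false

/-- A bound on the number of steps of a loop-free program. -/
def RamProg.maxCost : RamProg → ℕ
  | .skip => 1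
  | .store _ e₁ e₂ => e₁.cost + e₂.cost + 1
  | .seq p q => p.maxCost + q.maxCost
  | .ite e₁ e₂ p q => e₁.cost + e₂.cost + 1 + max p.maxCost q.maxCost
  | .loop _ _ _ => 0

/-- The effect of a loop-free program on the memory (loops are ignored). -/
def RamProg.run : RamProg → RamMemory → RamMemory
  | .skip, μ => μ
  | .store a e₁ e₂, μ => μ.write a (e₁.eval μ) (e₂.eval μ)
  | .seq p q, μ => q.run (p.run μ)
  | .ite e₁ e₂ p q, μ => if e₁.eval μ ≤ e₂.eval μ then p.run μ else q.run μ
  | .loop _ _ _, μ => μ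

theorem RamProg.exec_run (p : RamProg) (hp : p.loopFree = true) (μ : RamMemory) :
    ∃ T, RamExec p μ T (p.run μ) ∧ T ≤ p.maxCost := by
  induction p generalizing μ with
  | skip => exact ⟨1, .skip μ, le_rfl⟩
  | store a e₁ e₂ => exact ⟨_, .store μ a e₁ e₂, le_rfl⟩
  | seq p q ihp ihq =>
    simp only [loopFree, Bool.and_eq_true] at hp
    obtain ⟨T, h, hT⟩ := ihp hp.1 μ
    obtain ⟨T', h', hT'⟩ := ihq hp.2 (p.run μ)
    exact ⟨_, .seq h h', add_le_add hT hT'⟩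
  | ite e₁ e₂ p q ihp ihq =>
    simp only [loopFree, Bool.and_eq_true] at hp
    by_cases h : e₁.eval μ ≤ e₂.eval μ
    · obtain ⟨T, h', hT⟩ := ihp hp.1 μ
      have := le_max_left p.maxCost q.maxCost
      exact ⟨e₁.cost + e₂.cost + 1 + T, by simp only [run, h, if_true]; exact .ite_true h h',
        by simp only [maxCost]; omega⟩
    · obtain ⟨T, h', hT⟩ := ihq hp.2 μ
      have := le_max_right p.maxCost q.maxCost
      exact ⟨e₁.cost + e₂.cost + 1 + T, by simp only [run, h, if_false]; exact .ite_false h h',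
        by simp only [maxCost]; omega⟩
  | loop => simp [loopFree] at hp

namespace RamProg

variable {e₁ e₂ : RamExpr} {p q : RamProg} {μ : RamMemory} {a : ℕ}

theorem run_skip : RamProg.skip.run μ = μ := rfl

theorem run_store : (RamProg.store a e₁ e₂).run μ = μ.write a (e₁.eval μ) (e₂.eval μ) := rfl

theorem run_seq : (RamProg.seq p q).run μ = q.run (p.run μ) := rfl

theorem run_ite {z : ℤ} : (RamProg.ite e₁ e₂ p q).run μ a z =
    if e₁.eval μ ≤ e₂.eval μ then p.run μ a z else q.run μ a z := by
  rw [run]; split_ifs <;> rfl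

end RamProg

/-- The content of a register, that is, of cell `0` of an array. -/
abbrev rg (a : ℕ) : RamExpr := .load a (.lit 0)

/-- Assignment to a register. -/
abbrev setR (a : ℕ) (e : RamExpr) : RamProg := .store a (.lit 0) e

infixr:60 " ;; " => RamProg.seq

instance : Add RamExpr := ⟨.add⟩

instance : Sub RamExpr := ⟨.sub⟩

@[simp]
theorem RamExpr.eval_add (e₁ e₂ : RamExpr) (μ : RamMemory) :
    (e₁ + e₂).eval μ = e₁.eval μ + e₂.eval μ := rfl

@[simp]
theorem RamExpr.eval_sub (e₁ e₂ : RamExpr) (μ : RamMemory) :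
    (e₁ - e₂).eval μ = e₁.eval μ - e₂.eval μ := rfl

attribute [simp] RamExpr.eval

/-- `μ'` agrees with `μ` on all arrays that a loop with counter `i` and body `p` does not write
to. -/
def RamProg.LoopFrame (p : RamProg) (i : ℕ) (μ μ' : RamMemory) : Prop :=
  ∀ a, a ≠ i → a ∉ p.mods → μ' a = μ a

theorem RamProg.LoopFrame.eq {p : RamProg} {i : ℕ} {μ μ' : RamMemory} (h : p.LoopFrame i μ μ')
    (a : ℕ) (ha : a ≠ i := by decide) (ha' : a ∉ p.mods := by decide) : μ' a = μ a := h a ha ha'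

/-- `for i = 0, …, hi - 1 do body`, with the counter `i` in a register. -/
def forP (i : ℕ) (hi : RamExpr) (body : RamProg) : RamProg :=
  setR i (.lit 0) ;; .loop (rg i + .lit 1) hi (body ;; setR i (rg i + .lit 1))

section Time

/-! Running times are bounded by powers of a number `Q` that absorbs all constants. -/

variable {p q : RamProg} {μ : RamMemory} {R R' : RamMemory → Prop} {Q : ℕ} [hQ : Fact (1024 ≤ Q)]

theorem one_le_of_fact (Q : ℕ) [hQ : Fact (1024 ≤ Q)] : 1 ≤ Q := by have := hQ.out; omega

/-- A block without loops takes a constant number of steps, which `Q` absorbs. The side conditions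
on a concrete block are checked by evaluation. -/
theorem Runs.block {e : ℕ} (h : R (p.run μ)) (hp : p.loopFree = true := by rfl)
    (hc : p.maxCost ≤ 1024 := by decide) : Runs p μ (Q ^ (e + 1)) R := by
  obtain ⟨T, h1, h2⟩ := p.exec_run hp μ
  refine ⟨T, _, h1, ?_, h⟩
  calc T ≤ 1024 := h2.trans hc
    _ ≤ Q := hQ.out
    _ ≤ Q ^ (e + 1) := Nat.le_self_pow (by omega) Q

theorem Runs.blockX {e X : ℕ} (hX : 1 ≤ X) (h : R (p.run μ)) (hp : p.loopFree = true := by rfl)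
    (hc : p.maxCost ≤ 1024 := by decide) : Runs p μ (Q ^ (e + 1) * X) R :=
  (Runs.block h hp hc).mono (Nat.le_mul_of_pos_right _ hX) fun _ _ h => h

theorem Runs.raise {e e' X : ℕ} (h : Runs p μ (Q ^ e) R) (hX : 1 ≤ X)
    (he : e ≤ e' := by norm_num) :
    Runs p μ (Q ^ e' * X) R :=
  h.mono ((Nat.pow_le_pow_right (one_le_of_fact Q) he).trans (Nat.le_mul_of_pos_right _ hX))
    fun _ _ h => h

theorem Runs.up {e e' : ℕ} (h : Runs p μ (Q ^ e) R) (he : e ≤ e' := by norm_num) :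
    Runs p μ (Q ^ e') R := by
  simpa using h.raise (X := 1) le_rfl he

theorem Runs.upX {e e' X : ℕ} (h : Runs p μ (Q ^ e * X) R)
    (he : e ≤ e' := by norm_num) :
    Runs p μ (Q ^ e' * X) R :=
  h.mono (Nat.mul_le_mul_right _ (Nat.pow_le_pow_right (one_le_of_fact Q) he)) fun _ _ h => h

theorem Runs.seqX {e X : ℕ} (h₁ : Runs p μ (Q ^ e * X) R')
    (h₂ : ∀ μ', p.Frame μ μ' → R' μ' → Runs q μ' (Q ^ e * X) R) :
    Runs (p ;; q) μ (Q ^ (e + 1) * X) R := by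
  refine (h₁.seq h₂).mono ?_ fun _ _ h => h
  have : 2 * (Q ^ e * X) ≤ Q * (Q ^ e * X) :=
    Nat.mul_le_mul_right _ (by have := hQ.out; omega)
  rw [pow_succ]; nlinarith

theorem Runs.seqQ {e : ℕ} (h₁ : Runs p μ (Q ^ e) R')
    (h₂ : ∀ μ', p.Frame μ μ' → R' μ' → Runs q μ' (Q ^ e) R) :
    Runs (p ;; q) μ (Q ^ (e + 1)) R := by
  have := Runs.seqX (Q := Q) (e := e) (X := 1) (by simpa using h₁) (by simpa using h₂)
  simpa using this

theorem Runs.iteX {e X : ℕ} {e₁ e₂ : RamExpr} (hc : e₁.cost + e₂.cost ≤ 1000) (hX : 1 ≤ X)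
    (h₁ : e₁.eval μ ≤ e₂.eval μ → Runs p μ (Q ^ e * X) R)
    (h₂ : ¬ e₁.eval μ ≤ e₂.eval μ → Runs q μ (Q ^ e * X) R) :
    Runs (.ite e₁ e₂ p q) μ (Q ^ (e + 1) * X) R := by
  refine (Runs.ite h₁ h₂).mono ?_ fun _ _ h => h
  have h1 : 1 ≤ Q ^ e * X := Nat.mul_pos (Nat.pow_pos (one_le_of_fact Q)) hX
  have : 1024 * (Q ^ e * X) ≤ Q * (Q ^ e * X) := Nat.mul_le_mul_right _ hQ.out
  rw [pow_succ]; nlinarith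

theorem Runs.iteQ {e : ℕ} {e₁ e₂ : RamExpr} (hc : e₁.cost + e₂.cost ≤ 1000)
    (h₁ : e₁.eval μ ≤ e₂.eval μ → Runs p μ (Q ^ e) R)
    (h₂ : ¬ e₁.eval μ ≤ e₂.eval μ → Runs q μ (Q ^ e) R) :
    Runs (.ite e₁ e₂ p q) μ (Q ^ (e + 1)) R := by
  have := Runs.iteX (Q := Q) (e := e) (X := 1) hc le_rfl (by simpa using h₁) (by simpa using h₂)
  simpa using this

end Time

/-- The rule for counted loops. The invariant `Inv j` holds after `j` rounds; it must not mention
the counter. -/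
theorem Runs.forP {i : ℕ} {hi : RamExpr} {body : RamProg} {μ₀ : RamMemory} {N Tb : ℕ}
    (Inv : ℕ → RamMemory → Prop)
    (hi_mods : i ∉ body.mods)
    (hhi : ∀ μ, body.LoopFrame i μ₀ μ → hi.eval μ = N)
    (hInv : ∀ j μ v, Inv j μ → Inv j (μ.write i 0 v))
    (h0 : Inv 0 μ₀)
    (hstep : ∀ j < N, ∀ μ, body.LoopFrame i μ₀ μ → μ i 0 = j → Inv j μ →
      Runs body μ Tb (Inv (j + 1))) :
    Runs (forP i hi body) μ₀ (N * (Tb + hi.cost + 11) + hi.cost + 11) (Inv N) := by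
  have key : ∀ (d j : ℕ) (μ : RamMemory), j + d = N →
      (∀ a, a ≠ i → a ∉ body.mods → μ a = μ₀ a) → μ i 0 = j → Inv j μ →
      Runs (.loop (rg i + .lit 1) hi (body ;; setR i (rg i + .lit 1))) μ
        (d * (Tb + hi.cost + 11) + hi.cost + 6) (Inv N) := by
    intro d
    induction d with
    | zero =>
      intro j μ hj hf hji hI
      refine ⟨_, _, .loop_false ?_, ?_, ?_⟩
      · rw [hhi μ hf]; simp [hji]; omega
      · have c1 : (rg i + RamExpr.lit 1).cost = 4 := rfl
        rw [c1]; omega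
      · have : j = N := by omega
        rw [← this]; exact hI
    | succ d ih =>
      intro j μ hj hf hji hI
      obtain ⟨T₁, μ₁, g1, g2, g3⟩ := hstep j (by omega) μ hf hji hI
      have hf₁ : ∀ a, a ≠ i → a ∉ body.mods → μ₁ a = μ₀ a := fun a h h' => by
        rw [g1.frame a h', hf a h h']
      have hi₁ : μ₁ i 0 = j := by rw [g1.frame i hi_mods, hji]
      have e1 : RamExec (setR i (rg i + .lit 1)) μ₁ _ _ := .store μ₁ i _ _
      simp only [RamExpr.eval, hi₁] at e1
      obtain ⟨T₂, μ₂, k1, k2, k3⟩ := ih (j + 1) (μ₁.write i 0 (j + 1)) (by omega)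
        (fun a h h' => by rw [RamMemory.write_of_ne _ _ _ h, hf₁ a h h'])
        (by simp) (hInv _ _ _ g3)
      refine ⟨_, μ₂, .loop_true ?_ (.seq g1 e1) k1, ?_, k3⟩
      · rw [hhi μ hf]; simp [hji]; omega
      · have c1 : (rg i + RamExpr.lit 1).cost = 4 := rfl
        have c2 : (RamExpr.lit 0).cost = 1 := rfl
        rw [c1, c2, Nat.add_mul]
        omega
  obtain ⟨T, μ', h1, h2, h3⟩ := key N 0 (μ₀.write i 0 0) (by omega)
    (fun a h _ => RamMemory.write_of_ne _ _ _ h) (by simp) (hInv _ _ _ h0)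
  refine ⟨_, _, .seq (.store _ _ _ _) h1, ?_, h3⟩
  have c2 : (RamExpr.lit 0).cost = 1 := rfl
  rw [c2]; omega

theorem loop_time_le {N Tb c Q e f X Y : ℕ} (hQ : 1024 ≤ Q) (hN : N ≤ Q ^ f * Y)
    (hT : Tb ≤ Q ^ e * X) (hc : c ≤ 100) (hX : 1 ≤ X) (hY : 1 ≤ Y) :
    N * (Tb + c + 11) + c + 11 ≤ Q ^ (f + e + 1) * (Y * X) := by
  have hQ1 : 0 < Q := by omega
  have h1 : 1 ≤ Q ^ e * X := Nat.mul_pos (Nat.pow_pos hQ1) hX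
  have h2 : 1 ≤ Q ^ f * Y := Nat.mul_pos (Nat.pow_pos hQ1) hY
  have h3 : N * (Tb + c + 11) ≤ Q ^ f * Y * (Q ^ e * X + 111) := Nat.mul_le_mul hN (by omega)
  have h4 : Q ^ (f + e + 1) * (Y * X) = Q * (Q ^ f * Y * (Q ^ e * X)) := by ring
  rw [h4]
  generalize Q ^ f * Y = a at *
  generalize Q ^ e * X = b at *
  have h5 : 1024 * (a * b) ≤ Q * (a * b) := Nat.mul_le_mul_right _ hQ
  nlinarith [Nat.mul_le_mul h2 h1]

/-- The rule for counted loops, with times in the form `Q ^ e * X`. -/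
theorem Runs.forX {Q : ℕ} [hQ : Fact (1024 ≤ Q)] {i : ℕ} {hi : RamExpr} {body : RamProg}
    {μ₀ : RamMemory} {N e f X Y : ℕ}
    (Inv : ℕ → RamMemory → Prop)
    (hX : 1 ≤ X) (hY : 1 ≤ Y)
    (hN : N ≤ Q ^ f * Y)
    (hhi : ∀ μ, body.LoopFrame i μ₀ μ → hi.eval μ = N)
    (hInv : ∀ j μ v, Inv j μ → Inv j (μ.write i 0 v))
    (h0 : Inv 0 μ₀)
    (hstep : ∀ j < N, ∀ μ, body.LoopFrame i μ₀ μ → μ i 0 = j → Inv j μ →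
      Runs body μ (Q ^ e * X) (Inv (j + 1)))
    (hi_mods : i ∉ body.mods := by decide) (hc : hi.cost ≤ 100 := by decide) :
    Runs (_root_.forP i hi body) μ₀ (Q ^ (f + e + 1) * (Y * X)) (Inv N) :=
  (Runs.forP Inv hi_mods hhi hInv h0 hstep).mono
    (loop_time_le hQ.out hN le_rfl hc hX hY) fun _ _ h => h

theorem Runs.forQ {Q : ℕ} [hQ : Fact (1024 ≤ Q)] {i : ℕ} {hi : RamExpr} {body : RamProg}
    {μ₀ : RamMemory} {N e : ℕ} (f : ℕ)
    (Inv : ℕ → RamMemory → Prop)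
    (hN : N ≤ Q ^ f)
    (hhi : ∀ μ, body.LoopFrame i μ₀ μ → hi.eval μ = N)
    (hInv : ∀ j μ v, Inv j μ → Inv j (μ.write i 0 v))
    (h0 : Inv 0 μ₀)
    (hstep : ∀ j < N, ∀ μ, body.LoopFrame i μ₀ μ → μ i 0 = j → Inv j μ →
      Runs body μ (Q ^ e) (Inv (j + 1)))
    (hi_mods : i ∉ body.mods := by decide) (hc : hi.cost ≤ 100 := by decide) :
    Runs (_root_.forP i hi body) μ₀ (Q ^ (f + e + 1)) (Inv N) := by
  have := Runs.forX (Q := Q) (X := 1) (Y := 1) (e := e) (f := f) Inv le_rfl le_rfl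
    (by simpa using hN) hhi hInv h0 (by simpa using hstep) hi_mods hc
  simpa using this

/-- `dst := e₁ * e₂` by repeated addition, for `0 ≤ e₂`. -/
def mulP (dst cnt : ℕ) (e₁ e₂ : RamExpr) : RamProg :=
  setR dst (.lit 0) ;; forP cnt e₂ (setR dst (rg dst + e₁))

/-- The value of `e` depends only on the arrays other than those in `l`. -/
def RamExpr.avoids (l : List ℕ) : RamExpr → Bool
  | .lit _ => true
  | .load a e => !l.contains a && e.avoids l
  | .add e₁ e₂ => e₁.avoids l && e₂.avoids l
  | .sub e₁ e₂ => e₁.avoids l && e₂.avoids l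

theorem RamExpr.eval_congr {l : List ℕ} {e : RamExpr} {μ μ' : RamMemory}
    (he : e.avoids l = true) (h : ∀ a, a ∉ l → μ' a = μ a) : e.eval μ' = e.eval μ := by
  induction e with
  | lit => rfl
  | load a e ih =>
    simp only [avoids, Bool.and_eq_true, Bool.not_eq_true', List.contains_eq_mem,
      decide_eq_false_iff_not] at he
    simp only [eval]; rw [ih he.2, h a he.1]
  | add e₁ e₂ ih₁ ih₂ =>
    simp only [avoids, Bool.and_eq_true] at he
    simp only [eval]; rw [ih₁ he.1, ih₂ he.2]
  | sub e₁ e₂ ih₁ ih₂ =>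
    simp only [avoids, Bool.and_eq_true] at he
    simp only [eval]; rw [ih₁ he.1, ih₂ he.2]

theorem Runs.mulP {Q : ℕ} [hQ : Fact (1024 ≤ Q)] {dst cnt : ℕ} {e₁ e₂ : RamExpr} {μ : RamMemory}
    {N : ℕ} (f : ℕ) {c : ℤ} (hc : e₁.eval μ = c) (hN : e₂.eval μ = N) (hf : N ≤ Q ^ f)
    (h : dst ≠ cnt := by decide) (h₁ : e₁.avoids [dst, cnt] = true := by rfl)
    (h₂ : e₂.avoids [dst, cnt] = true := by rfl) (hc₁ : e₁.cost ≤ 100 := by decide)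
    (hc₂ : e₂.cost ≤ 100 := by decide) :
    Runs (_root_.mulP dst cnt e₁ e₂) μ (Q ^ (f + 3)) (fun μ' => μ' dst 0 = c * N) := by
  have hm : (setR dst (rg dst + e₁)).mods = [dst] := rfl
  unfold _root_.mulP
  refine Runs.seqQ (e := f + 2) (R' := fun μ' => μ' dst 0 = 0) ?_ ?_
  · exact .block (by simp [RamProg.run]) rfl (by simp [RamProg.maxCost, RamExpr.cost])
  · intro μ₁ hf₁ h0
    have hμ₁ : ∀ a, a ∉ [dst, cnt] → μ₁ a = μ a := fun a ha => hf₁ a (by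
      simp only [RamProg.mods]; simp only [List.mem_cons, not_or] at ha; simp [ha.1])
    have tr : ∀ μ', (setR dst (rg dst + e₁)).LoopFrame cnt μ₁ μ' →
        ∀ a, a ∉ [dst, cnt] → μ' a = μ a := fun μ' h' a ha => by
      rw [h' a (by simp_all) (by simp_all), hμ₁ a ha]
    refine Runs.forQ (e := 1) f (fun j μ' => μ' dst 0 = c * j) hf ?_ ?_ ?_ ?_
      (by simp [hm, h.symm]) hc₂
    · intro μ' h'
      rw [RamExpr.eval_congr h₂ (tr μ' h'), hN]
    · intro j μ' v hj
      rw [RamMemory.write_of_ne _ _ _ h]; exact hj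
    · simpa using h0
    · intro j _ μ' h' _ hI
      have : e₁.eval μ' = c := by rw [RamExpr.eval_congr h₁ (tr μ' h'), hc]
      refine .block (e := 0) (by simp [RamProg.run, this, hI]; ring) rfl ?_
      · have : (setR dst (rg dst + e₁)).maxCost = 1 + (2 + e₁.cost + 1) + 1 := rfl
        omega

/-! ### Codes of integer vectors -/

/-- The code in base `M` of the vector with leading entry `N` followed by the first `l` digits
`d`. -/
def code (M N : ℤ) (d : ℕ → ℤ) : ℕ → ℤ
  | 0 => N
  | l + 1 => code M N d l * M + d l

theorem code_add (M N N' : ℤ) (d d' : ℕ → ℤ) (l : ℕ) :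
    code M (N + N') (fun i => d i + d' i) l = code M N d l + code M N' d' l := by
  induction l with
  | zero => rfl
  | succ l ih => simp only [code, ih]; ring

theorem code_neg (M N : ℤ) (d : ℕ → ℤ) (l : ℕ) :
    code M (-N) (fun i => - d i) l = - code M N d l := by
  induction l with
  | zero => rfl
  | succ l ih => simp only [code, ih]; ring

theorem code_zero (M : ℤ) (l : ℕ) : code M 0 (fun _ => 0) l = 0 := by
  induction l with
  | zero => rfl
  | succ l ih => simp only [code, ih]; ring

theorem code_congr {M N : ℤ} {d d' : ℕ → ℤ} {l : ℕ} (h : ∀ i < l, d i = d' i) :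
    code M N d l = code M N d' l := by
  induction l with
  | zero => rfl
  | succ l ih => simp only [code, ih fun i hi => h i (by omega), h l (by omega)]

/-- If the digits are smaller than the base, the code vanishes only if all digits do. -/
theorem code_eq_zero {M N : ℤ} {d : ℕ → ℤ} {l : ℕ} (hd : ∀ i < l, |d i| < M)
    (h : code M N d l = 0) : N = 0 ∧ ∀ i < l, d i = 0 := by
  induction l with
  | zero => exact ⟨h, fun i hi => absurd hi (by omega)⟩
  | succ l ih =>
    simp only [code] at h
    have h1 : d l = 0 := by
      refine Int.eq_zero_of_abs_lt_dvd (m := M) ⟨- code M N d l, by linarith⟩ (hd l (by omega))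
    have hM : M ≠ 0 := by have := hd l (by omega); have := abs_nonneg (d l); omega
    rw [h1, add_zero] at h
    obtain ⟨h2, h3⟩ := ih (fun i hi => hd i (by omega)) ((mul_eq_zero.mp h).resolve_right hM)
    refine ⟨h2, fun i hi => ?_⟩
    rcases Nat.lt_succ_iff_lt_or_eq.mp hi with h' | rfl
    · exact h3 i h'
    · exact h1

theorem code_inj {M N N' : ℤ} {d d' : ℕ → ℤ} {l : ℕ} (hd : ∀ i < l, |d i - d' i| < M)
    (h : code M N d l = code M N' d' l) : N = N' ∧ ∀ i < l, d i = d' i := by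
  have h1 : code M (N + -N') (fun i => d i + - d' i) l = 0 := by
    rw [code_add, code_neg, h]; ring
  obtain ⟨h2, h3⟩ := code_eq_zero (by simpa [sub_eq_add_neg] using hd) h1
  exact ⟨by omega, fun i hi => by have := h3 i hi; omega⟩

theorem code_sum {ι : Type*} (M : ℤ) (N : ι → ℤ) (d : ι → ℕ → ℤ) (l : ℕ) (S : Finset ι) :
    code M (∑ x ∈ S, N x) (fun i => ∑ x ∈ S, d x i) l = ∑ x ∈ S, code M (N x) (d x) l := by
  classical
  induction S using Finset.induction_on with
  | empty => simpa using code_zero M l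
  | insert a S ha ih => simp only [Finset.sum_insert ha, code_add, ih]

theorem code_list_sum {ι : Type*} (M : ℤ) (N : ι → ℤ) (d : ι → ℕ → ℤ) (l : ℕ) (S : List ι) :
    code M (S.map N).sum (fun i => (S.map fun x => d x i).sum) l
      = (S.map fun x => code M (N x) (d x) l).sum := by
  induction S with
  | nil => simpa using code_zero M l
  | cons a S ih => simp only [List.map_cons, List.sum_cons, code_add, ih]

/-! ### A well-balanced order of the numbers below a power of two -/

/-- The order in which the unit numbers `0, …, 2 ^ L - 1` are processed: first all even numbers,
then all odd ones, recursively. -/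
def ordf : ℕ → ℕ → ℕ
  | 0, _ => 0
  | L + 1, a => if a < 2 ^ L then 2 * ordf L a else 2 * ordf L (a - 2 ^ L) + 1

theorem ordf_lt (L a : ℕ) : ordf L a < 2 ^ L := by
  induction L generalizing a with
  | zero => simp [ordf]
  | succ L ih =>
    have h1 := ih a
    have h2 := ih (a - 2 ^ L)
    simp only [ordf, pow_succ]
    split_ifs <;> omega

theorem sum_range_two_mul {α : Type*} [AddCommMonoid α] (f : ℕ → α) (n : ℕ) :
    ∑ j ∈ Finset.range (2 * n), f j = ∑ j ∈ Finset.range n, (f (2 * j) + f (2 * j + 1)) := by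
  induction n with
  | zero => simp
  | succ n ih =>
    rw [show 2 * (n + 1) = 2 * n + 1 + 1 by ring, Finset.sum_range_succ, Finset.sum_range_succ, ih,
      Finset.sum_range_succ, add_assoc]

theorem sum_ordf_le {α : Type*} [AddCommMonoid α] (f : ℕ → α) (L N : ℕ) (hN : N ≤ 2 ^ L) :
    ∑ a ∈ Finset.range N, f (ordf (L + 1) a) = ∑ a ∈ Finset.range N, f (2 * ordf L a) := by
  refine Finset.sum_congr rfl fun a ha => ?_
  have : a < 2 ^ L := by have := Finset.mem_range.mp ha; omega
  simp [ordf, this]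

theorem sum_ordf_add {α : Type*} [AddCommMonoid α] (f : ℕ → α) (L N : ℕ) :
    ∑ a ∈ Finset.range (2 ^ L + N), f (ordf (L + 1) a) =
      ∑ a ∈ Finset.range (2 ^ L), f (2 * ordf L a) +
        ∑ a ∈ Finset.range N, f (2 * ordf L a + 1) := by
  rw [Finset.sum_range_add, sum_ordf_le _ _ _ le_rfl]
  congr 1
  refine Finset.sum_congr rfl fun a _ => ?_
  simp [ordf]

theorem sum_ordf {α : Type*} [AddCommMonoid α] (f : ℕ → α) (L : ℕ) :
    ∑ a ∈ Finset.range (2 ^ L), f (ordf L a) = ∑ j ∈ Finset.range (2 ^ L), f j := by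
  induction L generalizing f with
  | zero => simp [ordf]
  | succ L ih =>
    have h1 := ih (fun j => f (2 * j))
    have h2 := ih (fun j => f (2 * j + 1))
    rw [show 2 ^ (L + 1) = 2 ^ L + 2 ^ L by ring, sum_ordf_add, h1, h2, ← two_mul,
      sum_range_two_mul, Finset.sum_add_distrib]

/-- The number of `a < N` with `ordf L a < m`. -/
def ordCount (L N m : ℕ) : ℤ := ∑ a ∈ Finset.range N, if ordf L a < m then 1 else 0

theorem ordCount_full (L m : ℕ) (hm : m ≤ 2 ^ L) : ordCount L (2 ^ L) m = m := by
  unfold ordCount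
  rw [sum_ordf (fun j => if j < m then (1 : ℤ) else 0), ← Finset.sum_filter]
  have : (Finset.range (2 ^ L)).filter (· < m) = Finset.range m := by
    ext j; simp; omega
  rw [this]; simp

/-- Every initial segment of the order contains about the same fraction of every interval
`{0, …, m - 1}`. -/
theorem abs_ordCount_sub_le (L N m : ℕ) (hN : N ≤ 2 ^ L) (hm : m ≤ 2 ^ L) :
    |2 ^ L * ordCount L N m - N * m| ≤ L * 2 ^ L := by
  induction L generalizing N m with
  | zero =>
    interval_cases N <;> interval_cases m <;> simp [ordCount, ordf]
  | succ L ih =>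
    have e1 : ∀ j, 2 * j < m ↔ j < (m + 1) / 2 := by intro j; omega
    have e2 : ∀ j, 2 * j + 1 < m ↔ j < m / 2 := by intro j; omega
    rw [pow_succ] at hm hN
    have hb1 : (m + 1) / 2 ≤ 2 ^ L := by omega
    have hb2 : m / 2 ≤ 2 ^ L := by omega
    obtain ⟨ε, hε0, hε1, h1, h2⟩ : ∃ ε : ℤ, 0 ≤ ε ∧ ε ≤ 1 ∧ 2 * (((m + 1) / 2 : ℕ) : ℤ) = m + ε ∧
        2 * ((m / 2 : ℕ) : ℤ) = m - ε :=
      ⟨m % 2, by omega, by omega, by omega, by omega⟩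
    generalize (m + 1) / 2 = u at *
    generalize m / 2 = v at *
    have hP : (1 : ℤ) ≤ 2 ^ L := one_le_pow₀ (by norm_num)
    rcases Nat.le_total N (2 ^ L) with h | h
    · have e : ordCount (L + 1) N m = ordCount L N u := by
        unfold ordCount
        rw [sum_ordf_le (fun j => if j < m then (1 : ℤ) else 0) _ _ h]
        simp only [e1]
      have := ih N _ h hb1
      rw [e]
      rw [abs_le] at this ⊢
      have hN' : (N : ℤ) ≤ 2 ^ L := by exact_mod_cast h
      have key : (2 : ℤ) ^ (L + 1) * ordCount L N u - N * m =
          2 * (2 ^ L * ordCount L N u - N * (u : ℤ)) + N * ε := by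
        have : (N : ℤ) * m = N * (2 * (u : ℤ)) - N * ε := by rw [h1]; ring
        rw [this]; ring
      rw [key, pow_succ]
      have hNε : 0 ≤ (N : ℤ) * ε ∧ (N : ℤ) * ε ≤ N := ⟨by positivity, by nlinarith⟩
      push_cast
      constructor <;> linarith [this.1, this.2, hNε.1, hNε.2]
    · obtain ⟨N', rfl⟩ := Nat.exists_eq_add_of_le h
      have hN'' : N' ≤ 2 ^ L := by omega
      have e : ordCount (L + 1) (2 ^ L + N') m = (u : ℤ) + ordCount L N' v := by
        rw [← ordCount_full L _ hb1]
        unfold ordCount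
        rw [sum_ordf_add (fun j => if j < m then (1 : ℤ) else 0)]
        simp only [e1, e2]
      have := ih N' _ hN'' hb2
      rw [e]
      rw [abs_le] at this ⊢
      have hN' : (N' : ℤ) ≤ 2 ^ L := by exact_mod_cast hN''
      have key : (2 : ℤ) ^ (L + 1) * ((u : ℤ) + ordCount L N' v)
            - ((2 ^ L + N' : ℕ) : ℤ) * m =
          2 * (2 ^ L * ordCount L N' v - N' * (v : ℤ)) + (2 ^ L - N') * ε := by
        have e3 : (N' : ℤ) * (2 * (v : ℤ)) = N' * (m - ε) := by rw [h2]
        have e4 : (2 : ℤ) ^ L * (2 * (u : ℤ)) = 2 ^ L * (m + ε) := by rw [h1]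
        push_cast at e3 e4 ⊢
        linear_combination e4 + e3
      rw [key, pow_succ]
      have hNε : 0 ≤ (2 ^ L - N' : ℤ) * ε ∧ (2 ^ L - N' : ℤ) * ε ≤ 2 ^ L :=
        ⟨mul_nonneg (by linarith) hε0, by nlinarith⟩
      push_cast
      constructor <;> linarith [this.1, this.2, hNε.1, hNε.2]

/-! ### Merge trees -/

/-- Items with their gains are merged in the order of decreasing gains. -/
def geGain (x y : ℕ × ℤ) : Bool := decide (y.2 ≤ x.2)

/-- The list at node `x` of the merge tree with leaf lists `leaf 0, …, leaf (m - 1)`: the leaves are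
the nodes `m, …, 2 * m - 1`, and an inner node `x` merges the lists at its children `2 * x` and
`2 * x + 1`. -/
def full (leaf : ℕ → List (ℕ × ℤ)) (m x : ℕ) : List (ℕ × ℤ) :=
  if 1 ≤ x ∧ x < m then
    List.merge (full leaf m (2 * x)) (full leaf m (2 * x + 1)) geGain
  else leaf (x - m)
termination_by 2 * m - x

section MergeTrees

variable {leaf leaf' : ℕ → List (ℕ × ℤ)} {m : ℕ}

theorem full_inner {x : ℕ} (h1 : 1 ≤ x) (h2 : x < m) : full leaf m x =
    List.merge (full leaf m (2 * x)) (full leaf m (2 * x + 1)) geGain := by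
  rw [full, if_pos ⟨h1, h2⟩]

theorem full_leaf {p : ℕ} : full leaf m (m + p) = leaf p := by
  rw [full, if_neg (by omega)]; congr 1; omega

theorem full_sorted (h : ∀ p < m, (leaf p).Pairwise fun x y => y.2 ≤ x.2) {x : ℕ} (h1 : 1 ≤ x)
    (h2 : x < 2 * m) : (full leaf m x).Pairwise fun x y => y.2 ≤ x.2 := by
  by_cases hx : x < m
  · rw [full_inner h1 hx]
    have h3 := full_sorted h (x := 2 * x) (by omega) (by omega)
    have h4 := full_sorted h (x := 2 * x + 1) (by omega) (by omega)
    have := List.pairwise_merge (le := geGain)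
      (fun a b c => by simp only [geGain, decide_eq_true_eq]; exact fun h h' => h'.trans h)
      (fun a b => by simp only [geGain, Bool.or_eq_true, decide_eq_true_eq]; exact le_total _ _)
      (full leaf m (2 * x)) (full leaf m (2 * x + 1))
      (by simpa [geGain] using h3) (by simpa [geGain] using h4)
    simpa [geGain] using this
  · obtain ⟨p, rfl⟩ := Nat.exists_eq_add_of_le (not_lt.mp hx)
    rw [full_leaf]; exact h p (by omega)
termination_by 2 * m - x

/-- The nodes `x, …, 2 * x - 1` cut the tree: the lists below them make up all leaf lists. -/
theorem sum_count_full [DecidableEq (ℕ × ℤ)] (a : ℕ × ℤ) {x : ℕ} (h1 : 1 ≤ x) (h2 : x ≤ m) :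
    ∑ y ∈ Finset.Ico x (2 * x), (full leaf m y).count a
      = ∑ p ∈ Finset.range m, (leaf p).count a := by
  rcases h2.eq_or_lt with rfl | h2
  · rw [two_mul, Finset.sum_Ico_eq_sum_range, Nat.add_sub_cancel]
    exact Finset.sum_congr rfl fun p _ => by rw [full_leaf]
  · rw [← sum_count_full a (x := x + 1) (by omega) h2, Finset.sum_eq_sum_Ico_succ_bot (by omega),
      show 2 * (x + 1) = 2 * x + 1 + 1 by ring, Finset.sum_Ico_succ_top (by omega),
      Finset.sum_Ico_succ_top (by omega), full_inner h1 h2,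
      (List.merge_perm_append (le := geGain)).count_eq, List.count_append]
    ring
termination_by m - x

theorem count_full_root [DecidableEq (ℕ × ℤ)] (a : ℕ × ℤ) (hm : 1 ≤ m) :
    (full leaf m 1).count a = ∑ p ∈ Finset.range m, (leaf p).count a := by
  rw [← sum_count_full a le_rfl hm]; simp

/-- `x` is `y` or one of its ancestors in the tree. -/
def Anc (x y : ℕ) : Prop := ∃ j, x = y / 2 ^ j

theorem Anc.le {x y : ℕ} (h : Anc x y) : x ≤ y := by
  obtain ⟨j, rfl⟩ := h; exact Nat.div_le_self _ _

theorem Anc.refl (x : ℕ) : Anc x x := ⟨0, by simp⟩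

theorem Anc.half {x y : ℕ} (h : Anc x y) : Anc (x / 2) y := by
  obtain ⟨j, rfl⟩ := h; exact ⟨j + 1, by rw [pow_succ, Nat.div_div_eq_div_mul]⟩

theorem anc_iff {x y : ℕ} : Anc x y ↔ x = y ∨ Anc x (y / 2) := by
  constructor
  · rintro ⟨j, rfl⟩
    cases j with
    | zero => left; simp
    | succ j => right; exact ⟨j, by rw [pow_succ', Nat.div_div_eq_div_mul]⟩
  · rintro (rfl | ⟨j, rfl⟩)
    · exact .refl _
    · exact ⟨j + 1, by rw [pow_succ', Nat.div_div_eq_div_mul]⟩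

theorem full_congr {p : ℕ} (h : ∀ p' < m, p' ≠ p → leaf' p' = leaf p') {x : ℕ} (h1 : 1 ≤ x)
    (h2 : x < 2 * m) (hx : ¬ Anc x (m + p)) : full leaf' m x = full leaf m x := by
  by_cases hxm : x < m
  · rw [full_inner h1 hxm, full_inner h1 hxm,
      full_congr h (x := 2 * x) (by omega) (by omega),
      full_congr h (x := 2 * x + 1) (by omega) (by omega)]
    · intro h'; apply hx; have := h'.half; rwa [show (2 * x + 1) / 2 = x by omega] at this
    · intro h'; apply hx; have := h'.half; rwa [show (2 * x) / 2 = x by omega] at this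
  · obtain ⟨q, rfl⟩ := Nat.exists_eq_add_of_le (not_lt.mp hxm)
    rw [full_leaf, full_leaf]
    refine h q (by omega) ?_
    rintro rfl
    exact hx (.refl _)
termination_by 2 * m - x

theorem full_congr' (h : ∀ p < m, leaf' p = leaf p) {x : ℕ} (h1 : 1 ≤ x)
    (h2 : x < 2 * m) : full leaf' m x = full leaf m x := by
  by_cases hxm : x < m
  · rw [full_inner h1 hxm, full_inner h1 hxm,
      full_congr' h (x := 2 * x) (by omega) (by omega),
      full_congr' h (x := 2 * x + 1) (by omega) (by omega)]
  · obtain ⟨q, rfl⟩ := Nat.exists_eq_add_of_le (not_lt.mp hxm)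
    rw [full_leaf, full_leaf]
    exact h q (by omega)
termination_by 2 * m - x

/-- A sublist of a decreasing list has at most the sum of an initial segment of the same length. -/
theorem sum_le_sum_take {l ms : List ℤ} (hl : l.Pairwise (fun x y => y ≤ x))
    (h : ms.Subperm l) : ms.sum ≤ (l.take ms.length).sum := by
  induction l generalizing ms with
  | nil => simp [List.subperm_nil.mp h]
  | cons a l ih =>
    rw [List.pairwise_cons] at hl
    by_cases ha : a ∈ ms
    · have h1 : ms.Perm (a :: ms.erase a) := List.perm_cons_erase ha
      have h2 : (ms.erase a).Subperm l := by
        have := h.erase a; simpa using this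
      have h3 := ih hl.2 h2
      rw [h1.sum_eq, h1.length_eq]
      simpa using h3
    · have h2 : ms.Subperm l := by
        have := h.erase a
        rwa [List.erase_of_not_mem ha, List.erase_cons_head] at this
      refine (ih hl.2 h2).trans ?_
      rcases hn : ms.length with _ | n
      · simp
      · have hlen : n < l.length := by have := h2.length_le; omega
        have h3 : (l.take (n + 1)).sum = (l.take n).sum + l[n] := List.sum_take_succ _ _ hlen
        have := hl.1 (l[n]) (List.getElem_mem hlen)
        rw [List.take_succ_cons, List.sum_cons, h3]
        omega

end MergeTrees

/-! ### Group knapsacks -/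

/-- Paths of a group knapsack. In every stage `σ`, at most one of the `O` options with the numbers
`σ * O, …, σ * O + (O - 1)` is chosen. The option `c` exists if `opt c = some (w, g)`; then it
shifts the state by `sh c` and gains `g`. All states have to be `valid`.
`KPath valid O opt sh σ z g cs`: there is a path through the first `σ` stages to the state `z` with
total gain `g`, and `cs` lists the chosen options together with their values `w`, the last one
first. -/
inductive KPath (valid : ℤ → Prop) (O : ℕ) (opt : ℕ → Option (ℕ × ℤ)) (sh : ℕ → ℤ) :
    ℕ → ℤ → ℤ → List (ℕ × ℕ) → Prop
  | nil : KPath valid O opt sh 0 0 0 []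
  | skip {σ : ℕ} {z g : ℤ} {cs : List (ℕ × ℕ)} :
      KPath valid O opt sh σ z g cs → KPath valid O opt sh (σ + 1) z g cs
  | take {σ o w : ℕ} {z g g' : ℤ} {cs : List (ℕ × ℕ)} :
      KPath valid O opt sh σ z g cs → o < O → opt (σ * O + o) = some (w, g') →
      valid (z + sh (σ * O + o)) →
      KPath valid O opt sh (σ + 1) (z + sh (σ * O + o)) (g + g') ((σ * O + o, w) :: cs)

namespace KPath

variable {valid : ℤ → Prop} {O : ℕ} {opt : ℕ → Option (ℕ × ℤ)} {sh : ℕ → ℤ} {σ : ℕ} {z g : ℤ}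
  {cs : List (ℕ × ℕ)}

theorem state_eq (h : KPath valid O opt sh σ z g cs) : z = (cs.map fun c => sh c.1).sum := by
  induction h with
  | nil => rfl
  | skip _ ih => exact ih
  | take _ _ _ _ ih => rw [List.map_cons, List.sum_cons, ← ih, add_comm]

theorem mem_opt (h : KPath valid O opt sh σ z g cs) :
    ∀ c ∈ cs, ∃ σ' < σ, ∃ o < O, c.1 = σ' * O + o ∧ ∃ g', opt c.1 = some (c.2, g') := by
  induction h with
  | nil => simp
  | skip _ ih =>
    intro c hc
    obtain ⟨σ', h1, h2⟩ := ih c hc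
    exact ⟨σ', by omega, h2⟩
  | @take σ o w z g g' cs _ ho hw _ ih =>
    intro c hc
    rcases List.mem_cons.mp hc with rfl | hc
    · exact ⟨σ, by omega, o, ho, rfl, g', hw⟩
    · obtain ⟨σ', h1, h2⟩ := ih c hc
      exact ⟨σ', by omega, h2⟩

theorem gain_eq (h : KPath valid O opt sh σ z g cs) {γ : ℕ × ℕ → ℤ}
    (hγ : ∀ σ' < σ, ∀ o < O, ∀ w g', opt (σ' * O + o) = some (w, g') → γ (σ' * O + o, w) = g') :
    g = (cs.map γ).sum := by
  induction h with
  | nil => rfl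
  | skip _ ih => exact ih fun σ' hσ' => hγ σ' (by omega)
  | @take σ o w z g g' cs _ ho hw _ ih =>
    rw [List.map_cons, List.sum_cons, ← ih fun σ' hσ' => hγ σ' (by omega),
      hγ σ (by omega) o ho w g' hw, add_comm]

theorem length_le (h : KPath valid O opt sh σ z g cs) : cs.length ≤ σ := by
  induction h with
  | nil => simp
  | skip _ ih => omega
  | take _ _ _ _ ih => simp; omega

/-- With a single option per stage, no option is chosen twice. -/
theorem sublist (h : KPath valid 1 opt sh σ z g cs) : (cs.map Prod.snd).reverse.Sublist
    ((List.range σ).filterMap fun c => (opt c).map Prod.fst) := by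
  induction h with
  | nil => simp
  | skip _ ih =>
    rw [List.range_succ, List.filterMap_append]
    exact ih.trans (List.sublist_append_left _ _)
  | @take σ o w z g g' cs _ ho hw _ ih =>
    obtain rfl : o = 0 := by omega
    rw [Nat.mul_one, Nat.add_zero] at hw
    rw [List.range_succ, List.filterMap_append, List.map_cons, List.reverse_cons]
    exact ih.append (by simp [hw])

/-- A choice of options gives a path if all partial sums are valid. -/
theorem of_choice (ch : ℕ → Option ℕ) (gain : ℕ → ℤ) (S : ℕ)
    (hch : ∀ σ < S, ∀ o, ch σ = some o → o < O ∧ ∃ w, opt (σ * O + o) = some (w, gain σ))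
    (hv : ∀ σ ≤ S, valid (∑ τ ∈ Finset.range σ, (ch τ).elim 0 fun o => sh (τ * O + o))) :
    ∀ σ ≤ S, ∃ cs, KPath valid O opt sh σ
      (∑ τ ∈ Finset.range σ, (ch τ).elim 0 fun o => sh (τ * O + o))
      (∑ τ ∈ Finset.range σ, (ch τ).elim 0 fun _ => gain τ) cs := by
  intro σ
  induction σ with
  | zero => intro _; exact ⟨[], by simpa using KPath.nil⟩
  | succ σ ih =>
    intro hσ
    obtain ⟨cs, h⟩ := ih (by omega)
    have h1 := hv (σ + 1) hσ
    rw [Finset.sum_range_succ] at h1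
    rw [Finset.sum_range_succ, Finset.sum_range_succ]
    rcases hc : ch σ with _ | o
    · exact ⟨cs, by simpa using h.skip⟩
    · obtain ⟨h2, w, h3⟩ := hch σ (by omega) o hc
      rw [hc] at h1
      exact ⟨_, h.take h2 h3 h1⟩

end KPath

/-- `z` is the code of a vector with leading entry between `0` and `N₀`, the first `r` digits
bounded by `R₁` and the other digits bounded by `R₂`. -/
def InBox (M : ℤ) (l r : ℕ) (N₀ R₁ R₂ : ℤ) (z : ℤ) : Prop :=
  ∃ N d, 0 ≤ N ∧ N ≤ N₀ ∧ (∀ i < r, |d i| ≤ R₁) ∧ (∀ i, r ≤ i → i < l → |d i| ≤ R₂) ∧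
    z = code M N d l

theorem inBox_zero {M : ℤ} {l r : ℕ} {N₀ R₁ R₂ : ℤ} (hN : 0 ≤ N₀) (h1 : 0 ≤ R₁) (h2 : 0 ≤ R₂) :
    InBox M l r N₀ R₁ R₂ 0 :=
  ⟨0, fun _ => 0, le_rfl, hN, by simp [h1], by simp [h2], (code_zero _ _).symm⟩

/-- As all states on a path are valid, no carries occur: digits add up. -/
theorem KPath.digits {M : ℤ} {l r : ℕ} {N₀ R₁ R₂ : ℤ} {O : ℕ} {opt : ℕ → Option (ℕ × ℤ)}
    {sh : ℕ → ℤ} {σ : ℕ} {z g : ℤ} {cs : List (ℕ × ℕ)}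
    (h : KPath (InBox M l r N₀ R₁ R₂) O opt sh σ z g cs)
    (hR₁ : 0 ≤ R₁) (hR₂ : 0 ≤ R₂) (h₁ : 3 * R₁ < M) (h₂ : R₁ + 2 * R₂ < M)
    (N : ℕ × ℕ → ℤ) (D : ℕ × ℕ → ℕ → ℤ)
    (hD : ∀ c ∈ cs, sh c.1 = code M (N c) (D c) l ∧ ∀ i < l, |D c i| ≤ R₁) :
    (∀ i < r, i < l → |(cs.map fun c => D c i).sum| ≤ R₁) ∧
      (∀ i, r ≤ i → i < l → |(cs.map fun c => D c i).sum| ≤ R₂) := by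
  induction h with
  | nil => simp [hR₁, hR₂]
  | skip _ ih => exact ih hD
  | @take σ o w z g g' cs hp ho hw hv ih =>
    have ih := ih fun c hc => hD c (List.mem_cons_of_mem _ hc)
    obtain ⟨N', d', -, -, b1, b2, e⟩ := hv
    set c : ℕ × ℕ := (σ * O + o, w)
    have hc := hD c List.mem_cons_self
    have e1 : z = code M (cs.map N).sum (fun i => (cs.map fun c => D c i).sum) l := by
      rw [code_list_sum, hp.state_eq]
      congr 1
      exact List.map_congr_left fun c' hc' => (hD c' (List.mem_cons_of_mem _ hc')).1
    have e2 : code M ((cs.map N).sum + N c) (fun i => (cs.map fun c => D c i).sum + D c i) l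
        = code M N' d' l := by
      rw [code_add, ← e1, ← e, ← hc.1]
    have hlt : ∀ i < l, |(cs.map fun c => D c i).sum + D c i - d' i| < M := by
      intro i hi
      have h3 := abs_le.mp (hc.2 i hi)
      rcases lt_or_ge i r with hr | hr
      · have h4 := abs_le.mp (ih.1 i hr hi)
        have h5 := abs_le.mp (b1 i hr)
        rw [abs_lt]; constructor <;> linarith
      · have h4 := abs_le.mp (ih.2 i hr hi)
        have h5 := abs_le.mp (b2 i hr hi)
        rw [abs_lt]; constructor <;> linarith
    have e3 := (code_inj hlt e2).2
    constructor
    · intro i hr hi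
      rw [List.map_cons, List.sum_cons, add_comm, e3 i hi]; exact b1 i hr
    · intro i hr hi
      rw [List.map_cons, List.sum_cons, add_comm, e3 i hi]; exact b2 i hr hi

/-! ### The best solutions within a brick -/

theorem sum_getElem?_le_count {α : Type*} [DecidableEq α] [BEq α] [LawfulBEq α] (l : List α) (p : α)
    (K : ℕ) :
    ∑ j ∈ Finset.range K, (if l[j]? = some p then 1 else 0) ≤ l.count p := by
  induction l generalizing K with
  | nil => simp
  | cons a l ih =>
    cases K with
    | zero => simp
    | succ K =>
      rw [Finset.sum_range_succ', List.count_cons]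
      simp only [List.getElem?_cons_succ, List.getElem?_cons_zero, Option.some.injEq]
      refine add_le_add (ih K) ?_
      by_cases h : a = p <;> simp [h]

theorem sum_range_mul_add {α : Type*} [AddCommMonoid α] (f : ℕ → ℕ → α) (V a₀ y₀ : ℕ)
    (hy : y₀ ≤ V) :
    ∑ c ∈ Finset.range (a₀ * V + y₀), f (c / V) (c % V) =
      ∑ a ∈ Finset.range a₀, ∑ y ∈ Finset.range V, f a y + ∑ y ∈ Finset.range y₀, f a₀ y := by
  rw [Finset.sum_range_add]
  congr 1
  · clear hy
    induction a₀ with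
    | zero => simp
    | succ a ih =>
      rw [Nat.succ_mul, Finset.sum_range_add, ih, Finset.sum_range_succ]
      congr 1
      refine Finset.sum_congr rfl fun y hy' => ?_
      have hy' := Finset.mem_range.mp hy'
      rw [Nat.mul_comm, Nat.mul_add_div (by omega), Nat.mul_add_mod, Nat.div_eq_of_lt hy',
        Nat.mod_eq_of_lt hy', Nat.add_zero]
  · refine Finset.sum_congr rfl fun y hy' => ?_
    have hy' := Finset.mem_range.mp hy'
    rw [Nat.mul_comm, Nat.mul_add_div (by omega), Nat.mul_add_mod,
      Nat.div_eq_of_lt (by omega : y < V), Nat.mod_eq_of_lt (by omega : y < V), Nat.add_zero]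

/-- The data of the subproblem for one brick. There are `m` items; item `p` has the digits `dv p`
(the column of the `n`-fold, or its negative), the gain `γ p` and the capacity `cap p`. The numbers
`vl 0, …, vl (V - 1)` are the states. -/
structure Brick where
  M : ℤ
  l : ℕ
  r : ℕ
  L : ℕ
  k : ℕ
  δ : ℕ
  R₁ : ℤ
  R₂ : ℤ
  N₀ : ℤ
  m : ℕ
  dv : ℕ → ℕ → ℤ
  γ : ℕ → ℤ
  cap : ℕ → ℕ
  V : ℕ
  vl : ℕ → ℤ

namespace Brick

variable (b : Brick)

/-- The code of one unit of item `p`. -/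
def item (p : ℕ) : ℤ := code b.M 1 (b.dv p) b.l

/-- The units of item `p` with code `z`. -/
def leaf (z : ℤ) (p : ℕ) : List (ℕ × ℤ) :=
  if b.item p = z then List.replicate (b.cap p) (p, b.γ p) else []

/-- The units with code `z`, in the order of decreasing gains. -/
def units (z : ℤ) : List (ℕ × ℤ) := full (b.leaf z) b.m 1

/-- The options of the knapsack for the brick: stage `a * V + y` may take the unit with the number
`ordf L a` among those with code `vl y`. -/
def opt (c : ℕ) : Option (ℕ × ℤ) := (b.units (b.vl (c % b.V)))[ordf b.L (c / b.V)]?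

/-- The shift of an option. -/
def sh (c : ℕ) : ℤ := b.vl (c % b.V)

/-- The valid states. -/
abbrev valid : ℤ → Prop := InBox b.M b.l b.r b.N₀ b.R₁ b.R₂

/-- The conditions on the parameters. -/
structure Good : Prop where
  k_le : b.k ≤ 2 ^ b.L
  k_le_N : (b.k : ℤ) ≤ b.N₀
  k_pos : 1 ≤ b.k
  R₁_le : (b.k * b.δ : ℤ) ≤ b.R₁
  R₂_le : (((2 * b.δ + 1) ^ b.l * (b.L + 1) * b.δ : ℕ) : ℤ) ≤ b.R₂
  M_gt : 3 * (b.R₁ + b.R₂) < b.M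
  m_pos : 1 ≤ b.m
  r_le : b.r ≤ b.l
  dv_le : ∀ p < b.m, ∀ i < b.l, |b.dv p i| ≤ b.δ
  vl_inj : ∀ y < b.V, ∀ y' < b.V, b.vl y = b.vl y' → y = y'
  vl_iff : ∀ z, (∃ y < b.V, b.vl y = z) ↔ b.valid z

variable {b}

theorem mem_units (hm : 1 ≤ b.m) {z : ℤ} {x : ℕ × ℤ} (hx : x ∈ b.units z) :
    x.1 < b.m ∧ b.item x.1 = z ∧ x.2 = b.γ x.1 := by
  classical
  have h1 : 0 < (b.units z).count x := List.count_pos_iff.mpr hx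
  rw [units, count_full_root x hm] at h1
  obtain ⟨p, hp, h2⟩ := Finset.exists_ne_zero_of_sum_ne_zero h1.ne'
  have h3 : x ∈ b.leaf z p := List.count_pos_iff.mp (Nat.pos_of_ne_zero h2)
  unfold leaf at h3
  split_ifs at h3 with h4
  · have := List.eq_of_mem_replicate h3
    subst this
    exact ⟨Finset.mem_range.mp hp, h4, rfl⟩
  · simp at h3

theorem count_units (hm : 1 ≤ b.m) (z : ℤ) {p : ℕ} (hp : p < b.m) :
    (b.units z).count (p, b.γ p) = if b.item p = z then b.cap p else 0 := by
  rw [units, count_full_root _ hm, Finset.sum_eq_single p]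
  · unfold leaf; split_ifs <;> simp
  · intro q _ hq
    unfold leaf
    split_ifs
    · rw [List.count_replicate, if_neg]; simp [hq]
    · simp
  · intro h; exact absurd (Finset.mem_range.mpr hp) h

theorem sorted_units (hm : 1 ≤ b.m) (z : ℤ) :
    (b.units z).Pairwise fun x y => y.2 ≤ x.2 := by
  refine full_sorted (fun p _ => ?_) le_rfl (by omega)
  unfold leaf
  split_ifs
  · simp [List.pairwise_replicate]
  · simp

/-- The multiset `ms` of items is a solution within the capacities. -/
def Fits (b : Brick) (ms : List ℕ) : Prop := ∀ p, (p ∈ ms → p < b.m) ∧ ms.count p ≤ b.cap p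

/-- The total gain of a list of items. -/
def gain (b : Brick) (ms : List ℕ) : ℤ := (ms.map b.γ).sum

/-- The digits of a list of items. -/
def dig (b : Brick) (ms : List ℕ) (i : ℕ) : ℤ := (ms.map fun p => b.dv p i).sum

theorem sum_item (ms : List ℕ) : (ms.map b.item).sum = code b.M ms.length (b.dig ms) b.l := by
  have := code_list_sum b.M (fun _ => 1) b.dv b.l ms
  unfold item dig
  rw [← this]; simp

theorem opt_some (hm : 1 ≤ b.m) {c p : ℕ} {g : ℤ} (h : b.opt c = some (p, g)) :
    p < b.m ∧ b.item p = b.sh c ∧ g = b.γ p :=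
  mem_units hm (List.mem_of_getElem? h)

/-- A path of the knapsack for the brick belongs to a solution within the capacities, whose code is
the final state. The lower digits are only bounded here; they vanish if the final state says so. -/
theorem sound (hb : b.Good) {z g : ℤ} {cs : List (ℕ × ℕ)}
    (h : KPath b.valid 1 b.opt b.sh (2 ^ b.L * b.V) z g cs) :
    b.Fits (cs.map Prod.snd) ∧ g = b.gain (cs.map Prod.snd) ∧
      z = code b.M (cs.map Prod.snd).length (b.dig (cs.map Prod.snd)) b.l ∧
      (∀ i < b.r, |b.dig (cs.map Prod.snd) i| ≤ b.R₁) ∧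
      (∀ i, b.r ≤ i → i < b.l → |b.dig (cs.map Prod.snd) i| ≤ b.R₂) := by
  have hm := hb.m_pos
  have hR₁ : 0 ≤ b.R₁ := le_trans (by positivity) hb.R₁_le
  have hR₂ : 0 ≤ b.R₂ := le_trans (by positivity) hb.R₂_le
  have hM := hb.M_gt
  have hmem : ∀ c ∈ cs, c.2 < b.m ∧ b.item c.2 = b.sh c.1 := by
    intro c hc
    obtain ⟨_, _, _, _, _, g', h5⟩ := h.mem_opt c hc
    exact ⟨(opt_some hm h5).1, (opt_some hm h5).2.1⟩
  refine ⟨fun p => ⟨?_, ?_⟩, ?_, ?_, ?_⟩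
  · intro hp
    obtain ⟨c, hc, rfl⟩ := List.mem_map.mp hp
    exact (hmem c hc).1
  · by_cases hpm : p < b.m
    swap
    · rw [List.count_eq_zero_of_not_mem (a := p)]
      · omega
      · intro hp
        obtain ⟨c, hc, rfl⟩ := List.mem_map.mp hp
        exact hpm (hmem c hc).1
    rw [← List.count_reverse]
    refine (List.Sublist.count_le p h.sublist).trans ?_
    have e1 : ∀ S, ((List.range S).filterMap fun c => (b.opt c).map Prod.fst).count p
        = ∑ c ∈ Finset.range S, if b.opt c = some (p, b.γ p) then 1 else 0 := by
      intro S
      induction S with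
      | zero => simp
      | succ S ih =>
        rw [List.range_succ, List.filterMap_append, List.count_append, ih,
          Finset.sum_range_succ]
        congr 1
        rcases ho : b.opt S with _ | ⟨q, g'⟩
        · simp [ho]
        · have := (opt_some hm ho).2.2
          subst this
          by_cases hq : q = p
          · subst hq; simp [ho]
          · simp [ho, hq]
    rw [e1]
    have e2 := sum_range_mul_add (fun a y => if (b.units (b.vl y))[ordf b.L a]? = some (p, b.γ p)
      then (1 : ℕ) else 0) b.V (2 ^ b.L) 0 (by omega)
    simp only [Nat.add_zero, Finset.range_zero, Finset.sum_empty] at e2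
    unfold opt
    rw [e2, Finset.sum_comm]
    have e3 : ∀ y ∈ Finset.range b.V, ∑ a ∈ Finset.range (2 ^ b.L),
        (if (b.units (b.vl y))[ordf b.L a]? = some (p, b.γ p) then (1 : ℕ) else 0) ≤
          if b.item p = b.vl y then b.cap p else 0 := by
      intro y _
      rw [sum_ordf (fun j => if (b.units (b.vl y))[j]? = some (p, b.γ p) then (1 : ℕ) else 0),
        ← count_units hm _ hpm]
      exact sum_getElem?_le_count (b.units (b.vl y)) (p, b.γ p) _
    refine (Finset.sum_le_sum e3).trans ?_
    by_cases hy : ∃ y < b.V, b.item p = b.vl y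
    · obtain ⟨y, hy, e⟩ := hy
      rw [Finset.sum_eq_single y]
      · split_ifs; omega
      · intro y' hy' hne
        rw [if_neg]
        intro e'
        exact hne (hb.vl_inj _ (Finset.mem_range.mp hy') _ hy (by rw [← e', e]))
      · intro h'; exact absurd (Finset.mem_range.mpr hy) h'
    · rw [Finset.sum_eq_zero]
      · omega
      · intro y hy'
        rw [if_neg fun e => hy ⟨y, Finset.mem_range.mp hy', e⟩]
  · rw [gain, List.map_map]
    refine h.gain_eq (γ := b.γ ∘ Prod.snd) fun σ' _ o _ w g' hw => ?_
    exact (opt_some hm hw).2.2.symm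
  · rw [← sum_item, h.state_eq, List.map_map]
    congr 1
    exact List.map_congr_left fun c hc => (hmem c hc).2.symm
  · have hδ : (b.δ : ℤ) ≤ b.R₁ := by
      have := hb.R₁_le; have := hb.k_pos; nlinarith
    have := h.digits hR₁ hR₂ (by linarith) (by linarith) (fun _ => 1) (fun c => b.dv c.2)
      fun c hc => ⟨(hmem c hc).2.symm, fun i hi => (hb.dv_le _ (hmem c hc).1 i hi).trans hδ⟩
    unfold dig
    simp only [List.map_map]
    exact ⟨fun i hi => this.1 i hi (hi.trans_le hb.r_le), this.2⟩

/-- The items of `ms` with code `z`. -/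
def part (b : Brick) (ms : List ℕ) (z : ℤ) : List ℕ := ms.filter fun p => b.item p = z

theorem sum_part (hb : b.Good) {α : Type*} [AddCommMonoid α] (f : ℕ → α) (ms : List ℕ)
    (hms : ∀ p ∈ ms, p < b.m) :
    ∑ y ∈ Finset.range b.V, ((b.part ms (b.vl y)).map f).sum = (ms.map f).sum := by
  induction ms with
  | nil => simp [part]
  | cons p ms ih =>
    have hp := hms p List.mem_cons_self
    have hδ : (b.δ : ℤ) ≤ b.R₁ := by
      have := hb.R₁_le; have := hb.k_pos; nlinarith
    have hδ' : (b.δ : ℤ) ≤ b.R₂ := by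
      refine le_trans ?_ hb.R₂_le
      exact_mod_cast Nat.le_mul_of_pos_left _ (by positivity)
    obtain ⟨y₀, hy₀, e⟩ : ∃ y < b.V, b.vl y = b.item p := by
      rw [hb.vl_iff]
      refine ⟨1, b.dv p, by norm_num, ?_, fun i hi => ?_, fun i _ hi => ?_, rfl⟩
      · have := hb.k_le_N; have := hb.k_pos; omega
      · exact (hb.dv_le p hp i (hi.trans_le hb.r_le)).trans hδ
      · exact (hb.dv_le p hp i hi).trans hδ'
    have e1 : ∀ y ∈ Finset.range b.V, ((b.part (p :: ms) (b.vl y)).map f).sum =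
        (if y = y₀ then f p else 0) + ((b.part ms (b.vl y)).map f).sum := by
      intro y hy
      by_cases h : y = y₀
      · subst h; simp [part, e]
      · have : b.item p ≠ b.vl y := fun h' =>
          h (hb.vl_inj _ (Finset.mem_range.mp hy) _ hy₀ (by rw [e, h']))
        simp [part, this, h]
    rw [Finset.sum_congr rfl e1, Finset.sum_add_distrib,
      ih fun q hq => hms q (List.mem_cons_of_mem _ hq)]
    simp [hy₀]

theorem part_subperm (hb : b.Good) {ms : List ℕ} (hms : b.Fits ms) (z : ℤ) :
    ((b.part ms z).map fun p => (p, b.γ p)).Subperm (b.units z) := by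
  rw [List.subperm_ext_iff]
  intro x hx
  obtain ⟨p, hp, rfl⟩ := List.mem_map.mp hx
  have hp' := List.mem_filter.mp hp
  have hpz : b.item p = z := by simpa using hp'.2
  rw [count_units hb.m_pos z ((hms p).1 hp'.1), if_pos hpz]
  have hinj : Function.Injective fun p => (p, b.γ p) := fun p q h => (Prod.mk.inj h).1
  rw [List.count_map_of_injective _ _ hinj, part, List.count_filter (by simpa using hpz)]
  exact (hms p).2

/-- The digits of the type with number `y`. -/
def tdig (b : Brick) (ms : List ℕ) (y : ℕ) : ℕ → ℤ :=
  ((b.part ms (b.vl y)).head?).elim (fun _ => 0) b.dv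

theorem mem_part {ms : List ℕ} {z : ℤ} {p : ℕ} : p ∈ b.part ms z ↔ p ∈ ms ∧ b.item p = z := by
  simp [part]

theorem tdig_eq (hb : b.Good) {ms : List ℕ} (hms : b.Fits ms) {y p : ℕ}
    (hp : p ∈ b.part ms (b.vl y)) : ∀ i < b.l, b.dv p i = b.tdig ms y i := by
  unfold tdig
  rcases hq : (b.part ms (b.vl y)).head? with _ | q
  · rw [List.head?_eq_none_iff] at hq; rw [hq] at hp; simp at hp
  · have hq' : q ∈ b.part ms (b.vl y) := List.mem_of_mem_head? hq
    have h1 := mem_part.mp hp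
    have h2 := mem_part.mp hq'
    refine (code_inj (fun i hi => ?_) (h1.2.trans h2.2.symm)).2
    have h3 := abs_le.mp (hb.dv_le p ((hms p).1 h1.1) i hi)
    have h4 := abs_le.mp (hb.dv_le q ((hms q).1 h2.1) i hi)
    have h5 := hb.M_gt
    have h6 := hb.R₁_le
    have h7 := hb.k_pos
    have h8 : (0 : ℤ) ≤ b.R₂ := le_trans (by positivity) hb.R₂_le
    have h9 : (b.δ : ℤ) ≤ b.R₁ := by nlinarith
    rw [abs_lt]; constructor <;> linarith

theorem abs_tdig_le (hb : b.Good) {ms : List ℕ} (hms : b.Fits ms) (y : ℕ) {i : ℕ}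
    (hi : i < b.l) : |b.tdig ms y i| ≤ b.δ := by
  unfold tdig
  rcases hq : (b.part ms (b.vl y)).head? with _ | q
  · simp
  · have hq' : q ∈ b.part ms (b.vl y) := List.mem_of_mem_head? hq
    exact hb.dv_le q ((hms q).1 (mem_part.mp hq').1) i hi

/-- The number of different types is bounded in terms of the entries of the matrix. -/
theorem card_types_le (hb : b.Good) {ms : List ℕ} (hms : b.Fits ms) :
    ((Finset.range b.V).filter fun y => b.part ms (b.vl y) ≠ []).card ≤ (2 * b.δ + 1) ^ b.l := by
  have hcard : (Finset.Icc (fun _ : Fin b.l => (-b.δ : ℤ)) (fun _ => (b.δ : ℤ))).card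
      = (2 * b.δ + 1) ^ b.l := by
    rw [Pi.card_Icc]
    simp only [Int.card_Icc, Finset.prod_const, Finset.card_univ, Fintype.card_fin]
    congr 1; omega
  rw [← hcard]
  refine Finset.card_le_card_of_injOn (fun y i => b.tdig ms y i) ?_ ?_
  · intro y _
    rw [Finset.mem_coe, Finset.mem_Icc]
    exact ⟨fun i => (abs_le.mp (abs_tdig_le hb hms y i.2)).1,
      fun i => (abs_le.mp (abs_tdig_le hb hms y i.2)).2⟩
  · intro y hy y' hy' h
    simp only [Finset.coe_filter, Set.mem_ofPred_eq, Finset.mem_range] at hy hy'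
    obtain ⟨p, hp⟩ := List.exists_mem_of_ne_nil _ hy.2
    obtain ⟨q, hq⟩ := List.exists_mem_of_ne_nil _ hy'.2
    refine hb.vl_inj y hy.1 y' hy'.1 ?_
    rw [← (mem_part.mp hp).2, ← (mem_part.mp hq).2]
    unfold item
    refine code_congr fun i hi => ?_
    rw [tdig_eq hb hms hp i hi, tdig_eq hb hms hq i hi]
    exact congrFun h ⟨i, hi⟩

/-- Stage `c` takes its unit if this is one of the first `#(part ms (vl y))` units of its type. -/
def choice (b : Brick) (ms : List ℕ) (c : ℕ) : Option ℕ :=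
  if ordf b.L (c / b.V) < (b.part ms (b.vl (c % b.V))).length then some 0 else none

/-- `Brick.choice` as a number, as a function of the position in the order and the type. -/
def chosen (b : Brick) (ms : List ℕ) (a y : ℕ) : ℤ :=
  if ordf b.L a < (b.part ms (b.vl y)).length then 1 else 0

theorem chosen_nonneg (b : Brick) (ms : List ℕ) (a y : ℕ) : 0 ≤ b.chosen ms a y := by
  unfold chosen; split_ifs <;> norm_num

theorem length_part_le (hb : b.Good) {ms : List ℕ} (hk : ms.length ≤ b.k) (z : ℤ) :
    (b.part ms z).length ≤ 2 ^ b.L :=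
  (List.length_filter_le _ _).trans (hk.trans hb.k_le)

theorem sum_chosen (hb : b.Good) {ms : List ℕ} (hms : b.Fits ms) (hk : ms.length ≤ b.k) :
    ∑ c ∈ Finset.range (2 ^ b.L * b.V), b.chosen ms (c / b.V) (c % b.V) = ms.length := by
  have := sum_range_mul_add (b.chosen ms) b.V (2 ^ b.L) 0 (by omega)
  simp only [Finset.range_zero, Finset.sum_empty, add_zero] at this
  rw [this, Finset.sum_comm]
  have e : ∀ y ∈ Finset.range b.V, ∑ a ∈ Finset.range (2 ^ b.L), b.chosen ms a y =
      ((b.part ms (b.vl y)).map fun _ => (1 : ℤ)).sum := by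
    intro y _
    have h := ordCount_full b.L _ (length_part_le hb hk (b.vl y))
    simpa [ordCount, chosen] using h
  rw [Finset.sum_congr rfl e, sum_part hb _ ms fun p hp => (hms p).1 hp]
  simp

/-- The number of units that stages before `a₀ * V + y₀` take, type by type. -/
theorem sum_chosen_mul (b : Brick) (ms : List ℕ) (f : ℕ → ℤ) (a₀ y₀ : ℕ) (hy : y₀ ≤ b.V) :
    ∑ c ∈ Finset.range (a₀ * b.V + y₀), b.chosen ms (c / b.V) (c % b.V) * f (c % b.V) =
      ∑ y ∈ Finset.range b.V, (ordCount b.L a₀ (b.part ms (b.vl y)).length +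
        if y < y₀ then b.chosen ms a₀ y else 0) * f y := by
  have := sum_range_mul_add (fun a y => b.chosen ms a y * f y) b.V a₀ y₀ hy
  rw [this, Finset.sum_comm]
  have e : ∑ y ∈ Finset.range y₀, b.chosen ms a₀ y * f y =
      ∑ y ∈ Finset.range b.V, (if y < y₀ then b.chosen ms a₀ y else 0) * f y := by
    simp only [ite_mul, zero_mul]
    rw [← Finset.sum_filter]
    refine Finset.sum_congr ?_ fun _ _ => rfl
    ext y; simp; omega
  rw [e, ← Finset.sum_add_distrib]
  refine Finset.sum_congr rfl fun y _ => ?_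
  rw [add_mul, ordCount, Finset.sum_mul]
  rfl

/-- The balance of the order keeps the digits of partial sums small where the total vanishes. -/
theorem abs_partial_le (hb : b.Good) {ms : List ℕ} (hms : b.Fits ms) (hk : ms.length ≤ b.k)
    {c₀ : ℕ} (hc₀ : c₀ ≤ 2 ^ b.L * b.V) {i : ℕ} (hi : i < b.l) (h0 : b.dig ms i = 0) :
    |∑ c ∈ Finset.range c₀, b.chosen ms (c / b.V) (c % b.V) * b.tdig ms (c % b.V) i| ≤ b.R₂ := by
  obtain ⟨a₀, y₀, hy, ha, rfl⟩ : ∃ a₀ y₀, y₀ ≤ b.V ∧ (a₀ ≤ 2 ^ b.L ∧ (0 < y₀ → a₀ < 2 ^ b.L)) ∧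
      c₀ = a₀ * b.V + y₀ := by
    rcases Nat.eq_zero_or_pos b.V with hV | hV
    · exact ⟨0, 0, by omega, by simp, by rw [hV] at hc₀; omega⟩
    · refine ⟨c₀ / b.V, c₀ % b.V, (Nat.mod_lt _ hV).le, ⟨?_, ?_⟩, ?_⟩
      · exact Nat.div_le_of_le_mul (by rwa [Nat.mul_comm])
      · intro hp
        rw [Nat.div_lt_iff_lt_mul hV]
        refine lt_of_le_of_ne hc₀ fun h => ?_
        rw [h, Nat.mul_mod_left] at hp
        omega
      · rw [Nat.mul_comm]; exact (Nat.div_add_mod _ _).symm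
  rw [sum_chosen_mul b ms (fun y => b.tdig ms y i) a₀ y₀ hy]
  -- `mu y` units of type `y` are taken altogether, and `cy y` of them before stage `c₀`
  set mu : ℕ → ℕ := fun y => (b.part ms (b.vl y)).length with hmu
  set cy : ℕ → ℤ := fun y => ordCount b.L a₀ (b.part ms (b.vl y)).length +
    if y < y₀ then b.chosen ms a₀ y else 0 with hcy
  have hP : (1 : ℤ) ≤ 2 ^ b.L := one_le_pow₀ (by norm_num)
  have htot : ∑ y ∈ Finset.range b.V, (mu y : ℤ) * b.tdig ms y i = 0 := by
    rw [← h0, dig, ← sum_part hb (fun p => b.dv p i) ms fun p hp => (hms p).1 hp]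
    refine Finset.sum_congr rfl fun y _ => ?_
    have : (b.part ms (b.vl y)).map (fun p => b.dv p i) =
        (b.part ms (b.vl y)).map (fun _ => b.tdig ms y i) :=
      List.map_congr_left fun p hp => tdig_eq hb hms hp i hi
    rw [this]; simp [hmu]
  have hbal : ∀ y, |2 ^ b.L * cy y - a₀ * mu y| ≤ (b.L + 1) * 2 ^ b.L := by
    intro y
    have h1 := abs_le.mp (abs_ordCount_sub_le b.L a₀ (mu y) ha.1 (length_part_le hb hk _))
    have h2 : 0 ≤ (if y < y₀ then b.chosen ms a₀ y else 0) ∧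
        (if y < y₀ then b.chosen ms a₀ y else 0) ≤ 1 := by
      unfold chosen; split_ifs <;> simp
    simp only [hcy]
    rw [abs_le]
    constructor <;> nlinarith
  have hzero : ∀ y, b.part ms (b.vl y) = [] → cy y = 0 ∧ mu y = 0 := by
    intro y hy'
    simp [hcy, hmu, hy', ordCount, chosen]
  -- subtract the multiple `a₀` of the vanishing total, so that only deviations remain
  have key : 2 ^ b.L * ∑ y ∈ Finset.range b.V, cy y * b.tdig ms y i =
      ∑ y ∈ (Finset.range b.V).filter (fun y => b.part ms (b.vl y) ≠ []),
        (2 ^ b.L * cy y - a₀ * mu y) * b.tdig ms y i := by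
    have : ∑ y ∈ Finset.range b.V, (2 ^ b.L * cy y - a₀ * mu y) * b.tdig ms y i =
        2 ^ b.L * ∑ y ∈ Finset.range b.V, cy y * b.tdig ms y i -
          a₀ * ∑ y ∈ Finset.range b.V, (mu y : ℤ) * b.tdig ms y i := by
      rw [Finset.mul_sum, Finset.mul_sum, ← Finset.sum_sub_distrib]
      exact Finset.sum_congr rfl fun y _ => by ring
    rw [htot, mul_zero, sub_zero] at this
    rw [← this, Finset.sum_filter]
    refine Finset.sum_congr rfl fun y _ => ?_
    split_ifs with h
    · rfl
    · rw [ne_eq, not_not] at h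
      rw [(hzero y h).1, (hzero y h).2]; simp
  have hbound : |2 ^ b.L * ∑ y ∈ Finset.range b.V, cy y * b.tdig ms y i| ≤
      2 ^ b.L * ((2 * b.δ + 1) ^ b.l * (b.L + 1) * b.δ) := by
    rw [key]
    refine (Finset.abs_sum_le_sum_abs _ _).trans ?_
    have h1 : ∀ y ∈ (Finset.range b.V).filter (fun y => b.part ms (b.vl y) ≠ []),
        |(2 ^ b.L * cy y - a₀ * mu y) * b.tdig ms y i| ≤ (b.L + 1) * 2 ^ b.L * b.δ := by
      intro y _
      rw [abs_mul]
      exact mul_le_mul (hbal y) (abs_tdig_le hb hms y hi) (abs_nonneg _) (by positivity)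
    refine (Finset.sum_le_card_nsmul _ _ _ h1).trans ?_
    rw [nsmul_eq_mul]
    have h2 : ((((Finset.range b.V).filter fun y => b.part ms (b.vl y) ≠ []).card : ℕ) : ℤ) ≤
        (2 * b.δ + 1) ^ b.l := by exact_mod_cast card_types_le hb hms
    have h3 : (0 : ℤ) ≤ (b.L + 1) * 2 ^ b.L * b.δ := by positivity
    calc _ ≤ ((2 * b.δ + 1) ^ b.l : ℤ) * ((b.L + 1) * 2 ^ b.L * b.δ) :=
          mul_le_mul_of_nonneg_right h2 h3
      _ = _ := by ring
  rw [abs_mul, abs_of_pos (by positivity)] at hbound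
  refine (le_of_mul_le_mul_left hbound (by positivity)).trans ?_
  exact_mod_cast hb.R₂_le

theorem valid_partial (hb : b.Good) {ms : List ℕ} (hms : b.Fits ms) (hk : ms.length ≤ b.k)
    (h0 : ∀ i, b.r ≤ i → i < b.l → b.dig ms i = 0) {c₀ : ℕ} (hc₀ : c₀ ≤ 2 ^ b.L * b.V) :
    b.valid (∑ c ∈ Finset.range c₀, b.chosen ms (c / b.V) (c % b.V) * b.sh c) := by
  have hN : ∑ c ∈ Finset.range c₀, b.chosen ms (c / b.V) (c % b.V) ≤ b.k := by
    calc _ ≤ ∑ c ∈ Finset.range (2 ^ b.L * b.V), b.chosen ms (c / b.V) (c % b.V) :=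
          Finset.sum_le_sum_of_subset_of_nonneg
            (fun c hc => Finset.mem_range.mpr ((Finset.mem_range.mp hc).trans_le hc₀))
            fun c _ _ => b.chosen_nonneg ms _ _
      _ = ms.length := sum_chosen hb hms hk
      _ ≤ b.k := by exact_mod_cast hk
  refine ⟨∑ c ∈ Finset.range c₀, b.chosen ms (c / b.V) (c % b.V),
    fun i => ∑ c ∈ Finset.range c₀, b.chosen ms (c / b.V) (c % b.V) * b.tdig ms (c % b.V) i,
    Finset.sum_nonneg fun c _ => b.chosen_nonneg ms _ _, hN.trans hb.k_le_N, ?_, ?_, ?_⟩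
  · intro i hi
    refine (Finset.abs_sum_le_sum_abs _ _).trans ?_
    have h1 : ∀ c ∈ Finset.range c₀, |b.chosen ms (c / b.V) (c % b.V) * b.tdig ms (c % b.V) i| ≤
        b.chosen ms (c / b.V) (c % b.V) * b.δ := by
      intro c _
      rw [abs_mul, abs_of_nonneg (b.chosen_nonneg ms _ _)]
      exact mul_le_mul_of_nonneg_left (abs_tdig_le hb hms _ (hi.trans_le hb.r_le))
        (b.chosen_nonneg ms _ _)
    refine (Finset.sum_le_sum h1).trans ?_
    rw [← Finset.sum_mul]
    exact (mul_le_mul_of_nonneg_right hN (by positivity)).trans hb.R₁_le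
  · intro i hr hi
    exact abs_partial_le hb hms hk hc₀ hi (h0 i hr hi)
  · rw [code_sum]
    refine Finset.sum_congr rfl fun c _ => ?_
    unfold chosen
    split_ifs with h
    · obtain ⟨p, hp⟩ := List.exists_mem_of_length_pos (Nat.zero_lt_of_lt h)
      have : code b.M 1 (b.tdig ms (c % b.V)) b.l = b.sh c := by
        rw [sh, ← (mem_part.mp hp).2, item]
        exact code_congr fun i hi => (tdig_eq hb hms hp i hi).symm
      simp [this]
    · simp [code_zero]

/-- Every solution with at most `k` units and vanishing lower digits is dominated by a path. -/
theorem complete (hb : b.Good) {ms : List ℕ} (hms : b.Fits ms) (hk : ms.length ≤ b.k)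
    (h0 : ∀ i, b.r ≤ i → i < b.l → b.dig ms i = 0) :
    ∃ cs g, KPath b.valid 1 b.opt b.sh (2 ^ b.L * b.V) (code b.M ms.length (b.dig ms) b.l) g cs ∧
      b.gain ms ≤ g := by
  -- the path takes the best units of every type, as many of them as there are in `ms`
  have hsub := fun y => part_subperm hb hms (b.vl y)
  have hlen : ∀ y, (b.part ms (b.vl y)).length ≤ (b.units (b.vl y)).length := fun y => by
    simpa using (hsub y).length_le
  set gn : ℕ → ℕ → ℤ := fun j y => ((b.units (b.vl y))[j]?).elim 0 Prod.snd with hgn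
  have hsh : ∀ c, (b.choice ms c).elim 0 (fun o => b.sh (c * 1 + o)) =
      b.chosen ms (c / b.V) (c % b.V) * b.sh c := by
    intro c
    unfold choice chosen
    split_ifs <;> simp
  have hga : ∀ c, (b.choice ms c).elim 0 (fun _ => gn (ordf b.L (c / b.V)) (c % b.V)) =
      b.chosen ms (c / b.V) (c % b.V) * gn (ordf b.L (c / b.V)) (c % b.V) := by
    intro c
    unfold choice chosen
    split_ifs <;> simp
  obtain ⟨cs, h⟩ := KPath.of_choice (valid := b.valid) (O := 1) (opt := b.opt) (sh := b.sh)
    (b.choice ms) (fun c => gn (ordf b.L (c / b.V)) (c % b.V)) (2 ^ b.L * b.V)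
    (by
      intro c _ o ho
      unfold choice at ho
      split_ifs at ho with h
      obtain rfl : 0 = o := by simpa using ho
      have hl := h.trans_le (hlen (c % b.V))
      refine ⟨by omega, ((b.units (b.vl (c % b.V)))[ordf b.L (c / b.V)]).1, ?_⟩
      simp only [opt, Nat.mul_one, Nat.add_zero, hgn]
      rw [List.getElem?_eq_getElem hl]
      rfl)
    (by
      intro c hc
      simp only [hsh]
      exact valid_partial hb hms hk h0 hc) _ le_rfl
  simp only [hsh, hga] at h
  have hz : ∑ c ∈ Finset.range (2 ^ b.L * b.V), b.chosen ms (c / b.V) (c % b.V) * b.sh c =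
      code b.M ms.length (b.dig ms) b.l := by
    have e := sum_chosen_mul b ms (fun y => b.vl y) (2 ^ b.L) 0 (by omega)
    simp only [Nat.add_zero] at e
    have e' : ∑ c ∈ Finset.range (2 ^ b.L * b.V), b.chosen ms (c / b.V) (c % b.V) * b.sh c = _ := e
    rw [e', ← sum_item, ← sum_part hb b.item ms fun p hp => (hms p).1 hp]
    refine Finset.sum_congr rfl fun y _ => ?_
    rw [ordCount_full _ _ (length_part_le hb hk _)]
    have : (b.part ms (b.vl y)).map b.item = (b.part ms (b.vl y)).map fun _ => b.vl y :=
      List.map_congr_left fun p hp => (mem_part.mp hp).2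
    rw [this]; simp
  rw [hz] at h
  refine ⟨cs, _, h, ?_⟩
  have e := sum_range_mul_add (fun a y => b.chosen ms a y * gn (ordf b.L a) y) b.V (2 ^ b.L) 0
    (by omega)
  simp only [Finset.range_zero, Finset.sum_empty, add_zero] at e
  rw [e, Finset.sum_comm, gain, ← sum_part hb b.γ ms fun p hp => (hms p).1 hp]
  refine Finset.sum_le_sum fun y _ => ?_
  have e2 : ∑ a ∈ Finset.range (2 ^ b.L), b.chosen ms a y * gn (ordf b.L a) y =
      ∑ j ∈ Finset.range (b.part ms (b.vl y)).length, gn j y := by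
    have := sum_ordf (fun j => (if j < (b.part ms (b.vl y)).length then (1 : ℤ) else 0) * gn j y)
      b.L
    unfold chosen
    rw [this]
    simp only [ite_mul, one_mul, zero_mul]
    rw [← Finset.sum_filter]
    refine Finset.sum_congr ?_ fun _ _ => rfl
    have := length_part_le hb hk (b.vl y)
    ext j; simp; omega
  have e3 : ∀ j ≤ (b.units (b.vl y)).length, ∑ i ∈ Finset.range j, gn i y =
      (((b.units (b.vl y)).map Prod.snd).take j).sum := by
    intro j
    induction j with
    | zero => simp
    | succ j ih =>
      intro hj
      rw [Finset.sum_range_succ, ih (by omega), List.sum_take_succ _ _ (by simpa using hj)]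
      simp [hgn, List.getElem?_eq_getElem (show j < _ from hj)]
  rw [e2, e3 _ (hlen y)]
  have h1 : ((b.part ms (b.vl y)).map b.γ).Subperm ((b.units (b.vl y)).map Prod.snd) := by
    obtain ⟨l, hl, hl'⟩ := hsub y
    refine ⟨l.map Prod.snd, ?_, hl'.map _⟩
    simpa [Function.comp_def] using hl.map Prod.snd
  have h2 := sum_le_sum_take (List.pairwise_map.mpr (sorted_units hb.m_pos (b.vl y))) h1
  simpa using h2

end Brick

/-! ### From best steps to knapsacks -/

/-- The bound on the digits of the rows of the blocks `B i` in the states. -/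
def digitBound (l k δ : ℕ) : ℕ := (2 * δ + 1) ^ l * (Nat.clog 2 k + 1) * δ

/-- The base of the codes. -/
def codeBase (l k δ : ℕ) : ℕ := 3 * (k ^ 3 * δ + digitBound l k δ) + 1

theorem sum_count_range {m : ℕ} {l : List ℕ} (h : ∀ p ∈ l, p < m) :
    ∑ p ∈ Finset.range m, l.count p = l.length := by
  induction l with
  | nil => simp
  | cons a l ih =>
    have ha := h a List.mem_cons_self
    simp only [List.count_cons, Finset.sum_add_distrib, List.length_cons]
    rw [ih fun p hp => h p (List.mem_cons_of_mem _ hp)]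
    simp [ha]

namespace NFoldInstance

variable {n r s t k : ℕ}

/-- A function of the variables as a function of the items: item `p < t` of brick `i` is the
variable `(i, p)`, and item `t + p` is its negative. -/
def onItems (F : Fin n × Fin t → ℤ) (i p : ℕ) : ℤ :=
  if hi : i < n then
    if hp : p < t then F (⟨i, hi⟩, ⟨p, hp⟩)
    else if hp' : p - t < t then - F (⟨i, hi⟩, ⟨p - t, hp'⟩) else 0
  else 0

/-- The digit `d` of the columns: the first `r` digits are the entries of the `A i`, the following
ones those of the `B i`. -/
def colDigit (I : NFoldInstance n r s t k) (d : ℕ) (v : Fin n × Fin t) : ℤ :=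
  if h : d < r then I.A v.1 ⟨d, h⟩ v.2
  else if h : d - r < s then I.B v.1 ⟨d - r, h⟩ v.2 else 0

/-- The capacity of an item. -/
def capOf (b : StepBounds n t) (i p : ℕ) : ℕ :=
  if hi : i < n then
    if hp : p < t then (b.up (⟨i, hi⟩, ⟨p, hp⟩)).toNat
    else if hp' : p - t < t then (- b.lo (⟨i, hi⟩, ⟨p - t, hp'⟩)).toNat else 0
  else 0

/-- The subproblem for brick `i`. -/
def brick (I : NFoldInstance n r s t k) (b : StepBounds n t) (δ V : ℕ) (vl : ℕ → ℤ) (i : ℕ) :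
    Brick where
  M := codeBase (r + s) k δ
  l := r + s
  r := r
  L := Nat.clog 2 k
  k := k
  δ := δ
  R₁ := ((k ^ 3 * δ : ℕ) : ℤ)
  R₂ := digitBound (r + s) k δ
  N₀ := ((k ^ 3 : ℕ) : ℤ)
  m := 2 * t
  dv := fun p d => onItems (I.colDigit d) i p
  γ := onItems I.c i
  cap := capOf b i
  V := V
  vl := vl

/-- The states, of which there are `V`, `V₂` and `V₃`: all states, the codes of solutions in a
brick, and the final states. -/
structure StateLists (r s k δ V V₂ V₃ : ℕ) (vl vl₂ vl₃ : ℕ → ℤ) : Prop where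
  inj : ∀ y < V, ∀ y' < V, vl y = vl y' → y = y'
  mem : ∀ z, (∃ y < V, vl y = z) ↔ InBox (codeBase (r + s) k δ) (r + s) r (k ^ 3 : ℕ)
    (k ^ 3 * δ : ℕ) (digitBound (r + s) k δ) z
  mem₂ : ∀ z, (∃ y < V₂, vl₂ y = z) ↔ InBox (codeBase (r + s) k δ) (r + s) r k
    (k ^ 3 * δ : ℕ) 0 z
  mem₃ : ∀ z, (∃ y < V₃, vl₃ y = z) ↔ InBox (codeBase (r + s) k δ) (r + s) r (k ^ 3 : ℕ) 0 0 z

/-- All entries of the matrix are bounded by `δ`. -/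
def EntriesLe (I : NFoldInstance n r s t k) (δ : ℕ) : Prop :=
  (∀ i p q, |I.A i p q| ≤ (δ : ℤ)) ∧ (∀ i p q, |I.B i p q| ≤ (δ : ℤ))

variable {I : NFoldInstance n r s t k} {b : StepBounds n t} {δ V V₂ V₃ : ℕ} {vl vl₂ vl₃ : ℕ → ℤ}

theorem abs_onItems_le {F : Fin n × Fin t → ℤ} {B : ℤ} (hB : 0 ≤ B) (hF : ∀ v, |F v| ≤ B)
    (i p : ℕ) : |onItems F i p| ≤ B := by
  unfold onItems
  split_ifs <;> simp [hB, hF, abs_neg]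

theorem abs_colDigit_le (hδ : I.EntriesLe δ) (d : ℕ) (v : Fin n × Fin t) :
    |I.colDigit d v| ≤ δ := by
  unfold colDigit
  split_ifs
  · exact hδ.1 _ _ _
  · exact hδ.2 _ _ _
  · simp

theorem brick_good (ht : 1 ≤ t) (hk : 1 ≤ k) (hδ : I.EntriesLe δ)
    (hS : StateLists r s k δ V V₂ V₃ vl vl₂ vl₃) (i : ℕ) : (I.brick b δ V vl i).Good where
  k_le := Nat.le_pow_clog (by norm_num) k
  k_le_N := by
    simp only [brick]
    exact_mod_cast Nat.le_self_pow (by norm_num) k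
  k_pos := hk
  R₁_le := by
    simp only [brick]
    exact_mod_cast Nat.mul_le_mul_right δ (Nat.le_self_pow (by norm_num) k)
  R₂_le := le_rfl
  M_gt := by simp only [brick, codeBase]; push_cast; linarith
  m_pos := by simp only [brick]; omega
  r_le := Nat.le_add_right _ _
  dv_le := fun p _ d _ => abs_onItems_le (by positivity) (abs_colDigit_le hδ d) i p
  vl_inj := hS.inj
  vl_iff := hS.mem

/-- A table of best solutions of brick `i`: entry `y < V₂` holds a best solution with the code
`vl₂ y` and its gain, if there is one. -/
structure TabOK (B : Brick) (V₂ : ℕ) (vl₂ : ℕ → ℤ) (tab : ℕ → Option (List ℕ × ℤ)) : Prop where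
  sound : ∀ y < V₂, ∀ ms g, tab y = some (ms, g) → B.Fits ms ∧ g = B.gain ms ∧ ms.length ≤ B.k ∧
    vl₂ y = code B.M ms.length (B.dig ms) B.l ∧ (∀ i < B.r, |B.dig ms i| ≤ B.R₁) ∧
      ∀ i, B.r ≤ i → i < B.l → B.dig ms i = 0
  complete : ∀ y < V₂, ∀ ms, B.Fits ms → ms.length ≤ B.k →
    (∀ i, B.r ≤ i → i < B.l → B.dig ms i = 0) → vl₂ y = code B.M ms.length (B.dig ms) B.l →
      ∃ ms' g, tab y = some (ms', g) ∧ B.gain ms ≤ g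

/-- The solutions with entry `y` in the tables, over the bricks in the set `j` of the partition. -/
def setLeaf (P : ℕ → ℕ) (tab : ℕ → ℕ → Option (List ℕ × ℤ)) (j y i : ℕ) : List (ℕ × ℤ) :=
  if P i = j then (tab i y).elim [] fun x => [(i, x.2)] else []

/-- The options of the final knapsack: stage `j` may take the best solution of one of the bricks in
the set `j`, with any code. -/
def setOpt (n : ℕ) (P : ℕ → ℕ) (V₂ : ℕ) (tab : ℕ → ℕ → Option (List ℕ × ℤ)) (c : ℕ) :
    Option (ℕ × ℤ) :=
  (full (setLeaf P tab (c / V₂) (c % V₂)) n 1)[0]?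

/-- The units that the chosen options consist of. -/
def unitsOf (V₂ : ℕ) (tab : ℕ → ℕ → Option (List ℕ × ℤ)) (cs : List (ℕ × ℕ)) : List (ℕ × ℕ) :=
  cs.flatMap fun c => ((tab c.2 (c.1 % V₂)).elim [] Prod.fst).map fun p => (c.2, p)

/-- The vector that consists of the given units. -/
def vecOf (t n : ℕ) (U : List (ℕ × ℕ)) (v : Fin n × Fin t) : ℤ :=
  U.count ((v.1 : ℕ), (v.2 : ℕ)) - U.count ((v.1 : ℕ), t + (v.2 : ℕ))

/-- The items of the units in brick `i`. -/
def inBrick (U : List (ℕ × ℕ)) (i : ℕ) : List ℕ := (U.filter fun u => u.1 = i).map Prod.snd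

theorem sum_mul_vecOf (F : Fin n × Fin t → ℤ) (U : List (ℕ × ℕ))
    (hU : ∀ u ∈ U, u.1 < n ∧ u.2 < 2 * t) :
    ∑ v, F v * vecOf t n U v = (U.map fun u => onItems F u.1 u.2).sum := by
  induction U with
  | nil => simp [vecOf]
  | cons u U ih =>
    obtain ⟨i, p⟩ := u
    have hu := hU (i, p) List.mem_cons_self
    rw [List.map_cons, List.sum_cons, ← ih fun u hu => hU u (List.mem_cons_of_mem _ hu)]
    have e : ∀ v, F v * vecOf t n ((i, p) :: U) v = F v * ((if (i, p) = ((v.1 : ℕ), (v.2 : ℕ))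
        then 1 else 0) - if (i, p) = ((v.1 : ℕ), t + (v.2 : ℕ)) then 1 else 0) +
          F v * vecOf t n U v := by
      intro v
      simp only [vecOf, List.count_cons, beq_iff_eq]
      push_cast; ring
    rw [Finset.sum_congr rfl fun v _ => e v, Finset.sum_add_distrib]
    congr 1
    simp only at hu ⊢
    unfold onItems
    rw [dif_pos hu.1]
    by_cases hp : p < t
    · rw [dif_pos hp, Finset.sum_eq_single (⟨i, hu.1⟩, ⟨p, hp⟩)]
      · have : t ≠ 0 := by omega
        simp [this]
      · rintro ⟨i', p'⟩ _ hne
        have h1 : ¬ (i, p) = ((i' : ℕ), (p' : ℕ)) := by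
          intro h
          obtain ⟨h1, h2⟩ := Prod.mk.inj h
          exact hne (by ext <;> simp [h1, h2])
        have h2 : ¬ (i, p) = ((i' : ℕ), t + (p' : ℕ)) := by
          intro h
          have := (Prod.mk.inj h).2
          omega
        simp only [h1, h2]; simp
      · simp
    · rw [dif_neg hp, dif_pos (by omega : p - t < t),
        Finset.sum_eq_single (⟨i, hu.1⟩, ⟨p - t, by omega⟩)]
      · have h1 : p ≠ p - t := by omega
        have h2 : p = t + (p - t) := by omega
        simp [h1, ← h2]
      · rintro ⟨i', p'⟩ _ hne
        have h1 : ¬ (i, p) = ((i' : ℕ), (p' : ℕ)) := by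
          intro h
          have := (Prod.mk.inj h).2
          omega
        have h2 : ¬ (i, p) = ((i' : ℕ), t + (p' : ℕ)) := by
          intro h
          obtain ⟨h1, h2⟩ := Prod.mk.inj h
          exact hne (by ext <;> simp [h1, h2])
        simp only [h1, h2]; simp
      · simp

theorem count_inBrick (U : List (ℕ × ℕ)) (i p : ℕ) : (inBrick U i).count p = U.count (i, p) := by
  induction U with
  | nil => rfl
  | cons u U ih =>
    obtain ⟨i', p'⟩ := u
    unfold inBrick at ih ⊢
    rw [List.filter_cons, List.count_cons]
    by_cases h : i' = i
    · subst h
      by_cases h' : p' = p <;> simp [h', ih]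
    · simp [h, ih]

theorem inBrick_append (U U' : List (ℕ × ℕ)) (i : ℕ) :
    inBrick (U ++ U') i = inBrick U i ++ inBrick U' i := by
  simp [inBrick]

theorem inBrick_map (ms : List ℕ) (i i' : ℕ) :
    inBrick (ms.map fun p => (i, p)) i' = if i = i' then ms else [] := by
  unfold inBrick
  split_ifs with h
  · subst h
    rw [List.filter_eq_self.mpr]
    · simp
    · simp
  · rw [List.filter_eq_nil_iff.mpr]
    · rfl
    · simp [h]

section

variable {P : ℕ → ℕ} {tab : ℕ → ℕ → Option (List ℕ × ℤ)}

theorem setOpt_some (hn : 1 ≤ n) {c i : ℕ} {g : ℤ} (h : setOpt n P V₂ tab c = some (i, g)) :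
    i < n ∧ P i = c / V₂ ∧ ∃ ms, tab i (c % V₂) = some (ms, g) := by
  classical
  have hx := List.mem_of_getElem? h
  have h1 := List.count_pos_iff.mpr hx
  rw [count_full_root _ hn] at h1
  obtain ⟨p, hp, h2⟩ := Finset.exists_ne_zero_of_sum_ne_zero h1.ne'
  have h3 : (i, g) ∈ setLeaf P tab (c / V₂) (c % V₂) p :=
    List.count_pos_iff.mp (Nat.pos_of_ne_zero h2)
  unfold setLeaf at h3
  split_ifs at h3 with h4
  · rcases ht : tab p (c % V₂) with _ | ⟨ms, g'⟩
    · simp [ht] at h3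
    · simp only [ht, Option.elim_some, List.mem_singleton, Prod.mk.injEq] at h3
      obtain ⟨rfl, rfl⟩ := h3
      exact ⟨Finset.mem_range.mp hp, h4, ms, ht⟩
  · simp at h3

theorem setOpt_complete {c i : ℕ} {ms : List ℕ} {g : ℤ} (hi : i < n)
    (hP : P i = c / V₂) (ht : tab i (c % V₂) = some (ms, g)) :
    ∃ i' g', setOpt n P V₂ tab c = some (i', g') ∧ g ≤ g' := by
  classical
  have h1 : (i, g) ∈ full (setLeaf P tab (c / V₂) (c % V₂)) n 1 := by
    rw [← List.count_pos_iff, count_full_root _ (by omega)]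
    refine Finset.sum_pos' (fun _ _ => Nat.zero_le _) ⟨i, Finset.mem_range.mpr hi, ?_⟩
    rw [List.count_pos_iff]
    simp [setLeaf, hP, ht]
  have h2 := full_sorted (leaf := setLeaf P tab (c / V₂) (c % V₂)) (m := n) (fun p _ => by
    unfold setLeaf
    split_ifs
    · rcases tab p (c % V₂) with _ | x <;> simp
    · simp) (x := 1) le_rfl (by omega)
  unfold setOpt
  rcases hl : full (setLeaf P tab (c / V₂) (c % V₂)) n 1 with _ | ⟨⟨i', g'⟩, l⟩
  · rw [hl] at h1; simp at h1
  · rw [hl] at h1 h2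
    refine ⟨i', g', rfl, ?_⟩
    rcases List.mem_cons.mp h1 with h | h
    · rw [(Prod.mk.inj h).2]
    · exact (List.pairwise_cons.mp h2).1 _ h

/-- Every path of the final knapsack uses at most one brick of every set, and there a solution from
the table. -/
theorem path_bricks (hn : 1 ≤ n) (hV₂ : ∀ o < V₂, 1 ≤ V₂) {valid : ℤ → Prop} {sh : ℕ → ℤ} {σ : ℕ}
    {z g : ℤ} {cs : List (ℕ × ℕ)} (h : KPath valid V₂ (setOpt n P V₂ tab) sh σ z g cs) :
    (∀ i, inBrick (unitsOf V₂ tab cs) i ≠ [] → i < n ∧ P i < σ ∧ ∃ y < V₂, ∃ g,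
      tab i y = some (inBrick (unitsOf V₂ tab cs) i, g)) ∧
    ∀ i i', inBrick (unitsOf V₂ tab cs) i ≠ [] → inBrick (unitsOf V₂ tab cs) i' ≠ [] →
      P i = P i' → i = i' := by
  induction h with
  | nil => simp [unitsOf, inBrick]
  | skip _ ih =>
    refine ⟨fun i hi => ?_, ih.2⟩
    obtain ⟨h1, h2, h3⟩ := ih.1 i hi
    exact ⟨h1, by omega, h3⟩
  | @take σ o w z g g' cs hp ho hw hv ih =>
    obtain ⟨h1, h2, ms, h3⟩ := setOpt_some hn hw
    have hVp := hV₂ o ho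
    rw [Nat.mul_comm, Nat.mul_add_div (by omega), Nat.div_eq_of_lt ho, Nat.add_zero] at h2
    have e1 : ∀ i, inBrick (unitsOf V₂ tab ((σ * V₂ + o, w) :: cs)) i =
        (if w = i then ms else []) ++ inBrick (unitsOf V₂ tab cs) i := by
      intro i
      unfold unitsOf
      rw [List.flatMap_cons, inBrick_append]
      congr 1
      simp only [h3, Option.elim_some]
      exact inBrick_map _ _ _
    have e2 : inBrick (unitsOf V₂ tab cs) w = [] := by
      by_contra hne
      have := (ih.1 w hne).2.1
      omega
    have e3 : ∀ i, inBrick (unitsOf V₂ tab ((σ * V₂ + o, w) :: cs)) i =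
        if w = i then ms else inBrick (unitsOf V₂ tab cs) i := by
      intro i
      rw [e1]
      split_ifs with hi
      · subst hi; simp [e2]
      · simp
    have hmod : (σ * V₂ + o) % V₂ = o := by
      rw [Nat.mul_comm, Nat.mul_add_mod, Nat.mod_eq_of_lt ho]
    rw [hmod] at h3
    simp only [e3]
    refine ⟨fun i hi => ?_, fun i i' hi hi' hP => ?_⟩
    · split_ifs at hi ⊢ with hw'
      · subst hw'; exact ⟨h1, by omega, o, ho, g', h3⟩
      · obtain ⟨h4, h5, h6⟩ := ih.1 i hi
        exact ⟨h4, by omega, h6⟩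
    · split_ifs at hi hi' with hw' hw'' hw''
      · omega
      · have := (ih.1 i' hi').2.1; subst hw'; omega
      · have := (ih.1 i hi).2.1; subst hw''; omega
      · exact ih.2 i i' hi hi' hP

theorem sum_unitsOf (f : ℕ × ℕ → ℤ) (cs : List (ℕ × ℕ)) :
    ((unitsOf V₂ tab cs).map f).sum = (cs.map fun c =>
      (((tab c.2 (c.1 % V₂)).elim [] Prod.fst).map fun p => f (c.2, p)).sum).sum := by
  induction cs with
  | nil => rfl
  | cons c cs ih =>
    have : unitsOf V₂ tab (c :: cs) = (((tab c.2 (c.1 % V₂)).elim [] Prod.fst).map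
      fun p => (c.2, p)) ++ unitsOf V₂ tab cs := by simp [unitsOf]
    rw [this, List.map_append, List.sum_append, ih, List.map_cons, List.sum_cons, List.map_map]
    rfl

theorem sum_inBrick (F G : Fin n × Fin t → ℤ) (i : ℕ) (hF : ∀ v, F v = if i = v.1 then G v else 0)
    (U : List (ℕ × ℕ)) : (U.map fun u => onItems F u.1 u.2).sum =
      ((inBrick U i).map fun p => onItems G i p).sum := by
  induction U with
  | nil => rfl
  | cons u U ih =>
    obtain ⟨i', p⟩ := u
    have e : inBrick ((i', p) :: U) i = (if i' = i then [p] else []) ++ inBrick U i := by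
      unfold inBrick
      rw [List.filter_cons]
      by_cases h : i' = i <;> simp [h]
    rw [List.map_cons, List.sum_cons, ih, e, List.map_append, List.sum_append]
    congr 1
    by_cases h : i' = i
    · subst h
      simp only [onItems, hF]; simp
    · have h' : ¬ i = i' := fun h' => h h'.symm
      simp only [onItems, hF, h, h']; simp

/-- The vectors that belong to the paths of the final knapsack are feasible. -/
theorem path_isStep (hn : 1 ≤ n) (hP : ∀ i : Fin n, P i = (I.P i : ℕ))
    (hT : ∀ i < n, TabOK (I.brick b δ V vl i) V₂ vl₂ (tab i)) {z g : ℤ} {cs : List (ℕ × ℕ)}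
    (h : KPath (InBox (codeBase (r + s) k δ) (r + s) r (k ^ 3 : ℕ) (k ^ 3 * δ : ℕ)
      (digitBound (r + s) k δ)) V₂ (setOpt n P V₂ tab) (fun c => vl₂ (c % V₂)) (k ^ 2) z g cs)
    (hz : InBox (codeBase (r + s) k δ) (r + s) r (k ^ 3 : ℕ) 0 0 z) :
    I.IsStep b (vecOf t n (unitsOf V₂ tab cs)) ∧
      I.c ⬝ᵥ vecOf t n (unitsOf V₂ tab cs) = g ∧
      ∀ u ∈ unitsOf V₂ tab cs, u.1 < n ∧ u.2 < 2 * t := by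
  set U := unitsOf V₂ tab cs with hU
  set ms : ℕ × ℕ → List ℕ := fun c => (tab c.2 (c.1 % V₂)).elim [] Prod.fst with hms
  have hV₂ : ∀ o < V₂, 1 ≤ V₂ := fun o ho => by omega
  obtain ⟨hb1, hb2⟩ := path_bricks hn hV₂ h
  have hR₁ : (0 : ℤ) ≤ ((k ^ 3 * δ : ℕ) : ℤ) := by positivity
  -- what the tables say about the chosen options
  have hcs : ∀ c ∈ cs, c.2 < n ∧ ∃ g', setOpt n P V₂ tab c.1 = some (c.2, g') ∧
      (I.brick b δ V vl c.2).Fits (ms c) ∧ g' = (I.brick b δ V vl c.2).gain (ms c) ∧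
      vl₂ (c.1 % V₂) = code (codeBase (r + s) k δ) (ms c).length
        ((I.brick b δ V vl c.2).dig (ms c)) (r + s) ∧
      ∀ d < r + s, |(I.brick b δ V vl c.2).dig (ms c) d| ≤ ((k ^ 3 * δ : ℕ) : ℤ) := by
    intro c hc
    obtain ⟨σ', h1, o, ho, h2, g', h3⟩ := h.mem_opt c hc
    obtain ⟨h4, -, l, h5⟩ := setOpt_some hn h3
    have h6 : c.1 % V₂ < V₂ := Nat.mod_lt _ (by omega)
    obtain ⟨k1, k2, -, k3, k4, k5⟩ := (hT c.2 h4).sound _ h6 l g' h5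
    have h7 : ms c = l := by simp [hms, h5]
    rw [h7]
    refine ⟨h4, g', h3, k1, k2, k3, fun d hd => ?_⟩
    rcases lt_or_ge d r with hd' | hd'
    · exact k4 d hd'
    · have e := k5 d hd' hd
      rw [e, abs_zero]; exact hR₁
  have hUr : ∀ u ∈ U, u.1 < n ∧ u.2 < 2 * t := by
    intro u hu
    rw [hU, unitsOf, List.mem_flatMap] at hu
    obtain ⟨c, hc, hu⟩ := hu
    obtain ⟨p, hp, rfl⟩ := List.mem_map.mp hu
    obtain ⟨h1, g', -, h2, -⟩ := hcs c hc
    exact ⟨h1, (h2 p).1 hp⟩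
  -- the rows of the blocks `A i`
  have hdig : ∀ d < r + s, (U.map fun u => onItems (I.colDigit d) u.1 u.2).sum = 0 := by
    have hd := h.digits hR₁ (by positivity) (by unfold codeBase; push_cast; linarith)
      (by unfold codeBase; push_cast; push_cast at hR₁; linarith)
      (fun c => (ms c).length) (fun c => (I.brick b δ V vl c.2).dig (ms c))
      fun c hc => by
        obtain ⟨-, g', -, -, -, h1, h2⟩ := hcs c hc
        exact ⟨h1, h2⟩
    obtain ⟨N, D, -, -, hD1, hD2, e⟩ := hz
    have e1 : code (codeBase (r + s) k δ) (cs.map fun c => ((ms c).length : ℤ)).sum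
        (fun d => (cs.map fun c => (I.brick b δ V vl c.2).dig (ms c) d).sum) (r + s)
          = code (codeBase (r + s) k δ) N D (r + s) := by
      rw [code_list_sum, ← e, h.state_eq]
      congr 1
      refine List.map_congr_left fun c hc => ?_
      obtain ⟨-, g', -, -, -, h1, -⟩ := hcs c hc
      exact h1.symm
    have hD0 : ∀ d < r + s, D d = 0 := by
      intro d hd
      rcases lt_or_ge d r with hr | hr
      · exact abs_nonpos_iff.mp (hD1 d hr)
      · exact abs_nonpos_iff.mp (hD2 d hr hd)
    have e2 := (code_inj (fun d hd' => by
      rw [hD0 d hd', sub_zero]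
      have hW : (0 : ℤ) ≤ digitBound (r + s) k δ := by positivity
      have hM : ((codeBase (r + s) k δ : ℕ) : ℤ) =
          3 * (((k ^ 3 * δ : ℕ) : ℤ) + digitBound (r + s) k δ) + 1 := by
        unfold codeBase; push_cast; ring
      rw [hM]
      rcases lt_or_ge d r with hr | hr
      · have := hd.1 d hr hd'; linarith
      · have := hd.2 d hr hd'; linarith) e1).2
    intro d hd'
    rw [hU, sum_unitsOf]
    have := e2 d hd'
    rw [hD0 d hd'] at this
    exact this
  -- the bricks of the solution
  have hbr : ∀ i : Fin n, (I.brick b δ V vl i).Fits (inBrick U i) ∧ (inBrick U i).length ≤ k ∧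
      ∀ d, r ≤ d → d < r + s → (I.brick b δ V vl i).dig (inBrick U i) d = 0 := by
    intro i
    by_cases hi : inBrick U i = []
    · rw [hi]
      exact ⟨fun p => by simp, by simp, fun d _ _ => by simp [Brick.dig]⟩
    · obtain ⟨-, -, y, hy, g', ht⟩ := hb1 i hi
      obtain ⟨k1, -, k2, -, -, k3⟩ := (hT i i.2).sound y hy _ _ ht
      exact ⟨k1, k2, k3⟩
  have hvec : ∀ (i : Fin n) (q : Fin t), vecOf t n U (i, q) =
      (inBrick U i).count (q : ℕ) - (inBrick U i).count (t + (q : ℕ)) := by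
    intro i q
    rw [count_inBrick, count_inBrick]; rfl
  refine ⟨⟨?_, ?_, ?_⟩, ?_, hUr⟩
  · funext row
    rw [Pi.zero_apply]
    rcases row with p | ⟨i, p⟩
    · have h1 := hdig p (by omega)
      rw [← sum_mul_vecOf _ _ hUr] at h1
      rw [← h1]
      unfold Matrix.mulVec dotProduct
      refine Finset.sum_congr rfl fun v _ => ?_
      simp [nFoldMatrix, colDigit]
    · have h1 := (hbr i).2.2 (r + p) (by omega) (by omega)
      set F : Fin n × Fin t → ℤ := fun v => if (i : ℕ) = v.1 then I.colDigit (r + p) v else 0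
      have h2 : (I.brick b δ V vl i).dig (inBrick U i) (r + p) =
          (U.map fun u => onItems F u.1 u.2).sum := (sum_inBrick F (I.colDigit (r + p)) i
            (fun v => rfl) U).symm
      rw [h2, ← sum_mul_vecOf _ _ hUr] at h1
      rw [← h1]
      unfold Matrix.mulVec dotProduct
      refine Finset.sum_congr rfl fun v _ => ?_
      have e : ((i : ℕ) = v.1) ↔ i = v.1 := Fin.ext_iff.symm
      by_cases h3 : i = v.1 <;> simp [nFoldMatrix, colDigit, F, e, h3]
  · rintro j ⟨i₀, hi₀⟩
    have hvan : ∀ i : Fin n, inBrick U i = [] → ∀ q, vecOf t n U (i, q) = 0 := by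
      intro i hi q
      rw [hvec, hi]; simp
    have hnorm : ∀ i : Fin n, ∑ q, |vecOf t n U (i, q)| ≤ (k : ℤ) := by
      intro i
      have h1 := sum_count_range fun p hp => ((hbr i).1 p).1 hp
      have h2 : (I.brick b δ V vl i).m = t + t := by simp [brick, two_mul]
      rw [h2, Finset.sum_range_add, ← Finset.sum_add_distrib, ← Fin.sum_univ_eq_sum_range
        (fun q => (inBrick U i).count q + (inBrick U i).count (t + q))] at h1
      calc ∑ q, |vecOf t n U (i, q)| ≤ ∑ q : Fin t,
            (((inBrick U i).count (q : ℕ) + (inBrick U i).count (t + (q : ℕ)) : ℕ) : ℤ) := by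
            refine Finset.sum_le_sum fun q _ => ?_
            rw [hvec, abs_le]; constructor <;> push_cast <;> omega
        _ = ((inBrick U i).length : ℤ) := by rw [← h1]; push_cast; rfl
        _ ≤ k := by exact_mod_cast (hbr i).2.1
    by_cases hex : ∃ i : Fin n, I.P i = j ∧ inBrick U i ≠ []
    · obtain ⟨i, hi, hne⟩ := hex
      refine ⟨i, hi, hnorm i, fun i' hi' hne' => hvan i' ?_⟩
      by_contra hne2
      exact hne' (Fin.ext (hb2 i' i hne2 hne (by rw [hP, hP, hi, hi'])))
    · push Not at hex
      exact ⟨i₀, hi₀, hnorm i₀, fun i' hi' _ => hvan i' (hex i' hi')⟩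
  · rintro ⟨i, q⟩
    have h1 := ((hbr i).1 q).2
    have h2 := ((hbr i).1 (t + q)).2
    have e1 : (I.brick b δ V vl i).cap q = (b.up (i, q)).toNat := by simp [brick, capOf]
    have e2 : (I.brick b δ V vl i).cap (t + q) = (- b.lo (i, q)).toNat := by simp [brick, capOf]
    have := b.lo_nonpos (i, q)
    have := b.up_nonneg (i, q)
    rw [hvec]
    omega
  · rw [h.gain_eq (γ := fun c => (I.brick b δ V vl ((setOpt n P V₂ tab c.1).elim 0 Prod.fst)).gain
      (ms (c.1, (setOpt n P V₂ tab c.1).elim 0 Prod.fst)))]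
    · unfold dotProduct
      rw [sum_mul_vecOf _ _ hUr, hU, sum_unitsOf]
      congr 1
      refine List.map_congr_left fun c hc => ?_
      obtain ⟨-, g', h1, -⟩ := hcs c hc
      simp only [h1, Option.elim_some]
      rfl
    · intro σ' _ o ho w g' hw
      obtain ⟨h4, -, l, h5⟩ := setOpt_some hn hw
      have h6 : (σ' * V₂ + o) % V₂ < V₂ := Nat.mod_lt _ (by omega)
      simp only [hw, Option.elim_some, hms, h5]
      exact ((hT w h4).sound _ h6 l g' h5).2.1.symm

/-- The vector `x` on brick `i`, as a list of items. -/
def itemsOf (x : Fin n × Fin t → ℤ) (i : ℕ) : List ℕ :=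
  if hi : i < n then (List.finRange t).flatMap fun q =>
    List.replicate (x (⟨i, hi⟩, q)).toNat (q : ℕ) ++
      List.replicate (- x (⟨i, hi⟩, q)).toNat (t + (q : ℕ))
  else []

theorem sum_itemsOf (x : Fin n × Fin t → ℤ) (i : Fin n) (f : ℕ → ℤ) :
    ((itemsOf x i).map f).sum = ∑ q, ((x (i, q)).toNat * f q + (- x (i, q)).toNat * f (t + q)) := by
  unfold itemsOf
  rw [dif_pos i.2, Fin.sum_univ_def, List.map_flatMap]
  induction List.finRange t with
  | nil => rfl
  | cons q l ih =>
    rw [List.flatMap_cons, List.sum_append, ih, List.map_cons, List.sum_cons]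
    simp

theorem sum_itemsOf_onItems (x : Fin n × Fin t → ℤ) (i : Fin n) (F : Fin n × Fin t → ℤ) :
    ((itemsOf x i).map fun p => onItems F i p).sum = ∑ q, F (i, q) * x (i, q) := by
  rw [sum_itemsOf]
  refine Finset.sum_congr rfl fun q _ => ?_
  have e1 : onItems F i q = F (i, q) := by simp [onItems]
  have e2 : onItems F i (t + q) = - F (i, q) := by simp [onItems]
  rw [e1, e2]
  have : ((x (i, q)).toNat : ℤ) - (- x (i, q)).toNat = x (i, q) := by omega
  linear_combination F (i, q) * this

theorem length_itemsOf (x : Fin n × Fin t → ℤ) (i : Fin n) :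
    ((itemsOf x i).length : ℤ) = ∑ q, |x (i, q)| := by
  have h := sum_itemsOf x i fun _ => 1
  simp only [List.map_const', List.sum_replicate, mul_one, nsmul_eq_mul] at h
  rw [h]
  refine Finset.sum_congr rfl fun q _ => ?_
  rcases abs_cases (x (i, q)) with h | h <;> omega

theorem count_eq_sum (p : ℕ) (l : List ℕ) :
    (l.count p : ℤ) = (l.map fun q => if q = p then 1 else 0).sum := by
  induction l with
  | nil => rfl
  | cons a l ih =>
    rw [List.count_cons, List.map_cons, List.sum_cons, ← ih]
    by_cases h : a = p <;> simp [h, add_comm]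

theorem itemsOf_fits (x : Fin n × Fin t → ℤ) (hx : ∀ v, b.lo v ≤ x v ∧ x v ≤ b.up v) (i : Fin n) :
    (I.brick b δ V vl i).Fits (itemsOf x i) := by
  intro p
  have hmem : p ∈ itemsOf x i → p < 2 * t := by
    unfold itemsOf
    rw [dif_pos i.2]
    intro hp
    obtain ⟨q, -, hq⟩ := List.mem_flatMap.mp hp
    rcases List.mem_append.mp hq with hq | hq
    · have := List.eq_of_mem_replicate hq; omega
    · have := List.eq_of_mem_replicate hq; omega
  refine ⟨hmem, ?_⟩
  by_cases hp : p ∈ itemsOf x i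
  swap
  · rw [List.count_eq_zero_of_not_mem hp]; omega
  have hp := hmem hp
  zify
  rw [count_eq_sum, sum_itemsOf]
  rcases lt_or_ge p t with h | h
  · rw [Finset.sum_eq_single ⟨p, h⟩]
    · have h1 := (hx (i, ⟨p, h⟩)).2
      have h2 := b.up_nonneg (i, ⟨p, h⟩)
      have h3 : ¬ t = 0 := by omega
      simp only [brick, capOf, dif_pos i.2, dif_pos h]
      simp [h3]
      omega
    · intro q _ hq
      have h1 : ¬ (q : ℕ) = p := fun e => hq (Fin.ext e)
      have h2 : ¬ t + (q : ℕ) = p := by omega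
      simp [h1, h2]
    · simp
  · obtain ⟨p, rfl⟩ := Nat.exists_eq_add_of_le h
    have h' : p < t := by omega
    rw [Finset.sum_eq_single ⟨p, h'⟩]
    · have h1 := (hx (i, ⟨p, h'⟩)).1
      have h2 := b.lo_nonpos (i, ⟨p, h'⟩)
      have h3 : ¬ t = 0 := by omega
      have e : (I.brick b δ V vl i).cap (t + p) = (- b.lo (i, ⟨p, h'⟩)).toNat := by
        simp [brick, capOf, h']
      rw [e]
      simp [h3]
      omega
    · intro q _ hq
      have h1 : ¬ (q : ℕ) = p := fun e => hq (Fin.ext e)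
      have h2 : ¬ (q : ℕ) = t + p := by omega
      simp [h1, h2]
    · simp

/-- Every feasible solution is dominated by a path of the final knapsack. -/
theorem isStep_path (hδ : I.EntriesLe δ)
    (hS : StateLists r s k δ V V₂ V₃ vl vl₂ vl₃) (hP : ∀ i : Fin n, P i = (I.P i : ℕ))
    (hT : ∀ i < n, TabOK (I.brick b δ V vl i) V₂ vl₂ (tab i)) {x : Fin n × Fin t → ℤ}
    (hx : I.IsStep b x) :
    ∃ z g cs, KPath (InBox (codeBase (r + s) k δ) (r + s) r (k ^ 3 : ℕ) (k ^ 3 * δ : ℕ)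
      (digitBound (r + s) k δ)) V₂ (setOpt n P V₂ tab) (fun c => vl₂ (c % V₂)) (k ^ 2) z g cs ∧
      InBox (codeBase (r + s) k δ) (r + s) r (k ^ 3 : ℕ) 0 0 z ∧ I.c ⬝ᵥ x ≤ g := by
  classical
  obtain ⟨hmat, hset, hbd⟩ := hx
  have hR₁ : (0 : ℤ) ≤ ((k ^ 3 * δ : ℕ) : ℤ) := by positivity
  -- the brick chosen in each nonempty set
  have hsel : ∀ j : Fin (k ^ 2), ∃ o : Option (Fin n), (o = none → ∀ i, I.P i ≠ j) ∧
      ∀ i, o = some i → I.P i = j ∧ ∑ q, |x (i, q)| ≤ (k : ℤ) ∧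
        ∀ i', I.P i' = j → i' ≠ i → ∀ q, x (i', q) = 0 := by
    intro j
    by_cases hj : ∃ i, I.P i = j
    · obtain ⟨i, hi⟩ := hset j hj
      exact ⟨some i, by simp, fun i' h => by obtain rfl := Option.some.inj h; exact hi⟩
    · push Not at hj
      exact ⟨none, fun _ => hj, by simp⟩
  choose sel hsel0 hsel1 using hsel
  have hvanish : ∀ (i : Fin n) (F : Fin n × Fin t → ℤ), sel (I.P i) ≠ some i →
      ∑ q, F (i, q) * x (i, q) = 0 := by
    intro i F h
    rcases hs : sel (I.P i) with _ | i'
    · exact absurd rfl (hsel0 _ hs i)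
    · refine Finset.sum_eq_zero fun q _ => ?_
      rw [(hsel1 _ _ hs).2.2 i rfl (fun e => h (by rw [hs, e])) q, mul_zero]
  -- sums over all bricks are sums over the chosen ones
  have hsum : ∀ F : Fin n × Fin t → ℤ, ∑ v, F v * x v =
      ∑ j, (sel j).elim 0 fun i => ((itemsOf x i).map fun p => onItems F i p).sum := by
    intro F
    rw [Fintype.sum_prod_type, ← Finset.sum_fiberwise (s := Finset.univ) I.P]
    refine Finset.sum_congr rfl fun j _ => ?_
    rcases hs : sel j with _ | i
    · rw [Finset.filter_false_of_mem fun i _ => hsel0 j hs i]; rfl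
    · rw [Finset.sum_eq_single i]
      · rw [Option.elim_some, sum_itemsOf_onItems]
      · intro i' hi' hne
        have hi' := (Finset.mem_filter.mp hi').2
        exact hvanish i' F fun e => hne (by rw [hi', hs] at e; exact (Option.some.inj e).symm)
      · intro h
        exact absurd (Finset.mem_filter.mpr ⟨Finset.mem_univ i, (hsel1 j i hs).1⟩) h
  have hrow : ∀ d < r, ∑ v, I.colDigit d v * x v = 0 := by
    intro d hd
    have := congrFun hmat (.inl ⟨d, hd⟩)
    rw [Pi.zero_apply] at this
    rw [← this]
    unfold Matrix.mulVec dotProduct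
    refine Finset.sum_congr rfl fun v _ => ?_
    simp [nFoldMatrix, colDigit, hd]
  have hrowB : ∀ (i : Fin n) d, r ≤ d → d < r + s →
      (I.brick b δ V vl i).dig (itemsOf x i) d = 0 := by
    intro i d hd hd'
    have e : (I.brick b δ V vl i).dig (itemsOf x i) d =
        ((itemsOf x i).map fun p => onItems (I.colDigit d) i p).sum := rfl
    rw [e, sum_itemsOf_onItems]
    have := congrFun hmat (.inr (i, ⟨d - r, by omega⟩))
    rw [Pi.zero_apply] at this
    rw [← this]
    unfold Matrix.mulVec dotProduct
    rw [Fintype.sum_prod_type, Finset.sum_eq_single i]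
    · refine Finset.sum_congr rfl fun q _ => ?_
      have h1 : ¬ d < r := by omega
      have h2 : d - r < s := by omega
      simp [nFoldMatrix, colDigit, h1, h2]
    · intro i' _ hne
      refine Finset.sum_eq_zero fun q _ => ?_
      simp [nFoldMatrix, hne.symm]
    · simp
  have hlen : ∀ j i, sel j = some i → (itemsOf x i).length ≤ k := by
    intro j i h
    have := (hsel1 j i h).2.1
    rw [← length_itemsOf] at this
    exact_mod_cast this
  have hdle : ∀ (i : Fin n) (d : ℕ), |(I.brick b δ V vl i).dig (itemsOf x i) d| ≤
      (itemsOf x i).length * δ := by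
    intro i d
    have e : (I.brick b δ V vl i).dig (itemsOf x i) d =
        ((itemsOf x i).map fun p => onItems (I.colDigit d) i p).sum := rfl
    rw [e]
    induction itemsOf x i with
    | nil => simp
    | cons p l ih =>
      rw [List.map_cons, List.sum_cons, List.length_cons]
      have := abs_onItems_le (by positivity) (abs_colDigit_le hδ d) (i : ℕ) p
      have := abs_add_le (onItems (I.colDigit d) i p)
        (l.map fun p => onItems (I.colDigit d) i p).sum
      push_cast
      linarith
  -- the entries of the tables
  have hent : ∀ j i, sel j = some i → ∃ y < V₂, vl₂ y = code (codeBase (r + s) k δ)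
      (itemsOf x i).length ((I.brick b δ V vl i).dig (itemsOf x i)) (r + s) ∧
      ∃ w g, setOpt n P V₂ tab (j * V₂ + y) = some (w, g) ∧
        (I.brick b δ V vl i).gain (itemsOf x i) ≤ g := by
    intro j i h
    have hl := hlen j i h
    obtain ⟨y, hy, e⟩ := (hS.mem₂ (code (codeBase (r + s) k δ) (itemsOf x i).length
      ((I.brick b δ V vl i).dig (itemsOf x i)) (r + s))).mpr
      ⟨_, _, by positivity, by exact_mod_cast hl, fun d _ => (hdle i d).trans (by
        have : (itemsOf x i).length * δ ≤ k ^ 3 * δ :=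
          Nat.mul_le_mul_right _ (hl.trans (Nat.le_self_pow (by norm_num) k))
        exact_mod_cast this), fun d hd hd' => by rw [hrowB i d hd hd', abs_zero], rfl⟩
    obtain ⟨ms', g, h1, h2⟩ := (hT i i.2).complete y hy _ (itemsOf_fits x hbd i) hl (hrowB i) e
    have e1 : (j * V₂ + y) / V₂ = (j : ℕ) := by
      rw [Nat.mul_comm, Nat.mul_add_div (by omega), Nat.div_eq_of_lt hy, Nat.add_zero]
    have e2 : (j * V₂ + y) % V₂ = y := by
      rw [Nat.mul_comm, Nat.mul_add_mod, Nat.mod_eq_of_lt hy]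
    obtain ⟨w, g', h3, h4⟩ := setOpt_complete (n := n) (P := P) (V₂ := V₂) (tab := tab)
      (c := j * V₂ + y) i.2 (by rw [hP, (hsel1 j i h).1, e1]) (by rw [e2]; exact h1)
    exact ⟨y, hy, e, w, g', h3, h2.trans h4⟩
  choose! ent hent1 hent2 wt gn hent3 hent4 using hent
  set sel' : ℕ → Option (Fin n) := fun j => if h : j < k ^ 2 then sel ⟨j, h⟩ else none with hsel'
  set ch : ℕ → Option ℕ := fun j => if h : j < k ^ 2 then
    (sel ⟨j, h⟩).map fun i => ent ⟨j, h⟩ i else none with hch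
  set gg : ℕ → ℤ := fun j => if h : j < k ^ 2 then
    (sel ⟨j, h⟩).elim 0 fun i => gn ⟨j, h⟩ i else 0 with hgg
  set Nj : ℕ → ℤ := fun j => (sel' j).elim 0 fun i => ((itemsOf x i).length : ℤ) with hNj
  set Dj : ℕ → ℕ → ℤ := fun j d => (sel' j).elim 0 fun i =>
    (I.brick b δ V vl i).dig (itemsOf x i) d with hDj
  have hsh : ∀ j < k ^ 2, ((ch j).elim 0 fun o => vl₂ ((j * V₂ + o) % V₂)) =
      code (codeBase (r + s) k δ) (Nj j) (Dj j) (r + s) := by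
    intro j hj
    simp only [hch, hNj, hDj, hsel', dif_pos hj]
    rcases hs : sel ⟨j, hj⟩ with _ | i
    · simp [code_zero]
    · have hy := hent1 _ _ hs
      have e2 : (j * V₂ + ent ⟨j, hj⟩ i) % V₂ = ent ⟨j, hj⟩ i := by
        rw [Nat.mul_comm, Nat.mul_add_mod, Nat.mod_eq_of_lt hy]
      simp only [Option.map_some, Option.elim_some, e2]
      exact hent2 _ _ hs
  have hNk : ∀ j, 0 ≤ Nj j ∧ Nj j ≤ k := by
    intro j
    simp only [hNj]
    rcases hs : sel' j with _ | i
    · simp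
    · simp only [hsel'] at hs
      split_ifs at hs with hj
      have := hlen _ _ hs
      simp only [Option.elim_some]
      omega
  have hDk : ∀ j d, |Dj j d| ≤ k * δ := by
    intro j d
    simp only [hDj]
    rcases hs : sel' j with _ | i
    · simp; positivity
    · simp only [hsel'] at hs
      split_ifs at hs with hj
      refine (hdle i d).trans ?_
      have := hlen _ _ hs
      exact mul_le_mul_of_nonneg_right (by exact_mod_cast this) (by positivity)
  have hDB : ∀ j d, r ≤ d → d < r + s → Dj j d = 0 := by
    intro j d hd hd'
    simp only [hDj]
    rcases hs : sel' j with _ | i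
    · rfl
    · exact hrowB i d hd hd'
  have hfin : ∀ σ ≤ k ^ 2, (∑ τ ∈ Finset.range σ, (ch τ).elim 0 fun o => vl₂ ((τ * V₂ + o) % V₂)) =
      code (codeBase (r + s) k δ) (∑ τ ∈ Finset.range σ, Nj τ)
        (fun d => ∑ τ ∈ Finset.range σ, Dj τ d) (r + s) := by
    intro σ hσ
    rw [code_sum]
    exact Finset.sum_congr rfl fun τ hτ => hsh τ ((Finset.mem_range.mp hτ).trans_le hσ)
  have hNσ : ∀ σ ≤ k ^ 2, 0 ≤ ∑ τ ∈ Finset.range σ, Nj τ ∧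
      ∑ τ ∈ Finset.range σ, Nj τ ≤ ((k ^ 3 : ℕ) : ℤ) := by
    intro σ hσ
    refine ⟨Finset.sum_nonneg fun τ _ => (hNk τ).1, ?_⟩
    refine (Finset.sum_le_card_nsmul _ _ _ fun τ _ => (hNk τ).2).trans ?_
    rw [Finset.card_range, nsmul_eq_mul, pow_succ]
    push_cast
    exact mul_le_mul_of_nonneg_right (by exact_mod_cast hσ) (by positivity)
  obtain ⟨cs, h⟩ := KPath.of_choice
    (valid := InBox (codeBase (r + s) k δ) (r + s) r (k ^ 3 : ℕ) (k ^ 3 * δ : ℕ)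
      (digitBound (r + s) k δ)) (O := V₂) (opt := setOpt n P V₂ tab)
    (sh := fun c => vl₂ (c % V₂)) ch gg (k ^ 2)
    (by
      intro j hj o ho
      simp only [hch, dif_pos hj] at ho
      obtain ⟨i, hi, rfl⟩ := Option.map_eq_some_iff.mp ho
      refine ⟨hent1 _ _ hi, wt ⟨j, hj⟩ i, ?_⟩
      simp only [hgg, dif_pos hj, hi, Option.elim_some]
      exact hent3 ⟨j, hj⟩ i hi)
    (by
      intro σ hσ
      rw [hfin σ hσ]
      refine ⟨_, _, (hNσ σ hσ).1, (hNσ σ hσ).2, fun d _ => ?_, fun d hd hd' => ?_, rfl⟩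
      · refine (Finset.abs_sum_le_sum_abs _ _).trans ?_
        refine (Finset.sum_le_card_nsmul _ _ _ fun τ _ => hDk τ d).trans ?_
        rw [Finset.card_range, nsmul_eq_mul, pow_succ]
        push_cast
        rw [mul_assoc]
        exact mul_le_mul_of_nonneg_right (by exact_mod_cast hσ) (by positivity)
      · rw [Finset.sum_eq_zero fun τ _ => hDB τ d hd hd', abs_zero]; positivity) _ le_rfl
  have hall : ∀ F : Fin n × Fin t → ℤ, ∑ τ ∈ Finset.range (k ^ 2), ((sel' τ).elim 0 fun i =>
      ((itemsOf x i).map fun p => onItems F i p).sum) = ∑ v, F v * x v := by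
    intro F
    rw [hsum, ← Fin.sum_univ_eq_sum_range (fun τ => (sel' τ).elim 0 fun i =>
      ((itemsOf x i).map fun p => onItems F i p).sum)]
    refine Finset.sum_congr rfl fun j _ => ?_
    simp [hsel']
  refine ⟨_, _, cs, h, ?_, ?_⟩
  · rw [hfin _ le_rfl]
    refine ⟨_, _, (hNσ _ le_rfl).1, (hNσ _ le_rfl).2, fun d hd => ?_, fun d hd hd' => ?_, rfl⟩
    · have : ∑ τ ∈ Finset.range (k ^ 2), Dj τ d = 0 := by
        rw [← hrow d hd]; exact hall (I.colDigit d)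
      rw [this, abs_zero]
    · rw [Finset.sum_eq_zero fun τ _ => hDB τ d hd hd', abs_zero]
  · unfold dotProduct
    rw [← hall I.c]
    refine Finset.sum_le_sum fun τ hτ => ?_
    have hτ := Finset.mem_range.mp hτ
    simp only [hsel', hch, hgg, dif_pos hτ]
    rcases hs : sel ⟨τ, hτ⟩ with _ | i
    · simp
    · exact hent4 _ _ hs

end

end NFoldInstance

open RamProg (run run_skip run_store run_seq run_ite mods maxCost)
open RamExpr (eval cost)

/-! ### Arrays of the programs -/

/-!
The arrays `0, …, 7` are the input, the arrays `8, …, 11` the output. The others hold: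
* the numbers `δ` (`xDl`), the base of the codes (`xM`) and its power `r + s` (`xH`), the bounds
  `digitBound` (`xW`) and `k ^ 3 * δ` (`xR`) on the digits, `L = ⌈log₂ k⌉` (`xL`), `2 ^ L` (`xK`),
  `k ^ 2` (`xKk`), `k ^ 3` (`xKc`);
* the lists of states (`xVl`, `xVlv`, `xVlw`) and their lengths (`xV`, `xVv`, `xVw`); `xVf` sends
  a state to its number plus one, and all other integers to `0`;
* the order `ordf L` (`xOrd`), the codes of the columns (`xCode`), the multiples of `t` (`xIt`) and
  of `V₂` (`xIv`), and the numbers `⌊x / 2⌋` (`xPr`), as there is no division;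
* the merge trees: `xWin` has the items plus one, `0` for no item, and `xVal` the gains; the tree
  in use has the address `xNb`, `xTm` leaves and lists of length `xTk`, and the leaf `xLf` is to
  receive `xCap` entries with the gain `xLv`;
* the tables of the bricks: whether there is a solution (`xBa`), its gain (`xBv`), the number of its
  units (`xSn`) and the units (`xSol`);
* the vector that is being computed (`xVec`), which is zero between the runs.

The remaining arrays are registers and lists for intermediate results.
-/

notation "xPar" => (0 : ℕ)
notation "xP" => (4 : ℕ)
notation "xDl" => (12 : ℕ)
notation "xM" => (13 : ℕ)
notation "xW" => (14 : ℕ)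
notation "xR" => (15 : ℕ)
notation "xK" => (16 : ℕ)
notation "xL" => (17 : ℕ)
notation "xV" => (18 : ℕ)
notation "xVv" => (19 : ℕ)
notation "xVw" => (20 : ℕ)
notation "xH" => (21 : ℕ)
notation "xKk" => (22 : ℕ)
notation "xKc" => (23 : ℕ)
notation "xVl" => (30 : ℕ)
notation "xVlv" => (31 : ℕ)
notation "xVlw" => (32 : ℕ)
notation "xVf" => (33 : ℕ)
notation "xOrd" => (34 : ℕ)
notation "xCode" => (35 : ℕ)
notation "xIt" => (36 : ℕ)
notation "xIv" => (37 : ℕ)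
notation "xPr" => (38 : ℕ)
notation "xWin" => (40 : ℕ)
notation "xVal" => (41 : ℕ)
notation "xBa" => (44 : ℕ)
notation "xBv" => (45 : ℕ)
notation "xSol" => (46 : ℕ)
notation "xSn" => (47 : ℕ)
notation "xVec" => (48 : ℕ)
notation "xNb" => (50 : ℕ)
notation "xTm" => (51 : ℕ)
notation "xTk" => (52 : ℕ)
notation "xNx" => (53 : ℕ)
notation "xMu" => (54 : ℕ)
notation "xMc" => (55 : ℕ)
notation "xDs" => (56 : ℕ)
notation "xLa" => (57 : ℕ)
notation "xRa" => (58 : ℕ)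
notation "xLp" => (59 : ℕ)
notation "xLf" => (60 : ℕ)
notation "xCap" => (61 : ℕ)
notation "xLv" => (62 : ℕ)
notation "xLq" => (63 : ℕ)

/-! ### Merge trees in memory -/

/-- Cell `z` of the arrays `w` and `v` holds the entry `o`: the array `w` holds `p + 1` for an entry
`(p, g)`, and `0` if there is none. -/
def CellIs (w v : ℤ → ℤ) (z : ℤ) : Option (ℕ × ℤ) → Prop
  | none => w z = 0
  | some x => w z = x.1 + 1 ∧ v z = x.2

/-- The first `κ` entries of `l` are stored at `ad`. -/
def ListAt (w v : ℤ → ℤ) (ad : ℤ) (κ : ℕ) (l : List (ℕ × ℤ)) : Prop :=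
  ∀ j < κ, CellIs w v (ad + j) l[j]?

/-- A merge tree with `m` leaves is stored at `nb`, with `κ` cells for each node. -/
def TreeAt (w v : ℤ → ℤ) (nb : ℤ) (m κ : ℕ) (leaf : ℕ → List (ℕ × ℤ)) : Prop :=
  ∀ x, 1 ≤ x → x < 2 * m → ListAt w v (nb + x * κ) κ (full leaf m x)

theorem CellIs.congr {w v w' v' : ℤ → ℤ} {z z' : ℤ} {o : Option (ℕ × ℤ)} (h : CellIs w v z o)
    (hw : w' z' = w z) (hv : v' z' = v z) : CellIs w' v' z' o := by
  cases o with
  | none => exact hw.trans h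
  | some x => exact ⟨hw.trans h.1, hv.trans h.2⟩

theorem CellIs.pos_iff {w v : ℤ → ℤ} {z : ℤ} {o : Option (ℕ × ℤ)} (h : CellIs w v z o) :
    w z ≤ 0 ↔ o = none := by
  cases o with
  | none => have : w z = 0 := h; simp [this]
  | some x => have := h.1; simp; omega

theorem ListAt.congr {w v w' v' : ℤ → ℤ} {ad : ℤ} {κ : ℕ} {l : List (ℕ × ℤ)}
    (h : ListAt w v ad κ l) (hw : ∀ z, ad ≤ z → z < ad + κ → w' z = w z ∧ v' z = v z) :
    ListAt w' v' ad κ l := fun j hj =>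
  (h j hj).congr (hw _ (by omega) (by omega)).1 (hw _ (by omega) (by omega)).2

theorem TreeAt.congr {w v w' v' : ℤ → ℤ} {nb : ℤ} {m κ : ℕ} {leaf : ℕ → List (ℕ × ℤ)}
    (h : TreeAt w v nb m κ leaf)
    (hw : ∀ z, nb ≤ z → z < nb + 2 * m * κ → w' z = w z ∧ v' z = v z) :
    TreeAt w' v' nb m κ leaf := by
  intro x h1 h2
  refine (h x h1 h2).congr fun z hz hz' => hw z ?_ ?_
  · have : (0 : ℤ) ≤ x * κ := by positivity
    omega
  · have : ((x : ℤ) + 1) * κ ≤ 2 * m * κ :=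
      mul_le_mul_of_nonneg_right (by omega) (by positivity)
    linarith

theorem TreeAt.leaf_congr {w v : ℤ → ℤ} {nb : ℤ} {m κ : ℕ} {leaf leaf' : ℕ → List (ℕ × ℤ)}
    (h : TreeAt w v nb m κ leaf) (hl : ∀ p < m, leaf' p = leaf p) : TreeAt w v nb m κ leaf' := by
  intro x h1 h2
  rw [full_congr' hl h1 h2]
  exact h x h1 h2

section Merge

variable {l₁ l₂ M : List (ℕ × ℤ)} {i₁ i₂ j : ℕ}

theorem drop_eq_nil_of_getElem? {α : Type*} {l : List α} {i : ℕ} (h : l[i]? = none) :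
    l.drop i = [] ∧ l.drop (i + 1) = [] := by
  rw [List.getElem?_eq_none_iff] at h
  exact ⟨List.drop_eq_nil_of_le h, List.drop_eq_nil_of_le (by omega)⟩

theorem drop_eq_cons_of_getElem? {α : Type*} {l : List α} {i : ℕ} {a : α} (h : l[i]? = some a) :
    l.drop i = a :: l.drop (i + 1) := by
  obtain ⟨h1, rfl⟩ := List.getElem?_eq_some_iff.mp h
  exact List.drop_eq_getElem_cons h1

theorem getElem?_of_drop_cons {α : Type*} {l l' : List α} {i : ℕ} {a : α}
    (h : l.drop i = a :: l') : l[i]? = some a ∧ l.drop (i + 1) = l' := by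
  have h1 : (l.drop i)[0]? = some a := by rw [h]; rfl
  rw [List.getElem?_drop, Nat.add_zero] at h1
  refine ⟨h1, ?_⟩
  rw [drop_eq_cons_of_getElem? h1] at h
  exact (List.cons.inj h).2

theorem merge_take_right (h : M.drop j = List.merge (l₁.drop i₁) (l₂.drop i₂) geGain)
    (h' : l₁[i₁]? = none ∨ ∃ x y, l₁[i₁]? = some x ∧ l₂[i₂]? = some y ∧ x.2 < y.2) :
    M[j]? = l₂[i₂]? ∧ M.drop (j + 1) = List.merge (l₁.drop i₁) (l₂.drop (i₂ + 1)) geGain := by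
  rcases h' with h' | ⟨x, y, hx, hy, hxy⟩
  · rw [(drop_eq_nil_of_getElem? h').1, List.nil_merge] at *
    constructor
    · have := congrArg (fun l => l[0]?) h
      simpa using this
    · have := congrArg (fun l => l.drop 1) h
      simpa [Nat.add_comm] using this
  · have e : ¬ geGain x y = true := by simp [geGain, hxy]
    rw [drop_eq_cons_of_getElem? hx, drop_eq_cons_of_getElem? hy,
      List.cons_merge_cons_neg _ _ _ e] at h
    obtain ⟨h1, h2⟩ := getElem?_of_drop_cons h
    rw [h1, hy, h2, drop_eq_cons_of_getElem? hx]
    exact ⟨rfl, rfl⟩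

theorem merge_take_left (h : M.drop j = List.merge (l₁.drop i₁) (l₂.drop i₂) geGain)
    {x : ℕ × ℤ} (hx : l₁[i₁]? = some x)
    (h' : l₂[i₂]? = none ∨ ∃ y, l₂[i₂]? = some y ∧ y.2 ≤ x.2) :
    M[j]? = l₁[i₁]? ∧ M.drop (j + 1) = List.merge (l₁.drop (i₁ + 1)) (l₂.drop i₂) geGain := by
  rcases h' with h' | ⟨y, hy, hxy⟩
  · rw [(drop_eq_nil_of_getElem? h').1, List.merge_right] at *
    rw [drop_eq_cons_of_getElem? hx] at h
    obtain ⟨h1, h2⟩ := getElem?_of_drop_cons h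
    exact ⟨by rw [h1, hx], h2⟩
  · have e : geGain x y = true := by simp [geGain, hxy]
    rw [drop_eq_cons_of_getElem? hx, drop_eq_cons_of_getElem? hy,
      List.cons_merge_cons_pos _ _ _ e] at h
    obtain ⟨h1, h2⟩ := getElem?_of_drop_cons h
    rw [h1, hx, h2, drop_eq_cons_of_getElem? hy]
    exact ⟨rfl, rfl⟩

end Merge

/-- Copies the entry at the register `a` to the output position and advances. -/
def copyP (a : ℕ) : RamProg :=
  .store xWin (rg xDs) (.load xWin (rg a)) ;; .store xVal (rg xDs) (.load xVal (rg a)) ;;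
    setR a (rg a + .lit 1) ;; setR xDs (rg xDs + .lit 1)

/-- Computes the list at node `xNx` from the lists at its children. -/
def nodeP : RamProg :=
  mulP xMu xMc (rg xNx) (rg xTk) ;;
  (setR xDs (rg xNb + rg xMu) ;; setR xLa (rg xDs + rg xMu) ;; setR xRa (rg xLa + rg xTk)) ;;
  forP xLp (rg xTk)
    (.ite (.load xWin (rg xLa)) (.lit 0) (copyP xRa)
      (.ite (.load xWin (rg xRa)) (.lit 0) (copyP xLa)
        (.ite (.load xVal (rg xRa)) (.load xVal (rg xLa)) (copyP xLa) (copyP xRa))))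

/-- The memories agree on the merge trees outside of the cells from `ad` to `ad + len - 1`. -/
def SameTrees (μ μ' : RamMemory) (ad len : ℤ) : Prop :=
  ∀ z, ¬ (ad ≤ z ∧ z < ad + len) → μ' xWin z = μ xWin z ∧ μ' xVal z = μ xVal z

theorem SameTrees.trans {μ μ' μ'' : RamMemory} {ad len : ℤ} (h : SameTrees μ μ' ad len)
    (h' : SameTrees μ' μ'' ad len) : SameTrees μ μ'' ad len := fun z hz =>
  ⟨(h' z hz).1.trans (h z hz).1, (h' z hz).2.trans (h z hz).2⟩

theorem SameTrees.refl {μ μ' : RamMemory} {ad len : ℤ} (h1 : μ' xWin = μ xWin)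
    (h2 : μ' xVal = μ xVal) : SameTrees μ μ' ad len := fun z _ => ⟨by rw [h1], by rw [h2]⟩

theorem SameTrees.mono {μ μ' : RamMemory} {ad len ad' len' : ℤ} (h : SameTrees μ μ' ad len)
    (h1 : ad' ≤ ad) (h2 : ad + len ≤ ad' + len') : SameTrees μ μ' ad' len' := fun z hz =>
  h z (by omega)

section TreeRuns

variable {Q : ℕ} [hQ : Fact (1024 ≤ Q)] {μ : RamMemory} {nb : ℤ} {m κ : ℕ}

/-- The list at an inner node becomes the merge of the lists at its children, cut off after `κ`
entries; so the stored lists are initial segments of the full ones. -/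
theorem nodeP_runs {l₁ l₂ : List (ℕ × ℤ)} {x : ℕ} (hx : 1 ≤ x) (hκ : κ ≤ Q)
    (h50 : μ xNb 0 = nb) (h52 : μ xTk 0 = κ) (h53 : μ xNx 0 = x)
    (h₁ : ListAt (μ xWin) (μ xVal) (nb + (2 * x : ℕ) * κ) κ l₁)
    (h₂ : ListAt (μ xWin) (μ xVal) (nb + (2 * x + 1 : ℕ) * κ) κ l₂) :
    Runs nodeP μ (Q ^ 8) fun μ' =>
      ListAt (μ' xWin) (μ' xVal) (nb + x * κ) κ (List.merge l₁ l₂ geGain) ∧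
        SameTrees μ μ' (nb + x * κ) κ := by
  unfold nodeP
  have hX : (κ : ℤ) ≤ x * κ := le_mul_of_one_le_left (by positivity) (by exact_mod_cast hx)
  have e₁ : nb + ((2 * x : ℕ) : ℤ) * κ = nb + x * κ + x * κ := by push_cast; ring
  have e₂ : nb + ((2 * x + 1 : ℕ) : ℤ) * κ = nb + x * κ + x * κ + κ := by push_cast; ring
  rw [e₁] at h₁
  rw [e₂] at h₂
  set X : ℤ := (x : ℤ) * κ with hXdef
  clear_value X
  refine Runs.seqQ ((Runs.mulP 1 (c := x) (N := κ) (by simpa using h53) (by simpa using h52)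
      (by simpa using hκ)).up) fun μ₁ hf₁ hμ₁ => ?_
  have g50 : μ₁ xNb 0 = nb := by rw [hf₁.eq _, h50]
  have g52 : μ₁ xTk 0 = κ := by rw [hf₁.eq _, h52]
  have s₁ : SameTrees μ μ₁ (nb + X) κ := .refl (hf₁.eq _) (hf₁.eq _)
  rw [← hXdef] at hμ₁
  refine Runs.seqQ (R' := fun μ' => μ' xDs 0 = nb + X ∧ μ' xLa 0 = nb + X + X ∧
      μ' xRa 0 = nb + X + X + κ) (.block ?_)
    fun μ₂ hf₂ hμ₂ => ?_
  · simp [run, g50, g52, hμ₁]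
  have s₂ : SameTrees μ μ₂ (nb + X) κ := s₁.trans (.refl (hf₂.eq _) (hf₂.eq _))
  have k52 : μ₂ xTk 0 = κ := by rw [hf₂.eq _, g52]
  generalize hM : List.merge l₁ l₂ geGain = M
  refine ((Runs.forQ (N := κ) (e := 4) 1 (fun j μ' => ∃ i₁ i₂, i₁ + i₂ = j ∧ μ' xDs 0 = nb + X + j ∧
      μ' xLa 0 = nb + X + X + i₁ ∧ μ' xRa 0 = nb + X + X + κ + i₂ ∧
      M.drop j = List.merge (l₁.drop i₁) (l₂.drop i₂) geGain ∧
      (∀ pos : ℕ, pos < j → CellIs (μ' xWin) (μ' xVal) (nb + X + pos) M[pos]?) ∧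
      SameTrees μ μ' (nb + X) κ) (by simpa using hκ) ?_ ?_ ?_ ?_).up).post ?_
  · intro μ' h'
    rw [eval, eval, h'.eq _, k52]
  · intro j μ' v h
    simpa [SameTrees] using h
  · exact ⟨0, 0, rfl, by simpa using hμ₂.1, by simpa using hμ₂.2.1, by simpa using hμ₂.2.2,
      by simpa using hM.symm, by simp, s₂⟩
  · rintro j hj μ' - - ⟨i₁, i₂, hij, hd, ha, hb, hdrop, hcell, hs⟩
    have c₁ : CellIs (μ' xWin) (μ' xVal) (μ' xLa 0) l₁[i₁]? := by
      have := hs (nb + X + X + i₁) (by omega)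
      rw [ha]; exact (h₁ i₁ (by omega)).congr this.1 this.2
    have c₂ : CellIs (μ' xWin) (μ' xVal) (μ' xRa 0) l₂[i₂]? := by
      have := hs (nb + X + X + κ + i₂) (by omega)
      rw [hb]; exact (h₂ i₂ (by omega)).congr this.1 this.2
    -- one copying step, for either of the two sources
    have step : ∀ (src : ℤ) (o : Option (ℕ × ℤ)), CellIs (μ' xWin) (μ' xVal) src o → M[j]? = o →
        (∀ pos : ℕ, pos < j + 1 → CellIs (Function.update (μ' xWin) (μ' xDs 0) (μ' xWin src))
          (Function.update (μ' xVal) (μ' xDs 0) (μ' xVal src)) (nb + X + pos) M[pos]?) ∧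
        ∀ z, ¬ (nb + X ≤ z ∧ z < nb + X + κ) →
          Function.update (μ' xWin) (μ' xDs 0) (μ' xWin src) z = μ xWin z ∧
          Function.update (μ' xVal) (μ' xDs 0) (μ' xVal src) z = μ xVal z := by
      intro src o hc ho
      constructor
      · intro pos hpos
        rcases Nat.lt_succ_iff_lt_or_eq.mp hpos with h | rfl
        · have hne : nb + X + (pos : ℤ) ≠ μ' xDs 0 := by rw [hd]; omega
          exact (hcell pos h).congr (by simp [hne]) (by simp [hne])
        · rw [ho]
          exact hc.congr (by simp [hd]) (by simp [hd])
      · intro z hz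
        have hne : z ≠ μ' xDs 0 := by rw [hd]; omega
        simpa [hne] using hs z hz
    have right : (l₁[i₁]? = none ∨ ∃ x y, l₁[i₁]? = some x ∧ l₂[i₂]? = some y ∧ x.2 < y.2) →
        ∃ a b, a + b = j + 1 ∧ ((copyP xRa).run μ') xDs 0 = nb + X + (j + 1 : ℕ) ∧
          ((copyP xRa).run μ') xLa 0 = nb + X + X + a ∧
          ((copyP xRa).run μ') xRa 0 = nb + X + X + κ + b ∧
          M.drop (j + 1) = List.merge (l₁.drop a) (l₂.drop b) geGain ∧
          (∀ pos : ℕ, pos < j + 1 → CellIs (((copyP xRa).run μ') xWin)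
            (((copyP xRa).run μ') xVal) (nb + X + pos) M[pos]?) ∧
          SameTrees μ ((copyP xRa).run μ') (nb + X) κ := by
      intro h
      obtain ⟨r1, r2⟩ := merge_take_right hdrop h
      obtain ⟨t1, t2⟩ := step _ _ c₂ r1
      refine ⟨i₁, i₂ + 1, by omega, ?_, ?_, ?_, r2, ?_, ?_⟩
      · simp [copyP, run, hd]; ring
      · simp [copyP, run, ha]
      · simp [copyP, run, hb]; ring
      · simpa [copyP, run] using t1
      · simpa [copyP, run, SameTrees] using t2
    have left : ∀ x, l₁[i₁]? = some x → (l₂[i₂]? = none ∨ ∃ y, l₂[i₂]? = some y ∧ y.2 ≤ x.2) →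
        ∃ a b, a + b = j + 1 ∧ ((copyP xLa).run μ') xDs 0 = nb + X + (j + 1 : ℕ) ∧
          ((copyP xLa).run μ') xLa 0 = nb + X + X + a ∧
          ((copyP xLa).run μ') xRa 0 = nb + X + X + κ + b ∧
          M.drop (j + 1) = List.merge (l₁.drop a) (l₂.drop b) geGain ∧
          (∀ pos : ℕ, pos < j + 1 → CellIs (((copyP xLa).run μ') xWin)
            (((copyP xLa).run μ') xVal) (nb + X + pos) M[pos]?) ∧
          SameTrees μ ((copyP xLa).run μ') (nb + X) κ := by
      intro x hx h
      obtain ⟨r1, r2⟩ := merge_take_left hdrop hx h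
      obtain ⟨t1, t2⟩ := step _ _ c₁ r1
      refine ⟨i₁ + 1, i₂, by omega, ?_, ?_, ?_, r2, ?_, ?_⟩
      · simp [copyP, run, hd]; ring
      · simp [copyP, run, ha]; ring
      · simp [copyP, run, hb]
      · simpa [copyP, run] using t1
      · simpa [copyP, run, SameTrees] using t2
    refine .iteQ (e := 3) (by decide) (fun q1 => ?_) fun q1 => .iteQ (e := 2) (by decide)
      (fun q2 => ?_) fun q2 => .iteQ (e := 1) (by decide) (fun q3 => ?_) fun q3 => ?_
    · exact .block (right (.inl (c₁.pos_iff.mp q1)))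
    all_goals obtain ⟨x, hx⟩ := Option.ne_none_iff_exists'.mp fun h => q1 (c₁.pos_iff.mpr h)
    · exact .block (left x hx (.inl (c₂.pos_iff.mp q2)))
    all_goals
      obtain ⟨y, hy⟩ := Option.ne_none_iff_exists'.mp fun h => q2 (c₂.pos_iff.mpr h)
      rw [hx] at c₁; rw [hy] at c₂
      simp only [eval] at q3
    · exact .block
        (left x hx (.inr ⟨y, hy, by rw [← c₁.2, ← c₂.2]; exact q3⟩))
    · exact .block
        (right (.inr ⟨x, y, hx, hy, by rw [← c₁.2, ← c₂.2]; omega⟩))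
  · rintro μ' - ⟨_, _, -, -, -, -, -, hcell, hs⟩
    exact ⟨hcell, hs⟩

theorem ListAt.of_same {μ' : RamMemory} {x y : ℕ} {l : List (ℕ × ℤ)}
    (h : ListAt (μ xWin) (μ xVal) (nb + y * κ) κ l) (hs : SameTrees μ μ' (nb + x * κ) κ)
    (hxy : y ≠ x) : ListAt (μ' xWin) (μ' xVal) (nb + y * κ) κ l := by
  refine h.congr fun z h1 h2 => hs z ?_
  rintro ⟨h3, h4⟩
  rcases lt_or_gt_of_ne hxy with h | h
  · have : ((y : ℤ) + 1) * κ ≤ x * κ := mul_le_mul_of_nonneg_right (by omega) (by positivity)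
    linarith
  · have : ((x : ℤ) + 1) * κ ≤ y * κ := mul_le_mul_of_nonneg_right (by omega) (by positivity)
    linarith

theorem SameTrees.of_node {μ' : RamMemory} {x : ℕ} (hs : SameTrees μ μ' (nb + x * κ) κ)
    (hx : x < 2 * m) : SameTrees μ μ' nb (2 * m * κ) := by
  refine hs.mono ?_ ?_
  · have : (0 : ℤ) ≤ x * κ := by positivity
    omega
  · have : ((x : ℤ) + 1) * κ ≤ 2 * m * κ :=
      mul_le_mul_of_nonneg_right (by omega) (by positivity)
    linarith

/-- Stores `xCap` copies of the entry (`xLf`, `xLv`) at the leaf `xLf`. -/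
def leafP : RamProg :=
  mulP xMu xMc (rg xTm + rg xLf) (rg xTk) ;;
  setR xDs (rg xNb + rg xMu) ;;
  forP xLp (rg xTk)
    (.ite (rg xLp + .lit 1) (rg xCap) (.store xWin (rg xDs) (rg xLf + .lit 1))
      (.store xWin (rg xDs) (.lit 0)) ;;
    .store xVal (rg xDs) (rg xLv) ;; setR xDs (rg xDs + .lit 1))

theorem leafP_runs {p cap : ℕ} {g : ℤ} (hκ : κ ≤ Q)
    (h50 : μ xNb 0 = nb) (h51 : μ xTm 0 = m) (h52 : μ xTk 0 = κ) (h60 : μ xLf 0 = p)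
    (h61 : μ xCap 0 = cap) (h62 : μ xLv 0 = g) :
    Runs leafP μ (Q ^ 6) fun μ' =>
      ListAt (μ' xWin) (μ' xVal) (nb + (m + p : ℕ) * κ) κ (List.replicate cap (p, g)) ∧
        SameTrees μ μ' (nb + (m + p : ℕ) * κ) κ := by
  unfold leafP
  refine Runs.seqQ ((Runs.mulP 1 (c := (m + p : ℕ)) (N := κ) (by simp [h51, h60])
      (by simpa using h52)
    (by simpa using hκ)).up) fun μ₁ hf₁ hμ₁ => ?_
  generalize ((m + p : ℕ) : ℤ) * κ = X at *
  refine Runs.seqQ (R' := fun μ' => μ' xDs 0 = nb + X)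
    (.block ?_) fun μ₂ hf₂ hμ₂ => ?_
  · simp [run, hf₁.eq xNb, h50, hμ₁]
  have tr : ∀ a, a ∉ [xMu, xMc, xDs] → μ₂ a = μ a := fun a ha => by
    simp only [List.mem_cons, not_or] at ha
    rw [hf₂ a (by simp [mods, ha]), hf₁ a (by simp [mulP, forP, mods, ha])]
  refine ((Runs.forQ (N := κ) (e := 1) 1 (fun j μ' => μ' xDs 0 = nb + X + j ∧
      (∀ pos : ℕ, pos < j → CellIs (μ' xWin) (μ' xVal) (nb + X + pos)
        (List.replicate cap (p, g))[pos]?) ∧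
      SameTrees μ μ' (nb + X) κ) (by simpa using hκ) ?_ ?_ ?_ ?_).up).post ?_
  · intro μ' h'
    rw [eval, eval, h'.eq _, tr _ (by decide), h52]
  · intro j μ' v h
    simpa [SameTrees] using h
  · exact ⟨by simpa using hμ₂, by simp, .refl (tr _ (by decide)) (tr _ (by decide))⟩
  · rintro j hj μ' hf hj' ⟨hd, hcell, hs⟩
    have k60 : μ' xLf 0 = p := by rw [hf.eq _, tr _ (by decide), h60]
    have k61 : μ' xCap 0 = cap := by rw [hf.eq _, tr _ (by decide), h61]
    have k62 : μ' xLv 0 = g := by rw [hf.eq _, tr _ (by decide), h62]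
    refine .block ?_
    have key : ∀ v : ℤ, CellIs (Function.update (μ' xWin) (nb + X + j) v)
        (Function.update (μ' xVal) (nb + X + j) g) (nb + X + j)
        (List.replicate cap (p, g))[j]? →
        (∀ pos : ℕ, pos < j + 1 → CellIs (Function.update (μ' xWin) (nb + X + j) v)
        (Function.update (μ' xVal) (nb + X + j) g) (nb + X + pos)
        (List.replicate cap (p, g))[pos]?) ∧
        ∀ z, ¬ (nb + X ≤ z ∧ z < nb + X + κ) →
          Function.update (μ' xWin) (nb + X + j) v z = μ xWin z ∧
          Function.update (μ' xVal) (nb + X + j) g z = μ xVal z := by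
      intro v hv
      constructor
      · intro pos hpos
        rcases Nat.lt_succ_iff_lt_or_eq.mp hpos with h | rfl
        · have hne : nb + X + (pos : ℤ) ≠ nb + X + j := by omega
          exact (hcell pos h).congr (by simp [hne]) (by simp [hne])
        · exact hv
      · intro z hz
        have hne : z ≠ nb + X + j := by omega
        simpa [hne] using hs z hz
    by_cases hc : j < cap
    · obtain ⟨t1, t2⟩ := key (p + 1) (by simp [hc, CellIs])
      have hc' : μ' xLp 0 + 1 ≤ μ' xCap 0 := by omega
      refine ⟨?_, ?_, ?_⟩
      · simp [run, hc', hd]; ring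
      · simpa [run, hc', hd, k60, k62] using t1
      · simpa [run, hc', hd, k60, k62, SameTrees] using t2
    · obtain ⟨t1, t2⟩ := key 0 (by simp [hc, CellIs])
      have hc' : ¬ μ' xLp 0 + 1 ≤ μ' xCap 0 := by omega
      refine ⟨?_, ?_, ?_⟩
      · simp [run, hc', hd]; ring
      · simpa [run, hc', hd, k62] using t1
      · simpa [run, hc', hd, k62, SameTrees] using t2
  · rintro μ' - ⟨-, hcell, hs⟩
    exact ⟨hcell, hs⟩

/-- Recomputes the lists at the ancestors of the leaf `xLf`. -/
def climbP : RamProg :=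
  setR xNx (.load xPr (rg xTm + rg xLf)) ;;
  .loop (.lit 1) (rg xNx) (nodeP ;; setR xNx (.load xPr (rg xNx)))

/-- The climb from the node `c` repairs a tree that is correct except at the ancestors of `c`, of
which there are logarithmically many. -/
theorem climb_loop_runs {leaf : ℕ → List (ℕ × ℤ)} (N : ℕ) (hκ : κ ≤ Q) :
    ∀ (c : ℕ) (μ : RamMemory), c < 2 ^ N → c < m → μ xNb 0 = nb → μ xTk 0 = κ → μ xNx 0 = c →
      (∀ x < m, μ xPr (x : ℤ) = (x / 2 : ℕ)) →
      (∀ x, 1 ≤ x → x < 2 * m → ¬ Anc x c →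
        ListAt (μ xWin) (μ xVal) (nb + x * κ) κ (full leaf m x)) →
      Runs (.loop (.lit 1) (rg xNx) (nodeP ;; setR xNx (.load xPr (rg xNx)))) μ (Q ^ 10 * (N + 1))
        fun μ' => TreeAt (μ' xWin) (μ' xVal) nb m κ leaf ∧ SameTrees μ μ' nb (2 * m * κ) := by
  have h1Q := one_le_of_fact Q
  have h2Q := hQ.out
  have hQ10 : 1024 ≤ Q ^ 10 := h2Q.trans (Nat.le_self_pow (by norm_num) Q)
  have base : ∀ (N : ℕ) (μ : RamMemory), μ xNx 0 = (0 : ℕ) →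
      (∀ x, 1 ≤ x → x < 2 * m → ¬ Anc x 0 →
        ListAt (μ xWin) (μ xVal) (nb + x * κ) κ (full leaf m x)) →
      Runs (.loop (.lit 1) (rg xNx) (nodeP ;; setR xNx (.load xPr (rg xNx)))) μ (Q ^ 10 * (N + 1))
        fun μ' => TreeAt (μ' xWin) (μ' xVal) nb m κ leaf ∧ SameTrees μ μ' nb (2 * m * κ) := by
    intro N μ h53 h
    refine ⟨_, μ, .loop_false (by simp [h53]), ?_, ?_, .refl rfl rfl⟩
    · have : (RamExpr.lit 1).cost + (rg xNx).cost + 1 = 4 := rfl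
      nlinarith
    · intro x h1 h2
      refine h x h1 h2 fun hA => ?_
      have := hA.le
      omega
  induction N with
  | zero =>
    intro c μ hc hm h50 h52 h53 hpr h
    obtain rfl : c = 0 := by simpa using hc
    exact base 0 μ h53 h
  | succ N ih =>
    intro c μ hc hm h50 h52 h53 hpr h
    rcases Nat.eq_zero_or_pos c with rfl | hpos
    · exact base _ μ h53 h
    have hA : ∀ x, c < x → ¬ Anc x c := fun x hx hA => by have := hA.le; omega
    obtain ⟨T₁, μ₁, g1, g2, hn, hs⟩ := nodeP_runs (Q := Q) hpos hκ h50 h52 h53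
      (h (2 * c) (by omega) (by omega) (hA _ (by omega)))
      (h (2 * c + 1) (by omega) (by omega) (hA _ (by omega)))
    rw [← full_inner hpos hm] at hn
    have e1 : RamExec (setR xNx (.load xPr (rg xNx))) μ₁ _ _ := .store μ₁ _ _ _
    simp only [eval] at e1
    rw [g1.frame xPr (by decide), g1.frame xNx (by decide), h53, hpr c hm] at e1
    have hs' := hs.of_node (m := m) (by omega)
    obtain ⟨T₂, μ₂, k1, k2, k3, k4⟩ := ih (c / 2) (μ₁.write xNx 0 ((c / 2 : ℕ) : ℤ))
      (by rw [pow_succ] at hc; omega) (by omega)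
      (by simpa [g1.frame xNb (by decide)] using h50)
      (by simpa [g1.frame xTk (by decide)] using h52) (by simp)
      (by simpa [g1.frame xPr (by decide)] using hpr)
      (by
        intro x h1 h2 h3
        simp only [RamMemory.write_apply]
        norm_num
        rcases eq_or_ne x c with rfl | hne
        · exact hn
        · exact (h x h1 h2 fun h' => (anc_iff.mp h').elim hne h3).of_same hs hne)
    refine ⟨_, μ₂, .loop_true (by simp [h53]; omega) (.seq g1 e1) k1, ?_, k3, ?_⟩
    · have c1 : (RamExpr.lit 1).cost + (rg xNx).cost + 1 = 4 := rfl
      have c2 : (RamExpr.lit 0).cost + (RamExpr.load xPr (rg xNx)).cost + 1 = 5 := rfl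
      have : Q ^ 8 + 9 ≤ Q ^ 10 := by
        have : 1024 * Q ^ 8 ≤ Q ^ 10 := by
          have := Nat.mul_le_mul_right (Q ^ 9) h2Q
          have e : Q * Q ^ 9 = Q ^ 10 := by ring
          have : Q ^ 8 ≤ Q ^ 9 := Nat.pow_le_pow_right h1Q (by norm_num)
          omega
        have := Nat.pow_pos (n := 8) h1Q
        omega
      have : Q ^ 10 * (N + 1 + 1) = Q ^ 10 * (N + 1) + Q ^ 10 := by ring
      omega
    · refine hs'.trans ?_
      intro z hz
      have := k4 z hz
      simpa using this

theorem climbP_runs {leaf : ℕ → List (ℕ × ℤ)} {p : ℕ} (hκ : κ ≤ Q) (hp : p < m)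
    (h50 : μ xNb 0 = nb) (h51 : μ xTm 0 = m) (h52 : μ xTk 0 = κ) (h60 : μ xLf 0 = p)
    (hpr : ∀ x < 2 * m, μ xPr (x : ℤ) = (x / 2 : ℕ))
    (h : ∀ x, 1 ≤ x → x < 2 * m → (¬ Anc x (m + p) ∨ x = m + p) →
        ListAt (μ xWin) (μ xVal) (nb + x * κ) κ (full leaf m x)) :
    Runs climbP μ (Q ^ 12 * (Nat.log 2 m + 1)) fun μ' =>
      TreeAt (μ' xWin) (μ' xVal) nb m κ leaf ∧ SameTrees μ μ' nb (2 * m * κ) := by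
  refine Runs.seqX (R' := fun μ' => μ' xNx 0 = ((m + p) / 2 : ℕ))
    (.blockX (by omega) ?_) fun μ₁ hf₁ hμ₁ => ?_
  · have := hpr (m + p) (by omega)
    push_cast at this
    simp [run, h51, h60, this]
  · have hlt : m < 2 ^ (Nat.log 2 m + 1) := Nat.lt_pow_succ_log_self (by norm_num) m
    refine (climb_loop_runs (leaf := leaf) (m := m) (nb := nb) (Nat.log 2 m + 1) hκ ((m + p) / 2)
      μ₁ (by omega) (by omega) (by rw [hf₁.eq _, h50])
      (by rw [hf₁.eq _, h52]) hμ₁ (by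
        intro x hx
        rw [hf₁.eq _, hpr x (by omega)]) ?_).mono ?_ ?_
    · intro x h1 h2 h3
      rw [hf₁.eq _, hf₁.eq _]
      exact h x h1 h2 (by
        by_cases hx : x = m + p
        · exact .inr hx
        · exact .inl fun h' => (anc_iff.mp h').elim hx h3)
    · have : 2 * Q ^ 10 ≤ Q ^ 11 := by
        rw [pow_succ, mul_comm]; exact Nat.mul_le_mul_left _ (by have := hQ.out; omega)
      calc Q ^ 10 * (Nat.log 2 m + 1 + 1) ≤ Q ^ 10 * (2 * (Nat.log 2 m + 1)) :=
            Nat.mul_le_mul_left _ (by omega)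
        _ = 2 * Q ^ 10 * (Nat.log 2 m + 1) := by ring
        _ ≤ Q ^ 11 * (Nat.log 2 m + 1) := Nat.mul_le_mul_right _ this
    · rintro μ' - ⟨k1, k2⟩
      refine ⟨k1, fun z hz => ?_⟩
      have := k2 z hz
      rwa [hf₁.eq _, hf₁.eq _] at this

/-- Changes the leaf `xLf` of a merge tree. -/
def updateP : RamProg := leafP ;; climbP

theorem updateP_runs {leaf leaf' : ℕ → List (ℕ × ℤ)} {p cap : ℕ} {g : ℤ} (hκ : κ ≤ Q) (hp : p < m)
    (h50 : μ xNb 0 = nb) (h51 : μ xTm 0 = m) (h52 : μ xTk 0 = κ) (h60 : μ xLf 0 = p)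
    (h61 : μ xCap 0 = cap) (h62 : μ xLv 0 = g)
    (hpr : ∀ x < 2 * m, μ xPr (x : ℤ) = (x / 2 : ℕ))
    (h : TreeAt (μ xWin) (μ xVal) nb m κ leaf)
    (hl : ∀ p' < m, p' ≠ p → leaf' p' = leaf p') (hl' : leaf' p = List.replicate cap (p, g)) :
    Runs updateP μ (Q ^ 13 * (Nat.log 2 m + 1)) fun μ' =>
      TreeAt (μ' xWin) (μ' xVal) nb m κ leaf' ∧ SameTrees μ μ' nb (2 * m * κ) := by
  refine Runs.seqX ((leafP_runs hκ h50 h51 h52 h60 h61 h62).raise (by omega)) ?_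
  rintro μ₁ hf ⟨h1, h2⟩
  refine (climbP_runs (leaf := leaf') hκ hp (by rw [hf.eq _, h50])
    (by rw [hf.eq _, h51]) (by rw [hf.eq _, h52])
    (by rw [hf.eq _, h60]) (by rw [hf.eq _]; exact hpr) ?_).post ?_
  · intro x hx1 hx2 hx
    by_cases hxp : x = m + p
    · subst hxp
      rw [full_leaf, hl']
      exact h1
    · rw [full_congr hl hx1 hx2 (hx.resolve_right hxp)]
      exact (h x hx1 hx2).of_same h2 hxp
  · rintro μ' - ⟨k1, k2⟩
    exact ⟨k1, (h2.of_node (by omega)).trans k2⟩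

/-- Computes the lists at all nodes of a merge tree from its leaves. -/
def buildP : RamProg :=
  forP xLq (rg xTm - .lit 1) (setR xNx (rg xTm - .lit 1 - rg xLq) ;; nodeP)

theorem buildP_runs {leaf : ℕ → List (ℕ × ℤ)} (hκ : κ ≤ Q) (hm : 1 ≤ m)
    (h50 : μ xNb 0 = nb) (h51 : μ xTm 0 = m) (h52 : μ xTk 0 = κ)
    (h : ∀ p < m, ListAt (μ xWin) (μ xVal) (nb + (m + p : ℕ) * κ) κ (leaf p)) :
    Runs buildP μ (Q ^ 10 * m) fun μ' =>
      TreeAt (μ' xWin) (μ' xVal) nb m κ leaf ∧ SameTrees μ μ' nb (2 * m * κ) := by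
  have := Runs.forX (Q := Q) (N := m - 1) (e := 9) (f := 0) (X := 1) (Y := m) (i := xLq)
    (hi := rg xTm - .lit 1) (body := setR xNx (rg xTm - .lit 1 - rg xLq) ;; nodeP) (μ₀ := μ)
    (fun j μ' => (∀ x, 1 ≤ x → x < 2 * m → m ≤ x + j →
      ListAt (μ' xWin) (μ' xVal) (nb + x * κ) κ (full leaf m x)) ∧
      SameTrees μ μ' nb (2 * m * κ)) le_rfl hm (by simp) ?_ ?_ ?_ ?_
  · refine this.mono (by simp) ?_
    rintro μ' - ⟨h1, h2⟩
    exact ⟨fun x hx1 hx2 => h1 x hx1 hx2 (by omega), h2⟩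
  · intro μ' h'
    simp [h'.eq xTm, h51]; omega
  · intro j μ' v h
    simpa [SameTrees] using h
  · refine ⟨fun x h1 h2 h3 => ?_, .refl rfl rfl⟩
    obtain ⟨p, rfl⟩ := Nat.exists_eq_add_of_le (by omega : m ≤ x)
    rw [full_leaf]
    exact h p (by omega)
  · rintro j hj μ' hf hji ⟨k1, k2⟩
    have k50 : μ' xNb 0 = nb := by rw [hf.eq _, h50]
    have k51 : μ' xTm 0 = m := by rw [hf.eq _, h51]
    have k52 : μ' xTk 0 = κ := by rw [hf.eq _, h52]
    rw [mul_one]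
    refine Runs.seqQ (R' := fun μ' => μ' xNx 0 = (m - 1 - j : ℕ))
      (.block ?_) fun μ₁ hf₁ hμ₁ => ?_
    · simp [run, k51, hji]; omega
    · have w : μ₁ xWin = μ' xWin := hf₁.eq _
      have v : μ₁ xVal = μ' xVal := hf₁.eq _
      refine (nodeP_runs (x := m - 1 - j) (by omega) hκ (by rw [hf₁.eq _, k50])
        (by rw [hf₁.eq _, k52]) hμ₁
        (by rw [w, v]; exact k1 (2 * (m - 1 - j)) (by omega) (by omega) (by omega))
        (by rw [w, v]; exact k1 (2 * (m - 1 - j) + 1) (by omega) (by omega) (by omega))).post ?_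
      rintro μ₂ - ⟨n1, n2⟩
      rw [← full_inner (by omega) (by omega)] at n1
      refine ⟨fun x h1 h2 h3 => ?_, ?_⟩
      · rcases eq_or_ne x (m - 1 - j) with rfl | hne
        · exact n1
        · exact ((k1 x h1 h2 (by omega)).congr fun z _ _ => ⟨by rw [w], by rw [v]⟩).of_same n2 hne
      · refine SameTrees.trans (fun z hz => ?_) (n2.of_node (m := m) (by omega))
        rw [w, v]
        exact k2 z hz

end TreeRuns

/-! ### Tables of group knapsacks -/

/-!
The options of a knapsack with `xS` stages of `xO` options each have the values `xOw` (plus one, `0`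
for a missing option), the gains `xOg` and the shifts `xOs`; `xOy` are the numbers of their codes in
the list of states. The table consists of the markers `xCh` and the values `xVt`, and `xCl` lists
the `xCc` options on a traced path.
-/

notation "xOw" => (64 : ℕ)
notation "xOg" => (65 : ℕ)
notation "xOs" => (66 : ℕ)
notation "xS" => (67 : ℕ)
notation "xO" => (68 : ℕ)
notation "xCh" => (69 : ℕ)
notation "xVt" => (70 : ℕ)
notation "xSrc" => (71 : ℕ)
notation "xDst" => (72 : ℕ)
notation "xIx" => (73 : ℕ)
notation "xY" => (74 : ℕ)
notation "xOl" => (75 : ℕ)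
notation "xSl" => (76 : ℕ)
notation "xU" => (77 : ℕ)
notation "xCx" => (78 : ℕ)
notation "xNv" => (79 : ℕ)
notation "xCc" => (80 : ℕ)
notation "xCl" => (81 : ℕ)
notation "xRr" => (82 : ℕ)

section Knapsack

variable {valid : ℤ → Prop} {V O S : ℕ} {opt : ℕ → Option (ℕ × ℤ)} {sh vl : ℕ → ℤ}

/-- The cell `y'` of a row of the table, with marker `a` and value `b`, is correct, where `c` and
`v` are the markers and values of the row before, and where only the first `o` options of the stage
that starts with the option `base` are taken into account. The marker is `0` for an unreachable
state, `1` for a state that is reached by choosing no option, and `c + 2` for a state that is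
reached by choosing the option `c`. -/
structure CellOK (V : ℕ) (opt : ℕ → Option (ℕ × ℤ)) (sh vl : ℕ → ℤ) (base : ℕ) (c v : ℕ → ℤ)
    (o y' : ℕ) (a b : ℤ) : Prop where
  skip : 1 ≤ c y' → 1 ≤ a ∧ v y' ≤ b
  take : ∀ o' < o, ∀ w g y, y < V → opt (base + o') = some (w, g) →
    vl y' = vl y + sh (base + o') → 1 ≤ c y → 1 ≤ a ∧ v y + g ≤ b
  back : 1 ≤ a → (a = 1 ∧ 1 ≤ c y' ∧ b = v y') ∨
    ∃ o' < o, a = (base + o' : ℕ) + 2 ∧ ∃ w g, opt (base + o') = some (w, g) ∧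
      ∃ y < V, vl y' = vl y + sh (base + o') ∧ 1 ≤ c y ∧ b = v y + g

namespace CellOK

variable {base o y' : ℕ} {c v : ℕ → ℤ} {a b : ℤ}

theorem start (h : 1 ≤ c y' → a = 1) (h' : ¬ 1 ≤ c y' → a = 0) :
    CellOK V opt sh vl base c v 0 y' a (v y') where
  skip hc := by rw [h hc]; simp
  take o' ho' := by omega
  back ha := by
    by_cases hc : 1 ≤ c y'
    · exact .inl ⟨h hc, hc, rfl⟩
    · rw [h' hc] at ha; omega

theorem mono {o₂ : ℕ} (h : CellOK V opt sh vl base c v o y' a b) (ho : o ≤ o₂)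
    (ht : ∀ o', o ≤ o' → o' < o₂ → ∀ w g y, y < V → opt (base + o') = some (w, g) →
      vl y' = vl y + sh (base + o') → 1 ≤ c y → 1 ≤ a ∧ v y + g ≤ b) :
    CellOK V opt sh vl base c v o₂ y' a b where
  skip := h.skip
  take o' ho' := by
    by_cases h' : o' < o
    · exact h.take o' h'
    · exact ht o' (by omega) ho'
  back ha := (h.back ha).imp_right fun ⟨o', h1, h2⟩ => ⟨o', by omega, h2⟩

theorem set (h : CellOK V opt sh vl base c v o y' a b) {w y : ℕ} {g : ℤ}
    (inj : ∀ y < V, ∀ y' < V, vl y = vl y' → y = y')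
    (ho : opt (base + o) = some (w, g)) (hy : y < V) (hs : vl y' = vl y + sh (base + o))
    (hc : 1 ≤ c y) (hb : 1 ≤ a → b ≤ v y + g) :
    CellOK V opt sh vl base c v (o + 1) y' ((base + o : ℕ) + 2) (v y + g) where
  skip hc' := by
    obtain ⟨h1, h2⟩ := h.skip hc'
    exact ⟨by omega, h2.trans (hb h1)⟩
  take o' ho' w' g' y₂ hy₂ h1 h2 h3 := by
    refine ⟨by omega, ?_⟩
    rcases Nat.lt_succ_iff_lt_or_eq.mp ho' with h4 | rfl
    · obtain ⟨h5, h6⟩ := h.take o' h4 w' g' y₂ hy₂ h1 h2 h3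
      exact h6.trans (hb h5)
    · rw [ho] at h1
      obtain ⟨rfl, rfl⟩ := Prod.mk.inj (Option.some.inj h1)
      have : y₂ = y := inj _ hy₂ _ hy (by omega)
      rw [this]
  back _ := .inr ⟨o, by omega, rfl, w, g, ho, y, hy, hs, hc, rfl⟩

theorem congr {c₂ v₂ : ℕ → ℤ} (h : CellOK V opt sh vl base c v o y' a b) (hy' : y' < V)
    (hc : ∀ y < V, c₂ y = c y ∧ v₂ y = v y) : CellOK V opt sh vl base c₂ v₂ o y' a b where
  skip := by rw [(hc y' hy').1, (hc y' hy').2]; exact h.skip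
  take o' ho' w g y hy := by rw [(hc y hy).1, (hc y hy).2]; exact h.take o' ho' w g y hy
  back ha := by
    rw [(hc y' hy').1, (hc y' hy').2]
    refine (h.back ha).imp_right ?_
    rintro ⟨o', ho', ha', w, g, hw, y, hy, hr⟩
    exact ⟨o', ho', ha', w, g, hw, y, hy, by rwa [(hc y hy).1, (hc y hy).2]⟩

end CellOK

/-- The table of a group knapsack with `S` stages. The cells of row `σ` start at `σ * V`. -/
structure KTable (V O S : ℕ) (opt : ℕ → Option (ℕ × ℤ)) (sh vl : ℕ → ℤ) (ch vt : ℤ → ℤ) :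
    Prop where
  start : ∀ y < V, (1 ≤ ch y ↔ vl y = 0) ∧ (vl y = 0 → vt y = 0)
  step : ∀ σ < S, ∀ y < V, CellOK V opt sh vl (σ * O) (fun y => ch ((σ * V + y : ℕ)))
    (fun y => vt ((σ * V + y : ℕ))) O y (ch (((σ + 1) * V + y : ℕ))) (vt (((σ + 1) * V + y : ℕ)))

theorem KTable.complete {ch vt : ℤ → ℤ} (h : KTable V O S opt sh vl ch vt)
    (hv : ∀ z, valid z → ∃ y < V, vl y = z) (h0 : valid 0)
    {σ : ℕ} {z g : ℤ} {cs : List (ℕ × ℕ)} (hσ : σ ≤ S) (hp : KPath valid O opt sh σ z g cs) :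
    ∃ y < V, vl y = z ∧ 1 ≤ ch (σ * V + y : ℕ) ∧ g ≤ vt (σ * V + y : ℕ) := by
  induction hp with
  | nil =>
    obtain ⟨y, hy, hy'⟩ := hv 0 h0
    have := h.start y hy
    exact ⟨y, hy, hy', by simpa using this.1.mpr hy', by simpa using (this.2 hy').ge⟩
  | skip _ ih =>
    obtain ⟨y, hy, h1, h2, h3⟩ := ih (by omega)
    obtain ⟨h4, h5⟩ := (h.step _ (by omega) y hy).skip h2
    exact ⟨y, hy, h1, h4, h3.trans h5⟩
  | @take σ o w z g g' cs _ ho hw hz ih =>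
    obtain ⟨y, hy, h1, h2, h3⟩ := ih (by omega)
    obtain ⟨y', hy', h1'⟩ := hv _ hz
    obtain ⟨h4, h5⟩ := (h.step _ (by omega) y' hy').take o ho w g' y hy hw (by rw [h1', h1]) h2
    exact ⟨y', hy', h1', h4, by omega⟩

/-- The arrays `f` and `g` hold the list of states and its inverse. -/
structure StatesAt (V : ℕ) (vl : ℕ → ℤ) (f g : ℤ → ℤ) : Prop where
  vl_eq : ∀ y < V, f y = vl y
  vf_eq : ∀ y < V, g (vl y) = y + 1
  vf_pos : ∀ z, 1 ≤ g z → ∃ y < V, g z = y + 1 ∧ vl y = z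

theorem StatesAt.inj {f g : ℤ → ℤ} (h : StatesAt V vl f g) :
    ∀ y < V, ∀ y' < V, vl y = vl y' → y = y' := by
  intro y hy y' hy' he
  have h1 := h.vf_eq y hy
  have h2 := h.vf_eq y' hy'
  rw [he, h2] at h1
  omega

/-- The options of a knapsack with `S` stages are stored in the arrays. -/
def OptsAt (N : ℕ) (opt : ℕ → Option (ℕ × ℤ)) (sh : ℕ → ℤ) (μ : RamMemory) : Prop :=
  ∀ c < N, CellIs (μ xOw) (μ xOg) c (opt c) ∧ μ xOs c = sh c

/-- Lets the option `xIx` reach the cell `xY`. -/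
def setCellP : RamProg :=
  .store xCh (rg xDst + rg xY) (rg xIx + .lit 2) ;; .store xVt (rg xDst + rg xY) (rg xNv)

/-- Tries whether the option `xIx` improves the cell `xY`. -/
def relaxP : RamProg :=
  setR xU (.load xVf (.load xVl (rg xY) - .load xOs (rg xIx))) ;;
  .ite (.lit 1) (rg xU)
    (setR xCx (rg xSrc + rg xU - .lit 1) ;;
    .ite (.lit 1) (.load xCh (rg xCx))
      (setR xNv (.load xVt (rg xCx) + .load xOg (rg xIx)) ;;
      .ite (.lit 1) (.load xCh (rg xDst + rg xY))
        (.ite (rg xNv) (.load xVt (rg xDst + rg xY)) .skip setCellP) setCellP) .skip) .skip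

theorem relaxP_run {μ : RamMemory} {base o y' w : ℕ} {src dst g : ℤ}
    (hst : StatesAt V vl (μ xVl) (μ xVf)) (hy' : y' < V) (hsrc : μ xSrc 0 = src)
    (hdst : μ xDst 0 = dst) (hY : μ xY 0 = y') (hIx : μ xIx 0 = (base + o : ℕ))
    (ho : opt (base + o) = some (w, g)) (hg : μ xOg (base + o : ℕ) = g)
    (hs : μ xOs (base + o : ℕ) = sh (base + o)) {c v : ℕ → ℤ}
    (hc : ∀ y < V, μ xCh (src + y) = c y) (hv : ∀ y < V, μ xVt (src + y) = v y)
    (h : CellOK V opt sh vl base c v o y' (μ xCh (dst + y')) (μ xVt (dst + y'))) :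
    CellOK V opt sh vl base c v (o + 1) y' (relaxP.run μ xCh (dst + y'))
      (relaxP.run μ xVt (dst + y')) ∧ ∀ z, z ≠ dst + y' →
        relaxP.run μ xCh z = μ xCh z ∧ relaxP.run μ xVt z = μ xVt z := by
  have same : (∀ w' g' y, y < V → opt (base + o) = some (w', g') →
      vl y' = vl y + sh (base + o) → 1 ≤ c y →
        1 ≤ μ xCh (dst + y') ∧ v y + g' ≤ μ xVt (dst + y')) →
      CellOK V opt sh vl base c v (o + 1) y' (μ xCh (dst + y')) (μ xVt (dst + y')) :=
    fun h' => h.mono (by omega) fun o' h1 h2 => by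
      obtain rfl : o' = o := by omega
      exact h'
  have hvl := hst.vl_eq y' hy'
  push_cast at hIx hg hs
  by_cases hu : 1 ≤ μ xVf (vl y' - sh (base + o))
  swap
  · have e : ∀ a, a ≠ xU → ∀ z, relaxP.run μ a z = μ a z := by
      intro a ha z
      simp [relaxP, run_skip, run_store, run_seq,
        run_ite, hY, hvl, hIx, hs, hu, ha]
    rw [e _ (by decide), e _ (by decide)]
    refine ⟨same fun w' g' y hy _ hyy _ => absurd ?_ hu,
        fun z _ => ⟨e _ (by decide) z, e _ (by decide) z⟩⟩
    rw [show vl y' - sh (base + o) = vl y by omega, hst.vf_eq y hy]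
    omega
  obtain ⟨y, hy, hy1, hy2⟩ := hst.vf_pos _ hu
  have hyy : vl y' = vl y + sh (base + o) := by omega
  have uniq : ∀ y₂, y₂ < V → vl y' = vl y₂ + sh (base + o) → y₂ = y := fun y₂ h1 h2 =>
    hst.inj _ h1 _ hy (by omega)
  have ecx : src + (y + 1 : ℤ) - 1 = src + y := by ring
  by_cases hcy : 1 ≤ c y
  swap
  · have e : ∀ a, a ≠ xU → a ≠ xCx → ∀ z, relaxP.run μ a z = μ a z := by
      intro a ha ha' z
      simp [relaxP, run_skip, run_store, run_seq,
        run_ite, hY, hvl, hIx, hs, hy1, ha, ha', hsrc, ecx, hc y hy, hcy]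
    rw [e _ (by decide) (by decide), e _ (by decide) (by decide)]
    refine ⟨same fun w' g' y₂ h1 _ h2 h3 => absurd ?_ hcy,
        fun z _ => ⟨e _ (by decide) (by decide) z, e _ (by decide) (by decide) z⟩⟩
    rwa [← uniq y₂ h1 h2]
  have same' : 1 ≤ μ xCh (dst + y') → v y + g ≤ μ xVt (dst + y') →
      CellOK V opt sh vl base c v (o + 1) y' (μ xCh (dst + y')) (μ xVt (dst + y')) := by
    refine fun h1 h2 => same fun w' g' y₂ h3 h4 h5 _ => ⟨h1, ?_⟩
    rw [ho] at h4
    obtain ⟨rfl, rfl⟩ := Prod.mk.inj (Option.some.inj h4)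
    rwa [uniq y₂ h3 h5]
  by_cases hk : 1 ≤ μ xCh (dst + y') ∧ v y + g ≤ μ xVt (dst + y')
  · have e : ∀ a, a ≠ xU → a ≠ xCx → a ≠ xNv → ∀ z, relaxP.run μ a z = μ a z := by
      intro a ha ha' ha'' z
      simp [relaxP, run_skip, run_store, run_seq,
        run_ite, hY, hvl, hIx, hs, hy1, ha, ha', ha'', hsrc, ecx, hc y hy, hcy,
        hdst, hk.1, hk.2, hv y hy, hg]
    rw [e _ (by decide) (by decide) (by decide), e _ (by decide) (by decide) (by decide)]
    exact ⟨same' hk.1 hk.2, fun z _ => ⟨e _ (by decide) (by decide) (by decide) z,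
      e _ (by decide) (by decide) (by decide) z⟩⟩
  · have e : (∀ z, relaxP.run μ xCh z =
        Function.update (μ xCh) (dst + y') ((base + o : ℕ) + 2) z) ∧
        ∀ z, relaxP.run μ xVt z = Function.update (μ xVt) (dst + y') (v y + g) z := by
      by_cases h1 : 1 ≤ μ xCh (dst + y')
      · have h2 : ¬ v y + g ≤ μ xVt (dst + y') := fun h' => hk ⟨h1, h'⟩
        simp [relaxP, setCellP, run_store, run_seq,
        run_ite, hY, hvl, hIx, hs, hy1, hsrc, ecx, hc y hy, hcy,
          hdst, h1, h2, hv y hy, hg]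
      · simp [relaxP, setCellP, run_store, run_seq,
        run_ite, hY, hvl, hIx, hs, hy1, hsrc, ecx, hc y hy, hcy,
          hdst, h1, hv y hy, hg]
    rw [e.1, e.2]
    refine ⟨?_, fun z hz => by rw [e.1, e.2]; simp [hz]⟩
    rw [Function.update_self, Function.update_self]
    refine h.set hst.inj ho hy hyy hcy fun h1 => ?_
    by_contra h2
    exact hk ⟨h1, by omega⟩

/-- The input of the knapsack program. -/
structure KnapIn (V O S : ℕ) (opt : ℕ → Option (ℕ × ℤ)) (sh vl : ℕ → ℤ) (μ : RamMemory) :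
    Prop where
  V_eq : μ xV 0 = V
  O_eq : μ xO 0 = O
  S_eq : μ xS 0 = S
  states : StatesAt V vl (μ xVl) (μ xVf)
  opts : OptsAt (S * O) opt sh μ

theorem KnapIn.congr {μ μ' : RamMemory} (h : KnapIn V O S opt sh vl μ)
    (h' : ∀ a ∈ [xV, xO, xS, xVl, xVf, xOw, xOg, xOs], μ' a = μ a) :
    KnapIn V O S opt sh vl μ' where
  V_eq := by rw [h' _ (by decide), h.V_eq]
  O_eq := by rw [h' _ (by decide), h.O_eq]
  S_eq := by rw [h' _ (by decide), h.S_eq]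
  states := by rw [h' _ (by decide), h' _ (by decide)]; exact h.states
  opts := by
    have := h.opts
    unfold OptsAt at *
    rwa [h' _ (by decide), h' _ (by decide), h' _ (by decide)]

/-- The memories agree on the table outside of the cells from `ad` to `ad + len - 1`. -/
def SameTable (μ μ' : RamMemory) (ad len : ℤ) : Prop :=
  ∀ z, ¬ (ad ≤ z ∧ z < ad + len) → μ' xCh z = μ xCh z ∧ μ' xVt z = μ xVt z

/-- Copies the row before, with the marker `1`. -/
def copyRowP : RamProg :=
  forP xY (rg xV)
    (.store xVt (rg xDst + rg xY) (.load xVt (rg xSrc + rg xY)) ;;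
    .ite (.lit 1) (.load xCh (rg xSrc + rg xY)) (.store xCh (rg xDst + rg xY) (.lit 1))
      (.store xCh (rg xDst + rg xY) (.lit 0)))

/-- Computes a row of the table of a knapsack. -/
def stageP : RamProg :=
  copyRowP ;;
  forP xOl (rg xO)
    (.ite (.lit 1) (.load xOw (rg xIx)) (forP xY (rg xV) relaxP) .skip ;;
    setR xIx (rg xIx + .lit 1))

/-- Computes the table of a knapsack. -/
def knapP : RamProg :=
  forP xY (rg xV) (.store xCh (rg xY) (.lit 0)) ;;
  (setR xU (.load xVf (.lit 0) - .lit 1) ;; .store xCh (rg xU) (.lit 1) ;;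
    .store xVt (rg xU) (.lit 0) ;; setR xSrc (.lit 0) ;; setR xDst (rg xV) ;;
    setR xIx (.lit 0)) ;;
  forP xSl (rg xS) (stageP ;; (setR xSrc (rg xDst) ;; setR xDst (rg xDst + rg xV)))

variable {Q : ℕ} [hQ : Fact (1024 ≤ Q)] {μ : RamMemory}

theorem copyRowP_runs {src dst : ℤ} (hV : V ≤ Q) (h : μ xV 0 = V) (hsrc : μ xSrc 0 = src)
    (hdst : μ xDst 0 = dst) (hsd : src + V ≤ dst) (base : ℕ) :
    Runs copyRowP μ (Q ^ 3) fun μ' =>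
      (∀ y < V, CellOK V opt sh vl base (fun y => μ xCh (src + y)) (fun y => μ xVt (src + y)) 0 y
        (μ' xCh (dst + y)) (μ' xVt (dst + y))) ∧ SameTable μ μ' dst V := by
  unfold copyRowP
  refine (Runs.forQ (N := V) (e := 1) 1 (fun j μ' => (∀ y < j,
      (1 ≤ μ xCh (src + y) → μ' xCh (dst + y) = 1) ∧
      (¬ 1 ≤ μ xCh (src + y) → μ' xCh (dst + y) = 0) ∧ μ' xVt (dst + y) = μ xVt (src + y)) ∧
      SameTable μ μ' dst V) (by simpa using hV) ?_ ?_ ?_ ?_).post ?_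
  · intro μ' h'
    rw [eval, eval, h'.eq _, h]
  · intro j μ' v h'
    simpa [SameTable] using h'
  · exact ⟨by simp, fun z _ => ⟨rfl, rfl⟩⟩
  · rintro j hj μ' hf hj' ⟨h1, h2⟩
    have k1 : μ' xSrc 0 = src := by rw [hf.eq _, hsrc]
    have k2 : μ' xDst 0 = dst := by rw [hf.eq _, hdst]
    obtain ⟨s1, s2⟩ := h2 (src + j) (by omega)
    refine .block ?_
    generalize hp : run _ μ' = μ''
    have r1 : ∀ z, μ'' xCh z = Function.update (μ' xCh) (dst + j)
        (if 1 ≤ μ xCh (src + j) then 1 else 0) z := by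
      intro z
      rw [← hp]
      by_cases hc : 1 ≤ μ xCh (src + j) <;>
        simp [run_seq, run_store, run_ite, hj', k1, k2, s1, hc]
    have r2 : ∀ z, μ'' xVt z = Function.update (μ' xVt) (dst + j) (μ xVt (src + j)) z := by
      intro z
      rw [← hp]
      simp [run_seq, run_store, run_ite, hj', k1, k2, s2]
    constructor
    · intro y hy
      rcases Nat.lt_succ_iff_lt_or_eq.mp hy with h3 | rfl
      · have : dst + (y : ℤ) ≠ dst + j := by omega
        rw [r1, r2, Function.update_of_ne this, Function.update_of_ne this]
        exact h1 y h3
      · rw [r1, r2, Function.update_self, Function.update_self]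
        exact ⟨fun h => if_pos h, fun h => if_neg h, rfl⟩
    · intro z hz
      have : z ≠ dst + j := by omega
      rw [r1, r2, Function.update_of_ne this, Function.update_of_ne this]
      exact h2 z hz
  · rintro μ' - ⟨h1, h2⟩
    refine ⟨fun y hy => ?_, h2⟩
    obtain ⟨h3, h4, h5⟩ := h1 y hy
    rw [h5]
    exact .start h3 h4

theorem stageP_runs {σ : ℕ} {src dst : ℤ} (hV : V ≤ Q) (hO : O ≤ Q) (hσ : σ < S)
    (hin : KnapIn V O S opt sh vl μ) (hsrc : μ xSrc 0 = src) (hdst : μ xDst 0 = dst)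
    (hix : μ xIx 0 = (σ * O : ℕ)) (hsd : src + V ≤ dst) :
    Runs stageP μ (Q ^ 10) fun μ' =>
      (∀ y < V, CellOK V opt sh vl (σ * O) (fun y => μ xCh (src + y)) (fun y => μ xVt (src + y))
        O y (μ' xCh (dst + y)) (μ' xVt (dst + y))) ∧ SameTable μ μ' dst V ∧
        μ' xIx 0 = ((σ + 1) * O : ℕ) := by
  unfold stageP
  refine Runs.seqQ ((copyRowP_runs (opt := opt) (sh := sh) (vl := vl)
    hV hin.V_eq hsrc hdst hsd (σ * O)).up) ?_
  rintro μ₁ hf₁ ⟨hc₁, hs₁⟩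
  refine ((Runs.forQ (N := O) (e := 6) 1 (fun j μ' =>
      (∀ y < V, CellOK V opt sh vl (σ * O) (fun y => μ xCh (src + y)) (fun y => μ xVt (src + y))
        j y (μ' xCh (dst + y)) (μ' xVt (dst + y))) ∧ SameTable μ μ' dst V ∧
        μ' xIx 0 = (σ * O + j : ℕ)) (by simpa using hO)
        ?_ ?_ ?_ ?_).up).post ?_
  · intro μ' h'
    rw [eval, eval, h'.eq _, hf₁.eq _, hin.O_eq]
  · intro j μ' v h'
    simpa [SameTable] using h'
  · refine ⟨hc₁, hs₁, ?_⟩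
    rw [hf₁.eq _]; simpa using hix
  · rintro j hj μ' hf - ⟨h1, h2, h3⟩
    have hin' : KnapIn V O S opt sh vl μ' := hin.congr fun a ha => by
      have h4 : ∀ a ∈ [xV, xO, xS, xVl, xVf, xOw, xOg, xOs], a ≠ xOl ∧
        a ∉ (RamProg.ite (.lit 1) (.load xOw (rg xIx)) (forP xY (rg xV) relaxP) .skip ;;
          setR xIx (rg xIx + .lit 1)).mods ∧ a ∉ copyRowP.mods := by decide
      rw [hf a (h4 a ha).1 (h4 a ha).2.1, hf₁ a (h4 a ha).2.2]
    have hlt : σ * O + j < S * O := by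
      calc σ * O + j < (σ + 1) * O := by rw [Nat.succ_mul]; omega
        _ ≤ S * O := Nat.mul_le_mul_right _ hσ
    obtain ⟨o1, o2⟩ := hin'.opts _ hlt
    have k1 : μ' xSrc 0 = src := by
      rw [hf.eq _, hf₁.eq _, hsrc]
    have k2 : μ' xDst 0 = dst := by
      rw [hf.eq _, hf₁.eq _, hdst]
    refine Runs.seqQ (R' := fun μ'' =>
      (∀ y < V, CellOK V opt sh vl (σ * O) (fun y => μ xCh (src + y)) (fun y => μ xVt (src + y))
        (j + 1) y (μ'' xCh (dst + y)) (μ'' xVt (dst + y))) ∧ SameTable μ μ'' dst V)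
      (Runs.iteQ (e := 4) (by decide) (fun hw => ?_) fun hw => ?_) ?_
    · -- the option exists
      simp only [eval, h3] at hw
      obtain ⟨⟨w, g⟩, ho⟩ := Option.ne_none_iff_exists'.mp fun h => by
        have := o1.pos_iff.mpr h
        omega
      rw [ho] at o1
      refine ((Runs.forQ (N := V) (e := 1) 1 (fun i μ'' =>
        (∀ y < V, CellOK V opt sh vl (σ * O) (fun y => μ xCh (src + y)) (fun y => μ xVt (src + y))
          (if y < i then j + 1 else j) y (μ'' xCh (dst + y)) (μ'' xVt (dst + y))) ∧
          SameTable μ μ'' dst V) (by simpa using hV) ?_ ?_ ?_ ?_).up).post ?_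
      · intro μ'' h''
        rw [eval, eval, h'' _ (by decide) (by decide), hin'.V_eq]
      · intro i μ'' v h''
        simpa [SameTable] using h''
      · exact ⟨by simpa using h1, h2⟩
      · rintro i hi μ'' hf'' hi'' ⟨h5, h6⟩
        have fr : ∀ a, a ∉ [xY, xU, xCx, xNv, xCh, xVt] → μ'' a = μ' a := fun a ha => by
          simp only [List.mem_cons, not_or] at ha
          exact hf'' a ha.1 (by simp [relaxP, setCellP, mods, ha])
        have h7 := h5 i hi
        rw [if_neg (lt_irrefl i)] at h7
        obtain ⟨r1, r2⟩ := relaxP_run (μ := μ'')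
          (by rw [fr _ (by decide), fr _ (by decide)]; exact hin'.states)
          hi (by rw [fr _ (by decide), k1]) (by rw [fr _ (by decide), k2]) hi''
          (by rw [fr _ (by decide), h3]) ho (by rw [fr _ (by decide)]; exact o1.2)
          (by rw [fr _ (by decide)]; exact o2) (fun y hy => (h6 _ (by omega)).1)
          (fun y hy => (h6 _ (by omega)).2) h7
        refine .block ⟨fun y hy => ?_, fun z hz => ?_⟩
        · rcases lt_trichotomy y i with h8 | rfl | h8
          · have := r2 (dst + y) (by omega)
            rw [this.1, this.2, if_pos (by omega)]
            simpa [h8] using h5 y hy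
          · rw [if_pos (by omega)]; exact r1
          · have := r2 (dst + y) (by omega)
            rw [this.1, this.2, if_neg (by omega)]
            simpa [h8.not_gt] using h5 y hy
        · have := r2 z (by omega)
          rw [this.1, this.2]
          exact h6 z hz
      · rintro μ'' - ⟨h5, h6⟩
        refine ⟨fun y hy => ?_, h6⟩
        have := h5 y hy
        rwa [if_pos hy] at this
    · -- the option does not exist
      simp only [eval, h3] at hw
      have ho := o1.pos_iff.mp (by omega)
      refine .block ⟨fun y hy => (h1 y hy).mono (by omega) ?_, h2⟩
      intro o' h4 h5 w g y' _ h6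
      obtain rfl : o' = j := by omega
      rw [ho] at h6
      cases h6
    · rintro μ'' hf'' ⟨h4, h5⟩
      refine .block ?_
      have : μ'' xIx 0 = (σ * O + j : ℕ) := by rw [hf''.eq _, h3]
      refine ⟨?_, ?_, ?_⟩
      · simpa [run_store] using h4
      · simpa [run_store, SameTable] using h5
      · simp [run_store, this]; ring
  · rintro μ' - ⟨h1, h2, h3⟩
    exact ⟨h1, h2, by rw [h3, Nat.succ_mul]⟩

theorem knapP_runs (hV : V ≤ Q) (hO : O ≤ Q) (hS : S ≤ Q ^ 2) (hz : ∃ y < V, vl y = 0)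
    (hin : KnapIn V O S opt sh vl μ) :
    Runs knapP μ (Q ^ 16) fun μ' => KTable V O S opt sh vl (μ' xCh) (μ' xVt) ∧
      μ' xSrc 0 = (S * V : ℕ) := by
  unfold knapP
  refine Runs.seqQ (R' := fun μ' => ∀ y < V, μ' xCh (y : ℤ) = 0) (.up (.forQ (e := 1) 1
    (N := V) (fun j μ' => ∀ y < j, μ' xCh (y : ℤ) = 0) (by simpa using hV)
    ?_ ?_ ?_ ?_)) ?_
  · intro μ' h'
    rw [eval, eval, h'.eq _, hin.V_eq]
  · intro j μ' v h'
    simpa using h'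
  · simp
  · intro j hj μ' hf hj' h
    refine .block ?_
    intro y hy
    rcases Nat.lt_succ_iff_lt_or_eq.mp hy with h3 | rfl
    · simp [run_store, hj', h3.ne, h y h3]
    · simp [run_store, hj']
  intro μ₁ hf₁ h₁
  have hin₁ : KnapIn V O S opt sh vl μ₁ := hin.congr fun a ha => by
    revert a; intro a ha; refine hf₁ a ?_; revert a; decide
  obtain ⟨y₀, hy₀, hy₀'⟩ := hz
  have hvf := hin₁.states.vf_eq y₀ hy₀
  rw [hy₀'] at hvf
  refine Runs.seqQ (R' := fun μ' => (∀ y < V, (1 ≤ μ' xCh (y : ℤ) ↔ vl y = 0) ∧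
      (vl y = 0 → μ' xVt y = 0)) ∧ μ' xSrc 0 = 0 ∧ μ' xDst 0 = V ∧ μ' xIx 0 = 0)
    (.block ?_) ?_
  · refine ⟨fun y hy => ?_, ?_⟩
    · by_cases h : y = y₀
      · subst h
        simp [run_store, run_seq, hvf, hy₀']
      · have : vl y ≠ 0 := fun h' => h (hin₁.states.inj _ hy _ hy₀ (h'.trans hy₀'.symm))
        simp [run_store, run_seq, hvf, this, h, h₁ y hy]
    · simp [run_store, run_seq, hin₁.V_eq]
  rintro μ₂ hf₂ ⟨h2, h3, h4, h5⟩
  have hin₂ : KnapIn V O S opt sh vl μ₂ := hin₁.congr fun a ha => by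
    revert a; intro a ha; refine hf₂ a ?_; revert a; decide
  refine ((Runs.forQ (N := S) (e := 11) 2 (fun j μ' => KTable V O j opt sh vl (μ' xCh) (μ' xVt) ∧
      μ' xSrc 0 = (j * V : ℕ) ∧ μ' xDst 0 = ((j + 1) * V : ℕ) ∧ μ' xIx 0 = (j * O : ℕ))
          (by simpa using hS) ?_ ?_ ?_ ?_).up).post ?_
  · intro μ' h'
    rw [eval, eval, h'.eq _, hin₂.S_eq]
  · intro j μ' v h'
    simpa using h'
  · refine ⟨⟨h2, fun σ hσ => by omega⟩, ?_, ?_, ?_⟩ <;> simp [h3, h4, h5]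
  · rintro j hj μ' hf - ⟨k1, k2, k3, k4⟩
    have hin' : KnapIn V O S opt sh vl μ' := hin₂.congr fun a ha => by
      have h4 : ∀ a ∈ [xV, xO, xS, xVl, xVf, xOw, xOg, xOs], a ≠ xSl ∧
        a ∉ (stageP ;; (setR xSrc (rg xDst) ;; setR xDst (rg xDst + rg xV))).mods := by decide
      exact hf a (h4 a ha).1 (h4 a ha).2
    refine Runs.seqQ (stageP_runs hV hO hj hin' k2 k3 k4
      (by push_cast; linarith)) ?_
    rintro μ'' hf'' ⟨m1, m2, m3⟩
    refine .block ?_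
    have e1 : μ'' xDst 0 = ((j + 1) * V : ℕ) := by rw [hf''.eq _, k3]
    have e2 : μ'' xV 0 = V := by rw [hf''.eq _, hin'.V_eq]
    have fr : ∀ z : ℕ, z < (j + 1) * V → μ'' xCh z = μ' xCh z ∧ μ'' xVt z = μ' xVt z := by
      intro z hz
      exact m2 z (by push_cast at *; rintro ⟨h, -⟩; norm_cast at h; omega)
    refine ⟨?_, ?_, ?_, ?_⟩
    · simp only [run_seq, run_store, RamMemory.write_apply]
      norm_num
      constructor
      · intro y hy
        have := fr y (by nlinarith)
        rw [this.1, this.2]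
        exact k1.start y hy
      · intro σ hσ y hy
        have le : ∀ y < V, σ * V + y < (j + 1) * V := fun y hy => by
          have : (σ + 1) * V ≤ (j + 1) * V := Nat.mul_le_mul_right _ (by omega)
          rw [Nat.succ_mul] at this
          omega
        rcases Nat.lt_succ_iff_lt_or_eq.mp hσ with h6 | rfl
        · have := k1.step σ h6 y hy
          have e3 := fr ((σ + 1) * V + y) (by
            have : (σ + 2) * V ≤ (j + 1) * V := Nat.mul_le_mul_right _ (by omega)
            nlinarith)
          rw [e3.1, e3.2]
          exact this.congr hy fun y hy => fr _ (le y hy)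
        · have := m1 y hy
          push_cast at this ⊢
          refine this.congr hy fun y hy => ?_
          have := fr _ (le y hy)
          push_cast at this
          exact this
    · simp [run_store, run_seq, e1]
    · simp [run_store, run_seq, e1, e2]; ring
    · simpa [run_store, run_seq] using m3
  · rintro μ' - ⟨k1, k2, -, -⟩
    exact ⟨k1, k2⟩

/-- Traces a path that ends in the state `xU`, and lists its chosen options. -/
def traceP : RamProg :=
  (setR xCc (.lit 0) ;; setR xRr (rg xSrc)) ;;
  forP xSl (rg xS)
    (.ite (.load xCh (rg xRr + rg xU)) (.lit 1) (setR xRr (rg xRr - rg xV))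
      (setR xCx (.load xCh (rg xRr + rg xU) - .lit 2) ;; .store xCl (rg xCc) (rg xCx) ;;
        setR xCc (rg xCc + .lit 1) ;; setR xRr (rg xRr - rg xV) ;;
        setR xU (.load xVf (.load xVl (rg xU) - .load xOs (rg xCx)) - .lit 1)))

/-- The list of options in the memory. -/
def ChosenAt (cs : List (ℕ × ℕ)) (μ : RamMemory) : Prop :=
  μ xCc 0 = cs.length ∧ ∀ (i : ℕ) (c : ℕ × ℕ), cs[i]? = some c → μ xCl (i : ℤ) = c.1

theorem traceP_runs {y : ℕ} (hS : S ≤ Q ^ 2) (hin : KnapIn V O S opt sh vl μ)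
    (hT : KTable V O S opt sh vl (μ xCh) (μ xVt)) (hsrc : μ xSrc 0 = (S * V : ℕ))
    (hU : μ xU 0 = y) (hy : y < V) (hch : 1 ≤ μ xCh (S * V + y : ℕ))
    (hvalid : ∀ y < V, valid (vl y)) :
    Runs traceP μ (Q ^ 6) fun μ' => ∃ cs,
      KPath valid O opt sh S (vl y) (μ xVt (S * V + y : ℕ)) cs ∧ ChosenAt cs μ' := by
  unfold traceP
  refine Runs.seqQ (R' := fun μ' => μ' xCc 0 = 0 ∧ μ' xRr 0 = (S * V : ℕ))
    (.block (by simp [run, hsrc])) ?_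
  rintro μ₁ hf₁ ⟨h1, h2⟩
  refine (Runs.forQ (N := S) (e := 2) 2 (fun j μ' => ∃ y' < V, ∃ tk : List (ℕ × ℕ),
      μ' xU 0 = y' ∧ μ' xRr 0 = ((S - j) * V : ℕ) ∧ 1 ≤ μ xCh ((S - j) * V + y' : ℕ) ∧
      ChosenAt tk μ' ∧
      ∀ cs, KPath valid O opt sh (S - j) (vl y') (μ xVt ((S - j) * V + y' : ℕ)) cs →
        KPath valid O opt sh S (vl y) (μ xVt (S * V + y : ℕ)) (tk ++ cs)) (by simpa using hS) ?_ ?_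
            ?_ ?_).post ?_
  · intro μ' h'
    rw [eval, eval, h'.eq _, hf₁.eq _, hin.S_eq]
  · intro j μ' v h'
    simpa [ChosenAt] using h'
  · exact ⟨y, hy, [], by rw [hf₁.eq _, hU], h2, hch, by simpa [ChosenAt] using h1,
      fun cs h => h⟩
  · rintro j hj μ' hf - ⟨y', hy', tk, k1, k2, k3, ⟨k4, k5⟩, k6⟩
    obtain ⟨σ, hσ⟩ : ∃ σ, S - j = σ + 1 := ⟨S - j - 1, by omega⟩
    have hσ' : S - (j + 1) = σ := by omega
    rw [hσ] at k2 k3 k6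
    rw [hσ']
    have fr : ∀ a, a ∉ [xCc, xRr, xSl, xCx, xCl, xU] → μ' a = μ a := fun a ha => by
      simp only [List.mem_cons, not_or] at ha
      rw [hf a ha.2.2.1 (by simp [mods, ha]), hf₁ a (by simp [mods, ha])]
    have v1 : μ' xV 0 = V := by rw [fr _ (by decide), hin.V_eq]
    have ch : μ' xCh (((σ + 1) * V : ℕ) + (y' : ℤ)) = μ xCh ((σ + 1) * V + y' : ℕ) := by
      rw [fr _ (by decide)]; push_cast; rfl
    have cell := hT.step σ (by omega) y' hy'
    have rr : (((σ + 1) * V : ℕ) : ℤ) - V = (σ * V : ℕ) := by push_cast; ring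
    rcases cell.back k3 with ⟨b1, b2, b3⟩ | ⟨o, ho, b1, w, g, b2, y'', hy'', b3, b4, b5⟩
    · refine .iteQ (e := 1) (by decide) (fun _ => .block ?_) fun hc => ?_
      · refine ⟨y', hy', tk, ?_, ?_, b2, ⟨?_, ?_⟩, fun cs hcs => k6 cs ?_⟩
        · simpa [run_store] using k1
        · rw [← rr, ← k2, ← v1]; simp [run_store]
        · simpa [run_store] using k4
        · simpa [run_store] using k5
        · rw [b3]; exact hcs.skip
      · exfalso; apply hc
        simp only [eval]
        rw [k1, k2, ch, b1]
    · refine .iteQ (e := 1) (by decide) (fun hc => ?_) fun _ => .block ?_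
      · exfalso
        simp only [eval] at hc
        rw [k1, k2, ch, b1] at hc
        omega
      · have hlt : σ * O + o < S * O := by
          calc σ * O + o < (σ + 1) * O := by rw [Nat.succ_mul]; omega
            _ ≤ S * O := Nat.mul_le_mul_right _ (by omega)
        have os := (hin.opts _ hlt).2
        rw [← fr xOs (by decide)] at os
        have vl' : μ' xVl y' = vl y' := by rw [fr _ (by decide), hin.states.vl_eq y' hy']
        have vf' : μ' xVf (vl y' - sh (σ * O + o)) = y'' + 1 := by
          rw [fr _ (by decide), b3, add_sub_cancel_right, hin.states.vf_eq y'' hy'']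
        have ch' : μ' xCh (((σ + 1) * V : ℕ) + (y' : ℤ)) - 2 = (σ * O + o : ℕ) := by
          rw [ch, b1]; ring
        refine ⟨y'', hy'', tk ++ [(σ * O + o, w)], ?_, ?_, b4, ⟨?_, ?_⟩, fun cs hcs => ?_⟩
        · simp only [run_store, run_seq, eval, RamExpr.eval_sub,
            RamMemory.write_apply, k1, k2, ch']
          push_cast at os
          simp [k1, os, vl', vf']
        · rw [← rr, ← k2, ← v1]; simp [run_store, run_seq]
        · simp [run_store, run_seq, k4]
        · intro i c hi
          simp only [run_store, run_seq, eval, RamExpr.eval_sub,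
            RamMemory.write_apply, k1, k2, ch']
          rcases lt_or_ge i tk.length with h | h
          · rw [List.getElem?_append_left h] at hi
            have := k5 i c hi
            simp [k4, h.ne, this]
          · rw [List.getElem?_append_right h] at hi
            obtain ⟨rfl⟩ : i = tk.length := by
              by_contra hne
              rw [List.getElem?_eq_none (by simp; omega)] at hi
              cases hi
            simp only [Nat.sub_self, List.getElem?_cons_zero, Option.some.injEq] at hi
            subst hi
            simp [k4]
        · rw [List.append_assoc]
          refine k6 _ ?_
          have := hcs.take ho b2 (by rw [← b3]; exact hvalid y' hy')
          rw [← b3, ← b5] at this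
          exact this
  · rintro μ' - ⟨y', hy', tk, -, -, k3, k4, k6⟩
    refine ⟨tk, ?_, k4⟩
    have h0 := hT.start y' hy'
    simp only [Nat.sub_self, Nat.zero_mul, Nat.zero_add] at k3 k6
    have e := h0.1.mp k3
    have := k6 [] (by rw [e, h0.2 e]; exact .nil)
    simpa using this

end Knapsack

open NFoldInstance (unitsOf vecOf capOf setLeaf TabOK setOpt onItems StateLists)

/-! ### The static data in memory -/

notation "xBi" => (83 : ℕ)
notation "xYy" => (84 : ℕ)
notation "xMa" => (85 : ℕ)
notation "xMb" => (86 : ℕ)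
notation "xPq" => (87 : ℕ)
notation "xAd" => (88 : ℕ)
notation "xAl" => (89 : ℕ)
notation "xOy" => (90 : ℕ)
notation "xZz" => (91 : ℕ)
notation "xCp" => (92 : ℕ)

/-- The memories agree on the arrays in `l`. -/
def Agree (l : List ℕ) (μ μ' : RamMemory) : Prop := ∀ a ∈ l, μ' a = μ a

theorem Agree.eq {l : List ℕ} {μ μ' : RamMemory} (h : Agree l μ μ') (a : ℕ)
    (ha : a ∈ l := by decide) : μ' a = μ a := h a ha

theorem Agree.trans {l : List ℕ} {μ μ' μ'' : RamMemory} (h : Agree l μ μ') (h' : Agree l μ' μ'') :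
    Agree l μ μ'' := fun a ha => (h' a ha).trans (h a ha)

theorem RamProg.Frame.agree {l : List ℕ} {p : RamProg} {μ μ' : RamMemory} (h : p.Frame μ μ')
    (hl : ∀ a ∈ l, a ∉ p.mods := by decide) : Agree l μ μ' := fun a ha => h a (hl a ha)

theorem Agree.of_loop {l : List ℕ} {p : RamProg} {i : ℕ} {μ μ' : RamMemory}
    (h : p.LoopFrame i μ μ') (hl : ∀ a ∈ l, a ≠ i ∧ a ∉ p.mods := by decide) :
    Agree l μ μ' := fun a ha => h a (hl a ha).1 (hl a ha).2

/-- The parameters of the algorithm: the bound `δ` on the entries, and the lists of states. -/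
structure Setup where
  δ : ℕ
  V : ℕ
  V₂ : ℕ
  V₃ : ℕ
  vl : ℕ → ℤ
  vl₂ : ℕ → ℤ
  vl₃ : ℕ → ℤ

namespace Setup

variable {n r s t k : ℕ}

/-- The correctness of the parameters, all of which are bounded by `Q`. -/
structure OK (D : Setup) (I : NFoldInstance n r s t k) (Q : ℕ) : Prop where
  n_pos : 1 ≤ n
  t_pos : 1 ≤ t
  k_pos : 1 ≤ k
  entries : I.EntriesLe D.δ
  lists : StateLists r s k D.δ D.V D.V₂ D.V₃ D.vl D.vl₂ D.vl₃
  V_le : D.V ≤ Q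
  V₂_le : D.V₂ ≤ Q
  V₃_le : D.V₃ ≤ Q
  k_le : k ^ 3 ≤ Q
  K_le : 2 ^ Nat.clog 2 k ≤ Q

/-- The arrays that hold the static data. -/
def staticL : List ℕ :=
  [xPar, 3, xP, xK, xV, xVv, xVw, xH, xKk, xVl, xVf, xVlv, xVlw, xOrd, xCode, xIt, xIv, xPr]

/-- The data that updates do not change. -/
structure StaticAt (D : Setup) (I : NFoldInstance n r s t k) (μ : RamMemory) : Prop where
  n_eq : μ xPar 0 = n
  t_eq : μ xPar 3 = t
  k_eq : μ xPar 4 = k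
  K_eq : μ xK 0 = (2 ^ Nat.clog 2 k : ℕ)
  V_eq : μ xV 0 = D.V
  V₂_eq : μ xVv 0 = D.V₂
  V₃_eq : μ xVw 0 = D.V₃
  H_eq : μ xH 0 = (codeBase (r + s) k D.δ : ℤ) ^ (r + s)
  kk_eq : μ xKk 0 = (k ^ 2 : ℕ)
  states : StatesAt D.V D.vl (μ xVl) (μ xVf)
  vl₂_eq : ∀ y : ℕ, y < D.V₂ → μ xVlv y = D.vl₂ y
  vl₃_eq : ∀ y : ℕ, y < D.V₃ → μ xVlw y = D.vl₃ y
  ord_eq : ∀ a : ℕ, a < 2 ^ Nat.clog 2 k → μ xOrd (a : ℤ) = ordf (Nat.clog 2 k) a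
  code_eq : ∀ (i : Fin n) (q : Fin t), μ xCode (i * t + q : ℕ) =
    code (codeBase (r + s) k D.δ) 1 (fun d => I.colDigit d (i, q)) (r + s)
  it_eq : ∀ i : ℕ, i < n → μ xIt (i : ℤ) = (i * t : ℕ)
  iv_eq : ∀ i : ℕ, i < n → μ xIv (i : ℤ) = (i * D.V₂ : ℕ)
  par_eq : ∀ x : ℕ, x < 4 * t + 2 * n → μ xPr (x : ℤ) = (x / 2 : ℕ)
  c_eq : ∀ (i : Fin n) (q : Fin t), μ 3 (i * t + q : ℕ) = I.c (i, q)
  P_eq : ∀ i : Fin n, μ xP (i : ℕ) = (I.P i : ℕ)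

theorem StaticAt.congr {D : Setup} {I : NFoldInstance n r s t k} {μ μ' : RamMemory}
    (h : D.StaticAt I μ) (hμ : Agree staticL μ μ') : D.StaticAt I μ' := by
  have e : ∀ a ∈ staticL, μ' a = μ a := hμ
  simp only [staticL, List.forall_mem_cons, List.not_mem_nil, false_implies, implies_true,
    and_true] at e
  obtain ⟨e1, e2, e3, e4, e5, e6, e7, e8, e9, e10, e11, e12, e13, e14, e15, e16, e17, e18⟩ := e
  constructor
  all_goals simp only [e1, e2, e3, e4, e5, e6, e7, e8, e9, e10, e11, e12, e13, e14, e15, e16, e17,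
    e18]
  exacts [h.n_eq, h.t_eq, h.k_eq, h.K_eq, h.V_eq, h.V₂_eq, h.V₃_eq, h.H_eq, h.kk_eq, h.states,
    h.vl₂_eq, h.vl₃_eq, h.ord_eq, h.code_eq, h.it_eq, h.iv_eq, h.par_eq, h.c_eq, h.P_eq]

/-- The subproblem for brick `i`. -/
abbrev brick (D : Setup) (I : NFoldInstance n r s t k) (b : StepBounds n t) (i : ℕ) : Brick :=
  I.brick b D.δ D.V D.vl i

/-- The address of the merge tree of the units of brick `i` with the code `y`. -/
def treeAd (D : Setup) (t k i y : ℕ) : ℕ := (i * D.V + y) * (2 * (2 * t) * 2 ^ Nat.clog 2 k)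

/-- The memory holds the merge trees of the units of the bricks. -/
def TreesAt (D : Setup) (n t k : ℕ) (lf : ℕ → ℕ → ℕ → List (ℕ × ℤ)) (μ : RamMemory) : Prop :=
  ∀ i < n, ∀ y < D.V, TreeAt (μ xWin) (μ xVal) (D.treeAd t k i y) (2 * t) (2 ^ Nat.clog 2 k)
    (lf i y)

/-- The address of a merge tree over the bricks. These trees are stored at negative addresses, apart
from the merge trees of the units. -/
def setAd (n g : ℕ) : ℤ := - (((g + 1) * (2 * n) : ℕ) : ℤ)

/-- The memory holds the merge trees over the bricks. -/
def SetTreesAt (n N : ℕ) (lf : ℕ → ℕ → List (ℕ × ℤ)) (μ : RamMemory) : Prop :=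
  ∀ g < N, TreeAt (μ xWin) (μ xVal) (setAd n g) n 1 (lf g)

end Setup

/-- The memory holds the bounds. -/
structure BoundsAt {n t : ℕ} (b : StepBounds n t) (μ : RamMemory) : Prop where
  lo_eq : ∀ (i : Fin n) (q : Fin t), μ 5 (i * t + q : ℕ) = b.lo (i, q)
  up_eq : ∀ (i : Fin n) (q : Fin t), μ 6 (i * t + q : ℕ) = b.up (i, q)

theorem BoundsAt.congr {n t : ℕ} {b : StepBounds n t} {μ μ' : RamMemory} (h : BoundsAt b μ)
    (hμ : Agree [5, 6] μ μ') : BoundsAt b μ' := by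
  constructor
  · rw [hμ.eq 5]; exact h.lo_eq
  · rw [hμ.eq 6]; exact h.up_eq

/-! ### The merge trees of the units -/

/-- Selects the merge tree of brick `xBi` and code `xYy`. -/
def selectP : RamProg :=
  mulP xMa xMc (.load xIt (rg xBi)) (rg xV) ;;
  mulP xMb xMc (.load xPar (.lit 3)) (rg xYy) ;;
  mulP xMu xMc (rg xMa + rg xMb) (rg xK) ;;
  (setR xNb (rg xMu + rg xMu + rg xMu + rg xMu) ;;
    setR xTm (.load xPar (.lit 3) + .load xPar (.lit 3)) ;; setR xTk (rg xK))

section Units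

variable {n r s t k Q : ℕ} [hQ : Fact (1024 ≤ Q)] {D : Setup} {I : NFoldInstance n r s t k}
  {b : StepBounds n t} {μ : RamMemory}

/-- The merge tree at `nb` with `m` leaves and lists of length `κ` is selected. -/
def Selected (nb : ℤ) (m κ : ℕ) (μ : RamMemory) : Prop :=
  μ xNb 0 = nb ∧ μ xTm 0 = m ∧ μ xTk 0 = κ

theorem Selected.congr {nb : ℤ} {m κ : ℕ} {μ μ' : RamMemory} (h : Selected nb m κ μ)
    (hμ : Agree [xNb, xTm, xTk] μ μ') : Selected nb m κ μ' := by
  unfold Selected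
  rwa [hμ.eq _, hμ.eq _, hμ.eq _]

theorem selectP_runs (hD : D.OK I Q) (hst : D.StaticAt I μ) {i y : ℕ} (hi : i < n) (hy : y < D.V)
    (hi' : μ xBi 0 = i) (hy' : μ xYy 0 = y) :
    Runs selectP μ (Q ^ 7) (Selected (D.treeAd t k i y) (2 * t) (2 ^ Nat.clog 2 k)) := by
  unfold selectP
  refine Runs.seqQ ((Runs.mulP 1 (c := (i * t : ℕ)) (N := D.V) (by simp [hi', hst.it_eq i hi])
      (by simp [hst.V_eq])
    (by simpa using hD.V_le)).up) fun μ₁ hf₁ h₁ => ?_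
  have hst₁ := hst.congr hf₁.agree
  refine Runs.seqQ ((Runs.mulP 1 (c := t) (N := y) (by simp [hst₁.t_eq])
    (by simp [hf₁.eq xYy, hy'])
    (by have := hD.V_le; rw [pow_one]; omega)).up) fun μ₂ hf₂ h₂ => ?_
  have hst₂ := hst₁.congr hf₂.agree
  rw [← hf₂.eq xMa] at h₁
  refine Runs.seqQ ((Runs.mulP 1 (c := _) (N := 2 ^ Nat.clog 2 k) rfl (by simp [hst₂.K_eq])
    (by simpa using hD.K_le)).up) fun μ₃ hf₃ h₃ => ?_
  have hst₃ := hst₂.congr hf₃.agree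
  refine .block ?_
  simp only [eval, h₁, h₂] at h₃
  refine ⟨?_, ?_, ?_⟩
  · simp [run, h₃, Setup.treeAd]; ring
  · simp [run, hst₃.t_eq]; ring
  · simp [run, hst₃.K_eq]

/-- Prepares the leaf of item `xPq` (with a positive sign). -/
def posLeafP : RamProg :=
  setR xAd (.load xIt (rg xBi) + rg xPq) ;; setR xLf (rg xPq) ;; setR xLv (.load 3 (rg xAd)) ;;
  setR xCap (.lit 0) ;;
  .ite (.load xCode (rg xAd)) (.load xVl (rg xYy))
    (.ite (.load xVl (rg xYy)) (.load xCode (rg xAd)) (setR xCap (.load 6 (rg xAd))) .skip) .skip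

/-- Prepares the leaf of the negative of item `xPq`. Both codes have the top digit `1`, so that
their sum is twice the power `xH` of the base. -/
def negLeafP : RamProg :=
  setR xAd (.load xIt (rg xBi) + rg xPq) ;; setR xLf (.load xPar (.lit 3) + rg xPq) ;;
  setR xLv (.lit 0 - .load 3 (rg xAd)) ;; setR xCap (.lit 0) ;;
  .ite (rg xH + rg xH - .load xCode (rg xAd)) (.load xVl (rg xYy))
    (.ite (.load xVl (rg xYy)) (rg xH + rg xH - .load xCode (rg xAd))
      (setR xCap (.lit 0 - .load 5 (rg xAd))) .skip) .skip

/-- The registers describe a leaf `p` with content `l`. -/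
def LeafIs (p : ℕ) (l : List (ℕ × ℤ)) (μ : RamMemory) : Prop :=
  μ xLf 0 = p ∧ ∃ (cap : ℕ) (g : ℤ), μ xCap 0 = cap ∧ μ xLv 0 = g ∧ l = List.replicate cap (p, g)

theorem code_const (M N : ℤ) (l : ℕ) : code M N (fun _ => 0) l = N * M ^ l := by
  induction l with
  | zero => simp [code]
  | succ l ih => rw [code, ih]; ring

theorem item_pos (D : Setup) (I : NFoldInstance n r s t k) (b : StepBounds n t) (i : Fin n)
    (q : Fin t) : (D.brick I b i).item q =
      code (codeBase (r + s) k D.δ) 1 (fun d => I.colDigit d (i, q)) (r + s) := by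
  simp [Brick.item, NFoldInstance.brick, onItems]

theorem item_neg (D : Setup) (I : NFoldInstance n r s t k) (b : StepBounds n t) (i : Fin n)
    (q : Fin t) : (D.brick I b i).item (t + q) =
      2 * (codeBase (r + s) k D.δ : ℤ) ^ (r + s) -
        code (codeBase (r + s) k D.δ) 1 (fun d => I.colDigit d (i, q)) (r + s) := by
  have h1 : (D.brick I b i).item (t + q) =
      code (codeBase (r + s) k D.δ) (2 + -1) (fun d => 0 + - I.colDigit d (i, q)) (r + s) := by
    simp [Brick.item, NFoldInstance.brick, onItems]
  rw [h1, code_add, code_neg, code_const]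
  ring

theorem posLeafP_run (hst : D.StaticAt I μ) (hb : BoundsAt b μ) {y : ℕ} (hy : y < D.V)
    (i : Fin n) (q : Fin t) (hi' : μ xBi 0 = (i : ℕ)) (hy' : μ xYy 0 = y)
    (hq : μ xPq 0 = (q : ℕ)) :
    LeafIs q ((D.brick I b i).leaf (D.vl y) q) (posLeafP.run μ) := by
  have h1 := hst.it_eq i i.2
  have h2 := hst.code_eq i q
  have h3 := hst.c_eq i q
  have h4 := hb.up_eq i q
  have h5 := hst.states.vl_eq y hy
  push_cast at h1 h2 h3 h4
  rw [← item_pos D I b i q] at h2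
  refine ⟨?_, ?_⟩
  · simp [posLeafP, run_seq, run_store, run_ite, run_skip, hq]
  · refine ⟨if (D.brick I b i).item q = D.vl y then (b.up (i, q)).toNat else 0, I.c (i, q), ?_, ?_,
        ?_⟩
    · by_cases e : (D.brick I b i).item q = D.vl y
      · have := b.up_nonneg (i, q)
        simp [posLeafP, run_seq, run_store, run_ite, hq, hi', h1, h2,
          hy', h5, h4, e, this]
      · rcases lt_or_gt_of_ne e with e' | e' <;>
        simp [posLeafP, run_seq, run_store, run_ite, run_skip, hq,
          hi', h1, h2, hy', h5, e, e'.not_ge]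
    · simp [posLeafP, run_seq, run_store, run_ite, run_skip, hq,
        hi', h1, h3]
    · unfold Brick.leaf
      split_ifs
      · simp [NFoldInstance.brick, capOf, onItems]
      · simp

theorem negLeafP_run (hst : D.StaticAt I μ) (hb : BoundsAt b μ) {y : ℕ} (hy : y < D.V)
    (i : Fin n) (q : Fin t) (hi' : μ xBi 0 = (i : ℕ)) (hy' : μ xYy 0 = y)
    (hq : μ xPq 0 = (q : ℕ)) :
    LeafIs (t + q) ((D.brick I b i).leaf (D.vl y) (t + q)) (negLeafP.run μ) := by
  have h1 := hst.it_eq i i.2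
  have h2 := hst.code_eq i q
  have h3 := hst.c_eq i q
  have h4 := hb.lo_eq i q
  have h5 := hst.states.vl_eq y hy
  have h6 := item_neg D I b i q
  push_cast at h1 h2 h3 h4
  have h7 : μ xH 0 + μ xH 0 - μ xCode (i * t + q) = (D.brick I b i).item (t + q) := by
    rw [h6, h2, hst.H_eq]; ring
  refine ⟨?_, ?_⟩
  · simp [negLeafP, run_seq, run_store, run_ite, run_skip, hq,
      hst.t_eq]
  · refine ⟨if (D.brick I b i).item (t + q) = D.vl y then (- b.lo (i, q)).toNat else 0,
      - I.c (i, q), ?_, ?_, ?_⟩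
    · by_cases e : (D.brick I b i).item (t + q) = D.vl y
      · have := b.lo_nonpos (i, q)
        simp [negLeafP, run_seq, run_store, run_ite, hq, hi', h1, h7,
          hy', h5, h4, e, this]
      · rcases lt_or_gt_of_ne e with e' | e' <;>
        simp [negLeafP, run_seq, run_store, run_ite, run_skip, hq,
          hi', h1, h7, hy', h5, e, e'.not_ge]
    · simp [negLeafP, run_seq, run_store, run_ite, run_skip, hq,
        hi', h1, h3]
    · unfold Brick.leaf
      split_ifs
      · simp [NFoldInstance.brick, capOf, onItems]
      · simp

theorem treeAd_sep (D : Setup) {t k i y i' y' : ℕ} (hy : y < D.V) (hy' : y' < D.V)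
    (h : ¬ (i' = i ∧ y' = y)) {z : ℤ} (h1 : (D.treeAd t k i' y' : ℤ) ≤ z)
    (h2 : z < D.treeAd t k i' y' + 2 * (2 * t : ℕ) * (2 ^ Nat.clog 2 k : ℕ)) :
    ¬ ((D.treeAd t k i y : ℤ) ≤ z ∧
      z < D.treeAd t k i y + 2 * (2 * t : ℕ) * (2 ^ Nat.clog 2 k : ℕ)) := by
  have hne : i' * D.V + y' ≠ i * D.V + y := by
    intro he
    have h3 := congrArg (· % D.V) he
    have h4 := congrArg (· / D.V) he
    have hV : 0 < D.V := by omega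
    simp only [Nat.mul_add_mod_self_right, Nat.mod_eq_of_lt hy, Nat.mod_eq_of_lt hy'] at h3
    rw [Nat.add_comm, Nat.add_comm (i * D.V)] at h4
    simp only [Nat.add_mul_div_right _ _ hV, Nat.div_eq_of_lt hy, Nat.div_eq_of_lt hy'] at h4
    exact h ⟨by omega, h3⟩
  rintro ⟨h3, h4⟩
  unfold Setup.treeAd at *
  generalize i' * D.V + y' = a at *
  generalize i * D.V + y = c at *
  have hw : (0 : ℤ) ≤ 2 * (2 * t : ℕ) * (2 ^ Nat.clog 2 k : ℕ) := by positivity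
  push_cast at *
  generalize (2 : ℤ) * (2 * t) * 2 ^ Nat.clog 2 k = w at *
  rcases lt_or_gt_of_ne hne with h5 | h5
  · have : ((a : ℤ) + 1) * w ≤ c * w := mul_le_mul_of_nonneg_right (by omega) hw
    linarith
  · have : ((c : ℤ) + 1) * w ≤ a * w := mul_le_mul_of_nonneg_right (by omega) hw
    linarith

theorem Setup.TreesAt.change {lf lf' : ℕ → ℕ → ℕ → List (ℕ × ℤ)} {μ' : RamMemory}
    (h : D.TreesAt n t k lf μ) {i y : ℕ} (hy : y < D.V)
    (hs : SameTrees μ μ' (D.treeAd t k i y) (2 * (2 * t : ℕ) * (2 ^ Nat.clog 2 k : ℕ)))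
    (hT : TreeAt (μ' xWin) (μ' xVal) (D.treeAd t k i y) (2 * t) (2 ^ Nat.clog 2 k) (lf' i y))
    (hl : ∀ i' y', ¬ (i' = i ∧ y' = y) → lf' i' y' = lf i' y') : D.TreesAt n t k lf' μ' := by
  intro i' hi' y' hy'
  by_cases e : i' = i ∧ y' = y
  · obtain ⟨rfl, rfl⟩ := e; exact hT
  · rw [hl i' y' e]
    exact (h i' hi' y' hy').congr fun z h1 h2 => hs z (treeAd_sep D hy hy' e h1 h2)

/-- Updates the leaves of the variable `xPq` of brick `xBi`. -/
def updateUnitsP : RamProg :=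
  forP xYy (rg xV) (selectP ;; posLeafP ;; updateP ;; negLeafP ;; updateP)

theorem updateUnitsP_runs {b' : StepBounds n t} (hD : D.OK I Q) (hst : D.StaticAt I μ)
    (hb : BoundsAt b' μ) (i : Fin n) (q : Fin t) (hi' : μ xBi 0 = (i : ℕ))
    (hq : μ xPq 0 = (q : ℕ))
    (hT : D.TreesAt n t k (fun i y => (D.brick I b i).leaf (D.vl y)) μ)
    (hbb : ∀ v, v ≠ (i, q) → b'.lo v = b.lo v ∧ b'.up v = b.up v) :
    Runs updateUnitsP μ (Q ^ 19 * (Nat.log 2 (2 * t) + 1)) fun μ' =>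
      D.TreesAt n t k (fun i y => (D.brick I b' i).leaf (D.vl y)) μ' ∧
        ∀ z < 0, μ' xWin z = μ xWin z ∧ μ' xVal z = μ xVal z := by
  set X := Nat.log 2 (2 * t) + 1
  have hX : 1 ≤ X := by omega
  have hleaf : ∀ (i' p : ℕ), i' < n → p < 2 * t → ¬ (i' = i ∧ (p = q ∨ p = t + q)) → ∀ z,
      (D.brick I b' i').leaf z p = (D.brick I b i').leaf z p := by
    intro i' p hi' hp hne z
    have : capOf b' i' p = capOf b i' p := by
      unfold capOf
      rw [dif_pos hi', dif_pos hi']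
      split_ifs with h1 h2
      · rw [(hbb (⟨i', hi'⟩, ⟨p, h1⟩) ?_).2]
        intro h
        obtain ⟨h3, h4⟩ := Prod.mk.inj h
        exact hne ⟨congrArg Fin.val h3, .inl (congrArg Fin.val h4)⟩
      · rw [(hbb (⟨i', hi'⟩, ⟨p - t, h2⟩) ?_).1]
        intro h
        obtain ⟨h3, h4⟩ := Prod.mk.inj h
        have := congrArg Fin.val h4
        simp only at this
        exact hne ⟨congrArg Fin.val h3, .inr (by omega)⟩
      · rfl
    simp only [Brick.leaf, Brick.item, NFoldInstance.brick, this]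
  have hpr : ∀ {μ' : RamMemory}, D.StaticAt I μ' → ∀ x < 2 * (2 * t),
      μ' xPr (x : ℤ) = (x / 2 : ℕ) :=
    fun h x hx => h.par_eq x (by omega)
  have := Runs.forX (Q := Q) (N := D.V) (e := 17) (f := 1) (X := X) (Y := 1) (i := xYy)
    (hi := rg xV) (body := selectP ;; posLeafP ;; updateP ;; negLeafP ;; updateP) (μ₀ := μ)
    (fun j μ' => D.TreesAt n t k (fun i' y => if i' = i ∧ j ≤ y then (D.brick I b i').leaf (D.vl y)
      else (D.brick I b' i').leaf (D.vl y)) μ' ∧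
      ∀ z < 0, μ' xWin z = μ xWin z ∧ μ' xVal z = μ xVal z) hX le_rfl (by simpa using hD.V_le) ?_ ?_
          ?_ ?_
  · refine this.mono (by simp) ?_
    rintro μ' - ⟨h1, h2⟩
    refine ⟨fun i' hi' y' hy' => ?_, h2⟩
    have := h1 i' hi' y' hy'
    beta_reduce at this
    rwa [if_neg (by omega)] at this
  · intro μ' h'
    rw [eval, eval, h'.eq _, hst.V_eq]
  · intro j μ' v h
    simpa [Setup.TreesAt] using h
  · refine ⟨fun i' hi' y' hy' => ?_, fun z _ => ⟨rfl, rfl⟩⟩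
    dsimp only
    by_cases e : i' = i
    · rw [if_pos ⟨e, by omega⟩]
      exact hT i' hi' y' hy'
    · rw [if_neg (fun h => e h.1)]
      exact (hT i' hi' y' hy').leaf_congr fun p hp => hleaf i' p hi' hp (fun h => e h.1) _
  · rintro y hy μ₀ hf hyi ⟨hT₀, hneg⟩
    have hst₀ := hst.congr (Agree.of_loop hf)
    have hb₀ := hb.congr (Agree.of_loop hf)
    have hi₀ : μ₀ xBi 0 = (i : ℕ) := by rw [hf.eq _, hi']
    have hq₀ : μ₀ xPq 0 = (q : ℕ) := by rw [hf.eq _, hq]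
    have T₀ := hT₀ i i.2 y hy
    beta_reduce at T₀
    rw [if_pos ⟨rfl, le_rfl⟩] at T₀
    set nb : ℤ := ((D.treeAd t k i y : ℕ) : ℤ)
    refine Runs.seqX ((selectP_runs hD hst₀ i.2 hy hi₀ hyi).raise hX) ?_
    intro μ₁ hf₁ sel₁
    have hst₁ := hst₀.congr hf₁.agree
    have hb₁ := hb₀.congr hf₁.agree
    have pos := posLeafP_run hst₁ hb₁ hy i q (by rw [hf₁.eq _, hi₀])
      (by rw [hf₁.eq _, hyi]) (by rw [hf₁.eq _, hq₀])
    refine Runs.seqX (.blockX hX pos) ?_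
    rintro μ₂ hf₂ ⟨l1, cap, g, l2, l3, l4⟩
    have hst₂ := hst₁.congr hf₂.agree
    have sel₂ := sel₁.congr hf₂.agree
    have w₂ : μ₂ xWin = μ₀ xWin := by rw [hf₂.eq _, hf₁.eq _]
    have v₂ : μ₂ xVal = μ₀ xVal := by rw [hf₂.eq _, hf₁.eq _]
    refine Runs.seqX (.upX (updateP_runs (leaf := (D.brick I b i).leaf (D.vl y))
      (leaf' := Function.update ((D.brick I b i).leaf (D.vl y)) q
        ((D.brick I b' i).leaf (D.vl y) q)) hD.K_le (by omega)
      sel₂.1 sel₂.2.1 sel₂.2.2 l1 l2 l3 (hpr hst₂) (by rw [w₂, v₂]; exact T₀)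
      (fun p' _ hne => by simp [hne]) (by simpa using l4))) ?_
    rintro μ₃ hf₃ ⟨T₃, s₃⟩
    have hst₃ := hst₂.congr hf₃.agree
    have hb₃ := (hb₁.congr hf₂.agree).congr hf₃.agree
    have sel₃ := sel₂.congr hf₃.agree
    have neg := negLeafP_run hst₃ hb₃ hy i q
      (by rw [hf₃.eq _, hf₂.eq _, hf₁.eq _, hi₀])
      (by rw [hf₃.eq _, hf₂.eq _, hf₁.eq _, hyi])
      (by rw [hf₃.eq _, hf₂.eq _, hf₁.eq _, hq₀])
    refine Runs.seqX (.blockX hX neg) ?_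
    rintro μ₄ hf₄ ⟨k1, cap', g', k2, k3, k4⟩
    have hst₄ := hst₃.congr hf₄.agree
    have sel₄ := sel₃.congr hf₄.agree
    have w₄ : μ₄ xWin = μ₃ xWin := hf₄.eq _
    have v₄ : μ₄ xVal = μ₃ xVal := hf₄.eq _
    refine (updateP_runs (leaf := Function.update ((D.brick I b i).leaf (D.vl y)) q
        ((D.brick I b' i).leaf (D.vl y) q)) (leaf' := (D.brick I b' i).leaf (D.vl y))
        hD.K_le (by omega) sel₄.1 sel₄.2.1 sel₄.2.2 k1 k2 k3 (hpr hst₄)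
        (by rw [w₄, v₄]; exact T₃) (fun p' hp' hne => ?_) k4).post ?_
    · by_cases e : p' = q
      · subst e; simp
      · rw [Function.update_of_ne e]
        exact hleaf i p' i.2 hp' (fun h => h.2.elim e hne) _
    · rintro μ₅ - ⟨T₅, s₅⟩
      have s : SameTrees μ₀ μ₅ nb (2 * (2 * t : ℕ) * (2 ^ Nat.clog 2 k : ℕ)) := by
        refine SameTrees.trans (SameTrees.refl w₂ v₂) (s₃.trans ?_)
        exact SameTrees.trans (SameTrees.refl w₄ v₄) s₅
      refine ⟨hT₀.change (i := i) hy s ?_ ?_, fun z hz => ?_⟩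
      · rw [if_neg (by omega)]; exact T₅
      · intro i' y' hne
        by_cases e : i' = i
        · have : y' ≠ y := fun h => hne ⟨e, h⟩
          by_cases e' : y ≤ y'
          · rw [if_pos ⟨e, by omega⟩, if_pos ⟨e, e'⟩]
          · rw [if_neg (by omega), if_neg (by omega)]
        · rw [if_neg (fun h => e h.1), if_neg (fun h => e h.1)]
      · have h0 : 0 ≤ nb := by positivity
        obtain ⟨e1, e2⟩ := s z (by omega)
        rw [e1, e2]
        exact hneg z hz

end Units

open Setup (setAd SetTreesAt)

/-! ### The tables of the bricks -/

/-- Appends the entry at `xAd` to the list of options; its shift is entry `xYy` of array `a`. -/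
def pushP (a : ℕ) : RamProg :=
  .store xOw (rg xIx) (.load xWin (rg xAd)) ;; .store xOg (rg xIx) (.load xVal (rg xAd)) ;;
  .store xOs (rg xIx) (.load a (rg xYy)) ;; .store xOy (rg xIx) (rg xYy) ;;
  setR xIx (rg xIx + .lit 1)

/-- The first `N` options and their remainders modulo `W` are stored, and `xIx` is the number of
options. -/
structure PushedAt (W N : ℕ) (opt : ℕ → Option (ℕ × ℤ)) (sh : ℕ → ℤ) (μ : RamMemory) : Prop where
  ix_eq : μ xIx 0 = N
  opts : OptsAt N opt sh μ
  mod_eq : ∀ c : ℕ, c < N → μ xOy c = (c % W : ℕ)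

theorem PushedAt.congr {W N : ℕ} {opt : ℕ → Option (ℕ × ℤ)} {sh : ℕ → ℤ} {μ μ' : RamMemory}
    (h : PushedAt W N opt sh μ) (hμ : Agree [xIx, xOw, xOg, xOs, xOy] μ μ') :
    PushedAt W N opt sh μ' where
  ix_eq := by rw [hμ.eq _]; exact h.ix_eq
  opts := by
    have := h.opts
    unfold OptsAt at *
    rwa [hμ.eq _, hμ.eq _, hμ.eq _]
  mod_eq := by rw [hμ.eq _]; exact h.mod_eq

theorem pushP_run {W N a y : ℕ} {opt : ℕ → Option (ℕ × ℤ)} {sh : ℕ → ℤ} {μ : RamMemory}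
    (h : PushedAt W N opt sh μ) (hc : CellIs (μ xWin) (μ xVal) (μ xAd 0) (opt N))
    (ha : a ≠ xOw ∧ a ≠ xOg) (hy : μ xYy 0 = y) (hy' : N % W = y) (hs : μ a (y : ℤ) = sh N) :
    PushedAt W (N + 1) opt sh ((pushP a).run μ) := by
  have hix := h.ix_eq
  constructor
  · simp [pushP, run_seq, run_store, hix]
  · intro c hcN
    simp only [pushP, run_seq, run_store, RamMemory.write_apply, eval]
    rcases Nat.lt_succ_iff_lt_or_eq.mp hcN with h1 | rfl
    · have hne : (c : ℤ) ≠ N := by omega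
      obtain ⟨k1, k2⟩ := h.opts c h1
      exact ⟨k1.congr (by simp [hix, hne]) (by simp [hix, hne]), by simp [hix, hne, k2]⟩
    · exact ⟨hc.congr (by simp [hix]) (by simp [hix]), by simp [hix, ha.1, ha.2, hy, hs]⟩
  · intro c hcN
    rcases Nat.lt_succ_iff_lt_or_eq.mp hcN with h1 | rfl
    · have hne : (c : ℤ) ≠ N := by omega
      have := h.mod_eq c h1
      simpa [pushP, run_seq, run_store, hix, hne] using this
    · simp [pushP, run_seq, run_store, hix, hy, hy']

/-- Lists the options of the knapsack for brick `xBi`. -/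
def fillUnitsP : RamProg :=
  setR xIx (.lit 0) ;;
  forP xAl (rg xK) (forP xYy (rg xV)
    (selectP ;; setR xAd (rg xNb + rg xTk + .load xOrd (rg xAl)) ;; pushP xVl))

section Table

variable {n r s t k Q : ℕ} [hQ : Fact (1024 ≤ Q)] {D : Setup} {I : NFoldInstance n r s t k}
  {b : StepBounds n t} {μ : RamMemory}

theorem PushedAt.zero {W : ℕ} {opt : ℕ → Option (ℕ × ℤ)} {sh : ℕ → ℤ} (h : μ xIx 0 = 0) :
    PushedAt W 0 opt sh μ where
  ix_eq := h
  opts c hc := by omega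
  mod_eq c hc := by omega

theorem fillUnitsP_runs (hD : D.OK I Q) (hst : D.StaticAt I μ) {i : ℕ} (hi : i < n)
    (hi' : μ xBi 0 = i)
    (hT : ∀ y < D.V, TreeAt (μ xWin) (μ xVal) (D.treeAd t k i y) (2 * t) (2 ^ Nat.clog 2 k)
      ((D.brick I b i).leaf (D.vl y))) :
    Runs fillUnitsP μ (Q ^ 14) (PushedAt D.V (2 ^ Nat.clog 2 k * D.V) (D.brick I b i).opt
      (D.brick I b i).sh) := by
  have ht := hD.t_pos
  refine Runs.seqQ (R' := fun μ' => μ' xIx 0 = 0) (.block (by simp [run])) fun μ₁ hf₁ h₁ => ?_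
  have hst₁ := hst.congr hf₁.agree
  refine (Runs.forQ (N := 2 ^ Nat.clog 2 k) (e := 11) 1 (fun a μ' => PushedAt D.V (a * D.V)
    (D.brick I b i).opt (D.brick I b i).sh μ') (by simpa using hD.K_le)
    ?_ ?_ ?_ ?_)
  · intro μ' h'
    rw [eval, eval, h'.eq _, hst₁.K_eq]
  · exact fun j μ' v h => h.congr fun a ha => by
      rw [RamMemory.write_of_ne]; revert a; decide
  · rw [Nat.zero_mul]; exact .zero h₁
  rintro a ha μ₂ hf₂ ha₂ h₂
  have hst₂ := hst₁.congr (Agree.of_loop hf₂)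
  refine (Runs.forQ (N := D.V) (e := 9) 1 (fun y μ' => PushedAt D.V (a * D.V + y)
    (D.brick I b i).opt (D.brick I b i).sh μ') (by simpa using hD.V_le)
    ?_ ?_ ?_ ?_).post ?_
  · intro μ' h'
    rw [eval, eval, h'.eq _, hst₂.V_eq]
  · exact fun j μ' v h => h.congr fun a ha => by
      rw [RamMemory.write_of_ne]; revert a; decide
  · exact h₂
  · rintro y hy μ₃ hf₃ hy₃ h₃
    have hst₃ := hst₂.congr (Agree.of_loop hf₃)
    refine Runs.seqQ (.up (selectP_runs hD hst₃ hi hy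
      (by rw [hf₃.eq _, hf₂.eq _, hf₁.eq _, hi'])
      hy₃)) ?_
    rintro μ₄ hf₄ ⟨s1, s2, s3⟩
    have hst₄ := hst₃.congr hf₄.agree
    have ho := ordf_lt (Nat.clog 2 k) a
    refine Runs.seqQ (R' := fun μ' => μ' xAd 0 =
      (D.treeAd t k i y : ℤ) + (1 : ℕ) * (2 ^ Nat.clog 2 k : ℕ) + (ordf (Nat.clog 2 k) a : ℕ))
      (.block ?_) ?_
    · have := hst₄.ord_eq a ha
      have hal : μ₄ xAl 0 = a := by rw [hf₄.eq _, hf₃.eq _, ha₂]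
      simp [run, s1, s3, hal, this]
    · intro μ₅ hf₅ had
      have hst₅ := hst₄.congr hf₅.agree
      have hmod : (a * D.V + y) % D.V = y := by
        rw [Nat.mul_add_mod_self_right, Nat.mod_eq_of_lt hy]
      have hdiv : (a * D.V + y) / D.V = a := by
        rw [Nat.add_comm, Nat.add_mul_div_right _ _ (by omega), Nat.div_eq_of_lt hy, Nat.zero_add]
      refine .block (pushP_run (y := y)
        ((h₃.congr hf₄.agree).congr hf₅.agree) ?_
        (by decide) (by rw [hf₅.eq _, hf₄.eq _, hy₃]) hmod ?_)
      · have := hT y hy 1 le_rfl (by omega) _ ho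
        rw [had]
        rw [hf₅.eq xWin, hf₄.eq xWin, hf₃.eq xWin,
          hf₂.eq xWin, hf₁.eq xWin,
          hf₅.eq xVal, hf₄.eq xVal, hf₃.eq xVal,
          hf₂.eq xVal, hf₁.eq xVal]
        have e : (D.brick I b i).opt (a * D.V + y) =
            (full ((D.brick I b i).leaf (D.vl y)) (2 * t) 1)[ordf (Nat.clog 2 k) a]? := by
          change (full ((D.brick I b i).leaf (D.vl ((a * D.V + y) % D.V))) (2 * t) 1)[
            ordf (Nat.clog 2 k) ((a * D.V + y) / D.V)]? = _
          rw [hmod, hdiv]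
        rw [← e] at this
        exact this
      · rw [hst₅.states.vl_eq y hy]
        simp [Brick.sh, NFoldInstance.brick, hmod]
  · intro μ' _ h
    rw [Nat.succ_mul]; exact h

/-- Entry `z` of the tables holds the solution `o`. -/
def EntryAt (k z : ℕ) (μ : RamMemory) : Option (List ℕ × ℤ) → Prop
  | none => μ xBa z = 0
  | some x => μ xBa z = 1 ∧ μ xBv z = x.2 ∧ μ xSn z = x.1.length ∧ x.1.length ≤ k ∧
      ∀ (pos p : ℕ), x.1[pos]? = some p → μ xSol (z * k + pos : ℕ) = p

/-- Entry `z` is the same in both memories. -/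
def SameEntry (k z : ℕ) (μ μ' : RamMemory) : Prop :=
  μ' xBa z = μ xBa z ∧ μ' xBv z = μ xBv z ∧ μ' xSn z = μ xSn z ∧
    ∀ pos < k, μ' xSol (z * k + pos : ℕ) = μ xSol (z * k + pos : ℕ)

theorem EntryAt.of_same {z : ℕ} {μ' : RamMemory} {o : Option (List ℕ × ℤ)} (h : EntryAt k z μ o)
    (hs : SameEntry k z μ μ') : EntryAt k z μ' o := by
  obtain ⟨h1, h2, h3, h4⟩ := hs
  cases o with
  | none => exact h1.trans h
  | some x =>
    obtain ⟨k1, k2, k3, k4, k5⟩ := h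
    refine ⟨h1.trans k1, h2.trans k2, h3.trans k3, k4, fun pos p hp => ?_⟩
    have := (List.getElem?_eq_some_iff.mp hp).1
    rw [h4 pos (by omega)]
    exact k5 pos p hp

theorem SameEntry.of_agree {z : ℕ} {μ' : RamMemory} (h : Agree [xBa, xBv, xSn, xSol] μ μ') :
    SameEntry k z μ μ' := by
  unfold SameEntry
  rw [h _ (by decide), h _ (by decide), h _ (by decide), h _ (by decide)]
  exact ⟨rfl, rfl, rfl, fun _ _ => rfl⟩

theorem SameEntry.trans {z : ℕ} {μ' μ'' : RamMemory} (h : SameEntry k z μ μ')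
    (h' : SameEntry k z μ' μ'') : SameEntry k z μ μ'' :=
  ⟨h'.1.trans h.1, h'.2.1.trans h.2.1, h'.2.2.1.trans h.2.2.1,
    fun pos hp => (h'.2.2.2 pos hp).trans (h.2.2.2 pos hp)⟩

/-- `o` is a best solution in a brick with the code `z`. -/
structure BestOf (B : Brick) (z : ℤ) (o : Option (List ℕ × ℤ)) : Prop where
  sound : ∀ ms g, o = some (ms, g) → B.Fits ms ∧ g = B.gain ms ∧ ms.length ≤ B.k ∧
    z = code B.M ms.length (B.dig ms) B.l ∧ (∀ i < B.r, |B.dig ms i| ≤ B.R₁) ∧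
      ∀ i, B.r ≤ i → i < B.l → B.dig ms i = 0
  complete : ∀ ms, B.Fits ms → ms.length ≤ B.k →
    (∀ i, B.r ≤ i → i < B.l → B.dig ms i = 0) → z = code B.M ms.length (B.dig ms) B.l →
      ∃ ms' g, o = some (ms', g) ∧ B.gain ms ≤ g

theorem Brick.Good.bestOf_none {B : Brick} (hB : B.Good) {ch vt : ℤ → ℤ} {z : ℤ}
    (hT : KTable B.V 1 (2 ^ B.L * B.V) B.opt B.sh B.vl ch vt) (h0 : B.valid 0)
    (h : ∀ y < B.V, B.vl y = z → ¬ 1 ≤ ch (2 ^ B.L * B.V * B.V + y : ℕ)) : BestOf B z none where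
  sound := by simp
  complete ms h1 h2 h3 h4 := by
    obtain ⟨cs, g, hp, -⟩ := Brick.complete hB h1 h2 h3
    obtain ⟨y, hy, e1, e2, -⟩ := hT.complete (fun z => (hB.vl_iff z).mpr) h0 le_rfl hp
    exact absurd e2 (h y hy (by rw [e1, h4]))

theorem Brick.Good.bestOf_some {B : Brick} (hB : B.Good) {ch vt : ℤ → ℤ} {y : ℕ} (hy : y < B.V)
    (hT : KTable B.V 1 (2 ^ B.L * B.V) B.opt B.sh B.vl ch vt) (h0 : B.valid 0)
    (hbox : InBox B.M B.l B.r B.k B.R₁ 0 (B.vl y)) {cs : List (ℕ × ℕ)}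
    (hp : KPath B.valid 1 B.opt B.sh (2 ^ B.L * B.V) (B.vl y)
      (vt (2 ^ B.L * B.V * B.V + y : ℕ)) cs) :
    BestOf B (B.vl y) (some (cs.map Prod.snd, vt (2 ^ B.L * B.V * B.V + y : ℕ))) where
  sound ms g he := by
    obtain ⟨rfl, rfl⟩ := Prod.mk.inj (Option.some.inj he)
    obtain ⟨s1, s2, s3, s4, s5⟩ := Brick.sound hB hp
    obtain ⟨N, d, b1, b2, b3, b4, b5⟩ := hbox
    have hR₁ : 0 ≤ B.R₁ := le_trans (by positivity) hB.R₁_le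
    have hR₂ : 0 ≤ B.R₂ := le_trans (by positivity) hB.R₂_le
    have hM := hB.M_gt
    have hinj := code_inj (M := B.M) (l := B.l) (fun i hi => ?_) (b5.symm.trans s3)
    · refine ⟨s1, s2, ?_, s3, s4, fun i h1 h2 => ?_⟩
      · have := hinj.1; omega
      · have := b4 i h1 h2
        rw [← hinj.2 i h2]
        exact abs_nonpos_iff.mp this
    · by_cases h1 : i < B.r
      · have := abs_le.mp (b3 i h1)
        have := abs_le.mp (s4 i h1)
        rw [abs_lt]; constructor <;> linarith
      · have := abs_le.mp (b4 i (by omega) hi)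
        have := abs_le.mp (s5 i (by omega) hi)
        rw [abs_lt]; constructor <;> linarith
  complete ms h1 h2 h3 h4 := by
    obtain ⟨cs', g, hp', hg⟩ := Brick.complete hB h1 h2 h3
    obtain ⟨y', hy', e1, e2, e3⟩ := hT.complete (fun z => (hB.vl_iff z).mpr) h0 le_rfl hp'
    obtain rfl := hB.vl_inj _ hy' _ hy (by rw [e1, h4])
    exact ⟨_, _, rfl, hg.trans e3⟩

/-- Computes entry `xYy` of the table of brick `xBi`. -/
def entryP : RamProg :=
  (setR xZz (.load xIv (rg xBi) + rg xYy) ;; setR xU (.load xVf (.load xVlv (rg xYy)) - .lit 1) ;;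
    .store xBa (rg xZz) (.lit 0)) ;;
  .ite (.lit 0) (rg xU) (.ite (.lit 1) (.load xCh (rg xSrc + rg xU))
    ((.store xBa (rg xZz) (.lit 1) ;; .store xBv (rg xZz) (.load xVt (rg xSrc + rg xU))) ;;
    traceP ;; .store xSn (rg xZz) (rg xCc) ;;
    mulP xMu xMc (rg xZz) (.load xPar (.lit 4)) ;;
    forP xCp (rg xCc)
      (.store xSol (rg xMu + rg xCp) (.load xOw (.load xCl (rg xCp)) - .lit 1))) .skip) .skip

theorem entryP_runs (hD : D.OK I Q) (hst : D.StaticAt I μ) {i y : ℕ} (hi : i < n) (hy : y < D.V₂)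
    (hi' : μ xBi 0 = i) (hy' : μ xYy 0 = y)
    (hin : KnapIn D.V 1 (2 ^ Nat.clog 2 k * D.V) (D.brick I b i).opt (D.brick I b i).sh D.vl μ)
    (hT : KTable D.V 1 (2 ^ Nat.clog 2 k * D.V) (D.brick I b i).opt (D.brick I b i).sh D.vl
      (μ xCh) (μ xVt)) (hsrc : μ xSrc 0 = (2 ^ Nat.clog 2 k * D.V * D.V : ℕ)) :
    Runs entryP μ (Q ^ 14) fun μ' =>
      (∃ o, BestOf (D.brick I b i) (D.vl₂ y) o ∧ EntryAt k (i * D.V₂ + y) μ' o) ∧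
        ∀ z, z ≠ i * D.V₂ + y → SameEntry k z μ μ' := by
  have hB : (D.brick I b i).Good :=
    NFoldInstance.brick_good hD.t_pos hD.k_pos hD.entries hD.lists i
  have h0 : (D.brick I b i).valid 0 := inBox_zero (by simp [NFoldInstance.brick])
    (by simp [NFoldInstance.brick]; positivity) (by simp [NFoldInstance.brick])
  have hz : i * D.V₂ + y = i * D.V₂ + y := rfl
  generalize hzd : i * D.V₂ + y = z at *
  have hs : ∀ y < D.V, (D.brick I b i).valid (D.vl y) := fun y hy =>
    (hB.vl_iff _).mp ⟨y, hy, rfl⟩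
  unfold entryP
  refine Runs.seqQ (R' := fun μ' => μ' xZz 0 = z ∧ μ' xU 0 = μ xVf (D.vl₂ y) - 1 ∧
    μ' xBa z = 0 ∧ ∀ z', z' ≠ z → SameEntry k z' μ μ') (.block ?_) ?_
  · have h1 := hst.it_eq i hi
    have h2 := hst.iv_eq i hi
    have h3 := hst.vl₂_eq y hy
    subst hzd
    push_cast at h2
    refine ⟨?_, ?_, ?_, fun z' hz' => ?_⟩
    · simp [run, hi', hy', h2]
    · simp [run, hy', h3]
    · simp [run, hi', hy', h2]
    · have : (z' : ℤ) ≠ i * D.V₂ + y := by exact_mod_cast hz'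
      simp [run, hi', hy', h2, SameEntry, this]
  rintro μ₁ hf₁ ⟨z1, u1, a1, e1⟩
  have hst₁ := hst.congr hf₁.agree
  have hin₁ := hin.congr hf₁.agree
  rw [← hf₁.eq xCh, ← hf₁.eq xVt] at hT
  rw [← hf₁.eq xSrc] at hsrc
  refine .iteQ (e := 12) (by decide) (fun hu => ?_) fun hu => ?_
  swap
  · refine .block ⟨⟨none, ?_, a1⟩, e1⟩
    refine hB.bestOf_none hT h0 fun y' hy' he => absurd ?_ hu
    simp only [eval, u1]
    rw [← he]
    have : μ xVf (D.vl y') = y' + 1 := hin.states.vf_eq y' hy'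
    simp only [NFoldInstance.brick] at *
    omega
  simp only [eval, u1] at hu
  obtain ⟨y', hy', w1, w2⟩ := hin.states.vf_pos (D.vl₂ y) (by omega)
  have hu' : μ₁ xU 0 = y' := by rw [u1, w1]; ring
  refine .iteQ (e := 11) (by decide) (fun hc => ?_) fun hc => ?_
  swap
  · refine .block ⟨⟨none, ?_, a1⟩, e1⟩
    refine hB.bestOf_none hT h0 fun y'' hy'' he => ?_
    obtain rfl : y'' = y' := hB.vl_inj _ hy'' _ hy' (he.trans w2.symm)
    simp only [eval, hsrc, hu', ← Nat.cast_add] at hc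
    exact hc
  simp only [eval, hsrc, hu', ← Nat.cast_add] at hc
  refine Runs.seqQ (R' := fun μ' => μ' xBa z = 1 ∧
    μ' xBv z = μ₁ xVt (2 ^ Nat.clog 2 k * D.V * D.V + y' : ℕ) ∧
    ∀ z', z' ≠ z → SameEntry k z' μ μ') (.block ?_) ?_
  · push_cast at hsrc
    refine ⟨?_, ?_, fun z' hz' => (e1 z' hz').trans ?_⟩
    · simp [run, z1]
    · simp [run, z1, hsrc, hu']
    · have : (z' : ℤ) ≠ z := by exact_mod_cast hz'
      simp [run, z1, SameEntry, this]
  rintro μ₂ hf₂ ⟨a2, v2, e2⟩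
  have hst₂ := hst₁.congr hf₂.agree
  have hin₂ := hin₁.congr hf₂.agree
  rw [← hf₂.eq xCh, ← hf₂.eq xVt] at hT
  rw [← hf₂.eq xVt] at v2
  have hKV : 2 ^ Nat.clog 2 k * D.V ≤ Q ^ 2 := by
    rw [pow_two]; exact Nat.mul_le_mul hD.K_le hD.V_le
  refine Runs.seqQ ((traceP_runs (valid := (D.brick I b i).valid) hKV hin₂ hT
    (by rw [hf₂.eq _, hsrc]) (by rw [hf₂.eq _, hu']) hy'
    (by rw [hf₂.eq _]; exact hc) hs).up) ?_
  rintro μ₃ hf₃ ⟨cs, hp, hcc⟩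
  have hst₃ := hst₂.congr hf₃.agree
  have z3 : μ₃ xZz 0 = z := by rw [hf₃.eq _, hf₂.eq _, z1]
  have best := hB.bestOf_some hy' hT h0 (by
    have := (hD.lists.mem₂ (D.vl₂ y)).mp ⟨y, hy, rfl⟩
    rw [← w2] at this
    exact this) hp
  have hlen : cs.length ≤ k := by
    have := (best.sound _ _ rfl).2.2.1
    simpa [NFoldInstance.brick] using this
  have hkQ : k ≤ Q := (Nat.le_self_pow (by norm_num) k).trans hD.k_le
  refine Runs.seqQ (R' := fun μ' => μ' xSn z = cs.length ∧ μ' xBa z = 1 ∧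
    μ' xBv z = μ₂ xVt (2 ^ Nat.clog 2 k * D.V * D.V + y' : ℕ) ∧
    ∀ z', z' ≠ z → SameEntry k z' μ μ') (.block ?_) ?_
  · refine ⟨?_, ?_, ?_, fun z' hz' => ((e2 z' hz').trans (.of_agree hf₃.agree)).trans ?_⟩
    · simp [run, z3, hcc.1]
    · simpa [run, hf₃.eq xBa] using a2
    · simpa [run, hf₃.eq xBv] using v2
    · have : (z' : ℤ) ≠ z := by exact_mod_cast hz'
      simp [run, z3, SameEntry, this]
  rintro μ₄ hf₄ ⟨n4, a4, v4, e4⟩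
  have hst₄ := hst₃.congr hf₄.agree
  refine Runs.seqQ (.up (Runs.mulP 1 (c := z) (N := k) (by simp [hf₄.eq xZz, z3])
      (by simp [hst₄.k_eq])
    (by simpa using hkQ))) ?_
  rintro μ₅ hf₅ m5
  refine ((Runs.forQ (N := cs.length) (e := 1) 1 (fun j μ' => (∀ pos p : ℕ, pos < j →
    (cs.map Prod.snd)[pos]? = some p → μ' xSol (z * k + pos : ℕ) = p) ∧
    ∀ z', z' ≠ z → SameEntry k z' μ μ') (by rw [pow_one]; omega)
    ?_ ?_ ?_ ?_).up).post ?_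
  · intro μ' h'
    rw [eval, eval, h'.eq _, hf₅.eq _,
      hf₄.eq _, hcc.1]
  · intro j μ' v h
    simpa [SameEntry] using h
  · exact ⟨fun _ _ h => by omega,
      fun z' hz' => (e4 z' hz').trans (.of_agree hf₅.agree)⟩
  · rintro j hj μ' hf hj' ⟨h1, h2⟩
    obtain ⟨c, hc⟩ : ∃ c, cs[j]? = some c := ⟨cs[j], List.getElem?_eq_getElem hj⟩
    have hw : μ' xOw (c.1 : ℤ) = c.2 + 1 := by
      obtain ⟨σ, hσ, o, ho, hc1, g', hopt⟩ := hp.mem_opt c (List.mem_of_getElem? hc)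
      have := (hin₂.opts c.1 (by omega)).1
      rw [hopt] at this
      rw [hf.eq _, hf₅.eq _, hf₄.eq _, hf₃.eq _]
      exact this.1
    have hl : μ' xCl (j : ℤ) = c.1 := by
      rw [hf.eq _, hf₅.eq _, hf₄.eq _]
      exact hcc.2 j c hc
    have hm : μ' xMu 0 = (z * k : ℕ) := by
      rw [hf.eq _, m5]; push_cast; rfl
    have wr : ∀ x : ℤ, (run (.store xSol (rg xMu + rg xCp)
        (.load xOw (.load xCl (rg xCp)) - .lit 1)) μ') xSol x =
        Function.update (μ' xSol) ((z * k + j : ℕ) : ℤ) c.2 x := by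
      intro x
      simp [run, hm, hj', hl, hw, Function.update_apply]
    refine .block ⟨fun pos p hpos hp' => ?_, fun z' hz' =>
      (h2 z' hz').trans ⟨rfl, rfl, rfl, fun pos hpos => ?_⟩⟩
    · rw [wr]
      rcases Nat.lt_succ_iff_lt_or_eq.mp hpos with h3 | rfl
      · rw [Function.update_of_ne (by norm_cast; omega)]
        exact h1 pos p h3 hp'
      · rw [Function.update_self]
        rw [List.getElem?_map, hc] at hp'
        exact congrArg _ (Option.some.inj hp')
    · rw [wr, Function.update_of_ne]
      norm_cast
      intro he
      apply hz'
      have h3 : j < k := by omega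
      have := congrArg (· / k) he
      simp only [Nat.mul_comm _ k] at this
      rwa [Nat.mul_add_div (by omega), Nat.mul_add_div (by omega), Nat.div_eq_of_lt hpos,
        Nat.div_eq_of_lt h3] at this
  · rintro μ' hf ⟨h1, h2⟩
    have fr : ∀ a ∈ [xBa, xBv, xSn], μ' a = μ₄ a := fun a ha => by
      rw [hf a (by revert a; decide), hf₅ a (by revert a; decide)]
    refine ⟨⟨_, by rw [← w2]; exact best, ?_⟩, h2⟩
    refine ⟨?_, ?_, ?_, ?_, fun pos p hp' => h1 pos p ?_ hp'⟩
    · rw [fr _ (by decide), a4]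
    · rw [fr _ (by decide), v4]; rfl
    · rw [fr _ (by decide), n4]; simp
    · simpa using hlen
    · have := (List.getElem?_eq_some_iff.mp hp').1
      simpa using this

/-- Computes the table of brick `xBi`. -/
def brickTableP : RamProg :=
  fillUnitsP ;; (setR xS (rg xIx) ;; setR xO (.lit 1)) ;; knapP ;; forP xYy (rg xVv) entryP

theorem brickTableP_runs (hD : D.OK I Q) (hst : D.StaticAt I μ) {i : ℕ} (hi : i < n)
    (hi' : μ xBi 0 = i)
    (hT : ∀ y < D.V, TreeAt (μ xWin) (μ xVal) (D.treeAd t k i y) (2 * t) (2 ^ Nat.clog 2 k)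
      ((D.brick I b i).leaf (D.vl y))) :
    Runs brickTableP μ (Q ^ 19) fun μ' => ∃ tb : ℕ → Option (List ℕ × ℤ),
      TabOK (D.brick I b i) D.V₂ D.vl₂ tb ∧
      (∀ y < D.V₂, EntryAt k (i * D.V₂ + y) μ' (tb y)) ∧
      ∀ z, (∀ y < D.V₂, z ≠ i * D.V₂ + y) → SameEntry k z μ μ' := by
  have hKV : 2 ^ Nat.clog 2 k * D.V ≤ Q ^ 2 := by
    rw [pow_two]; exact Nat.mul_le_mul hD.K_le hD.V_le
  have hk := hD.k_pos
  have hz : ∃ y < D.V, D.vl y = 0 := (hD.lists.mem 0).mpr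
    (inBox_zero (by positivity) (by positivity) (by positivity))
  unfold brickTableP
  refine Runs.seqQ ((fillUnitsP_runs hD hst hi hi' hT).up)
    fun μ₁ hf₁ h₁ => ?_
  have hst₁ := hst.congr hf₁.agree
  refine Runs.seqQ (R' := KnapIn D.V 1 (2 ^ Nat.clog 2 k * D.V) (D.brick I b i).opt
    (D.brick I b i).sh D.vl) (.block ?_) ?_
  · have := h₁.opts
    constructor
    · simp [run, hst₁.V_eq]
    · simp [run]
    · simp [run, h₁.ix_eq]
    · simpa [run] using hst₁.states
    · simpa [run, OptsAt] using this
  intro μ₂ hf₂ h₂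
  have hst₂ := hst₁.congr hf₂.agree
  refine Runs.seqQ ((knapP_runs hD.V_le (one_le_of_fact Q) hKV hz h₂).up)
    ?_
  rintro μ₃ hf₃ ⟨hK, hsrc⟩
  have hst₃ := hst₂.congr hf₃.agree
  have h₃ := h₂.congr hf₃.agree
  refine (Runs.forQ (N := D.V₂) (e := 14) 1 (fun j μ' =>
    (∀ y < j, ∃ o, BestOf (D.brick I b i) (D.vl₂ y) o ∧ EntryAt k (i * D.V₂ + y) μ' o) ∧
      ∀ z, (∀ y < j, z ≠ i * D.V₂ + y) → SameEntry k z μ μ')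
    (by simpa using hD.V₂_le) ?_ ?_ ?_ ?_).post ?_
  · intro μ' h'
    rw [eval, eval, h'.eq _, hst₃.V₂_eq]
  · rintro j μ' v ⟨h1, h2⟩
    have hs : ∀ z, SameEntry k z μ' (μ'.write xYy 0 v) := fun z => .of_agree fun a ha => by
      rw [RamMemory.write_of_ne]; revert a; decide
    exact ⟨fun y hy => (h1 y hy).imp fun o h => ⟨h.1, h.2.of_same (hs _)⟩,
      fun z hz => (h2 z hz).trans (hs z)⟩
  · exact ⟨fun y hy => by omega, fun z _ => (SameEntry.of_agree hf₁.agree).trans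
      ((SameEntry.of_agree hf₂.agree).trans (.of_agree hf₃.agree))⟩
  · rintro y hy μ₄ hf₄ hy₄ ⟨h1, h2⟩
    have hst₄ := hst₃.congr (Agree.of_loop hf₄)
    refine (entryP_runs hD hst₄ hi hy ?_ hy₄
      (h₃.congr fun a ha => hf₄ a (by revert a; decide) (by revert a; decide)) ?_ ?_).post ?_
    · rw [hf₄.eq _, hf₃.eq _, hf₂.eq _,
        hf₁.eq _, hi']
    · rw [hf₄.eq _, hf₄.eq _]; exact hK
    · rw [hf₄.eq _, hsrc]
    rintro μ₅ - ⟨h3, h4⟩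
    refine ⟨fun y' hy' => ?_, fun z hz => (h2 z fun y' hy' => hz y' (by omega)).trans
      (h4 z (hz y (by omega)))⟩
    rcases Nat.lt_succ_iff_lt_or_eq.mp hy' with h5 | rfl
    · exact (h1 y' h5).imp fun o h => ⟨h.1, h.2.of_same (h4 _ (by omega))⟩
    · exact h3
  · rintro μ' - ⟨h1, h2⟩
    have h3 : ∀ y, ∃ o, y < D.V₂ → BestOf (D.brick I b i) (D.vl₂ y) o ∧
        EntryAt k (i * D.V₂ + y) μ' o := fun y => by
      by_cases hy : y < D.V₂
      · exact (h1 y hy).imp fun o h _ => h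
      · exact ⟨none, fun h => absurd h hy⟩
    choose tb htb using h3
    exact ⟨tb, ⟨fun y hy => (htb y hy).1.sound, fun y hy => (htb y hy).1.complete⟩,
      fun y hy => (htb y hy).2, h2⟩

/-- The memory holds the tables of all bricks. -/
def TablesAt (D : Setup) (n k : ℕ) (tab : ℕ → ℕ → Option (List ℕ × ℤ)) (μ : RamMemory) : Prop :=
  ∀ i < n, ∀ y < D.V₂, EntryAt k (i * D.V₂ + y) μ (tab i y)

theorem TablesAt.congr {tab : ℕ → ℕ → Option (List ℕ × ℤ)} {μ' : RamMemory}
    (h : TablesAt D n k tab μ) (hμ : Agree [xBa, xBv, xSn, xSol] μ μ') : TablesAt D n k tab μ' :=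
  fun i hi y hy => (h i hi y hy).of_same (.of_agree hμ)

theorem TablesAt.update {tab : ℕ → ℕ → Option (List ℕ × ℤ)} {μ' : RamMemory} {i N : ℕ}
    {tb : ℕ → Option (List ℕ × ℤ)} (h : TablesAt D N k tab μ)
    (h1 : ∀ y < D.V₂, EntryAt k (i * D.V₂ + y) μ' (tb y))
    (h2 : ∀ z, (∀ y < D.V₂, z ≠ i * D.V₂ + y) → SameEntry k z μ μ')
    (hN : ∀ i' < n, i' ≠ i → i' < N) : TablesAt D n k (Function.update tab i tb) μ' := by
  intro i' hi' y hy
  by_cases e : i' = i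
  · subst e; rw [Function.update_self]; exact h1 y hy
  · rw [Function.update_of_ne e]
    refine (h i' (hN i' hi' e) y hy).of_same (h2 _ fun y' hy' he => e ?_)
    have h3 := congrArg (· / D.V₂) he
    rw [Nat.add_comm, Nat.add_comm (i * D.V₂)] at h3
    simp only [Nat.add_mul_div_right _ _ (by omega : 0 < D.V₂), Nat.div_eq_of_lt hy,
      Nat.div_eq_of_lt hy'] at h3
    omega

end Table

/-! ### The merge trees over the bricks -/

notation "xFw" => (93 : ℕ)
notation "xBst" => (94 : ℕ)
notation "xBg" => (95 : ℕ)
notation "xFi" => (96 : ℕ)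
notation "xFq" => (97 : ℕ)
notation "xFa" => (98 : ℕ)
notation "xFn" => (99 : ℕ)
notation "xPp" => (100 : ℕ)

/-- The set of the partition that brick `i` belongs to. -/
def NFoldInstance.setOf {n r s t k : ℕ} (I : NFoldInstance n r s t k) (i : ℕ) : ℕ :=
  if h : i < n then I.P ⟨i, h⟩ else 0

/-- Prepares the leaf of brick `xBi` in the tree of its set and the code `xYy`. -/
def setLeafP : RamProg :=
  mulP xMa xMc (rg xVv) (.load xP (rg xBi)) ;;
  mulP xMu xMc (.load xPar (.lit 0)) (rg xMa + rg xYy + .lit 1) ;;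
  (setR xNb (.lit 0 - rg xMu - rg xMu) ;; setR xTm (.load xPar (.lit 0)) ;; setR xTk (.lit 1) ;;
    setR xLf (rg xBi) ;; setR xZz (.load xIv (rg xBi) + rg xYy) ;;
    setR xCap (.load xBa (rg xZz)) ;; setR xLv (.load xBv (rg xZz)))

theorem Setup.OK.kk_le {n r s t k Q : ℕ} {D : Setup} {I : NFoldInstance n r s t k}
    (hD : D.OK I Q) : k ^ 2 ≤ Q :=
  (Nat.pow_le_pow_right hD.k_pos (by norm_num)).trans hD.k_le

theorem index_lt {a m y V : ℕ} (ha : a < m) (hy : y < V) : a * V + y < m * V := by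
  have := Nat.mul_le_mul_right V (Nat.succ_le_of_lt ha)
  rw [Nat.succ_mul] at this
  omega

theorem Setup.OK.set_le {n r s t k Q : ℕ} {D : Setup} {I : NFoldInstance n r s t k}
    (hD : D.OK I Q) {j y : ℕ} (hj : j < k ^ 2) (hy : y < D.V₂) :
    j * D.V₂ + y + 1 ≤ Q ^ 2 := by
  have h1 := index_lt hj hy
  have h2 := Nat.mul_le_mul hD.kk_le hD.V₂_le
  rw [pow_two]; omega

section Sets

variable {n r s t k Q : ℕ} [hQ : Fact (1024 ≤ Q)] {D : Setup} {I : NFoldInstance n r s t k}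
  {b : StepBounds n t} {μ : RamMemory} {tab : ℕ → ℕ → Option (List ℕ × ℤ)}

theorem Setup.StaticAt.setOf_eq (hst : D.StaticAt I μ) {i : ℕ} (hi : i < n) :
    μ xP (i : ℤ) = I.setOf i := by
  rw [NFoldInstance.setOf, dif_pos hi]; exact hst.P_eq ⟨i, hi⟩

theorem NFoldInstance.setOf_lt (I : NFoldInstance n r s t k) {i : ℕ} (hi : i < n) :
    I.setOf i < k ^ 2 := by
  rw [NFoldInstance.setOf, dif_pos hi]; exact (I.P ⟨i, hi⟩).2

theorem setLeafP_runs (hD : D.OK I Q) (hst : D.StaticAt I μ) {i y : ℕ} (hi : i < n)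
    (hy : y < D.V₂) (hi' : μ xBi 0 = i) (hy' : μ xYy 0 = y)
    (he : EntryAt k (i * D.V₂ + y) μ (tab i y)) :
    Runs setLeafP μ (Q ^ 7) fun μ' =>
      Selected (setAd n (I.setOf i * D.V₂ + y)) n 1 μ' ∧
        LeafIs i (setLeaf I.setOf tab (I.setOf i) y i) μ' := by
  have hj := I.setOf_lt hi
  unfold setLeafP
  refine Runs.seqQ ((Runs.mulP 1 (c := D.V₂) (N := I.setOf i) (by simp [hst.V₂_eq])
      (by simp [hi', hst.setOf_eq hi])
    (by have := hD.kk_le; rw [pow_one]; omega)).up) fun μ₁ hf₁ h₁ => ?_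
  have hst₁ := hst.congr hf₁.agree
  have hy₁ : μ₁ xYy 0 = y := by rw [hf₁.eq _, hy']
  refine Runs.seqQ ((Runs.mulP 2 (c := n) (N := I.setOf i * D.V₂ + y + 1) (by simp [hst₁.n_eq])
    (by simp [h₁, hy₁]; ring) (hD.set_le hj hy)).up) fun μ₂ hf₂ h₂ => ?_
  have hst₂ := hst₁.congr hf₂.agree
  have hi₂ : μ₂ xBi 0 = i := by rw [hf₂.eq _, hf₁.eq _, hi']
  have hy₂ : μ₂ xYy 0 = y := by rw [hf₂.eq _, hy₁]
  have he₂ := (he.of_same (.of_agree hf₁.agree)).of_same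
    (.of_agree hf₂.agree)
  have hv := hst₂.iv_eq i hi
  push_cast at hv
  refine .block ⟨⟨?_, ?_, ?_⟩, ?_, ?_⟩
  · simp [run, h₂, setAd]; ring
  · simp [run, hst₂.n_eq]
  · simp [run]
  · simp [run, hi₂]
  · unfold setLeaf
    rw [if_pos rfl]
    rcases ht : tab i y with _ | ⟨ms, g⟩
    · rw [ht] at he₂
      have : μ₂ xBa (i * D.V₂ + y) = 0 := by exact_mod_cast he₂
      exact ⟨0, _, by simp [run, hi₂, hy₂, hv, this], rfl, by simp⟩
    · rw [ht] at he₂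
      have h3 : μ₂ xBa (i * D.V₂ + y) = 1 := by exact_mod_cast he₂.1
      have h4 : μ₂ xBv (i * D.V₂ + y) = g := by exact_mod_cast he₂.2.1
      exact ⟨1, g, by simp [run, hi₂, hy₂, hv, h3], by simp [run, hi₂, hy₂, hv, h4],
        by simp⟩

theorem setAd_sep {g g' : ℕ} (h : g' ≠ g) {z : ℤ} (h1 : setAd n g' ≤ z)
    (h2 : z < setAd n g' + 2 * n * (1 : ℕ)) :
    ¬ (setAd n g ≤ z ∧ z < setAd n g + 2 * n * (1 : ℕ)) := by
  rintro ⟨h3, h4⟩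
  unfold setAd at *
  have hw : (0 : ℤ) ≤ 2 * n := by positivity
  push_cast at *
  generalize (2 : ℤ) * n = w at *
  rcases lt_or_gt_of_ne h with h5 | h5
  · have : ((g' : ℤ) + 1) * w ≤ g * w := mul_le_mul_of_nonneg_right (by omega) hw
    linarith
  · have : ((g : ℤ) + 1) * w ≤ g' * w := mul_le_mul_of_nonneg_right (by omega) hw
    linarith

theorem setAd_neg {g : ℕ} {z : ℤ} (h : setAd n g ≤ z ∧ z < setAd n g + 2 * n * (1 : ℕ)) :
    z < 0 := by
  obtain ⟨h1, h2⟩ := h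
  unfold setAd at *
  have hw : (0 : ℤ) ≤ g * (2 * n) := by positivity
  push_cast at *
  linarith

theorem Setup.SetTreesAt.change {N g : ℕ} {lf lf' : ℕ → ℕ → List (ℕ × ℤ)} {μ' : RamMemory}
    (h : SetTreesAt n N lf μ)
    (hs : SameTrees μ μ' (setAd n g) (2 * n * (1 : ℕ)))
    (hT : TreeAt (μ' xWin) (μ' xVal) (setAd n g) n 1 (lf' g))
    (hl : ∀ g', g' ≠ g → ∀ p < n, lf' g' p = lf g' p) : SetTreesAt n N lf' μ' := by
  intro g' hg'
  by_cases e : g' = g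
  · subst e; exact hT
  · exact ((h g' hg').congr fun z h1 h2 => hs z (setAd_sep e h1 h2)).leaf_congr (hl g' e)

theorem div_index {j V y : ℕ} (hy : y < V) : (j * V + y) / V = j := by
  rw [Nat.add_comm, Nat.add_mul_div_right _ _ (by omega), Nat.div_eq_of_lt hy, Nat.zero_add]

theorem mod_index {j V y : ℕ} (hy : y < V) : (j * V + y) % V = y := by
  rw [Nat.mul_add_mod_self_right, Nat.mod_eq_of_lt hy]

/-- The leaves of the merge trees over the bricks, which are numbered by pairs of a set and a
code. -/
def Setup.setLf (D : Setup) (I : NFoldInstance n r s t k) (tab : ℕ → ℕ → Option (List ℕ × ℤ))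
    (g : ℕ) : ℕ → List (ℕ × ℤ) := setLeaf I.setOf tab (g / D.V₂) (g % D.V₂)

/-- Updates the leaves of brick `xBi`. -/
def updateSetsP : RamProg := forP xYy (rg xVv) (setLeafP ;; updateP)

theorem updateSetsP_runs (hD : D.OK I Q) (hst : D.StaticAt I μ) {i : ℕ} (hi : i < n)
    (hi' : μ xBi 0 = i) {tb : ℕ → Option (List ℕ × ℤ)}
    (hT : SetTreesAt n (k ^ 2 * D.V₂) (D.setLf I tab) μ)
    (he : ∀ y < D.V₂, EntryAt k (i * D.V₂ + y) μ (tb y)) :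
    Runs updateSetsP μ (Q ^ 16 * (Nat.log 2 n + 1)) fun μ' =>
      SetTreesAt n (k ^ 2 * D.V₂) (D.setLf I (Function.update tab i tb)) μ' ∧
        ∀ z, 0 ≤ z → μ' xWin z = μ xWin z ∧ μ' xVal z = μ xVal z := by
  set X := Nat.log 2 n + 1
  have hX : 1 ≤ X := by omega
  -- the leaves after the first `j` rounds
  set lf : ℕ → ℕ → ℕ → List (ℕ × ℤ) := fun j g =>
    if g / D.V₂ = I.setOf i ∧ g % D.V₂ < j then D.setLf I (Function.update tab i tb) g
    else D.setLf I tab g with hlf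
  have hsame : ∀ g p, (g / D.V₂ = I.setOf i → p ≠ i) →
      D.setLf I (Function.update tab i tb) g p = D.setLf I tab g p := by
    intro g p h
    unfold Setup.setLf setLeaf
    by_cases e : p = i
    · subst e
      rw [if_neg fun h' => h h'.symm rfl, if_neg fun h' => h h'.symm rfl]
    · rw [Function.update_of_ne e]
  have := Runs.forX (Q := Q) (N := D.V₂) (e := 14) (f := 1) (X := X) (Y := 1) (i := xYy)
    (hi := rg xVv) (body := setLeafP ;; updateP) (μ₀ := μ)
    (fun j μ' => SetTreesAt n (k ^ 2 * D.V₂) (lf j) μ' ∧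
      ∀ z, 0 ≤ z → μ' xWin z = μ xWin z ∧ μ' xVal z = μ xVal z) hX le_rfl (by simpa using hD.V₂_le)
          ?_ ?_ ?_ ?_
  · refine this.mono (by simp) ?_
    rintro μ' - ⟨h1, h2⟩
    refine ⟨fun g hg => (h1 g hg).leaf_congr fun p hp => ?_, h2⟩
    by_cases e : g / D.V₂ = I.setOf i
    · have hV : 0 < D.V₂ := Nat.pos_of_ne_zero fun h => by simp [h] at hg
      simp [hlf, e, Nat.mod_lt g hV]
    · simp only [hlf, e, false_and, if_false]
      exact hsame g p fun h => absurd h e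
  · intro μ' h'
    rw [eval, eval, h'.eq _, hst.V₂_eq]
  · intro j μ' v h
    simpa [SetTreesAt] using h
  · refine ⟨fun g hg => ?_, fun z _ => ⟨rfl, rfl⟩⟩
    simpa [hlf] using hT g hg
  · rintro y hy μ₀ hf hyi ⟨hT₀, hnn⟩
    have hst₀ := hst.congr (Agree.of_loop hf)
    have hi₀ : μ₀ xBi 0 = i := by rw [hf.eq _, hi']
    have hg : I.setOf i * D.V₂ + y < k ^ 2 * D.V₂ := index_lt (I.setOf_lt hi) hy
    set g := I.setOf i * D.V₂ + y with hgd
    have hdiv : g / D.V₂ = I.setOf i := div_index hy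
    have hmod : g % D.V₂ = y := mod_index hy
    have T₀ := hT₀ g hg
    refine Runs.seqX ((setLeafP_runs (tab := Function.update tab i tb) hD hst₀ hi hy hi₀
      hyi ?_).raise hX) ?_
    · rw [Function.update_self]
      exact (he y hy).of_same (.of_agree (Agree.of_loop hf))
    rintro μ₁ hf₁ ⟨sel, l1, cap, v, l2, l3, l4⟩
    have hst₁ := hst₀.congr hf₁.agree
    have w₁ : μ₁ xWin = μ₀ xWin := hf₁.eq _
    have v₁ : μ₁ xVal = μ₀ xVal := hf₁.eq _
    refine (updateP_runs (leaf := lf y g) (leaf' := D.setLf I (Function.update tab i tb) g)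
      (one_le_of_fact Q) hi sel.1 sel.2.1 sel.2.2 l1 l2 l3
      (fun x hx => hst₁.par_eq x (by omega)) (by rw [w₁, v₁]; exact T₀) ?_ ?_).post ?_
    · intro p hp hne
      rw [hsame g p fun _ => hne]
      simp [hlf, hmod]
    · rw [← l4]; simp only [Setup.setLf, hdiv, hmod]
    rintro μ₂ hf₂ ⟨T₂, s₂⟩
    have s : SameTrees μ₀ μ₂ (setAd n g) (2 * n * (1 : ℕ)) := (SameTrees.refl w₁ v₁).trans s₂
    refine ⟨hT₀.change s ?_ ?_, fun z hz => ?_⟩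
    · have : lf (y + 1) g = D.setLf I (Function.update tab i tb) g := by simp [hlf, hdiv, hmod]
      rw [this]; exact T₂
    · intro g' hne p hp
      have : ¬ (g' / D.V₂ = I.setOf i ∧ g' % D.V₂ = y) := fun h => hne (by
        rw [hgd, ← h.1, ← h.2, Nat.div_add_mod'])
      simp only [hlf]
      generalize g' / D.V₂ = c at *
      generalize g' % D.V₂ = d at *
      have e : (c = I.setOf i ∧ d < y + 1) ↔ (c = I.setOf i ∧ d < y) := by omega
      simp only [e]
    · obtain ⟨e1, e2⟩ := s z fun h => by have := setAd_neg h; omega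
      rw [e1, e2]
      exact hnn z hz

end Sets

/-! ### The final knapsack -/

/-- The option at the root of the next tree over the bricks. -/
def pushSetP : RamProg :=
  mulP xMu xMc (.load xPar (.lit 0)) (rg xIx + .lit 1) ;;
  (setR xAd (.lit 1 - rg xMu - rg xMu) ;; pushP xVlv)

/-- Lists the options of the final knapsack. -/
def fillSetsP : RamProg :=
  setR xIx (.lit 0) ;; forP xAl (rg xKk) (forP xYy (rg xVv) pushSetP)

/-- Finds the best of the states in which the vector is in the kernel. -/
def bestP : RamProg :=
  (setR xBst (.load xVf (.lit 0) - .lit 1) ;; setR xBg (.load xVt (rg xSrc + rg xBst))) ;;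
  forP xYy (rg xVw)
    (setR xU (.load xVf (.load xVlw (rg xYy)) - .lit 1) ;;
    .ite (.lit 1) (.load xCh (rg xSrc + rg xU))
      (.ite (rg xBg) (.load xVt (rg xSrc + rg xU))
        (setR xBst (rg xU) ;; setR xBg (.load xVt (rg xSrc + rg xU))) .skip) .skip)

section Final

variable {n r s t k Q : ℕ} [hQ : Fact (1024 ≤ Q)] {D : Setup} {I : NFoldInstance n r s t k}
  {b : StepBounds n t} {μ : RamMemory} {tab : ℕ → ℕ → Option (List ℕ × ℤ)}

theorem fillSetsP_runs (hD : D.OK I Q) (hst : D.StaticAt I μ)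
    (hT : SetTreesAt n (k ^ 2 * D.V₂) (D.setLf I tab) μ) :
    Runs fillSetsP μ (Q ^ 11) (PushedAt D.V₂ (k ^ 2 * D.V₂)
      (setOpt n I.setOf D.V₂ tab) (fun c => D.vl₂ (c % D.V₂))) := by
  have hn := hD.n_pos
  refine Runs.seqQ (R' := fun μ' => μ' xIx 0 = 0) (.block (by simp [run])) fun μ₁ hf₁ h₁ => ?_
  have hst₁ := hst.congr hf₁.agree
  refine (Runs.forQ (N := k ^ 2) (e := 8) 1 (fun a μ' => PushedAt D.V₂ (a * D.V₂)
    (setOpt n I.setOf D.V₂ tab) (fun c => D.vl₂ (c % D.V₂)) μ') (by simpa using hD.kk_le) ?_ ?_ ?_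
        ?_)
  · intro μ' h'
    rw [eval, eval, h'.eq _, hst₁.kk_eq]
  · exact fun j μ' v h => h.congr fun a ha => by
      rw [RamMemory.write_of_ne]; revert a; decide
  · rw [Nat.zero_mul]; exact .zero h₁
  rintro a ha μ₂ hf₂ ha₂ h₂
  have hst₂ := hst₁.congr (Agree.of_loop hf₂)
  refine (Runs.forQ (N := D.V₂) (e := 6) 1 (fun y μ' => PushedAt D.V₂ (a * D.V₂ + y)
    (setOpt n I.setOf D.V₂ tab) (fun c => D.vl₂ (c % D.V₂)) μ') (by simpa using hD.V₂_le) ?_ ?_ ?_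
        ?_).post ?_
  · intro μ' h'
    rw [eval, eval, h'.eq _, hst₂.V₂_eq]
  · exact fun j μ' v h => h.congr fun a ha => by
      rw [RamMemory.write_of_ne]; revert a; decide
  · exact h₂
  · rintro y hy μ₃ hf₃ hy₃ h₃
    have hst₃ := hst₂.congr (Agree.of_loop hf₃)
    refine Runs.seqQ (.up (Runs.mulP 2 (c := n) (N := a * D.V₂ + y + 1) (by simp [hst₃.n_eq])
        (by simp [h₃.ix_eq])
      (hD.set_le ha hy))) fun μ₄ hf₄ h₄ => ?_
    have hst₄ := hst₃.congr hf₄.agree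
    refine Runs.seqQ (R' := fun μ' => μ' xAd 0 = setAd n (a * D.V₂ + y) + (1 : ℕ) *
      (1 : ℕ) + (0 : ℕ)) (.block ?_) ?_
    · simp [run, h₄, setAd]; ring
    intro μ₅ hf₅ had
    have hst₅ := hst₄.congr hf₅.agree
    refine .block (pushP_run (N := a * D.V₂ + y) (y := y)
      ((h₃.congr hf₄.agree).congr hf₅.agree) ?_
      (by decide) (by rw [hf₅.eq _, hf₄.eq _, hy₃]) (mod_index hy) ?_)
    · have := hT _ (index_lt ha hy) 1 le_rfl (by omega) 0 one_pos
      rw [had]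
      rw [hf₅.eq xWin, hf₄.eq xWin, hf₃.eq xWin,
        hf₂.eq xWin, hf₁.eq xWin,
        hf₅.eq xVal, hf₄.eq xVal, hf₃.eq xVal,
        hf₂.eq xVal, hf₁.eq xVal]
      exact this
    · rw [hst₅.vl₂_eq y hy, mod_index hy]
  · intro μ' _ h
    rw [Nat.succ_mul]; exact h

theorem bestP_runs (hD : D.OK I Q) (hst : D.StaticAt I μ) {src : ℕ} (hsrc : μ xSrc 0 = src)
    (h0 : ∃ y < D.V, D.vl y = 0 ∧ 1 ≤ μ xCh (src + y : ℕ)) :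
    Runs bestP μ (Q ^ 5) fun μ' => ∃ y < D.V, μ' xBst 0 = y ∧ (∃ y' < D.V₃, D.vl y = D.vl₃ y') ∧
      1 ≤ μ xCh (src + y : ℕ) ∧ ∀ y' < D.V, (∃ y'' < D.V₃, D.vl y' = D.vl₃ y'') →
        1 ≤ μ xCh (src + y' : ℕ) → μ xVt (src + y' : ℕ) ≤ μ xVt (src + y : ℕ) := by
  have hk := hD.k_pos
  have h3 : ∀ y' < D.V₃, ∃ y < D.V, D.vl y = D.vl₃ y' := by
    intro y' hy'
    obtain ⟨N, d, h1, h2, h3, h4, h5⟩ := (hD.lists.mem₃ _).mp ⟨y', hy', rfl⟩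
    exact (hD.lists.mem _).mpr ⟨N, d, h1, h2, fun i hi => (h3 i hi).trans (by positivity),
      fun i hi hi' => (h4 i hi hi').trans (by positivity), h5⟩
  refine Runs.seqQ (R' := fun μ' => ∃ y < D.V, D.vl y = 0 ∧ 1 ≤ μ xCh (src + y : ℕ) ∧
    μ' xBst 0 = y ∧ μ' xBg 0 = μ xVt (src + y : ℕ)) (.block ?_) ?_
  · obtain ⟨y, hy, hy0, hch⟩ := h0
    have := hst.states.vf_eq y hy
    rw [hy0] at this
    exact ⟨y, hy, hy0, hch, by simp [run, this], by simp [run, this, hsrc]⟩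
  rintro μ₁ hf₁ ⟨y₀, hy₀, hz, hch₀, e1, e2⟩
  have hst₁ := hst.congr hf₁.agree
  have hy₀' : ∃ y' < D.V₃, D.vl y₀ = D.vl₃ y' := by
    obtain ⟨y', hy', h⟩ := (hD.lists.mem₃ 0).mpr (inBox_zero (by positivity) le_rfl le_rfl)
    exact ⟨y', hy', by rw [hz, h]⟩
  refine (Runs.forQ (N := D.V₃) (e := 2) 1 (fun j μ' => ∃ y < D.V, μ' xBst 0 = y ∧
      μ' xBg 0 = μ xVt (src + y : ℕ) ∧ (∃ y' < D.V₃, D.vl y = D.vl₃ y') ∧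
      1 ≤ μ xCh (src + y : ℕ) ∧ ∀ y' < D.V, (∃ y'' < j, D.vl y' = D.vl₃ y'') →
        1 ≤ μ xCh (src + y' : ℕ) → μ xVt (src + y' : ℕ) ≤ μ xVt (src + y : ℕ))
            (by simpa using hD.V₃_le) ?_ ?_ ?_ ?_).post ?_
  · intro μ' h'
    rw [eval, eval, h'.eq _, hst₁.V₃_eq]
  · intro j μ' v h
    simpa using h
  · exact ⟨y₀, hy₀, e1, e2, hy₀', hch₀, fun y' _ h => by obtain ⟨_, h, _⟩ := h; omega⟩
  · rintro j hj μ₂ hf₂ hj₂ ⟨y, hy, b1, b2, b3, b4, b5⟩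
    have hst₂ := hst₁.congr (Agree.of_loop hf₂)
    obtain ⟨u, hu, hu'⟩ := h3 j hj
    have hvf := hst₂.states.vf_eq u hu
    rw [hu'] at hvf
    have hvl := hst₂.vl₃_eq j hj
    have hs₂ : μ₂ xSrc 0 = src := by
      rw [hf₂.eq _, hf₁.eq _, hsrc]
    have hc₂ : μ₂ xCh (src + u) = μ xCh (src + u : ℕ) := by
      rw [hf₂.eq _, hf₁.eq _]; push_cast; rfl
    have hv₂ : μ₂ xVt (src + u) = μ xVt (src + u : ℕ) := by
      rw [hf₂.eq _, hf₁.eq _]; push_cast; rfl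
    -- the only state with the code number `j`
    have only : ∀ y' < D.V, D.vl y' = D.vl₃ j → y' = u := fun y' hy' h =>
      hD.lists.inj y' hy' u hu (by rw [h, hu'])
    have step : ∀ {y : ℕ}, (∀ y' < D.V, (∃ y'' < j, D.vl y' = D.vl₃ y'') →
        1 ≤ μ xCh (src + y' : ℕ) → μ xVt (src + y' : ℕ) ≤ μ xVt (src + y : ℕ)) →
        (1 ≤ μ xCh (src + u : ℕ) → μ xVt (src + u : ℕ) ≤ μ xVt (src + y : ℕ)) →
        ∀ y' < D.V, (∃ y'' < j + 1, D.vl y' = D.vl₃ y'') →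
        1 ≤ μ xCh (src + y' : ℕ) → μ xVt (src + y' : ℕ) ≤ μ xVt (src + y : ℕ) := by
      rintro y h1 h2 y' hy' ⟨y'', hy'', e⟩ h
      rcases Nat.lt_succ_iff_lt_or_eq.mp hy'' with h4 | rfl
      · exact h1 y' hy' ⟨y'', h4, e⟩ h
      · obtain rfl := only y' hy' e
        exact h2 h
    refine .block ?_
    by_cases c1 : 1 ≤ μ xCh (src + u : ℕ)
    · have c1' := c1
      push_cast at c1'
      by_cases c2 : μ xVt (src + y : ℕ) ≤ μ xVt (src + u : ℕ)
      · have c2' := c2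
        push_cast at c2'
        refine ⟨u, hu, ?_, ?_, ⟨j, hj, hu'⟩, c1, step (fun y' hy' h h' => ?_) fun _ => le_rfl⟩
        · simp [run_seq, run_store, run_ite, hj₂, hvl, hvf, hs₂, hc₂, hv₂,
            b2, c1', c2']
        · simp [run_seq, run_store, run_ite, hj₂, hvl, hvf, hs₂, hc₂, hv₂,
            b2, c1', c2']
        · exact (b5 y' hy' h h').trans c2
      · have c2' := c2
        push_cast at c2'
        refine ⟨y, hy, ?_, ?_, b3, b4, step b5 fun _ => (not_le.mp c2).le⟩
        · simp [run_seq, run_store, run_ite, run_skip, hj₂, hvl,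
            hvf, hs₂, hc₂, hv₂, b1, b2, c1', c2']
        · simp [run_seq, run_store, run_ite, run_skip, hj₂, hvl,
            hvf, hs₂, hc₂, hv₂, b2, c1', c2']
    · have c1' := c1
      push_cast at c1'
      refine ⟨y, hy, ?_, ?_, b3, b4, step b5 fun h => absurd h c1⟩
      · simp [run_seq, run_store, run_ite, run_skip, hj₂, hvl,
          hvf, hs₂, hc₂, b1, c1']
      · simp [run_seq, run_store, run_ite, run_skip, hj₂, hvl,
          hvf, hs₂, hc₂, b2, c1']
  · rintro μ' - ⟨y, hy, b1, -, b3, b4, b5⟩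
    exact ⟨y, hy, b1, b3, b4, b5⟩

/-! ### The output -/

/-- The variables in `F` are listed in memory, they include every nonzero entry of `x`, and the
array `xVec` holds `x`. -/
structure FlatAt (F : List (Fin n × Fin t)) (x : Fin n × Fin t → ℤ) (μ : RamMemory) : Prop where
  n_eq : μ xFn 0 = F.length
  list : ∀ (m : ℕ) (v : Fin n × Fin t), F[m]? = some v → μ xFi m = (v.1 : ℕ) ∧
    μ xFq m = (v.2 : ℕ) ∧ μ xFa m = (v.1 * t + v.2 : ℕ)
  mem : ∀ v, x v ≠ 0 → v ∈ F
  vec : ∀ v : Fin n × Fin t, μ xVec (v.1 * t + v.2 : ℕ) = x v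
  zero : ∀ z : ℤ, (∀ v ∈ F, z ≠ (v.1 * t + v.2 : ℕ)) → μ xVec z = 0

theorem FlatAt.congr {F : List (Fin n × Fin t)} {x : Fin n × Fin t → ℤ} {μ' : RamMemory}
    (h : FlatAt F x μ) (hμ : Agree [xFn, xFi, xFq, xFa, xVec] μ μ') : FlatAt F x μ' := by
  obtain ⟨h1, h2, h3, h4, h5⟩ := h
  constructor
  · rw [hμ.eq _, h1]
  · rw [hμ.eq _, hμ.eq _, hμ.eq _]; exact h2
  · exact h3
  · rw [hμ.eq _]; exact h4
  · rw [hμ.eq _]; exact h5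

/-- Appends the item `xPp` of brick `xFw`. -/
def appendP : RamProg :=
  .store xFi (rg xFn) (rg xFw) ;; .store xFq (rg xFn) (rg xPp) ;; setR xNv (.lit 1) ;;
  .ite (.load xPar (.lit 3)) (rg xPp)
    (.store xFq (rg xFn) (rg xPp - .load xPar (.lit 3)) ;; setR xNv (.lit 0 - .lit 1)) .skip

/-- Records the address of the appended variable, and changes the vector. -/
def addP : RamProg :=
  .store xFa (rg xFn) (.load xIt (rg xFw) + .load xFq (rg xFn)) ;;
  .store xVec (.load xFa (rg xFn)) (.load xVec (.load xFa (rg xFn)) + rg xNv) ;;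
  setR xFn (rg xFn + .lit 1)

theorem address_inj {v w : Fin n × Fin t} (h : (v.1 * t + v.2 : ℕ) = w.1 * t + w.2) : v = w := by
  have h1 := congrArg (· / t) h
  have h2 := congrArg (· % t) h
  simp only [div_index v.2.2, div_index w.2.2, mod_index v.2.2, mod_index w.2.2] at h1 h2
  exact Prod.ext (Fin.ext h1) (Fin.ext h2)

theorem appendP_runs (hst : D.StaticAt I μ) {F : List (Fin n × Fin t)}
    {U : List (ℕ × ℕ)} (h : FlatAt F (vecOf t n U) μ) {i p : ℕ} (hi : i < n)
    (hp : p < 2 * t) (hi' : μ xFw 0 = i) (hp' : μ xPp 0 = p) (hFU : F.length = U.length) :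
    Runs (appendP ;; addP) μ (Q ^ 2) fun μ' => ∃ F', F'.length = (U ++ [(i, p)]).length ∧
      FlatAt F' (vecOf t n (U ++ [(i, p)])) μ' := by
  set q : ℕ := if p < t then p else p - t with hq
  have hqt : q < t := by rw [hq]; split_ifs <;> omega
  set w : ℤ := if p < t then 1 else -1 with hw
  set v : Fin n × Fin t := (⟨i, hi⟩, ⟨q, hqt⟩) with hv
  have hvec : ∀ u, vecOf t n (U ++ [(i, p)]) u =
      vecOf t n U u + if u = v then w else 0 := by
    rintro ⟨i', q'⟩
    simp only [vecOf, List.count_append, List.count_singleton, beq_iff_eq,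
      Prod.mk.injEq, hv, Fin.ext_iff]
    have := q'.2
    by_cases c : p < t
    · have e1 : ¬ p = t + q' := by omega
      simp only [e1, and_false, if_false, hw, hq, if_pos c]
      by_cases e2 : i = i' <;> by_cases e3 : p = q' <;> simp [e2, e3, eq_comm]
      ring
    · have e1 : ¬ p = q' := by omega
      have e2 : (p = t + q') ↔ (q' : ℕ) = p - t := by omega
      simp only [e1, and_false, if_false, hw, hq, if_neg c, e2]
      by_cases e2 : i = i' <;> by_cases e3 : (q' : ℕ) = p - t <;> simp [e2, e3, eq_comm]
      ring
  refine Runs.seqQ (R' := fun μ' => μ' xFi F.length = i ∧ μ' xFq F.length = q ∧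
    μ' xNv 0 = w ∧ (∀ m < F.length, μ' xFi m = μ xFi m ∧ μ' xFq m = μ xFq m))
    (.block ?_) ?_
  · have hn := h.n_eq
    have hne : ∀ m < F.length, (m : ℤ) ≠ F.length := fun m hm => by omega
    by_cases c : p < t
    · have c' : ¬ (t : ℤ) ≤ p := by omega
      refine ⟨?_, ?_, ?_, fun m hm => ⟨?_, ?_⟩⟩
      · simp [appendP, run_seq, run_store, run_ite, run_skip, hn,
          hi', hp', hst.t_eq, c']
      · simp [appendP, run_seq, run_store, run_ite, run_skip, hn,
          hp', hst.t_eq, c', hq, c]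
      · simp [appendP, run_seq, run_store, run_ite, run_skip,
          hp', hst.t_eq, c', hw, c]
      · simp [appendP, run_seq, run_store, run_ite, run_skip, hn,
          hp', hst.t_eq, c', hne m hm]
      · simp [appendP, run_seq, run_store, run_ite, run_skip, hn,
          hp', hst.t_eq, c', hne m hm]
    · have c' : (t : ℤ) ≤ p := by omega
      have e : ((p - t : ℕ) : ℤ) = p - t := by omega
      refine ⟨?_, ?_, ?_, fun m hm => ⟨?_, ?_⟩⟩
      · simp [appendP, run_seq, run_store, run_ite, hn, hi', hp', hst.t_eq,
          c']
      · simp [appendP, run_seq, run_store, run_ite, hn, hp', hst.t_eq, c',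
          hq, c, e]
      · simp [appendP, run_seq, run_store, run_ite, hp', hst.t_eq, c', hw,
          c]
      · simp [appendP, run_seq, run_store, run_ite, hn, hp', hst.t_eq, c',
          hne m hm]
      · simp [appendP, run_seq, run_store, run_ite, hn, hp', hst.t_eq, c',
          hne m hm]
  rintro μ₁ hf₁ ⟨a1, a2, a3, a4⟩
  have hst₁ := hst.congr hf₁.agree
  have hn : μ₁ xFn 0 = F.length := by rw [hf₁.eq _, h.n_eq]
  have hi₁ : μ₁ xFw 0 = i := by rw [hf₁.eq _, hi']
  have hit := hst₁.it_eq i hi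
  push_cast at hit
  have hx₁ : μ₁ xVec = μ xVec := hf₁.eq _
  have hx : μ₁ xVec (i * t + q) = vecOf t n U v := by
    rw [hx₁]; exact_mod_cast h.vec v
  have wr : ∀ z : ℤ, addP.run μ₁ xVec z =
      if z = i * t + q then vecOf t n U v + w else μ xVec z := by
    intro z
    simp [addP, run, hn, hi₁, hit, a2, a3, hx, ← hx₁, Function.update_apply]
  refine .block ⟨F ++ [v], by simp [hFU], ?_, ?_, ?_, ?_, ?_⟩
  · simp [addP, run, hn]
  · intro m u hm
    rw [List.getElem?_append] at hm
    split_ifs at hm with hlt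
    · obtain ⟨k1, k2, k3⟩ := h.list m u hm
      have hne : (m : ℤ) ≠ F.length := by omega
      have fa : μ₁ xFa = μ xFa := hf₁.eq _
      obtain ⟨k4, k5⟩ := a4 m hlt
      push_cast at k3
      simp [addP, run, hn, hne, k1, k2, k3, k4, k5, fa]
    · have hm' : m = F.length := by
        have := (List.getElem?_eq_some_iff.mp hm).1
        simp at this; omega
      subst hm'
      simp only [Nat.sub_self, List.getElem?_cons_zero, Option.some.injEq] at hm
      subst hm
      simp [addP, run, hn, a1, a2, hi₁, hit, hv]
  · intro u hu
    rw [hvec] at hu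
    by_cases e : u = v
    · simp [e]
    · rw [if_neg e, add_zero] at hu
      exact List.mem_append_left _ (h.mem u hu)
  · intro u
    rw [wr, hvec]
    by_cases e : u = v
    · subst e; simp [hv]
    · rw [if_neg e, if_neg, add_zero, h.vec]
      intro h'
      exact e (address_inj (by exact_mod_cast h'))
  · intro z hz
    rw [wr, if_neg]
    · exact h.zero z fun u hu => hz u (List.mem_append_left _ hu)
    · have := hz v (by simp)
      rw [hv] at this
      exact_mod_cast this

/-- Outputs variable number `xCp` if its entry is not zero, and clears its entry. The position after
the output may be overwritten in any case, as only the counter makes it part of the output. -/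
def emitP : RamProg :=
  setR xAd (.load xFa (rg xCp)) ;; setR xNv (.load xVec (rg xAd)) ;;
  .store 9 (.load 8 (.lit 0)) (.load xFi (rg xCp)) ;;
  .store 10 (.load 8 (.lit 0)) (.load xFq (rg xCp)) ;;
  .store 11 (.load 8 (.lit 0)) (rg xNv) ;; .store xVec (rg xAd) (.lit 0) ;;
  .ite (rg xNv) (.lit 0) (.ite (.lit 0) (rg xNv) .skip
      (.store 8 (.lit 0) (.load 8 (.lit 0) + .lit 1)))
    (.store 8 (.lit 0) (.load 8 (.lit 0) + .lit 1))

/-- Outputs the vector and clears it. -/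
def outputP : RamProg := .store 8 (.lit 0) (.lit 0) ;; forP xCp (rg xFn) emitP

theorem outputP_runs {F : List (Fin n × Fin t)} {x : Fin n × Fin t → ℤ} (h : FlatAt F x μ)
    (hF : F.length ≤ Q) :
    Runs outputP μ (Q ^ 4) fun μ' => μ'.Shows x ∧ ∀ z, μ' xVec z = 0 := by
  classical
  refine Runs.seqQ (R' := fun μ' => μ' 8 0 = 0) (.block (by simp [run])) fun μ₁ hf₁ h₁ => ?_
  replace h := h.congr hf₁.agree
  refine (Runs.forQ (N := F.length) (e := 1) 1 (fun j μ' =>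
    (∃ L : List (Fin n × Fin t), L.Nodup ∧ (∀ v, v ∈ L ↔ x v ≠ 0 ∧ v ∈ F.take j) ∧
    μ' 8 0 = L.length ∧ ∀ (m : ℕ) (hm : m < L.length),
      μ' 9 (m : ℤ) = ((L[m].1 : ℕ) : ℤ) ∧ μ' 10 (m : ℤ) = ((L[m].2 : ℕ) : ℤ) ∧
        μ' 11 (m : ℤ) = x L[m]) ∧
      ∀ z : ℤ, μ' xVec z = if ∃ v ∈ F.take j, z = (v.1 * t + v.2 : ℕ) then 0 else μ₁ xVec z)
          (by simpa using hF) ?_ ?_ ?_ ?_).post ?_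
  · intro μ' h'
    rw [eval, eval, h'.eq _, h.n_eq]
  · intro j μ' v h
    simpa using h
  · exact ⟨⟨[], by simp, by simp, by simp [h₁], by simp⟩, by simp⟩
  · rintro j hj μ₂ hf₂ hj₂ ⟨⟨L, l1, l2, l3, l4⟩, vec⟩
    set v := F[j] with hv
    have hget : F[j]? = some v := List.getElem?_eq_getElem hj
    have htake : F.take (j + 1) = F.take j ++ [v] := by
      rw [List.take_add_one, hget]; rfl
    obtain ⟨f1, f2, f3⟩ := h.list j v hget
    rw [← hf₂.eq xFi] at f1
    rw [← hf₂.eq xFq] at f2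
    rw [← hf₂.eq xFa] at f3
    -- an entry that has been listed before has been cleared
    have hval : μ₂ xVec (v.1 * t + v.2 : ℕ) = if v ∈ F.take j then 0 else x v := by
      rw [vec, h.vec]
      congr 1
      refine propext ⟨fun ⟨u, hu, e⟩ => ?_, fun hu => ⟨v, hu, rfl⟩⟩
      rwa [address_inj (by exact_mod_cast e : (v.1 * t + v.2 : ℕ) = u.1 * t + u.2)]
    set a : ℕ := v.1 * t + v.2
    have wr : ∀ z, emitP.run μ₂ xVec z = if z = a then 0 else μ₂ xVec z := by
      intro z
      by_cases c1 : μ₂ xVec a ≤ 0 <;> by_cases c2 : 0 ≤ μ₂ xVec a <;>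
      simp [emitP, run_seq, run_store, run_ite, run_skip, hj₂, f3,
        c1, c2, Function.update_apply]
    have vec' : ∀ z : ℤ, emitP.run μ₂ xVec z =
        if ∃ v ∈ F.take (j + 1), z = (v.1 * t + v.2 : ℕ) then 0 else μ₁ xVec z := by
      intro z
      rw [wr, htake, vec]
      by_cases e : z = a
      · rw [if_pos e, if_pos ⟨v, by simp, e⟩]
      · rw [if_neg e]
        congr 1
        refine propext ⟨fun ⟨u, hu, e'⟩ => ⟨u, List.mem_append_left _ hu, e'⟩,
            fun ⟨u, hu, e'⟩ => ?_⟩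
        rcases List.mem_append.mp hu with hu | hu
        · exact ⟨u, hu, e'⟩
        · rw [List.mem_singleton] at hu
          subst hu
          exact absurd e' e
    refine .block ⟨?_, fun z => (vec' z).trans (by congr)⟩
    have hne : ∀ m < L.length, (m : ℤ) ≠ L.length := fun m hm => by omega
    by_cases c : μ₂ xVec a = 0
    · refine ⟨L, l1, fun u => ?_, ?_, fun m hm => ?_⟩
      · rw [l2, htake]
        constructor
        · exact fun hu => ⟨hu.1, List.mem_append_left _ hu.2⟩
        · rintro ⟨h1, h2⟩
          refine ⟨h1, ?_⟩
          rcases List.mem_append.mp h2 with hu | hu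
          · exact hu
          · rw [List.mem_singleton] at hu
            subst hu
            rw [c] at hval
            by_contra h3
            rw [if_neg h3] at hval
            exact h1 hval.symm
      · simp [emitP, run_seq, run_store, run_ite, run_skip, hj₂, f3,
          c, l3]
      · obtain ⟨m1, m2, m3⟩ := l4 m hm
        have := hne m hm
        simp [emitP, run_seq, run_store, run_ite, run_skip, hj₂, f3,
          c, l3, m1, m2, m3, this]
    · have hnot : v ∉ F.take j := fun hc => c (by rw [hval, if_pos hc])
      have hxv : μ₂ xVec a = x v := by rw [hval, if_neg hnot]
      have key : ∀ b : ℕ, ∀ z : ℤ, b ∈ [8, 9, 10, 11] → emitP.run μ₂ b z =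
          if b = 8 then (if z = 0 then (L.length : ℤ) + 1 else μ₂ 8 z)
          else if z = L.length then (if b = 9 then ((v.1 : ℕ) : ℤ)
            else if b = 10 then ((v.2 : ℕ) : ℤ) else x v) else μ₂ b z := by
        intro b z hb
        simp only [List.mem_cons, List.not_mem_nil, or_false] at hb
        rw [hxv] at c
        rcases lt_or_gt_of_ne c with c' | c'
        · rcases hb with rfl | rfl | rfl | rfl <;>
          simp [emitP, run_seq, run_store, run_ite, hj₂,
            f1, f2, f3, c'.le, c'.not_ge, l3, hxv, Function.update_apply]
        · rcases hb with rfl | rfl | rfl | rfl <;>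
          simp [emitP, run_seq, run_store, run_ite, hj₂,
            f1, f2, f3, c'.not_ge, l3, hxv, Function.update_apply]
      refine ⟨L ++ [v], ?_, fun u => ?_, ?_, fun m hm => ?_⟩
      · rw [List.nodup_append]
        refine ⟨l1, by simp, ?_⟩
        rintro u hu w hw rfl
        rw [List.mem_singleton] at hw
        subst hw
        exact hnot ((l2 _).mp hu).2
      · rw [htake, List.mem_append, List.mem_append, l2]
        constructor
        · rintro (⟨h1, h2⟩ | h1)
          · exact ⟨h1, .inl h2⟩
          · refine ⟨?_, .inr h1⟩
            rw [List.mem_singleton.mp h1, ← hxv]; exact c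
        · rintro ⟨h1, h2 | h2⟩
          · exact .inl ⟨h1, h2⟩
          · exact .inr h2
      · rw [key 8 0 (by simp)]; simp
      · rw [key 9 _ (by simp), key 10 _ (by simp), key 11 _ (by simp)]
        rw [List.length_append, List.length_singleton] at hm
        rcases Nat.lt_succ_iff_lt_or_eq.mp hm with h1 | rfl
        · have := hne m h1
          rw [List.getElem_append_left h1]
          simpa [this] using l4 m h1
        · simp
  · rintro μ' - ⟨⟨L, l1, l2, l3, l4⟩, vec⟩
    rw [List.take_length] at vec
    refine ⟨⟨L, l1, fun v => ?_, l3, l4⟩, fun z => ?_⟩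
    · rw [l2, List.take_length]
      exact ⟨fun h => h.1, fun h' => ⟨h', h.mem v h'⟩⟩
    · rw [vec]
      split_ifs with hc
      · rfl
      · push Not at hc
        exact h.zero z hc

/-! ### The final solution -/

/-- Lists the units of the chosen options and adds them up. -/
def flattenP : RamProg :=
  setR xFn (.lit 0) ;;
  forP xAl (rg xCc)
    ((setR xFw (.load xOw (.load xCl (rg xAl)) - .lit 1) ;;
      setR xZz (.load xIv (rg xFw) + .load xOy (.load xCl (rg xAl)))) ;;
    mulP xMu xMc (rg xZz) (.load xPar (.lit 4)) ;;
    forP xCp (.load xSn (rg xZz)) (setR xPp (.load xSol (rg xMu + rg xCp)) ;; (appendP ;; addP)))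

theorem flattenP_runs (hD : D.OK I Q) (hst : D.StaticAt I μ) (htab : TablesAt D n k tab μ)
    (hvec : ∀ z, μ xVec z = 0) {cs : List (ℕ × ℕ)} (hcs : ChosenAt cs μ) (hlen : cs.length ≤ Q)
    (hV₂ : 1 ≤ D.V₂)
    (hc : ∀ c ∈ cs, c.2 < n ∧ (∃ x, tab c.2 (c.1 % D.V₂) = some x) ∧
      μ xOw (c.1 : ℤ) = c.2 + 1 ∧ μ xOy (c.1 : ℤ) = (c.1 % D.V₂ : ℕ))
    (hU : ∀ u ∈ unitsOf D.V₂ tab cs, u.1 < n ∧ u.2 < 2 * t) :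
    Runs flattenP μ (Q ^ 10) fun μ' => ∃ F,
      F.length = (unitsOf D.V₂ tab cs).length ∧
        FlatAt F (vecOf t n (unitsOf D.V₂ tab cs)) μ' := by
  refine Runs.seqQ (R' := fun μ' => μ' xFn 0 = 0) (.block (by simp [run])) fun μ₁ hf₁ h₁ => ?_
  have hst₁ := hst.congr hf₁.agree
  have htab₁ := htab.congr hf₁.agree
  refine (Runs.forQ (N := cs.length) (e := 7) 1 (fun j μ' => ∃ F,
      F.length = (unitsOf D.V₂ tab (cs.take j)).length ∧
        FlatAt F (vecOf t n (unitsOf D.V₂ tab (cs.take j))) μ') (by simpa using hlen) ?_ ?_ ?_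
            ?_).post ?_
  · intro μ' h'
    rw [eval, eval, h'.eq _, hf₁.eq _, hcs.1]
  · rintro j μ' v ⟨F, h1, h2⟩
    exact ⟨F, h1, h2.congr fun a ha => by rw [RamMemory.write_of_ne]; revert a; decide⟩
  · refine ⟨[], by simp [unitsOf], by simp [h₁], by simp, ?_, ?_, ?_⟩
    · simp [unitsOf, vecOf]
    · intro v
      rw [hf₁.eq _, hvec]
      simp [unitsOf, vecOf]
    · intro z _
      rw [hf₁.eq _, hvec]
  · rintro j hj μ₂ hf₂ hj₂ ⟨F, hF, flat⟩
    have hst₂ := hst₁.congr (Agree.of_loop hf₂)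
    have htab₂ := htab₁.congr (Agree.of_loop hf₂)
    set c := cs[j] with hcd
    have hget : cs[j]? = some c := List.getElem?_eq_getElem hj
    obtain ⟨c1, ⟨⟨ms, g⟩, c2⟩, c3, c4⟩ := hc c (List.getElem_mem hj)
    have hunits : unitsOf D.V₂ tab (cs.take (j + 1)) =
        unitsOf D.V₂ tab (cs.take j) ++ ms.map fun p => (c.2, p) := by
      rw [List.take_add_one, hget]
      simp [unitsOf, c2]
    have hms : ∀ p ∈ ms, p < 2 * t := fun p hp => (hU (c.2, p) (by
      refine List.mem_flatMap.mpr ⟨c, List.getElem_mem hj, ?_⟩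
      rw [c2]
      exact List.mem_map.mpr ⟨p, hp, rfl⟩)).2
    set z := c.2 * D.V₂ + c.1 % D.V₂ with hz
    have hent := htab₂ c.2 c1 (c.1 % D.V₂) (Nat.mod_lt _ hV₂)
    rw [c2] at hent
    obtain ⟨-, -, e3, e4, e5⟩ := hent
    rw [← hz] at e3 e5
    refine Runs.seqQ (R' := fun μ' => μ' xFw 0 = c.2 ∧ μ' xZz 0 = z)
      (.block ?_) ?_
    · have h1 : μ₂ xCl j = c.1 := by
        rw [hf₂.eq _, hf₁.eq _]; exact hcs.2 j c hget
      have h2 := hst₂.iv_eq c.2 c1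
      rw [← hf₁.eq xOw, ← hf₂.eq xOw] at c3
      rw [← hf₁.eq xOy, ← hf₂.eq xOy] at c4
      exact ⟨by simp [run, hj₂, h1, c3], by simp [run, hj₂, h1, c3, c4, h2, hz]⟩
    rintro μ₃ hf₃ ⟨w3, z3⟩
    have hst₃ := hst₂.congr hf₃.agree
    have hkQ : k ≤ Q := (Nat.le_self_pow (by norm_num) k).trans hD.k_le
    refine Runs.seqQ (.up (Runs.mulP 1 (c := z) (N := k) (by simp [z3]) (by simp [hst₃.k_eq])
      (by simpa using hkQ))) ?_
    intro μ₄ hf₄ m4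
    have hst₄ := hst₃.congr hf₄.agree
    refine (Runs.forQ (N := ms.length) (e := 3) 1 (fun l μ' => ∃ F, F.length =
        (unitsOf D.V₂ tab (cs.take j) ++ (ms.take l).map fun p => (c.2, p)).length ∧
        FlatAt F (vecOf t n (unitsOf D.V₂ tab (cs.take j) ++
          (ms.take l).map fun p => (c.2, p))) μ') (by rw [pow_one]; exact e4.trans hkQ) ?_ ?_ ?_
              ?_).post ?_
    · intro μ' h'
      simp only [eval]
      rw [h'.eq xZz, h'.eq xSn, hf₄.eq xZz, z3,
        hf₄.eq xSn, hf₃.eq xSn, e3]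
    · rintro j μ' v ⟨F, h1, h2⟩
      exact ⟨F, h1, h2.congr fun a ha => by rw [RamMemory.write_of_ne]; revert a; decide⟩
    · refine ⟨F, by simpa using hF, ?_⟩
      simpa using (flat.congr hf₃.agree).congr hf₄.agree
    · rintro l hl μ₅ hf₅ hl₅ ⟨F', hF', flat'⟩
      have hst₅ := hst₄.congr (Agree.of_loop hf₅)
      have hget' : ms[l]? = some ms[l] := List.getElem?_eq_getElem hl
      refine Runs.seqQ (R' := fun μ' => μ' xPp 0 = ms[l])
        (.block ?_) ?_
      · have h1 := e5 l _ hget'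
        rw [← hf₃.eq xSol, ← hf₄.eq xSol,
          ← hf₅.eq xSol] at h1
        rw [← hf₅.eq xMu] at m4
        push_cast at h1
        simp [run, m4, hl₅, h1]
      intro μ₆ hf₆ p6
      have := appendP_runs (Q := Q) (hst₅.congr hf₆.agree)
        (flat'.congr hf₆.agree) c1 (hms _ (List.getElem_mem hl))
        (by rw [hf₆.eq _, hf₅.eq _, hf₄.eq _, w3]) p6 hF'
      refine this.post fun μ' _ h => ?_
      have e : ms.take (l + 1) = ms.take l ++ [ms[l]] := by rw [List.take_add_one, hget']; rfl
      simp only [e, List.map_append, List.map_cons, List.map_nil, ← List.append_assoc]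
      exact h
    · rintro μ' - h
      rw [hunits]
      simpa using h
  · rintro μ' - h
    simpa using h

/-- Computes a best step from the merge trees over the bricks. -/
def finalP : RamProg :=
  fillSetsP ;; (setR xS (rg xKk) ;; setR xO (rg xVv)) ;; knapP ;; bestP ;;
  (setR xU (rg xBst)) ;; traceP ;; flattenP ;; outputP

theorem KPath.empty {valid : ℤ → Prop} {O : ℕ} {opt : ℕ → Option (ℕ × ℤ)} {sh : ℕ → ℤ} (S : ℕ) :
    KPath valid O opt sh S 0 0 [] := by
  induction S with
  | zero => exact .nil
  | succ S ih => exact .skip ih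

theorem finalP_runs (hD : D.OK I Q) (hst : D.StaticAt I μ) (htab : TablesAt D n k tab μ)
    (hok : ∀ i < n, TabOK (D.brick I b i) D.V₂ D.vl₂ (tab i))
    (hT : SetTreesAt n (k ^ 2 * D.V₂) (D.setLf I tab) μ) (hvec : ∀ z, μ xVec z = 0) :
    Runs finalP μ (Q ^ 23) fun μ' => (∃ x, I.IsBestStep b x ∧ μ'.Shows x) ∧
      ∀ z, μ' xVec z = 0 := by
  have hk := hD.k_pos
  have hz : InBox (codeBase (r + s) k D.δ) (r + s) r (k ^ 3 : ℕ) (k ^ 3 * D.δ : ℕ)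
    (digitBound (r + s) k D.δ) 0 := inBox_zero (by positivity) (by positivity) (by positivity)
  have hV₂ : 1 ≤ D.V₂ := by
    obtain ⟨y, hy, -⟩ := (hD.lists.mem₂ 0).mpr (inBox_zero (by positivity) (by positivity) le_rfl)
    omega
  have hkk : k ^ 2 ≤ Q ^ 2 := hD.kk_le.trans (Nat.le_self_pow (by norm_num) Q)
  have hP : ∀ i : Fin n, I.setOf i = (I.P i : ℕ) := fun i => by
    simp [NFoldInstance.setOf]
  set opt := setOpt n I.setOf D.V₂ tab with hopt
  set sh : ℕ → ℤ := fun c => D.vl₂ (c % D.V₂) with hsh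
  unfold finalP
  refine Runs.seqQ ((fillSetsP_runs hD hst hT).up) fun μ₁ hf₁ h₁ => ?_
  have hst₁ := hst.congr hf₁.agree
  refine Runs.seqQ (R' := KnapIn D.V D.V₂ (k ^ 2) opt sh D.vl)
    (.block ?_) ?_
  · have := h₁.opts
    constructor
    · simp [run, hst₁.V_eq]
    · simp [run, hst₁.V₂_eq]
    · simp [run, hst₁.kk_eq]
    · simpa [run] using hst₁.states
    · simpa [run, OptsAt] using this
  intro μ₂ hf₂ h₂
  have hst₂ := hst₁.congr hf₂.agree
  refine Runs.seqQ ((knapP_runs hD.V_le hD.V₂_le hkk ((hD.lists.mem 0).mpr hz) h₂).up) ?_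
  rintro μ₃ hf₃ ⟨hK, hsrc⟩
  have hst₃ := hst₂.congr hf₃.agree
  have h₃ := h₂.congr hf₃.agree
  have comp : ∀ {z g : ℤ} {cs : List (ℕ × ℕ)}, KPath (InBox (codeBase (r + s) k D.δ) (r + s) r
      (k ^ 3 : ℕ) (k ^ 3 * D.δ : ℕ) (digitBound (r + s) k D.δ)) D.V₂ opt sh (k ^ 2) z g cs →
      ∃ y < D.V, D.vl y = z ∧ 1 ≤ μ₃ xCh (k ^ 2 * D.V + y : ℕ) ∧
        g ≤ μ₃ xVt (k ^ 2 * D.V + y : ℕ) :=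
    fun hp => hK.complete (fun z => (hD.lists.mem z).mpr) hz le_rfl hp
  obtain ⟨y₀, hy₀, v₀, ch₀, -⟩ := comp (.empty _)
  refine Runs.seqQ ((bestP_runs hD hst₃ hsrc ⟨y₀, hy₀, v₀, ch₀⟩).up) ?_
  rintro μ₄ hf₄ ⟨y, hy, b1, ⟨y₃, hy₃, b2⟩, b3, b4⟩
  have hst₄ := hst₃.congr hf₄.agree
  refine Runs.seqQ (R' := fun μ' => μ' xU 0 = y) (.block (by simp [run, b1])) fun μ₅ hf₅ u5 => ?_
  have hst₅ := hst₄.congr hf₅.agree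
  rw [← hf₄.eq xCh, ← hf₅.eq xCh] at hK b3
  rw [← hf₄.eq xVt, ← hf₅.eq xVt] at hK
  refine Runs.seqQ ((traceP_runs (valid := InBox (codeBase (r + s) k D.δ) (r + s) r
    (k ^ 3 : ℕ) (k ^ 3 * D.δ : ℕ) (digitBound (r + s) k D.δ)) hkk
    ((h₃.congr hf₄.agree).congr hf₅.agree) hK
    (by rw [hf₅.eq _, hf₄.eq _, hsrc]) u5 hy b3
    fun y hy => (hD.lists.mem _).mp ⟨y, hy, rfl⟩).up) ?_
  rintro μ₆ hf₆ ⟨cs, hp, hcs⟩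
  obtain ⟨x1, x2, x3⟩ := NFoldInstance.path_isStep hD.n_pos hP hok hp
    ((hD.lists.mem₃ _).mp ⟨y₃, hy₃, b2.symm⟩)
  set U := unitsOf D.V₂ tab cs with hU
  -- what memory and tables say about the chosen options
  have hc : ∀ c ∈ cs, c.2 < n ∧ (∃ x, tab c.2 (c.1 % D.V₂) = some x) ∧
      μ₆ xOw (c.1 : ℤ) = c.2 + 1 ∧ μ₆ xOy (c.1 : ℤ) = (c.1 % D.V₂ : ℕ) := by
    intro c hc
    obtain ⟨σ, hσ, o, ho, hc1, g', ho'⟩ := hp.mem_opt c hc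
    have hlt : c.1 < k ^ 2 * D.V₂ := by rw [hc1]; exact index_lt hσ ho
    obtain ⟨i1, -, ms, i2⟩ := NFoldInstance.setOpt_some hD.n_pos ho'
    refine ⟨i1, ⟨_, i2⟩, ?_, ?_⟩
    · have := (h₃.opts c.1 hlt).1
      rw [ho'] at this
      rw [hf₆.eq _, hf₅.eq _, hf₄.eq _]
      exact this.1
    · rw [hf₆.eq _, hf₅.eq _, hf₄.eq _, hf₃.eq _,
        hf₂.eq _]
      exact h₁.mod_eq _ hlt
  have hUlen : U.length ≤ Q := by
    have h1 : U.length ≤ cs.length * k := by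
      rw [hU, unitsOf, List.length_flatMap, ← smul_eq_mul]
      refine (List.sum_le_card_nsmul _ k ?_).trans (by simp)
      simp only [List.mem_map, forall_exists_index, and_imp]
      rintro _ c hcm rfl
      obtain ⟨i1, ⟨⟨ms, g⟩, i2⟩, -⟩ := hc c hcm
      have := htab c.2 i1 (c.1 % D.V₂) (Nat.mod_lt _ hV₂)
      rw [i2] at this ⊢
      simpa using this.2.2.2.1
    calc U.length ≤ cs.length * k := h1
      _ ≤ k ^ 2 * k := Nat.mul_le_mul_right _ hp.length_le
      _ = k ^ 3 := by ring
      _ ≤ Q := hD.k_le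
  have htab₆ := ((((((htab.congr hf₁.agree).congr hf₂.agree).congr
    hf₃.agree).congr hf₄.agree).congr hf₅.agree).congr
    hf₆.agree)
  refine Runs.seqQ ((flattenP_runs hD (hst₅.congr hf₆.agree) htab₆ ?_ hcs
    (hp.length_le.trans hD.kk_le) hV₂ hc x3).up) ?_
  · intro z
    rw [hf₆.eq _, hf₅.eq _, hf₄.eq _, hf₃.eq _,
      hf₂.eq _, hf₁.eq _, hvec]
  rintro μ₇ hf₇ ⟨F, hF, flat⟩
  refine ((outputP_runs flat (hF.le.trans hUlen)).up).post ?_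
  rintro μ₈ - ⟨o1, o2⟩
  refine ⟨⟨_, ⟨x1, fun x hx => ?_⟩, o1⟩, o2⟩
  obtain ⟨z, g, cs', hp', hz', hg⟩ := NFoldInstance.isStep_path hD.entries hD.lists hP hok hx
  obtain ⟨y', hy', v', ch', g'⟩ := comp hp'
  obtain ⟨y'', hy'', v''⟩ := (hD.lists.mem₃ z).mpr hz'
  have := b4 y' hy' ⟨y'', hy'', by rw [v', v'']⟩ ch'
  rw [x2, hf₅.eq _, hf₄.eq _]
  linarith

end Final

/-! ### The update -/

/-- The memory between two runs of the update program, when the bounds are `b`. -/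
structure Setup.Ready {n r s t k : ℕ} (D : Setup) (I : NFoldInstance n r s t k)
    (b : StepBounds n t) (μ : RamMemory) : Prop where
  static : D.StaticAt I μ
  bounds : BoundsAt b μ
  trees : D.TreesAt n t k (fun i y => (D.brick I b i).leaf (D.vl y)) μ
  tables : ∃ tab, TablesAt D n k tab μ ∧
    (∀ i < n, TabOK (D.brick I b i) D.V₂ D.vl₂ (tab i)) ∧
    SetTreesAt n (k ^ 2 * D.V₂) (D.setLf I tab) μ
  vec : ∀ z, μ xVec z = 0

/-- Stores the announced bounds. -/
def readP : RamProg :=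
  setR xBi (.load 7 (.lit 0)) ;; setR xPq (.load 7 (.lit 1)) ;;
  setR xAd (.load xIt (rg xBi) + rg xPq) ;;
  .store 5 (rg xAd) (.load 7 (.lit 2)) ;; .store 6 (rg xAd) (.load 7 (.lit 3))

/-- The update program. -/
def updP : RamProg := readP ;; updateUnitsP ;; brickTableP ;; updateSetsP ;; finalP

section Update

variable {n r s t k Q : ℕ} [hQ : Fact (1024 ≤ Q)] {D : Setup} {I : NFoldInstance n r s t k}
  {b : StepBounds n t} {μ : RamMemory}

theorem brick_congr {b' : StepBounds n t} {i : ℕ}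
    (h : ∀ v : Fin n × Fin t, (v.1 : ℕ) = i → b'.lo v = b.lo v ∧ b'.up v = b.up v) :
    D.brick I b' i = D.brick I b i := by
  have : capOf b' i = capOf b i := by
    funext p
    unfold capOf
    split_ifs with h1 h2 h3
    · rw [(h _ rfl).2]
    · rw [(h _ rfl).1]
    · rfl
    · rfl
  simp only [Setup.brick, NFoldInstance.brick, this]

/-- A run of the update program shows a best step for the new bounds, and restores the invariant. -/
theorem updP_runs (hD : D.OK I Q) (h : D.Ready I b μ) (w : BoundChange n t) :
    Runs updP (μ.announce w) (Q ^ 27 * (Nat.log 2 (n * t) + 1)) fun μ' =>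
      (∃ x, I.IsBestStep (b.change w) x ∧ μ'.Shows x) ∧ D.Ready I (b.change w) μ' := by
  obtain ⟨hst, hb, htr, ⟨tab, htab, hok, hset⟩, hvec⟩ := h
  set i := w.var.1 with hi
  set q := w.var.2 with hq
  set X := Nat.log 2 (n * t) + 1 with hXd
  have hX : 1 ≤ X := by omega
  have hn := hD.n_pos
  have ht := hD.t_pos
  have hQ1 := one_le_of_fact Q
  have hQ2 := hQ.out
  have hlt : Nat.log 2 (2 * t) + 1 ≤ 2 * X := by
    have h1 : Nat.log 2 (2 * t) = Nat.log 2 t + 1 := by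
      rw [Nat.mul_comm, Nat.log_mul_base (by norm_num) (by omega)]
    have h2 : Nat.log 2 t ≤ Nat.log 2 (n * t) :=
      Nat.log_mono_right (Nat.le_mul_of_pos_left t hn)
    omega
  have hln : Nat.log 2 n + 1 ≤ X := by
    have h2 : Nat.log 2 n ≤ Nat.log 2 (n * t) :=
      Nat.log_mono_right (Nat.le_mul_of_pos_right n ht)
    omega
  have hbb : ∀ v, v ≠ (i, q) → (b.change w).lo v = b.lo v ∧ (b.change w).up v = b.up v := by
    intro v hv
    exact ⟨Function.update_of_ne hv _ _, Function.update_of_ne hv _ _⟩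
  have ann : ∀ a, a ≠ 7 → μ.announce w a = μ a := fun a ha => by
    unfold RamMemory.announce
    rw [RamMemory.write_of_ne _ _ _ ha, RamMemory.write_of_ne _ _ _ ha,
      RamMemory.write_of_ne _ _ _ ha, RamMemory.write_of_ne _ _ _ ha]
  have a0 : μ.announce w 7 0 = i := by simp [RamMemory.announce, hi]
  have a1 : μ.announce w 7 1 = q := by simp [RamMemory.announce, hq]
  have a2 : μ.announce w 7 2 = w.lo := by simp [RamMemory.announce]
  have a3 : μ.announce w 7 3 = w.up := by simp [RamMemory.announce]
  generalize μ.announce w = μ₀ at *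
  have hst₀ : D.StaticAt I μ₀ := hst.congr fun a ha => ann a (by revert a; decide)
  have hb₀ : BoundsAt b μ₀ := hb.congr fun a ha => ann a (by revert a; decide)
  unfold updP
  refine Runs.seqX (R' := fun μ' => μ' xBi 0 = (i : ℕ) ∧ μ' xPq 0 = (q : ℕ) ∧
    BoundsAt (b.change w) μ') (.blockX hX ?_) ?_
  · have hit := hst₀.it_eq i i.2
    refine ⟨by simp [readP, run, a0], by simp [readP, run, a1], ?_, ?_⟩
    · intro i' q'
      have h1 := hb₀.lo_eq i' q'
      by_cases e : (i', q') = (i, q)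
      · obtain ⟨rfl, rfl⟩ := Prod.mk.inj e
        have : (b.change w).lo (i, q) = w.lo := Function.update_self _ _ _
        rw [this]
        simp [readP, run, a0, a1, a2, hit]
      · rw [(hbb _ e).1, ← h1]
        have : (i' : ℤ) * t + q' ≠ i * t + q := fun h' =>
          e (address_inj (v := (i', q')) (w := (i, q)) (by exact_mod_cast h'))
        simp [readP, run, a0, a1, hit, this]
    · intro i' q'
      have h1 := hb₀.up_eq i' q'
      by_cases e : (i', q') = (i, q)
      · obtain ⟨rfl, rfl⟩ := Prod.mk.inj e
        have : (b.change w).up (i, q) = w.up := Function.update_self _ _ _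
        rw [this]
        simp [readP, run, a0, a1, a3, hit]
      · rw [(hbb _ e).2, ← h1]
        have : (i' : ℤ) * t + q' ≠ i * t + q := fun h' =>
          e (address_inj (v := (i', q')) (w := (i, q)) (by exact_mod_cast h'))
        simp [readP, run, a0, a1, hit, this]
  rintro μ₁ hf₁ ⟨i1, q1, b1⟩
  have hst₁ := hst₀.congr hf₁.agree
  have win₁ : μ₁ xWin = μ xWin := by rw [hf₁.eq _, ann _ (by decide)]
  have val₁ : μ₁ xVal = μ xVal := by rw [hf₁.eq _, ann _ (by decide)]
  have tr₁ : D.TreesAt n t k (fun i y => (D.brick I b i).leaf (D.vl y)) μ₁ := by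
    unfold Setup.TreesAt
    rw [win₁, val₁]; exact htr
  refine Runs.seqX ((updateUnitsP_runs hD hst₁ b1 i q i1 q1 tr₁ hbb).mono
    (T₂ := Q ^ 25 * X) ?_ fun _ _ h => h) ?_
  · calc Q ^ 19 * (Nat.log 2 (2 * t) + 1) ≤ Q ^ 19 * (2 * X) := Nat.mul_le_mul_left _ hlt
      _ ≤ Q ^ 19 * (Q * X) := Nat.mul_le_mul_left _ (Nat.mul_le_mul_right _ (by omega))
      _ = Q ^ 20 * X := by ring
      _ ≤ Q ^ 25 * X := Nat.mul_le_mul_right _ (Nat.pow_le_pow_right hQ1 (by norm_num))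
  rintro μ₂ hf₂ ⟨tr₂, neg₂⟩
  have hst₂ := hst₁.congr hf₂.agree
  have b2 := b1.congr hf₂.agree
  have i2 : μ₂ xBi 0 = (i : ℕ) := by rw [hf₂.eq _, i1]
  have set₂ : SetTreesAt n (k ^ 2 * D.V₂) (D.setLf I tab) μ₂ := fun g hg =>
    (hset g hg).congr fun z h1 h2 => by
      obtain ⟨e1, e2⟩ := neg₂ z (setAd_neg (n := n) ⟨h1, h2⟩)
      rw [e1, e2, win₁, val₁]
      exact ⟨rfl, rfl⟩
  have htab₂ : TablesAt D n k tab μ₂ := htab.congr fun a ha => by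
    rw [hf₂ a (by revert a; decide), hf₁ a (by revert a; decide), ann a (by revert a; decide)]
  refine Runs.seqX ((brickTableP_runs hD hst₂ i.2 i2 (tr₂ i i.2)).raise hX)
    ?_
  rintro μ₃ hf₃ ⟨tb, tb1, tb2, tb3⟩
  have hst₃ := hst₂.congr hf₃.agree
  have b3 := b2.congr hf₃.agree
  have htab₃ : TablesAt D n k (Function.update tab i tb) μ₃ :=
    htab₂.update tb2 tb3 fun i' h _ => h
  have set₃ : SetTreesAt n (k ^ 2 * D.V₂) (D.setLf I tab) μ₃ := by
    unfold SetTreesAt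
    rw [hf₃.eq _, hf₃.eq _]; exact set₂
  have hok₃ : ∀ i' < n, TabOK (D.brick I (b.change w) i') D.V₂ D.vl₂
      (Function.update tab i tb i') := by
    intro i' hi'
    by_cases e : i' = i
    · rw [e, Function.update_self]; exact tb1
    · rw [Function.update_of_ne e, brick_congr fun v hv => hbb v fun h => e (by rw [← hv, h])]
      exact hok i' hi'
  refine Runs.seqX ((updateSetsP_runs hD hst₃ i.2 (by rw [hf₃.eq _, i2]) set₃
    tb2).mono (T₂ := Q ^ 23 * X) ?_ fun _ _ h => h) ?_
  · exact Nat.mul_le_mul (Nat.pow_le_pow_right hQ1 (by norm_num)) hln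
  rintro μ₄ hf₄ ⟨set₄, pos₄⟩
  have hst₄ := hst₃.congr hf₄.agree
  have tr₄ : D.TreesAt n t k (fun i y => (D.brick I (b.change w) i).leaf (D.vl y)) μ₄ :=
    fun i' hi' y hy => (tr₂ i' hi' y hy).congr fun z h1 _ => by
      obtain ⟨e1, e2⟩ := pos₄ z (le_trans (by positivity) h1)
      rw [e1, e2, hf₃.eq _, hf₃.eq _]
      exact ⟨rfl, rfl⟩
  have htab₄ := htab₃.congr hf₄.agree
  refine ((finalP_runs hD hst₄ htab₄ hok₃ set₄ fun z => ?_).raise hX).post ?_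
  · rw [hf₄.eq _, hf₃.eq _, hf₂.eq _, hf₁.eq _,
      ann _ (by decide), hvec]
  rintro μ₅ hf₅ ⟨best, vec⟩
  refine ⟨best, hst₄.congr hf₅.agree,
    (b3.congr hf₄.agree).congr hf₅.agree, ?_,
    ⟨_, htab₄.congr hf₅.agree, hok₃, ?_⟩, vec⟩
  · unfold Setup.TreesAt
    rw [hf₅.eq _, hf₅.eq _]; exact tr₄
  · unfold SetTreesAt
    rw [hf₅.eq _, hf₅.eq _]; exact set₄

theorem maintains_of_ready {T : ℕ} (hD : D.OK I Q) (hT : Q ^ 27 * (Nat.log 2 (n * t) + 1) ≤ T)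
    (ws : List (BoundChange n t)) :
    ∀ {b : StepBounds n t} {μ : RamMemory}, D.Ready I b μ → I.Maintains updP T b μ ws := by
  induction ws with
  | nil => exact fun _ => trivial
  | cons w ws ih =>
    intro b μ h
    obtain ⟨T', μ', hexec, hle, best, ready⟩ := updP_runs hD h w
    exact ⟨T', μ', hexec, hle.trans hT, best, ih ready⟩

end Update

/-! ### The lists of states -/

notation "xRx" => (102 : ℕ)
notation "xTp" => (101 : ℕ)
notation "xGe" => (103 : ℕ)
notation "xGs" => (104 : ℕ)
notation "xCk" => (105 : ℕ)
notation "xCr" => (106 : ℕ)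
notation "xAc" => (107 : ℕ)
notation "xGa" => (108 : ℕ)
notation "xGb" => (109 : ℕ)
notation "xGc" => (110 : ℕ)

/-- Appends a digit between `-R` and `R` to the numbers in a list, in base `M`. -/
def levelList (M : ℤ) (R : ℕ) (l : List ℤ) : List ℤ :=
  l.flatMap fun e => (List.range (2 * R + 1)).map fun x : ℕ => e * M - R + x

/-- The codes with top digit at most `N₀` and further digits bounded by `ρ`. -/
def stateList (M : ℤ) (N₀ : ℕ) (ρ : ℕ → ℕ) : ℕ → List ℤ
  | 0 => (List.range (N₀ + 1)).map fun x : ℕ => (x : ℤ)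
  | l + 1 => levelList M (ρ l) (stateList M N₀ ρ l)

section

variable {M : ℤ} {N₀ : ℕ} {ρ : ℕ → ℕ}

theorem mem_levelList {R : ℕ} {l : List ℤ} {z : ℤ} :
    z ∈ levelList M R l ↔ ∃ e ∈ l, ∃ x : ℤ, |x| ≤ R ∧ z = e * M + x := by
  simp only [levelList, List.mem_flatMap, List.mem_map, List.mem_range]
  refine exists_congr fun e => and_congr_right fun _ => ⟨?_, ?_⟩
  · rintro ⟨x, hx, rfl⟩
    exact ⟨x - R, abs_le.mpr ⟨by omega, by omega⟩, by ring⟩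
  · rintro ⟨x, hx, rfl⟩
    obtain ⟨h1, h2⟩ := abs_le.mp hx
    exact ⟨(x + R).toNat, by omega, by rw [Int.toNat_of_nonneg (by omega)]; ring⟩

theorem mem_stateList {l : ℕ} {z : ℤ} : z ∈ stateList M N₀ ρ l ↔ ∃ (N : ℤ) (d : ℕ → ℤ),
    0 ≤ N ∧ N ≤ N₀ ∧ (∀ i < l, |d i| ≤ ρ i) ∧ z = code M N d l := by
  induction l generalizing z with
  | zero =>
    simp only [stateList, List.mem_map, List.mem_range, code]
    constructor
    · rintro ⟨x, hx, rfl⟩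
      exact ⟨x, fun _ => 0, by omega, by omega, by simp, rfl⟩
    · rintro ⟨N, d, h1, h2, -, rfl⟩
      exact ⟨_, (show Int.toNat _ < _ by omega), Int.toNat_of_nonneg h1⟩
  | succ l ih =>
    rw [stateList, mem_levelList]
    constructor
    · rintro ⟨e, he, x, hx, rfl⟩
      obtain ⟨N, d, h1, h2, h3, rfl⟩ := ih.mp he
      refine ⟨N, Function.update d l x, h1, h2, fun i hi => ?_, ?_⟩
      · rcases Nat.lt_succ_iff_lt_or_eq.mp hi with h | rfl
        · rw [Function.update_of_ne (by omega)]; exact h3 i h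
        · simpa using hx
      · rw [code, Function.update_self, code_congr (d := Function.update d l x) (d' := d)
          fun i hi => Function.update_of_ne hi.ne _ _]
    · rintro ⟨N, d, h1, h2, h3, rfl⟩
      exact ⟨_, ih.mpr ⟨N, d, h1, h2, fun i hi => h3 i (by omega), rfl⟩, d l, h3 l (by omega), rfl⟩

theorem nodup_levelList {R : ℕ} {l : List ℤ} (hl : l.Nodup) (hM : 2 * (R : ℤ) < M) :
    (levelList M R l).Nodup := by
  rw [levelList, List.nodup_flatMap]
  refine ⟨fun e _ => (List.nodup_range).map fun x y h => by simpa using h, hl.imp ?_⟩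
  intro e e' hne
  rw [Function.onFun, List.disjoint_left]
  simp only [List.mem_map, List.mem_range]
  rintro _ ⟨x, hx, rfl⟩ ⟨x', hx', h⟩
  have h1 : (e - e') * M = x' - x := by linear_combination -h
  rcases lt_or_gt_of_ne hne with h2 | h2
  · nlinarith
  · nlinarith

theorem nodup_stateList {l : ℕ} (hM : ∀ i < l, 2 * (ρ i : ℤ) < M) :
    (stateList M N₀ ρ l).Nodup := by
  induction l with
  | zero => exact List.nodup_range.map fun x y h => by simpa using h
  | succ l ih => exact nodup_levelList (ih fun i hi => hM i (by omega)) (hM l (by omega))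

theorem length_stateList (l : ℕ) : (stateList M N₀ ρ l).length =
    (N₀ + 1) * ∏ i ∈ Finset.range l, (2 * ρ i + 1) := by
  induction l with
  | zero => simp [stateList]
  | succ l ih =>
    rw [stateList, levelList, List.length_flatMap, Finset.prod_range_succ, ← mul_assoc, ← ih]
    simp

theorem length_stateList_le {l l' : ℕ} (h : l ≤ l') :
    (stateList M N₀ ρ l).length ≤ (stateList M N₀ ρ l').length := by
  rw [length_stateList, length_stateList]
  exact Nat.mul_le_mul_left _ (Finset.prod_le_prod_of_subset_of_one_le'
    (Finset.range_mono h) fun _ _ _ => by omega)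

end

/-- The bound on digit `i`: `R₁` for the first `r` digits, and `R₂` for the others. -/
def digitRange (r R₁ R₂ i : ℕ) : ℕ := if i < r then R₁ else R₂

/-- The parameters that belong to the bound `δ` on the entries. -/
def setupOf (r s k δ : ℕ) : Setup where
  δ := δ
  V := (stateList (codeBase (r + s) k δ) (k ^ 3)
    (digitRange r (k ^ 3 * δ) (digitBound (r + s) k δ)) (r + s)).length
  V₂ := (stateList (codeBase (r + s) k δ) k (digitRange r (k ^ 3 * δ) 0) (r + s)).length
  V₃ := (stateList (codeBase (r + s) k δ) (k ^ 3) (digitRange r 0 0) (r + s)).length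
  vl y := ((stateList (codeBase (r + s) k δ) (k ^ 3)
    (digitRange r (k ^ 3 * δ) (digitBound (r + s) k δ)) (r + s))[y]?).getD 0
  vl₂ y := ((stateList (codeBase (r + s) k δ) k (digitRange r (k ^ 3 * δ) 0) (r + s))[y]?).getD 0
  vl₃ y := ((stateList (codeBase (r + s) k δ) (k ^ 3) (digitRange r 0 0) (r + s))[y]?).getD 0

theorem mem_iff_getD {l : List ℤ} {z : ℤ} : (∃ y < l.length, (l[y]?).getD 0 = z) ↔ z ∈ l := by
  rw [List.mem_iff_getElem]
  refine exists_congr fun y => ⟨fun ⟨h, e⟩ => ⟨h, by simpa [h] using e⟩,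
    fun ⟨h, e⟩ => ⟨h, by simpa [h] using e⟩⟩

theorem mem_stateList_inBox {M : ℤ} {N₀ R₁ R₂ r s : ℕ} {z : ℤ} :
    z ∈ stateList M N₀ (digitRange r R₁ R₂) (r + s) ↔ InBox M (r + s) r N₀ R₁ R₂ z := by
  rw [mem_stateList]
  refine exists_congr fun N => exists_congr fun d => and_congr_right fun _ =>
    and_congr_right fun _ => ?_
  rw [← and_assoc]
  refine and_congr_left fun _ => ⟨fun h => ⟨fun i hi => ?_, fun i h1 h2 => ?_⟩, fun h i hi => ?_⟩
  · simpa [digitRange, hi] using h i (by omega)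
  · simpa [digitRange, h1.not_gt] using h i h2
  · by_cases hr : i < r
    · simpa [digitRange, hr] using h.1 i hr
    · simpa [digitRange, hr] using h.2 i (by omega) hi

theorem setupOf_lists (r s k δ : ℕ) : StateLists r s k δ (setupOf r s k δ).V
    (setupOf r s k δ).V₂ (setupOf r s k δ).V₃ (setupOf r s k δ).vl (setupOf r s k δ).vl₂
    (setupOf r s k δ).vl₃ where
  inj y hy y' hy' h := by
    have hnd : (stateList (codeBase (r + s) k δ) (k ^ 3)
        (digitRange r (k ^ 3 * δ) (digitBound (r + s) k δ)) (r + s)).Nodup := by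
      refine nodup_stateList fun i _ => ?_
      unfold digitRange codeBase
      split_ifs <;> (norm_cast; omega)
    have hy1 := hy
    have hy1' := hy'
    simp only [setupOf] at hy1 hy1' h
    rw [List.getElem?_eq_getElem hy1, List.getElem?_eq_getElem hy1'] at h
    exact (hnd.getElem_inj_iff).mp (by simpa using h)
  mem z := mem_iff_getD.trans mem_stateList_inBox
  mem₂ z := mem_iff_getD.trans (by exact_mod_cast mem_stateList_inBox)
  mem₃ z := mem_iff_getD.trans (by exact_mod_cast mem_stateList_inBox)

/-- The list `l` is stored in array `a`, and its length in register `c`. -/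
def HoldsList (a c : ℕ) (l : List ℤ) (μ : RamMemory) : Prop :=
  μ c 0 = l.length ∧ ∀ (y : ℕ) (z : ℤ), l[y]? = some z → μ a y = z

/-- Appends the value of `e` to a list. -/
def pushL (a c : ℕ) (e : RamExpr) : RamProg := .store a (rg c) e ;; setR c (rg c + .lit 1)

theorem HoldsList.push {a c : ℕ} {l : List ℤ} {μ : RamMemory} {e : RamExpr} {z : ℤ}
    (h : HoldsList a c l μ) (hac : a ≠ c) (he : e.eval μ = z) :
    HoldsList a c (l ++ [z]) ((pushL a c e).run μ) := by
  obtain ⟨h1, h2⟩ := h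
  refine ⟨by simp [pushL, run_seq, run_store, hac.symm, h1], fun y x hy => ?_⟩
  rw [List.getElem?_append] at hy
  split_ifs at hy with hlt
  · have : (y : ℤ) ≠ l.length := by omega
    simp [pushL, run_seq, run_store, hac, h1, this, h2 y x hy]
  · have hy' : y = l.length := by
      have := (List.getElem?_eq_some_iff.mp hy).1
      simp at this; omega
    subst hy'
    simp only [Nat.sub_self, List.getElem?_cons_zero, Option.some.injEq] at hy
    simp [pushL, run_seq, run_store, hac, h1, he, hy]

theorem HoldsList.congr {a c : ℕ} {l : List ℤ} {μ μ' : RamMemory} (h : HoldsList a c l μ)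
    (hμ : Agree [a, c] μ μ') : HoldsList a c l μ' := by
  unfold HoldsList
  rwa [hμ a (by simp), hμ c (by simp)]

/-- Copies a list. -/
def copyL (a c a' c' : ℕ) : RamProg :=
  setR c' (.lit 0) ;; forP xY (rg c) (pushL a' c' (.load a (rg xY)))

section Lists

variable {n r s t k Q : ℕ} [hQ : Fact (1024 ≤ Q)] {μ : RamMemory}

theorem copyL_runs {a c a' c' : ℕ} {l : List ℤ} (hd : [xY, a, c, a', c'].Nodup)
    (h : HoldsList a c l μ) (hl : l.length ≤ Q) :
    Runs (copyL a c a' c') μ (Q ^ 4) (HoldsList a' c' l) := by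
  simp only [List.nodup_cons, List.mem_cons, not_or, List.not_mem_nil, not_false_eq_true,
    and_true, List.nodup_nil] at hd
  obtain ⟨⟨n1, n2, n3, n4⟩, ⟨n5, n6, n7⟩, ⟨n8, n9⟩, n10⟩ := hd
  refine Runs.seqQ (R' := fun μ' => μ' c' 0 = 0) (.block (by simp [run]) rfl
    (by simp [maxCost, cost]))
    fun μ₁ hf₁ h₁ => ?_
  replace h := h.congr (hf₁.agree (by simp [mods, n7, n9]))
  have hm : (pushL a' c' (.load a (rg xY))).mods = [a', c'] := rfl
  refine (Runs.forQ (N := l.length) (e := 1) 1 (fun j μ' => HoldsList a' c' (l.take j) μ')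
    (by simpa using hl) ?_ ?_ ?_ ?_
    (by simp [hm, n3, n4]) (by simp [cost])).post ?_
  · intro μ' h'
    simp only [RamProg.LoopFrame, hm, List.mem_cons, List.not_mem_nil, or_false, not_or] at h'
    rw [eval, eval, h' c (Ne.symm n2) ⟨n8, n9⟩, h.1]
  · intro j μ' v h
    refine h.congr fun b hb => RamMemory.write_of_ne _ _ _ ?_
    simp only [List.mem_cons, List.not_mem_nil, or_false] at hb
    rcases hb with rfl | rfl
    · exact Ne.symm n3
    · exact Ne.symm n4
  · exact ⟨by simp [h₁], by simp⟩
  · intro j hj μ₂ hf₂ hj₂ h₂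
    simp only [RamProg.LoopFrame, hm, List.mem_cons, List.not_mem_nil, or_false, not_or] at hf₂
    have hget : l[j]? = some l[j] := List.getElem?_eq_getElem hj
    rw [List.take_add_one, hget]
    refine .block (h₂.push n10 ?_) rfl (by simp [pushL, maxCost, cost])
    simp only [eval, hj₂]
    rw [hf₂ a (Ne.symm n1) ⟨n6, n7⟩]
    exact h.2 j _ hget
  · intro μ' _ h
    simpa using h

/-- Appends a digit to the numbers in the list `xGe`; its absolute value is bounded by `xGb` in the
first `r` rounds, and by `xGc` afterwards. -/
def levelP : RamProg :=
  (setR xIx (.lit 0) ;; setR xRx (rg xGc) ;;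
    .ite (rg xSl + .lit 1) (.load xPar (.lit 1)) (setR xRx (rg xGb)) .skip) ;;
  forP xDs (rg xGs) (mulP xMu xMc (.load xGe (rg xDs)) (rg xM) ;;
    forP xOl (rg xRx + rg xRx + .lit 1) (pushL xTp xIx (rg xMu - rg xRx + rg xOl))) ;;
  copyL xTp xIx xGe xGs

/-- Computes a list of states. -/
def statesP : RamProg :=
  setR xGs (.lit 0) ;; forP xY (rg xGa + .lit 1) (pushL xGe xGs (rg xY)) ;;
  forP xSl (.load xPar (.lit 1) + .load xPar (.lit 2)) levelP

theorem levelP_runs {R R' M j : ℕ} {l : List ℤ} (hr : μ xPar 1 = r) (hj : μ xSl 0 = j)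
    (hR : μ xGb 0 = R) (hR' : μ xGc 0 = R') (hM : μ xM 0 = M) (hMQ : M ≤ Q)
    (hl : HoldsList xGe xGs l μ) (hlen : (levelList M (digitRange r R R' j) l).length ≤ Q)
    (hρQ : 2 * digitRange r R R' j + 1 ≤ Q) (hlQ : l.length ≤ Q) :
    Runs levelP μ (Q ^ 9) (HoldsList xGe xGs (levelList M (digitRange r R R' j) l)) := by
  have hρ : digitRange r R R' j = if j < r then R else R' := rfl
  set ρ := digitRange r R R' j
  refine Runs.seqQ (R' := fun μ' => μ' xIx 0 = 0 ∧ μ' xRx 0 = ρ)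
    (.block ?_) ?_
  · by_cases c : j < r
    · have c' : (j : ℤ) + 1 ≤ r := by omega
      simp [run_seq, run_store, run_ite, hj, hr, c', hR, hρ, c]
    · have c' : ¬ (j : ℤ) + 1 ≤ r := by omega
      simp [run_seq, run_store, run_ite, run_skip, hj, hr, c',
        hR', hρ, c]
  rintro μ₁ hf₁ ⟨i1, r1⟩
  replace hl := hl.congr hf₁.agree
  refine Runs.seqQ (R' := HoldsList xTp xIx (levelList M ρ l)) ?_ fun μ₂ hf₂ h₂ =>
    (copyL_runs (by decide) h₂ hlen).up
  refine (Runs.forQ (N := l.length) (e := 5) 1 (fun j μ' => HoldsList xTp xIx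
    (levelList M ρ (l.take j)) μ') (by simpa using hlQ) ?_ ?_ ?_ ?_).post ?_
  · intro μ' h'
    rw [eval, eval, h'.eq _, hl.1]
  · exact fun j μ' v h => h.congr fun a ha => by rw [RamMemory.write_of_ne]; revert a; decide
  · exact ⟨by simp [i1, levelList], by simp [levelList]⟩
  · intro j hj μ₂ hf₂ hj₂ h₂
    have hget : l[j]? = some l[j] := List.getElem?_eq_getElem hj
    refine Runs.seqQ (Runs.mulP 1 (c := l[j]) (N := M) ?_ ?_ (by simpa using hMQ)) fun μ₃ hf₃ h₃ =>
        ?_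
    · simp only [eval, hj₂]
      rw [hf₂.eq xGe]
      exact hl.2 j _ hget
    · simp only [eval]
      rw [hf₂.eq xM, hf₁.eq xM, hM]
    refine ((Runs.forQ (N := 2 * ρ + 1) (e := 1) 1 (fun x μ' => HoldsList xTp xIx
      (levelList M ρ (l.take j) ++ (List.range x).map fun x : ℕ => l[j] * M - ρ + x) μ')
          (by simpa using hρQ) ?_ ?_ ?_ ?_).up).post ?_
    · intro μ' h'
      simp only [eval]
      rw [h'.eq xRx, hf₃.eq xRx, hf₂.eq xRx, r1]
      push_cast; ring
    · exact fun j μ' v h => h.congr fun a ha => by rw [RamMemory.write_of_ne]; revert a; decide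
    · simpa using h₂.congr hf₃.agree
    · intro x hx μ₄ hf₄ hx₄ h₄
      rw [List.range_succ, List.map_append, ← List.append_assoc]
      refine .block (h₄.push (by decide) ?_)
      simp only [eval, RamExpr.eval_sub, hx₄]
      rw [hf₄.eq xMu, h₃, hf₄.eq xRx,
        hf₃.eq xRx, hf₂.eq xRx, r1]
    · intro μ' _ h
      have e : l.take (j + 1) = l.take j ++ [l[j]] := by rw [List.take_add_one, hget]; rfl
      rw [e, levelList, List.flatMap_append, List.flatMap_singleton]
      exact h
  · intro μ' _ h
    simpa using h

theorem statesP_runs {N R R' M : ℕ} (hr : μ xPar 1 = r) (hs : μ xPar 2 = s) (hM : μ xM 0 = M)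
    (hMQ : M ≤ Q) (hN : μ xGa 0 = N) (hR : μ xGb 0 = R) (hR' : μ xGc 0 = R')
    (hlen : (stateList M N (digitRange r R R') (r + s)).length ≤ Q) (hrs : r + s ≤ Q)
    (hRQ : 2 * R + 1 ≤ Q) (hRQ' : 2 * R' + 1 ≤ Q) :
    Runs statesP μ (Q ^ 13)
      (HoldsList xGe xGs (stateList M N (digitRange r R R') (r + s))) := by
  have hNQ : N + 1 ≤ Q := by
    have := (length_stateList_le (M := M) (N₀ := N) (ρ := digitRange r R R')
      (Nat.zero_le (r + s))).trans hlen
    simpa [stateList] using this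
  refine Runs.seqQ (R' := fun μ' => μ' xGs 0 = 0) (.block (by simp [run])) fun μ₁ hf₁ h₁ => ?_
  refine Runs.seqQ (R' := HoldsList xGe xGs (stateList M N (digitRange r R R') 0)) ?_ ?_
  · refine (Runs.forQ (N := N + 1) (e := 1) 1 (fun j μ' => HoldsList xGe xGs
      ((List.range j).map fun x : ℕ => (x : ℤ)) μ') (by simpa using hNQ)
      ?_ ?_ ?_ ?_).up
    · intro μ' h'
      simp only [eval]
      rw [h'.eq xGa, hf₁.eq xGa, hN]
      push_cast; rfl
    · exact fun j μ' v h => h.congr fun a ha => by rw [RamMemory.write_of_ne]; revert a; decide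
    · exact ⟨by simp [h₁], by simp⟩
    · intro j _ μ₂ hf₂ hj₂ h₂
      rw [List.range_succ, List.map_append]
      exact .block (h₂.push (by decide) (by simp [hj₂]))
  intro μ₂ hf₂ h₂
  refine (Runs.forQ (N := r + s) (e := 9) 1 (fun j μ' => HoldsList xGe xGs
    (stateList M N (digitRange r R R') j) μ') (by simpa using hrs)
    ?_ ?_ h₂ ?_)
  · intro μ' h'
    simp only [eval]
    rw [h'.eq xPar, hf₂.eq xPar, hf₁.eq xPar, hr, hs]
    push_cast; rfl
  · exact fun j μ' v h => h.congr fun a ha => by rw [RamMemory.write_of_ne]; revert a; decide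
  · intro j hj μ₃ hf₃ hj₃ h₃
    have tr : ∀ a ∈ [xPar, xGb, xGc, xM], μ₃ a = μ a := fun a ha => by
      rw [hf₃ a (by revert a; decide) (by revert a; decide), hf₂ a (by revert a; decide),
        hf₁ a (by revert a; decide)]
    refine levelP_runs (r := r) (by rw [tr _ (by decide), hr]) hj₃ (by rw [tr _ (by decide), hR])
      (by rw [tr _ (by decide), hR']) (by rw [tr _ (by decide), hM]) hMQ h₃ ?_ ?_ ?_
    · exact (length_stateList_le (l := j + 1) (by omega)).trans hlen
    · unfold digitRange; split_ifs <;> assumption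
    · exact (length_stateList_le (by omega)).trans hlen

end Lists

/-! ### The parameters -/

/-- Stores the multiples of `xCr` in the array `a`, and leaves `n` times `xCr` in `xAc`. -/
def sumsP (a : ℕ) : RamProg :=
  setR xAc (.lit 0) ;;
  forP xCk (.load xPar (.lit 0)) (.store a (rg xCk) (rg xAc) ;; setR xAc (rg xAc + rg xCr))

/-- Raises `xDl` to the absolute values of the first `xU` entries of the array `a`. -/
def scanP (a : ℕ) : RamProg :=
  forP xCk (rg xU) (.ite (.load a (rg xCk)) (rg xDl)
    (.ite (.lit 0 - .load a (rg xCk)) (rg xDl) .skip (setR xDl (.lit 0 - .load a (rg xCk))))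
    (setR xDl (.load a (rg xCk))))

/-- Determines the largest absolute value of an entry of the matrix, or `2` if that is larger. -/
def entriesP : RamProg :=
  setR xCr (.load xPar (.lit 3)) ;; sumsP xIt ;; setR xDl (.lit 2) ;;
  mulP xU xMc (rg xAc) (.load xPar (.lit 1)) ;; scanP 1 ;;
  mulP xU xMc (rg xAc) (.load xPar (.lit 2)) ;; scanP 2

/-- `xAc := xGa ^ (r + s)`. -/
def powP : RamProg :=
  setR xAc (.lit 1) ;; forP xSl (.load xPar (.lit 1) + .load xPar (.lit 2))
    (mulP xMu xMc (rg xAc) (rg xGa) ;; setR xAc (rg xMu))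

/-- Passes from `ordf L` to `ordf (L + 1)`. -/
def doubleP : RamProg :=
  forP xY (rg xK)
    (.store xOrd (rg xK + rg xY) (.load xOrd (rg xY) + .load xOrd (rg xY) + .lit 1) ;;
    .store xOrd (rg xY) (.load xOrd (rg xY) + .load xOrd (rg xY))) ;;
  (setR xK (rg xK + rg xK) ;; setR xL (rg xL + .lit 1))

/-- Computes the least power of two that is at least `k`, and the order of the stages. -/
def ordP : RamProg :=
  (setR xK (.lit 1) ;; setR xL (.lit 0) ;; .store xOrd (.lit 0) (.lit 0)) ;;
  forP xCk (.load xPar (.lit 4)) (.ite (rg xK + .lit 1) (.load xPar (.lit 4)) doubleP .skip)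

/-- Computes the powers of `k`, and the range of the first digits. -/
def cubeP : RamProg :=
  mulP xKk xMc (.load xPar (.lit 4)) (.load xPar (.lit 4)) ;;
  mulP xKc xMc (rg xKk) (.load xPar (.lit 4)) ;; mulP xR xMc (rg xKc) (rg xDl)

/-- Computes the base of the codes, and its power. -/
def baseP : RamProg :=
  setR xGa (rg xDl + rg xDl + .lit 1) ;; powP ;;
  mulP xW xMc (rg xAc) (rg xL + .lit 1) ;; mulP xMu xMc (rg xW) (rg xDl) ;;
  (setR xW (rg xMu) ;; setR xM (rg xR + rg xW) ;; setR xM (rg xM + rg xM + rg xM + .lit 1) ;;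
    setR xGa (rg xM)) ;; powP ;; setR xH (rg xAc)

/-- Computes the list of states with the given ranges. -/
def listP (a c : ℕ) (e₀ e₁ e₂ : RamExpr) : RamProg :=
  (setR xGa e₀ ;; setR xGb e₁ ;; setR xGc e₂) ;; statesP ;; copyL xGe xGs a c

/-- Inverts the list of states. -/
def indexP : RamProg := forP xYy (rg xV) (.store xVf (.load xVl (rg xYy)) (rg xYy + .lit 1))

/-- Stores the halves of the small numbers. -/
def halfP : RamProg :=
  forP xCk (.load xPar (.lit 0) + .load xPar (.lit 3) + .load xPar (.lit 3))
    (.store xPr (rg xCk + rg xCk) (rg xCk) ;; .store xPr (rg xCk + rg xCk + .lit 1) (rg xCk))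

/-- Appends the entries of a column of the blocks in array `a`, which have `x` rows, to the code in
`xAc`. -/
def hornerP (a x : ℕ) : RamProg :=
  mulP xMa xMc (.load xIt (rg xBi)) (.load xPar (.lit x)) ;; setR xAd (rg xMa + rg xPq) ;;
  forP xSl (.load xPar (.lit x)) (mulP xMu xMc (rg xAc) (rg xM) ;;
    (setR xAc (rg xMu + .load a (rg xAd)) ;; setR xAd (rg xAd + .load xPar (.lit 3))))

/-- Computes the codes of the columns. -/
def codesP : RamProg :=
  forP xBi (.load xPar (.lit 0)) (forP xPq (.load xPar (.lit 3))
    (setR xAc (.lit 1) ;; hornerP 1 1 ;; hornerP 2 2 ;;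
      .store xCode (.load xIt (rg xBi) + rg xPq) (rg xAc)))

/-- The numbers that have to be small for the running time. -/
structure SmallSizes (r s k δ Q : ℕ) : Prop where
  rs : r + s ≤ Q
  kc : k ^ 3 + 1 ≤ Q
  L : Nat.clog 2 k + 1 ≤ Q
  del : 2 * δ + 1 ≤ Q
  R : 2 * (k ^ 3 * δ) + 1 ≤ Q
  W : 2 * digitBound (r + s) k δ + 1 ≤ Q
  base : codeBase (r + s) k δ ≤ Q
  V : (setupOf r s k δ).V ≤ Q
  V₂ : (setupOf r s k δ).V₂ ≤ Q
  V₃ : (setupOf r s k δ).V₃ ≤ Q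
  K : 2 ^ Nat.clog 2 k ≤ Q

section Parameters

variable {n r s t k Q : ℕ} [hQ : Fact (1024 ≤ Q)] {I : NFoldInstance n r s t k}
  {b : StepBounds n t} {μ : RamMemory}

theorem sumsP_runs {a c : ℕ} (ha : a = xIt ∨ a = xIv) (hn : μ xPar 0 = n) (hn' : 1 ≤ n)
    (hc : μ xCr 0 = c) :
    Runs (sumsP a) μ (Q ^ 3 * n) fun μ' => (∀ i : ℕ, i < n → μ' a i = (i * c : ℕ)) ∧
      μ' xAc 0 = (n * c : ℕ) := by
  refine Runs.seqX (R' := fun μ' => μ' xAc 0 = 0)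
    (.blockX hn' (by simp [run])) fun μ₁ hf₁ h₁ => ?_
  have := Runs.forX (Q := Q) (N := n) (e := 1) (f := 0) (X := 1) (Y := n) (i := xCk)
    (hi := .load xPar (.lit 0)) (body := .store a (rg xCk) (rg xAc) ;; setR xAc (rg xAc + rg xCr))
    (μ₀ := μ₁) (fun j μ' => (∀ i : ℕ, i < j → μ' a i = (i * c : ℕ)) ∧ μ' xAc 0 = (j * c : ℕ))
    le_rfl hn' (by simp) ?_ ?_ ?_ ?_ (by rcases ha with rfl | rfl <;> decide)
  · exact this.mono (by simp) fun _ _ h => h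
  · intro μ' h'
    simp only [eval]
    rw [h'.eq xPar (ha' := by rcases ha with rfl | rfl <;> decide), hf₁.eq xPar, hn]
  · rintro j μ' v h
    rcases ha with rfl | rfl <;> simpa using h
  · simpa using h₁
  · rintro j hj μ₂ hf₂ hj₂ ⟨h1, h2⟩
    have hc₂ : μ₂ xCr 0 = c := by
      rw [hf₂.eq xCr (ha' := by rcases ha with rfl | rfl <;> decide), hf₁.eq xCr, hc]
    rw [mul_one]
    refine .block ⟨fun i hi => ?_, ?_⟩ rfl (by simp [maxCost, cost])
    · rcases Nat.lt_succ_iff_lt_or_eq.mp hi with h3 | rfl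
      · have : (i : ℤ) ≠ j := by omega
        have h1 := h1 i h3
        push_cast at h1
        rcases ha with rfl | rfl <;> simp [run, hj₂, this, h1]
      · rcases ha with rfl | rfl <;> simp [run, hj₂, h2]
    · rcases ha with rfl | rfl <;> (simp [run, h2, hc₂]; ring)

theorem scanP_runs {a N δ Δ Y : ℕ} (ha : a = 1 ∨ a = 2) (hN : μ xU 0 = N) (hNQ : N ≤ Q ^ 1 * Y)
    (hY : 1 ≤ Y) (hδ : μ xDl 0 = δ) (h2 : 2 ≤ δ) (hδΔ : δ ≤ Δ)
    (hΔ : ∀ z : ℕ, z < N → |μ a z| ≤ (Δ : ℤ)) :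
    Runs (scanP a) μ (Q ^ 3 * Y) fun μ' => ∃ δ' : ℕ, μ' xDl 0 = δ' ∧ δ ≤ δ' ∧ δ' ≤ Δ ∧
      ∀ z : ℕ, z < N → |μ a z| ≤ (δ' : ℤ) := by
  have := Runs.forX (Q := Q) (N := N) (e := 1) (f := 1) (X := 1) (Y := Y) (i := xCk)
    (hi := rg xU) (body := .ite (.load a (rg xCk)) (rg xDl)
    (.ite (.lit 0 - .load a (rg xCk)) (rg xDl) .skip (setR xDl (.lit 0 - .load a (rg xCk))))
    (setR xDl (.load a (rg xCk)))) (μ₀ := μ) (fun j μ' => ∃ δ' : ℕ, μ' xDl 0 = δ' ∧ δ ≤ δ' ∧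
      δ' ≤ Δ ∧ ∀ z : ℕ, z < j → |μ a z| ≤ (δ' : ℤ)) le_rfl hY hNQ
      ?_ ?_ ?_ ?_ (by simp [mods])
  · exact this.mono (by simp) fun _ _ h => h
  · intro μ' h'
    simp only [eval]
    rw [h'.eq xU (ha' := by simp [mods]), hN]
  · rintro j μ' v h
    simpa using h
  · exact ⟨δ, hδ, le_rfl, hδΔ, by simp⟩
  · rintro j hj μ₁ hf₁ hj₁ ⟨d, d1, d2, d3, d4⟩
    have ha' : μ₁ a = μ a := by
      rcases ha with rfl | rfl <;> exact hf₁.eq _ (ha' := by simp [mods])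
    have hv := hΔ j hj
    rw [mul_one]
    refine .block ?_ rfl (by rcases ha with rfl | rfl <;> decide)
    have fin : ∀ d' : ℕ, d ≤ d' → |μ a j| ≤ (d' : ℤ) → ∀ z : ℕ, z < j + 1 → |μ a z| ≤ (d' : ℤ) := by
      intro d' h1 h3 z hz
      rcases Nat.lt_succ_iff_lt_or_eq.mp hz with h4 | rfl
      · exact (d4 z h4).trans (by exact_mod_cast h1)
      · exact h3
    have e1 : μ₁ a j = μ a j := by rw [ha']
    have hne : a ≠ xDl := by rcases ha with rfl | rfl <;> decide
    obtain ⟨b1, b2⟩ := abs_le.mp hv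
    by_cases c1 : μ a j ≤ d
    · by_cases c2 : - μ a j ≤ d
      · exact ⟨d, by simp [run_ite, run_skip, hj₁, e1, d1, c1, c2], d2, d3,
          fin d le_rfl (abs_le.mpr ⟨by linarith, c1⟩)⟩
      · exact ⟨(- μ a j).toNat, by
          simp [run_ite, run_store, hj₁, e1, d1, c1, c2]; omega, by omega,
          by omega, fin _ (by omega) (abs_le.mpr ⟨by omega, by omega⟩)⟩
    · exact ⟨(μ a j).toNat, by
        simp [run_ite, run_store, hj₁, e1, d1, c1]; omega, by omega,
        by omega, fin _ (by omega) (abs_le.mpr ⟨by omega, by omega⟩)⟩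

theorem scan_covers {n' r' t' z : ℕ} {A : Fin n' → Fin r' → Fin t' → ℤ} {f : ℤ → ℤ} {C : ℤ}

    (hA : ∀ (i : Fin n') (p : Fin r') (q : Fin t'),
      f (((i : ℤ) * r' + (p : ℤ)) * t' + (q : ℤ)) = A i p q) :
    ((∀ i p q, |A i p q| ≤ C) → z < n' * t' * r' → |f z| ≤ C) ∧
      ((∀ z : ℕ, z < n' * t' * r' → |f z| ≤ C) → ∀ i p q, |A i p q| ≤ C) := by
  constructor
  · intro h hz
    have ht : 0 < t' := Nat.pos_of_ne_zero fun h => by simp [h] at hz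
    have hr : 0 < r' := Nat.pos_of_ne_zero fun h => by simp [h] at hz
    have h1 : z / t' < n' * r' := by
      rw [Nat.div_lt_iff_lt_mul ht]; calc z < n' * t' * r' := hz
        _ = n' * r' * t' := by ring
    have := hA ⟨z / t' / r', by rwa [Nat.div_lt_iff_lt_mul hr]⟩ ⟨z / t' % r', Nat.mod_lt _ hr⟩
      ⟨z % t', Nat.mod_lt _ ht⟩
    have e : (((z / t' / r' : ℕ) : ℤ) * r' + ((z / t' % r' : ℕ) : ℤ)) * t' + ((z % t' : ℕ) : ℤ)
        = z := by
      exact_mod_cast by rw [Nat.div_add_mod', Nat.div_add_mod']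
    rw [← e]
    simp only at this
    rw [this]
    exact h _ _ _
  · intro h i p q
    have := h ((i * r' + p) * t' + q) (by
      calc (i * r' + p) * t' + q < n' * r' * t' := index_lt (index_lt i.2 p.2) q.2
        _ = n' * t' * r' := by ring)
    push_cast at this
    rwa [hA] at this

theorem entriesP_runs (h : I.IsInput b μ) (hn : 1 ≤ n) (ht : 1 ≤ t) (hrs : r + s ≤ Q) {Δ : ℕ}
    (hΔ : 2 ≤ Δ) (hI : I.EntriesLe Δ) :
    Runs entriesP μ (Q ^ 10 * (n * t)) fun μ' => (∀ i : ℕ, i < n → μ' xIt i = (i * t : ℕ)) ∧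
      ∃ δ : ℕ, μ' xDl 0 = δ ∧ 2 ≤ δ ∧ δ ≤ Δ ∧ I.EntriesLe δ := by
  have hX : 1 ≤ n * t := Nat.mul_pos hn ht
  have hA : ∀ z : ℕ, z < n * t * r → |μ 1 z| ≤ (Δ : ℤ) := fun z =>
    (scan_covers (A := fun i p q => I.A i p q) h.A_eq).1 hI.1
  have hB : ∀ z : ℕ, z < n * t * s → |μ 2 z| ≤ (Δ : ℤ) := fun z =>
    (scan_covers (A := fun i p q => I.B i p q) h.B_eq).1 hI.2
  have le : ∀ m ≤ Q, n * t * m ≤ Q ^ 1 * (n * t) := fun m hm => by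
    rw [pow_one, Nat.mul_comm]; exact Nat.mul_le_mul_right _ hm
  unfold entriesP
  refine Runs.seqX (R' := fun μ' => μ' xCr 0 = t) (.blockX hX (by simp [run, h.t_eq]))
      fun μ₁ hf₁ h₁ => ?_
  refine Runs.seqX (((sumsP_runs (.inl rfl) (by rw [hf₁.eq _, h.n_eq]) hn h₁).mono
    (Nat.mul_le_mul_left _ (Nat.le_mul_of_pos_right _ ht)) fun _ _ h => h).upX) ?_
  rintro μ₂ hf₂ ⟨t2, a2⟩
  refine Runs.seqX (R' := fun μ' => μ' xDl 0 = (2 : ℕ)) (.blockX hX (by simp [run]))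
      fun μ₃ hf₃ h₃ => ?_
  refine Runs.seqX (.raise (Runs.mulP 1 (c := (n * t : ℕ)) (N := r) (by simp [hf₃.eq xAc, a2])
    (by simp [hf₃.eq xPar, hf₂.eq xPar, hf₁.eq xPar, h.r_eq])
    (by rw [pow_one]; omega)) hX) fun μ₄ hf₄ h₄ => ?_
  have e4 : ∀ a ∈ [0, 1, 2], μ₄ a = μ a := fun a ha => by
    rw [hf₄ a (by revert a; decide), hf₃ a (by revert a; decide), hf₂ a (by revert a; decide),
      hf₁ a (by revert a; decide)]
  refine Runs.seqX ((scanP_runs (δ := 2) (Δ := Δ) (N := n * t * r) (.inl rfl)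
    (by rw [h₄]; push_cast; ring) (le r (by omega)) hX (by rw [hf₄.eq _, h₃]) le_rfl hΔ
    (by rw [e4 1 (by decide)]; exact hA)).upX) ?_
  rintro μ₅ hf₅ ⟨δ₁, d1, d2, d3, d4⟩
  refine Runs.seqX (.raise (Runs.mulP 1 (c := (n * t : ℕ)) (N := s)
      (by simp [hf₅.eq xAc, hf₄.eq xAc, hf₃.eq xAc, a2])
    (by simp [hf₅.eq xPar, e4 0 (by decide), h.s_eq])
    (by rw [pow_one]; omega)) hX) fun μ₆ hf₆ h₆ => ?_
  have e6 : ∀ a ∈ [1, 2], μ₆ a = μ a := fun a ha => by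
    rw [hf₆ a (by revert a; decide), hf₅ a (by revert a; decide),
      e4 a (List.mem_cons_of_mem _ ha)]
  refine ((scanP_runs (δ := δ₁) (Δ := Δ) (N := n * t * s) (.inr rfl)
    (by rw [h₆]; push_cast; ring) (le s (by omega)) hX (by rw [hf₆.eq _, d1]) d2 d3
    (by rw [e6 2 (by decide)]; exact hB)).upX).post ?_
  rintro μ₇ hf₇ ⟨δ₂, f1, f2, f3, f4⟩
  refine ⟨?_, δ₂, f1, d2.trans f2, f3, ?_, ?_⟩
  · rw [hf₇.eq _, hf₆.eq _, hf₅.eq _, hf₄.eq _,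
      hf₃.eq _]
    exact t2
  · refine (scan_covers (z := 0) (A := fun i p q => I.A i p q) h.A_eq).2 fun z hz => ?_
    have := d4 z hz
    rw [e4 1 (by decide)] at this
    exact this.trans (by exact_mod_cast f2)
  · refine (scan_covers (z := 0) (A := fun i p q => I.B i p q) h.B_eq).2 fun z hz => ?_
    have := f4 z hz
    rwa [e6 2 (by decide)] at this

theorem powP_runs {B : ℕ} (hr : μ xPar 1 = r) (hs : μ xPar 2 = s) (hB : μ xGa 0 = B) (hBQ : B ≤ Q)
    (hrs : r + s ≤ Q) : Runs powP μ (Q ^ 8) fun μ' => μ' xAc 0 = (B : ℤ) ^ (r + s) := by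
  refine Runs.seqQ (R' := fun μ' => μ' xAc 0 = 1) (.block (by simp [run])) fun μ₁ hf₁ h₁ => ?_
  refine Runs.forQ (N := r + s) (e := 5) 1 (fun j μ' => μ' xAc 0 = (B : ℤ) ^ j) (by simpa using hrs)
      ?_ ?_ (by simpa using h₁) ?_
  · intro μ' h'
    simp only [eval]
    rw [h'.eq xPar, hf₁.eq xPar, hr, hs]
    push_cast; rfl
  · intro j μ' v h
    simpa using h
  · intro j hj μ₂ hf₂ hj₂ h₂
    refine Runs.seqQ (Runs.mulP 1 (c := (B : ℤ) ^ j) (N := B) (by simpa using h₂)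
      (by simp [hf₂.eq xGa, hf₁.eq xGa, hB]) (by simpa using hBQ))
      fun μ₃ hf₃ h₃ => .block ?_
    simp [run, h₃, pow_succ]

theorem doubleP_runs {L : ℕ} (hK : μ xK 0 = (2 ^ L : ℕ)) (hL : μ xL 0 = L) (hQL : 2 ^ L ≤ Q)
    (ho : ∀ a : ℕ, a < 2 ^ L → μ xOrd a = ordf L a) :
    Runs doubleP μ (Q ^ 4) fun μ' => μ' xK 0 = (2 ^ (L + 1) : ℕ) ∧ μ' xL 0 = (L + 1 : ℕ) ∧
      ∀ a : ℕ, a < 2 ^ (L + 1) → μ' xOrd a = ordf (L + 1) a := by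
  refine Runs.seqQ (Runs.forQ (N := 2 ^ L) (e := 1) 1 (fun j μ' => ∀ a : ℕ, a < 2 ^ L →
    μ' xOrd a = (if a < j then 2 * ordf L a else ordf L a : ℕ) ∧
    (a < j → μ' xOrd (2 ^ L + a : ℕ) = (2 * ordf L a + 1 : ℕ)))
    (by simpa using hQL) ?_ ?_ (fun a ha => ⟨by simpa using ho a ha, by simp⟩) ?_) ?_
  · intro μ' h'
    rw [eval, eval, h'.eq _, hK]
  · intro j μ' v h
    simpa using h
  · intro j hj μ₁ hf₁ hj₁ h₁
    have hK₁ : μ₁ xK 0 = (2 ^ L : ℕ) := by rw [hf₁.eq _, hK]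
    have hv := (h₁ j hj).1
    rw [if_neg (lt_irrefl j)] at hv
    refine .block fun a ha => ?_
    have hp : (0 : ℤ) < (2 ^ L : ℕ) := by positivity
    have n1 : (j : ℤ) ≠ (2 ^ L : ℕ) + j := by omega
    have e1 : ((RamProg.store xOrd (rg xK + rg xY) (.load xOrd (rg xY) + .load xOrd (rg xY) +
        .lit 1) ;; .store xOrd (rg xY) (.load xOrd (rg xY) + .load xOrd (rg xY))).run μ₁) xOrd =
        Function.update (Function.update (μ₁ xOrd) ((2 ^ L : ℕ) + j) (2 * ordf L j + 1 : ℕ)) j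
          (2 * ordf L j : ℕ) := by
      simp only [run_seq, run_store, RamMemory.write_apply, eval, if_true, reduceIte, hj₁, hK₁,
          Function.update_of_ne n1, hv,
        show xY ≠ xOrd by decide]
      congr 1
      · congr 1; push_cast; ring
      · push_cast; ring
    rw [e1]
    obtain ⟨g1, g2⟩ := h₁ a ha
    rcases eq_or_ne a j with rfl | h3
    · have h4 : ((2 ^ L + a : ℕ) : ℤ) = (2 ^ L : ℕ) + a := Nat.cast_add _ _
      rw [h4, Function.update_self, if_pos (Nat.lt_succ_self a), Function.update_of_ne n1.symm,
        Function.update_self]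
      exact ⟨rfl, fun _ => rfl⟩
    · have h4 : a < j + 1 ↔ a < j := by omega
      simp only [h4]
      rw [Function.update_of_ne (by exact_mod_cast h3), Function.update_of_ne (by omega),
        Function.update_of_ne (by omega), Function.update_of_ne (by omega)]
      exact ⟨g1, g2⟩
  · intro μ₁ hf₁ h₁
    refine .block ⟨?_, ?_, fun a ha => ?_⟩
    · simp [run, hf₁.eq xK, hK]; ring
    · simp [run, hf₁.eq xL, hL]
    · have e1 : ∀ z, ((setR xK (rg xK + rg xK) ;; setR xL (rg xL + .lit 1)).run μ₁) xOrd z =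
          μ₁ xOrd z := fun z => by simp [run]
      rw [e1, ordf]
      split_ifs with h3
      · simpa [h3] using (h₁ a h3).1
      · have h5 : a - 2 ^ L < 2 ^ L := by rw [pow_succ] at ha; omega
        have := (h₁ _ h5).2 h5
        rwa [Nat.add_sub_cancel' (not_lt.mp h3)] at this

theorem ordP_runs (hk : μ xPar 4 = k) (hK : 2 ^ Nat.clog 2 k ≤ Q) (hkQ : k ≤ Q) :
    Runs ordP μ (Q ^ 8) fun μ' => μ' xK 0 = (2 ^ Nat.clog 2 k : ℕ) ∧ μ' xL 0 = Nat.clog 2 k ∧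
      ∀ a : ℕ, a < 2 ^ Nat.clog 2 k → μ' xOrd a = ordf (Nat.clog 2 k) a := by
  refine Runs.seqQ (R' := fun μ' => μ' xK 0 = (2 ^ 0 : ℕ) ∧ μ' xL 0 = (0 : ℕ) ∧
    ∀ a : ℕ, a < 2 ^ 0 → μ' xOrd a = ordf 0 a) (.block (by simp [run, ordf])) fun μ₁ hf₁ h₁ => ?_
  have hk₁ : μ₁ xPar 4 = k := by rw [hf₁.eq _, hk]
  refine (Runs.forQ (N := k) (e := 5) 1 (fun j μ' => μ' xK 0 = (2 ^ min j (Nat.clog 2 k) : ℕ) ∧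
    μ' xL 0 = (min j (Nat.clog 2 k) : ℕ) ∧ ∀ a : ℕ, a < 2 ^ min j (Nat.clog 2 k) →
      μ' xOrd a = ordf (min j (Nat.clog 2 k)) a) (by simpa using hkQ)
    ?_ ?_ (by simpa using h₁) ?_).post ?_
  · intro μ' h'
    simp only [eval]
    rw [h'.eq _, hk₁]
  · intro j μ' v h
    simpa using h
  · rintro j hj μ₂ hf₂ hj₂ ⟨h1, h2, h3⟩
    have hk₂ : μ₂ xPar 4 = k := by rw [hf₂.eq _, hk₁]
    have hle : 2 ^ min j (Nat.clog 2 k) ≤ Q :=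
      (Nat.pow_le_pow_right (by norm_num) (min_le_right _ _)).trans hK
    have key : 2 ^ min j (Nat.clog 2 k) < k ↔ j < Nat.clog 2 k := by
      rw [← not_le, ← Nat.clog_le_iff_le_pow (by norm_num)]
      omega
    refine .iteQ (e := 4) (by decide) (fun c => ?_) fun c => ?_
    · have c' : j < Nat.clog 2 k := by
        rw [← key]
        simp only [eval, h1, hk₂] at c
        exact_mod_cast c
      have e1 : min j (Nat.clog 2 k) = j := min_eq_left c'.le
      have e2 : min (j + 1) (Nat.clog 2 k) = j + 1 := min_eq_left c'
      rw [e1] at h1 h2 h3 hle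
      rw [e2]
      exact doubleP_runs h1 h2 hle h3
    · have c' : ¬ j < Nat.clog 2 k := by
        rw [← key]
        simp only [eval, h1, hk₂] at c
        exact_mod_cast c
      have e1 : min (j + 1) (Nat.clog 2 k) = min j (Nat.clog 2 k) := by omega
      rw [e1]
      exact .block ⟨h1, h2, h3⟩
  · rintro μ' - h
    have : min k (Nat.clog 2 k) = Nat.clog 2 k := by
      refine min_eq_right ?_
      rw [Nat.clog_le_iff_le_pow (by norm_num)]
      exact Nat.lt_two_pow_self.le
    rwa [this] at h

theorem cubeP_runs {δ : ℕ} (hk : μ xPar 4 = k) (hδ : μ xDl 0 = δ) (hkQ : k ≤ Q) (hδQ : δ ≤ Q) :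
    Runs cubeP μ (Q ^ 6) fun μ' => μ' xKk 0 = (k ^ 2 : ℕ) ∧ μ' xKc 0 = (k ^ 3 : ℕ) ∧
      μ' xR 0 = (k ^ 3 * δ : ℕ) := by
  unfold cubeP
  refine Runs.seqQ ((Runs.mulP 1 (c := k) (N := k) (by simp [hk]) (by simp [hk])
      (by simpa using hkQ)).up)
    fun μ₁ hf₁ h₁ => ?_
  refine Runs.seqQ (Runs.mulP 1 (c := (k : ℤ) * k) (N := k) (by simp [h₁])
    (by simp [hf₁.eq xPar, hk]) (by simpa using hkQ)) fun μ₂ hf₂ h₂ => ?_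
  refine (Runs.mulP 1 (c := (k : ℤ) * k * k) (N := δ) (by simp [h₂])
    (by simp [hf₂.eq xDl, hf₁.eq xDl, hδ]) (by simpa using hδQ)).post
    fun μ₃ hf₃ h₃ => ?_
  rw [hf₃.eq xKk, hf₂.eq xKk, hf₃.eq xKc, h₁, h₂, h₃]
  push_cast
  exact ⟨by ring, by ring, by ring⟩

theorem baseP_runs {δ : ℕ} (hS : SmallSizes r s k δ Q) (hr : μ xPar 1 = r) (hs : μ xPar 2 = s)
    (hδ : μ xDl 0 = δ) (hR : μ xR 0 = (k ^ 3 * δ : ℕ)) (hL : μ xL 0 = Nat.clog 2 k) :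
    Runs baseP μ (Q ^ 14) fun μ' => μ' xW 0 = digitBound (r + s) k δ ∧
      μ' xM 0 = codeBase (r + s) k δ ∧ μ' xH 0 = (codeBase (r + s) k δ : ℤ) ^ (r + s) := by
  have hδQ : δ ≤ Q := by have := hS.del; omega
  unfold baseP
  refine Runs.seqQ (R' := fun μ' => μ' xGa 0 = (2 * δ + 1 : ℕ)) (.block (by simp [run, hδ]; ring))
      fun μ₁ hf₁ h₁ => ?_
  refine Runs.seqQ ((powP_runs (r := r) (s := s) (by rw [hf₁.eq _, hr])
    (by rw [hf₁.eq _, hs]) h₁ hS.del hS.rs).up) fun μ₂ hf₂ h₂ => ?_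
  refine Runs.seqQ ((Runs.mulP 1 (c := ((2 * δ + 1) ^ (r + s) : ℕ))
    (N := Nat.clog 2 k + 1) (by simp [h₂]) (by simp [hf₂.eq xL, hf₁.eq xL, hL])
    (by simpa using hS.L)).up) fun μ₃ hf₃ h₃ => ?_
  refine Runs.seqQ ((Runs.mulP 1 (c := ((2 * δ + 1) ^ (r + s) * (Nat.clog 2 k + 1) : ℕ))
    (N := δ) (by simp only [eval, h₃]; push_cast; ring)
    (by simp [hf₃.eq xDl, hf₂.eq xDl, hf₁.eq xDl, hδ])
    (by simpa using hδQ)).up) fun μ₄ hf₄ h₄ => ?_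
  have hR₄ : μ₄ xR 0 = (k ^ 3 * δ : ℕ) := by
    rw [hf₄.eq xR, hf₃.eq xR, hf₂.eq xR, hf₁.eq xR, hR]
  replace h₄ : μ₄ xMu 0 = digitBound (r + s) k δ := by rw [h₄, digitBound]; push_cast; ring
  refine Runs.seqQ (R' := fun μ' => μ' xW 0 = digitBound (r + s) k δ ∧
    μ' xM 0 = codeBase (r + s) k δ ∧ μ' xGa 0 = codeBase (r + s) k δ)
    (.block ?_) ?_
  · simp only [codeBase]
    simp [run, h₄, hR₄]
    ring
  rintro μ₅ hf₅ ⟨w5, m5, g5⟩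
  have par : μ₅ xPar = μ xPar := by
    rw [hf₅.eq _, hf₄.eq _, hf₃.eq _, hf₂.eq _,
      hf₁.eq _]
  refine Runs.seqQ (powP_runs (r := r) (s := s) (by rw [par, hr]) (by rw [par, hs]) g5
    hS.base hS.rs) fun μ₆ hf₆ h₆ => .block ?_
  have e1 := hf₆.eq xW
  have e2 := hf₆.eq xM
  simp [run, e1, e2, w5, m5, h₆]

theorem listP_runs {a c N R R' M : ℕ} {e₀ e₁ e₂ : RamExpr} (hd : [xY, xGe, xGs, a, c].Nodup)
    (he : e₀.cost + e₁.cost + e₂.cost ≤ 100) (h₁ : e₁.avoids [xGa] = true)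
    (h₂ : e₂.avoids [xGa, xGb] = true) (hr : μ xPar 1 = r)
    (hs : μ xPar 2 = s) (hM : μ xM 0 = M) (hMQ : M ≤ Q) (hN : e₀.eval μ = N) (hR : e₁.eval μ = R)
    (hR' : e₂.eval μ = R') (hlen : (stateList M N (digitRange r R R') (r + s)).length ≤ Q)
    (hrs : r + s ≤ Q) (hRQ : 2 * R + 1 ≤ Q) (hRQ' : 2 * R' + 1 ≤ Q) :
    Runs (listP a c e₀ e₁ e₂) μ (Q ^ 15)
      (HoldsList a c (stateList M N (digitRange r R R') (r + s))) := by
  unfold listP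
  refine Runs.seqQ (R' := fun μ' => μ' xGa 0 = N ∧ μ' xGb 0 = R ∧ μ' xGc 0 = R')
    (.block ?_ rfl (by simp [maxCost, cost]; omega)) ?_
  · have g1 : ∀ v, e₁.eval (μ.write xGa 0 v) = R := fun v => by
      rw [RamExpr.eval_congr h₁ (μ := μ) fun b hb =>
          RamMemory.write_of_ne _ _ _ (by simpa using hb),
        hR]
    have g2 : ∀ v w, e₂.eval ((μ.write xGa 0 v).write xGb 0 w) = R' := fun v w => by
      rw [RamExpr.eval_congr h₂ (μ := μ) fun b hb => ?_, hR']
      simp only [List.mem_cons, List.not_mem_nil, or_false, not_or] at hb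
      rw [RamMemory.write_of_ne _ _ _ hb.2, RamMemory.write_of_ne _ _ _ hb.1]
    simp only [run_seq, run_store, eval, g1, g2, hN]
    simp
  rintro μ₁ hf₁ ⟨a1, a2, a3⟩
  exact Runs.seqQ (statesP_runs (r := r) (s := s) (by rw [hf₁ _ (by simp [mods]), hr])
    (by rw [hf₁ _ (by simp [mods]), hs]) (by rw [hf₁ _ (by simp [mods]), hM])
    hMQ a1 a2 a3 hlen hrs hRQ hRQ')
    fun μ₂ hf₂ h₂ => (copyL_runs hd h₂ hlen).up

theorem indexP_runs {V : ℕ} {vl : ℕ → ℤ} (hV : μ xV 0 = V) (hVQ : V ≤ Q)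
    (hvl : ∀ y : ℕ, y < V → μ xVl y = vl y) (hinj : ∀ y < V, ∀ y' < V, vl y = vl y' → y = y')
    (h0 : ∀ z, μ xVf z = 0) :
    Runs indexP μ (Q ^ 3) fun μ' => StatesAt V vl (μ' xVl) (μ' xVf) := by
  refine (Runs.forQ (N := V) (e := 1) 1 (fun j μ' => ∀ z, (∃ y < j, vl y = z ∧ μ' xVf z = y + 1) ∨
    (μ' xVf z = 0 ∧ ∀ y < j, vl y ≠ z)) (by simpa using hVQ) ?_ ?_
    (fun z => .inr ⟨h0 z, by simp⟩) ?_).post ?_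
  · intro μ' h'
    rw [eval, eval, h'.eq _, hV]
  · intro j μ' v h
    simpa using h
  · intro j hj μ₁ hf₁ hj₁ h₁
    have hv : μ₁ xVl j = vl j := by rw [hf₁.eq _, hvl j hj]
    refine .block fun z => ?_
    have e : (RamProg.store xVf (.load xVl (rg xYy)) (rg xYy + .lit 1)).run μ₁ xVf =
        Function.update (μ₁ xVf) (vl j) (j + 1) := by
      simp [run, hj₁, hv]
    rw [e]
    rcases eq_or_ne z (vl j) with rfl | hne
    · exact .inl ⟨j, by omega, rfl, by simp⟩
    rw [Function.update_of_ne hne]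
    rcases h₁ z with ⟨y, hy, h3⟩ | ⟨h3, h4⟩
    · exact .inl ⟨y, by omega, h3⟩
    · refine .inr ⟨h3, fun y hy => ?_⟩
      rcases Nat.lt_succ_iff_lt_or_eq.mp hy with h5 | rfl
      · exact h4 y h5
      · exact hne.symm
  · intro μ' hf h
    refine ⟨fun y hy => by rw [hf.eq _, hvl y hy], fun y hy => ?_, fun z hz => ?_⟩
    · rcases h (vl y) with ⟨y', hy', h1, h2⟩ | ⟨-, h2⟩
      · rw [h2, hinj y' hy' y hy h1]
      · exact absurd rfl (h2 y hy)
    · rcases h z with ⟨y', hy', h1, h2⟩ | ⟨h2, -⟩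
      · exact ⟨y', hy', h2, h1⟩
      · omega

theorem halfP_runs (hn : μ xPar 0 = n) (ht : μ xPar 3 = t) (hn' : 1 ≤ n) (ht' : 1 ≤ t) :
    Runs halfP μ (Q ^ 3 * (n * t)) fun μ' =>
      ∀ x : ℕ, x < 4 * t + 2 * n → μ' xPr x = (x / 2 : ℕ) := by
  have hX : 1 ≤ n * t := Nat.mul_pos hn' ht'
  have := Runs.forX (Q := Q) (N := n + t + t) (e := 1) (f := 1) (X := 1) (Y := n * t) (i := xCk)
    (hi := .load xPar (.lit 0) + .load xPar (.lit 3) + .load xPar (.lit 3))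
    (body := .store xPr (rg xCk + rg xCk) (rg xCk) ;; .store xPr (rg xCk + rg xCk + .lit 1)
        (rg xCk))
    (μ₀ := μ) (fun j μ' => ∀ x : ℕ, x < 2 * j → μ' xPr x = (x / 2 : ℕ))
    le_rfl hX ?_ ?_ ?_ (by simp) ?_
  · exact this.mono (by simp) fun μ' _ h x hx => h x (by omega)
  · have h1 : n ≤ n * t := Nat.le_mul_of_pos_right _ ht'
    have h2 : t ≤ n * t := Nat.le_mul_of_pos_left _ hn'
    have := Nat.mul_le_mul_right (n * t) hQ.out
    rw [pow_one]; omega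
  · intro μ' h'
    simp only [eval]
    rw [h'.eq xPar, hn, ht]
    push_cast; rfl
  · intro j μ' v h
    simpa using h
  · intro j hj μ₁ hf₁ hj₁ h₁
    rw [mul_one]
    refine .block fun x hx => ?_
    have e : (RamProg.store xPr (rg xCk + rg xCk) (rg xCk) ;;
        .store xPr (rg xCk + rg xCk + .lit 1) (rg xCk)).run μ₁ xPr =
        Function.update (Function.update (μ₁ xPr) (j + j) j) (j + j + 1) j := by
      simp [run, hj₁]
    rw [e]
    rcases eq_or_ne x (2 * j + 1) with rfl | h1
    · have : ((2 * j + 1 : ℕ) : ℤ) = j + j + 1 := by push_cast; ring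
      rw [this, Function.update_self]; omega
    rw [Function.update_of_ne (by omega)]
    rcases eq_or_ne x (2 * j) with rfl | h2
    · have : ((2 * j : ℕ) : ℤ) = j + j := by push_cast; ring
      rw [this, Function.update_self]; omega
    rw [Function.update_of_ne (by omega)]
    exact h₁ x (by omega)

theorem hornerP_runs {a x h i q M l : ℕ} {d : ℕ → ℤ} (ha : a = 1 ∨ a = 2) (hx : μ xPar x = h)
    (hhQ : h ≤ Q) (ht : μ xPar 3 = t) (hM : μ xM 0 = M) (hMQ : M ≤ Q) (hi : μ xBi 0 = i)
    (hq : μ xPq 0 = q) (hit : μ xIt i = (i * t : ℕ)) (hacc : μ xAc 0 = code M 1 d l)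
    (hd : ∀ p : ℕ, p < h → μ a ((i * h + p) * t + q : ℕ) = d (l + p)) :
    Runs (hornerP a x) μ (Q ^ 9) fun μ' => μ' xAc 0 = code M 1 d (l + h) := by
  unfold hornerP
  refine Runs.seqQ ((Runs.mulP 1 (c := (i * t : ℕ)) (N := h) (by simp [hi, hit]) (by simp [hx])
    (by simpa using hhQ) (hc₂ := by simp [cost])).up) fun μ₁ hf₁ h₁ => ?_
  replace hf₁ : ∀ b, b ∉ [xMa, xMc] → μ₁ b = μ b := fun b hb => hf₁ b (by
    simp only [List.mem_cons, List.not_mem_nil, or_false, not_or] at hb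
    simp [mulP, forP, mods, hb])
  refine Runs.seqQ (R' := fun μ' => μ' xAd 0 = (i * t * h + q : ℕ))
      (.block (by simp [run, h₁, hf₁ xPq (by decide), hq]))
    fun μ₂ hf₂ h₂ => ?_
  have tr : ∀ b, b ∉ [xMa, xMc, xAd] → μ₂ b = μ b := fun b hb => by
    simp only [List.mem_cons, List.not_mem_nil, or_false, not_or] at hb
    rw [hf₂ b (by simp [mods, hb.2.2]), hf₁ b (by simp [hb.1, hb.2.1])]
  have ha2 : μ₂ a = μ a := by rcases ha with rfl | rfl <;> exact tr _ (by decide)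
  refine (Runs.forQ (N := h) (e := 5) 1 (fun j μ' => μ' xAc 0 = code M 1 d (l + j) ∧
    μ' xAd 0 = (i * t * h + q + j * t : ℕ)) (by simpa using hhQ) ?_ ?_
    (by simpa [tr xAc (by decide), hacc] using h₂) ?_ (by simp [mulP, forP, mods])
    (by simp [cost])).post
    fun μ' _ h => h.1
  · intro μ' h'
    simp only [eval]
    rw [h'.eq xPar (ha' := by simp [mulP, forP, mods]), tr xPar (by decide), hx]
  · intro j μ' v h
    simpa using h
  · rintro j hj μ₃ hf₃ hj₃ ⟨h3, h4⟩
    replace hf₃ : ∀ b, b ∉ [xSl, xMu, xMc, xAc, xAd] → μ₃ b = μ₂ b := fun b hb => by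
      simp only [List.mem_cons, List.not_mem_nil, or_false, not_or] at hb
      exact hf₃ b hb.1 (by simp [mulP, forP, mods, hb])
    have ha3 : μ₃ a = μ a := by
      rw [← ha2]; rcases ha with rfl | rfl <;> exact hf₃ _ (by decide)
    refine Runs.seqQ (Runs.mulP 1 (c := code M 1 d (l + j)) (N := M) (by simp [h3])
      (by simp [hf₃ xM (by decide), tr xM (by decide), hM]) (by simpa using hMQ))
      fun μ₄ hf₄ h₄ => .block ?_ rfl
        (by simp [maxCost, cost])
    have hv : μ₄ a (i * t * h + q + j * t : ℕ) = d (l + j) := by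
      rw [← hd j hj, ← ha3]
      have : i * t * h + q + j * t = (i * h + j) * t + q := by ring
      rw [this]
      rcases ha with rfl | rfl <;> rw [hf₄.eq _]
    have p4 : μ₄ xPar 3 = t := by
      rw [hf₄.eq _, hf₃ _ (by decide), tr _ (by decide), ht]
    have d4 : μ₄ xAd 0 = (i * t * h + q + j * t : ℕ) := by rw [hf₄.eq _, h4]
    refine ⟨?_, ?_⟩
    · push_cast at hv d4
      rw [← Nat.add_assoc, code]
      simp [run, h₄, d4, hv]
    · simp [run, d4, p4]; ring

theorem codesP_runs {M : ℕ} {μ₀ : RamMemory} (h₀ : I.IsInput b μ₀) (e₀ : Agree [xPar, 1, 2] μ₀ μ)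
    (hQ0 : r + s ≤ Q) (hn : 1 ≤ n) (ht : 1 ≤ t) (hM : μ xM 0 = M) (hMQ : M ≤ Q)
    (hit : ∀ i : ℕ, i < n → μ xIt i = (i * t : ℕ)) :
    Runs codesP μ (Q ^ 14 * (n * t)) fun μ' => ∀ (i : Fin n) (q : Fin t),
      μ' xCode (i * t + q : ℕ) = code M 1 (fun d => I.colDigit d (i, q)) (r + s) := by
  have n_eq : μ xPar 0 = n := by rw [e₀ _ (by decide)]; exact h₀.n_eq
  have r_eq : μ xPar 1 = r := by rw [e₀ _ (by decide)]; exact h₀.r_eq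
  have s_eq : μ xPar 2 = s := by rw [e₀ _ (by decide)]; exact h₀.s_eq
  have t_eq : μ xPar 3 = t := by rw [e₀ _ (by decide)]; exact h₀.t_eq
  have hA : ∀ (i : Fin n) (q : Fin t) (p : ℕ), p < r →
      μ 1 ((i * r + p) * t + q : ℕ) = I.colDigit p (i, q) := fun i q p hp => by
    have := h₀.A_eq i ⟨p, hp⟩ q
    push_cast
    rw [e₀ _ (by decide), NFoldInstance.colDigit, dif_pos hp, ← this]
  have hB : ∀ (i : Fin n) (q : Fin t) (p : ℕ), p < s →
      μ 2 ((i * s + p) * t + q : ℕ) = I.colDigit (r + p) (i, q) := fun i q p hp => by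
    have := h₀.B_eq i ⟨p, hp⟩ q
    have e : r + p - r = p := by omega
    push_cast
    rw [NFoldInstance.colDigit, dif_neg (by omega), dif_pos (by omega)]
    simp only [e]
    rw [e₀ _ (by decide), ← this]
  unfold codesP
  have := Runs.forX (Q := Q) (N := n) (e := 13) (f := 0) (X := t) (Y := n) (i := xBi)
    (hi := .load xPar (.lit 0)) (body := forP xPq (.load xPar (.lit 3))
    (setR xAc (.lit 1) ;; hornerP 1 1 ;; hornerP 2 2 ;;
      .store xCode (.load xIt (rg xBi) + rg xPq) (rg xAc))) (μ₀ := μ)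
    (fun j μ' => ∀ (i : Fin n) (q : Fin t), (i * t + q : ℕ) < j * t →
      μ' xCode (i * t + q : ℕ) = code M 1 (fun d => I.colDigit d (i, q)) (r + s)) ht hn (by simp) ?_
          ?_ (by simp) ?_
  · exact this.mono (by simp) fun μ' _ h i q => h i q (index_lt i.2 q.2)
  · intro μ' h'
    simp only [eval]
    rw [h'.eq xPar, n_eq]
  · intro j μ' v h
    simpa using h
  intro i hi μ₁ hf₁ hi₁ h₁
  have e₁ : Agree [xPar, xIt, xM, 1, 2] μ μ₁ := Agree.of_loop hf₁
  have := Runs.forX (Q := Q) (N := t) (e := 12) (f := 0) (X := 1) (Y := t) (i := xPq)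
    (hi := .load xPar (.lit 3)) (body := setR xAc (.lit 1) ;; hornerP 1 1 ;; hornerP 2 2 ;;
      .store xCode (.load xIt (rg xBi) + rg xPq) (rg xAc)) (μ₀ := μ₁)
    (fun j μ' => ∀ (i' : Fin n) (q : Fin t), (i' * t + q : ℕ) < i * t + j →
      μ' xCode (i' * t + q : ℕ) = code M 1 (fun d => I.colDigit d (i', q)) (r + s)) le_rfl ht
          (by simp) ?_ ?_ h₁ ?_
  · exact this.mono (by simp) fun μ' _ h i' q h' => h i' q (by rwa [Nat.succ_mul] at h')
  · intro μ' h'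
    simp only [eval]
    rw [h'.eq xPar, e₁ xPar (by decide), t_eq]
  · intro j μ' v h
    simpa using h
  intro q hq μ₂ hf₂ hq₂ h₂
  have e₂ : Agree [xPar, xIt, xM, 1, 2] μ μ₂ := e₁.trans (Agree.of_loop hf₂)
  have hi₂ : μ₂ xBi 0 = i := by rw [hf₂.eq _, hi₁]
  set d : ℕ → ℤ := fun d => I.colDigit d (⟨i, hi⟩, ⟨q, hq⟩)
  rw [mul_one]
  refine Runs.seqQ (R' := fun μ' => μ' xAc 0 = code M 1 d 0) (.block (by simp [run, code]))
      fun μ₃ hf₃ h₃ => ?_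
  have e₃ : Agree [xPar, xIt, xM, 1, 2] μ μ₃ := e₂.trans hf₃.agree
  refine Runs.seqQ ((hornerP_runs (h := r) (i := i) (q := q) (t := t) (.inl rfl)
    (by rw [e₃ _ (by decide)]; exact r_eq) (by omega) (by rw [e₃ _ (by decide), t_eq])
    (by rw [e₃ _ (by decide), hM]) hMQ (by rw [hf₃.eq _, hi₂])
    (by rw [hf₃.eq _, hq₂]) (by rw [e₃ _ (by decide), hit i hi]) h₃ fun p hp => ?_).up)
      fun μ₄ hf₄ h₄ => ?_
  · rw [e₃ _ (by decide), Nat.zero_add]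
    exact hA ⟨i, hi⟩ ⟨q, hq⟩ p hp
  have e₄ : Agree [xPar, xIt, xM, 1, 2] μ μ₄ := e₃.trans hf₄.agree
  rw [Nat.zero_add] at h₄
  have hi₄ : μ₄ xBi 0 = i := by rw [hf₄.eq _, hf₃.eq _, hi₂]
  have hq₄ : μ₄ xPq 0 = q := by rw [hf₄.eq _, hf₃.eq _, hq₂]
  refine Runs.seqQ (hornerP_runs (h := s) (i := i) (q := q) (t := t) (.inr rfl)
    (by rw [e₄ _ (by decide)]; exact s_eq) (by omega) (by rw [e₄ _ (by decide), t_eq])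
    (by rw [e₄ _ (by decide), hM]) hMQ hi₄ hq₄ (by rw [e₄ _ (by decide), hit i hi]) h₄
    fun p hp => ?_) fun μ₅ hf₅ h₅ => .block fun i' q' h' => ?_
  · rw [e₄ _ (by decide)]
    exact hB ⟨i, hi⟩ ⟨q, hq⟩ p hp
  have e₅ : Agree [xPar, xIt, xM, 1, 2] μ μ₅ := e₄.trans hf₅.agree
  have hi₅ : μ₅ xBi 0 = i := by rw [hf₅.eq _, hi₄]
  have hq₅ : μ₅ xPq 0 = q := by rw [hf₅.eq _, hq₄]
  have e : (RamProg.store xCode (.load xIt (rg xBi) + rg xPq) (rg xAc)).run μ₅ xCode =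
      Function.update (μ₂ xCode) (i * t + q : ℕ) (code M 1 d (r + s)) := by
    rw [← hf₃.eq xCode, ← hf₄.eq xCode, ← hf₅.eq xCode]
    simp [run, hi₅, hq₅, h₅, e₅ xIt (by decide), hit i hi]
  rw [e]
  by_cases c : (i' * t + q' : ℕ) = i * t + q
  · obtain ⟨rfl, rfl⟩ := Prod.mk.inj
      (address_inj (v := (i', q')) (w := (⟨i, hi⟩, ⟨q, hq⟩)) c)
    rw [Function.update_self]
  · rw [Function.update_of_ne (by exact_mod_cast c)]
    exact h₂ i' q' (by omega)

theorem HoldsList.getD {a c : ℕ} {l : List ℤ} (h : HoldsList a c l μ) (y : ℕ)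
    (hy : y < l.length) : μ a y = (l[y]?).getD 0 := by
  rw [h.2 y l[y] (List.getElem?_eq_getElem hy), List.getElem?_eq_getElem hy, Option.getD_some]

/-- Computes the numerical parameters. -/
def numbersP : RamProg := entriesP ;; cubeP ;; ordP ;; baseP

/-- Computes the three lists of states. -/
def listsP : RamProg :=
  listP xVl xV (rg xKc) (rg xR) (rg xW) ;; listP xVlv xVv (.load xPar (.lit 4)) (rg xR) (.lit 0) ;;
  listP xVlw xVw (rg xKc) (.lit 0) (.lit 0)

/-- Computes the static data. -/
def staticP : RamProg :=
  numbersP ;; listsP ;; indexP ;; setR xCr (rg xVv) ;; sumsP xIv ;; halfP ;; codesP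

theorem numbersP_runs (h : I.IsInput b μ) (hn : 1 ≤ n) (ht : 1 ≤ t) {Δ : ℕ} (hΔ : 2 ≤ Δ)
    (hI : I.EntriesLe Δ) (hS : ∀ δ, 2 ≤ δ → δ ≤ Δ → SmallSizes r s k δ Q) :
    Runs numbersP μ (Q ^ 17 * (n * t)) fun μ' => (∀ i : ℕ, i < n → μ' xIt i = (i * t : ℕ)) ∧
      μ' xK 0 = (2 ^ Nat.clog 2 k : ℕ) ∧
      (∀ a : ℕ, a < 2 ^ Nat.clog 2 k → μ' xOrd a = ordf (Nat.clog 2 k) a) ∧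
      μ' xKk 0 = (k ^ 2 : ℕ) ∧ μ' xKc 0 = (k ^ 3 : ℕ) ∧ ∃ δ, 2 ≤ δ ∧ δ ≤ Δ ∧ I.EntriesLe δ ∧
      μ' xR 0 = (k ^ 3 * δ : ℕ) ∧ μ' xW 0 = digitBound (r + s) k δ ∧
      μ' xM 0 = codeBase (r + s) k δ ∧ μ' xH 0 = (codeBase (r + s) k δ : ℤ) ^ (r + s) := by
  have hX : 1 ≤ n * t := Nat.mul_pos hn ht
  unfold numbersP
  refine Runs.seqX ((entriesP_runs h hn ht (hS 2 le_rfl hΔ).rs hΔ hI).upX) ?_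
  rintro μ₁ hf₁ ⟨t1, δ, d1, d2, d3, d4⟩
  have hS := hS δ d2 d3
  have hδQ : δ ≤ Q := by have := hS.del; omega
  have hkQ : k ≤ Q := by
    have := hS.kc
    have : k ≤ k ^ 3 := Nat.le_self_pow (by norm_num) k
    omega
  refine Runs.seqX (.raise (cubeP_runs (k := k) (by rw [hf₁.eq _]; exact h.k_eq)
    d1 hkQ hδQ) hX) ?_
  rintro μ₂ hf₂ ⟨k1, k2, k3⟩
  refine Runs.seqX (.raise (ordP_runs (k := k)
    (by rw [hf₂.eq _, hf₁.eq _]; exact h.k_eq) hS.K hkQ) hX) ?_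
  rintro μ₃ hf₃ ⟨o1, o2, o3⟩
  have par : μ₃ xPar = μ xPar := by
    rw [hf₃.eq _, hf₂.eq _, hf₁.eq _]
  refine (Runs.raise (baseP_runs hS (by rw [par]; exact h.r_eq) (by rw [par]; exact h.s_eq)
    (by rw [hf₃.eq _, hf₂.eq _, d1]) (by rw [hf₃.eq _, k3]) o2)
    hX).post ?_
  rintro μ₄ hf₄ ⟨w1, w2, w3⟩
  rw [hf₄.eq xIt, hf₄.eq xK, hf₄.eq xOrd, hf₄.eq xKk,
    hf₄.eq xKc, hf₄.eq xR, hf₃.eq xIt, hf₃.eq xKk,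
    hf₃.eq xKc, hf₃.eq xR, hf₂.eq xIt]
  exact ⟨t1, o1, o3, k1, k2, δ, d2, d3, d4, k3, w1, w2, w3⟩

theorem listsP_runs {δ : ℕ} (hS : SmallSizes r s k δ Q) (hr : μ xPar 1 = r) (hs : μ xPar 2 = s)
    (hk : μ xPar 4 = k) (hKc : μ xKc 0 = (k ^ 3 : ℕ)) (hR : μ xR 0 = (k ^ 3 * δ : ℕ))
    (hW : μ xW 0 = digitBound (r + s) k δ) (hM : μ xM 0 = codeBase (r + s) k δ) :
    Runs listsP μ (Q ^ 17) fun μ' =>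
      HoldsList xVl xV (stateList (codeBase (r + s) k δ) (k ^ 3)
        (digitRange r (k ^ 3 * δ) (digitBound (r + s) k δ)) (r + s)) μ' ∧
      HoldsList xVlv xVv (stateList (codeBase (r + s) k δ) k (digitRange r (k ^ 3 * δ) 0) (r + s))
          μ' ∧
      HoldsList xVlw xVw (stateList (codeBase (r + s) k δ) (k ^ 3) (digitRange r 0 0) (r + s))
          μ' := by
  have h0 : 2 * 0 + 1 ≤ Q := one_le_of_fact Q
  unfold listsP
  refine Runs.seqQ (.up (listP_runs (by decide) (by decide) (by decide) (by decide) hr hs hM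
    hS.base hKc hR hW hS.V hS.rs hS.R hS.W)) fun μ₁ hf₁ h₁ => ?_
  refine Runs.seqQ (listP_runs (r := r) (s := s) (M := codeBase (r + s) k δ) (N := k)
    (R := k ^ 3 * δ) (R' := 0) (by decide) (by decide) (by decide) (by decide)
    (by rw [hf₁.eq _, hr]) (by rw [hf₁.eq _, hs]) (by rw [hf₁.eq _, hM])
    hS.base (by simp [hf₁.eq xPar, hk]) (by simp [hf₁.eq xR, hR]) rfl
    hS.V₂ hS.rs hS.R h0) fun μ₂ hf₂ h₂ => ?_
  have tr : ∀ a ∈ [xPar, xM, xKc], μ₂ a = μ a := fun a ha => by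
    rw [hf₂ a (by revert a; decide), hf₁ a (by revert a; decide)]
  refine (listP_runs (r := r) (s := s) (M := codeBase (r + s) k δ) (N := k ^ 3)
    (R := 0) (R' := 0) (by decide) (by decide) (by decide) (by decide)
    (by rw [tr _ (by decide), hr]) (by rw [tr _ (by decide), hs]) (by rw [tr _ (by decide), hM])
    hS.base (by simp [tr xKc (by decide), hKc]) rfl rfl
    hS.V₃ hS.rs h0 h0).post fun μ₃ hf₃ h₃ => ?_
  exact ⟨(h₁.congr hf₂.agree).congr hf₃.agree,
    h₂.congr hf₃.agree, h₃⟩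

theorem staticP_runs (h : I.IsInput b μ) (hn : 1 ≤ n) (ht : 1 ≤ t) {Δ : ℕ} (hΔ : 2 ≤ Δ)
    (hI : I.EntriesLe Δ) (hS : ∀ δ, 2 ≤ δ → δ ≤ Δ → SmallSizes r s k δ Q) :
    Runs staticP μ (Q ^ 20 * (n * t)) fun μ' => ∃ δ, 2 ≤ δ ∧ δ ≤ Δ ∧ I.EntriesLe δ ∧
      (setupOf r s k δ).StaticAt I μ' := by
  have hX : 1 ≤ n * t := Nat.mul_pos hn ht
  have hX' : n ≤ n * t := Nat.le_mul_of_pos_right _ ht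
  unfold staticP
  refine Runs.seqX (.upX (numbersP_runs h hn ht hΔ hI hS)) ?_
  rintro μ₁ hf₁ ⟨t1, K1, o1, k1, k2, δ, d1, d2, d3, r1, w1, m1, H1⟩
  have hS := hS δ d1 d2
  have in₁ : Agree [0, 1, 2, 3, 4, 5, 6] μ μ₁ := hf₁.agree
  refine Runs.seqX (.raise (listsP_runs hS (by rw [in₁.eq _]; exact h.r_eq)
    (by rw [in₁.eq _]; exact h.s_eq) (by rw [in₁.eq _]; exact h.k_eq) k2 r1 w1 m1) hX) ?_
  rintro μ₂ hf₂ ⟨l1, l2, l3⟩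
  have in₂ := in₁.trans hf₂.agree
  have hL := setupOf_lists r s k δ
  refine Runs.seqX (.raise (indexP_runs (V := (setupOf r s k δ).V)
    (vl := (setupOf r s k δ).vl) l1.1 hS.V l1.getD hL.inj fun z => ?_) hX)
    fun μ₃ hf₃ h₃ => ?_
  · rw [hf₂.eq _, hf₁.eq _]; exact h.zero_eq _ (by norm_num) z
  have in₃ := in₂.trans hf₃.agree
  refine Runs.seqX (R' := fun μ' => μ' xCr 0 = (setupOf r s k δ).V₂) (.blockX hX ?_)
      fun μ₄ hf₄ h₄ => ?_
  · have : μ₃ xVv 0 = (setupOf r s k δ).V₂ := by rw [hf₃.eq xVv]; exact l2.1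
    simpa [run] using this
  have in₄ := in₃.trans hf₄.agree
  refine Runs.seqX (.upX ((sumsP_runs (n := n) (.inr rfl)
    (by rw [in₄.eq _]; exact h.n_eq) hn h₄).mono (Nat.mul_le_mul_left _ hX')
    fun _ _ h => h)) ?_
  rintro μ₅ hf₅ ⟨v5, -⟩
  have in₅ := in₄.trans hf₅.agree
  refine Runs.seqX (.upX (halfP_runs (n := n) (t := t)
    (by rw [in₅.eq _]; exact h.n_eq) (by rw [in₅.eq _]; exact h.t_eq) hn ht)) fun μ₆ hf₆ h₆ => ?_
  have in₆ := in₅.trans hf₆.agree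
  have keep : ∀ a ∈ [xIt, xM], μ₆ a = μ₁ a := fun a ha => by
    rw [hf₆ a (by revert a; decide), hf₅ a (by revert a; decide), hf₄ a (by revert a; decide),
      hf₃ a (by revert a; decide), hf₂ a (by revert a; decide)]
  refine (codesP_runs (M := codeBase (r + s) k δ) h (fun a ha => in₆ a (by revert a; decide)) hS.rs
      hn ht
    (by rw [keep _ (by decide), m1]) hS.base (by rw [keep _ (by decide)]; exact t1)).post
    fun μ₇ hf₇ h₇ => ⟨δ, d1, d2, d3, ?_⟩
  have in₇ := in₆.trans hf₇.agree
  have keep₁ : ∀ a ∈ [xK, xOrd, xKk, xH, xIt], μ₇ a = μ₁ a := fun a ha => by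
    rw [hf₇ a (by revert a; decide), hf₆ a (by revert a; decide), hf₅ a (by revert a; decide),
      hf₄ a (by revert a; decide), hf₃ a (by revert a; decide), hf₂ a (by revert a; decide)]
  have keep₃ : ∀ a ∈ [xVl, xV, xVlv, xVv, xVlw, xVw, xVf], μ₇ a = μ₃ a := fun a ha => by
    rw [hf₇ a (by revert a; decide), hf₆ a (by revert a; decide), hf₅ a (by revert a; decide),
      hf₄ a (by revert a; decide)]
  have keep₂ : ∀ a ∈ [xVl, xV, xVlv, xVv, xVlw, xVw], μ₇ a = μ₂ a := fun a ha => by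
    rw [keep₃ a (by revert a; decide), hf₃ a (by revert a; decide)]
  exact {
    n_eq := by rw [in₇.eq _]; exact h.n_eq
    t_eq := by rw [in₇.eq _]; exact h.t_eq
    k_eq := by rw [in₇.eq _]; exact h.k_eq
    K_eq := by rw [keep₁ _ (by decide)]; exact K1
    V_eq := by rw [keep₂ _ (by decide)]; exact l1.1
    V₂_eq := by rw [keep₂ _ (by decide)]; exact l2.1
    V₃_eq := by rw [keep₂ _ (by decide)]; exact l3.1
    H_eq := by rw [keep₁ _ (by decide)]; exact H1
    kk_eq := by rw [keep₁ _ (by decide)]; exact k1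
    states := by rw [keep₃ _ (by decide), keep₃ _ (by decide)]; exact h₃
    vl₂_eq := by rw [keep₂ _ (by decide)]; exact l2.getD
    vl₃_eq := by rw [keep₂ _ (by decide)]; exact l3.getD
    ord_eq := by rw [keep₁ _ (by decide)]; exact o1
    code_eq := h₇
    it_eq := by rw [keep₁ _ (by decide)]; exact t1
    iv_eq := by rw [hf₇.eq _, hf₆.eq _]; exact v5
    par_eq := by rw [hf₇.eq _]; exact h₆
    c_eq := fun i q => by rw [in₇.eq _]; exact_mod_cast h.c_eq i q
    P_eq := fun i => by rw [in₇.eq _]; exact h.P_eq i }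

end Parameters

/-! ### Initialization -/

/-- Computes the leaves of the selected merge tree of units. -/
def unitLeavesP : RamProg :=
  forP xPq (.load xPar (.lit 3)) (posLeafP ;; leafP ;; negLeafP ;; leafP)

/-- Computes the merge trees of units. -/
def unitTreesP : RamProg :=
  forP xBi (.load xPar (.lit 0)) (forP xYy (rg xV) (selectP ;; unitLeavesP ;; buildP))

/-- Computes the tables of the bricks. -/
def tablesP : RamProg := forP xBi (.load xPar (.lit 0)) brickTableP

/-- Computes the leaves of the merge trees over the bricks. -/
def setLeavesP : RamProg :=
  forP xBi (.load xPar (.lit 0)) (forP xYy (rg xVv) (setLeafP ;; leafP))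

/-- Computes the merge trees over the bricks. -/
def setTreesP : RamProg :=
  mulP xGa xMc (rg xVv) (rg xKk) ;;
  (setR xNb (.lit 0) ;; setR xTm (.load xPar (.lit 0)) ;; setR xTk (.lit 1)) ;;
  forP xCk (rg xGa) (setR xNb (rg xNb - rg xTm - rg xTm) ;; buildP)

/-- The initialization program. -/
def initP : RamProg := staticP ;; unitTreesP ;; tablesP ;; setLeavesP ;; setTreesP ;; finalP

theorem SmallSizes.ok {n r s t k Q δ : ℕ} {I : NFoldInstance n r s t k}
    (hS : SmallSizes r s k δ Q) (hn : 1 ≤ n) (ht : 1 ≤ t) (hk : 1 ≤ k)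
    (hδ : I.EntriesLe δ) : (setupOf r s k δ).OK I Q :=
  ⟨hn, ht, hk, hδ, setupOf_lists r s k δ, hS.V, hS.V₂, hS.V₃, by have := hS.kc; omega, hS.K⟩

section Init

variable {n r s t k Q : ℕ} [hQ : Fact (1024 ≤ Q)] {D : Setup} {I : NFoldInstance n r s t k}
  {b : StepBounds n t} {μ : RamMemory} {tab : ℕ → ℕ → Option (List ℕ × ℤ)}

theorem leaf_sep {nb : ℤ} {m κ p p' : ℕ} (h : p' ≠ p) {z : ℤ} (h1 : nb + (m + p' : ℕ) * κ ≤ z)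
    (h2 : z < nb + (m + p' : ℕ) * κ + κ) :
    ¬ (nb + (m + p : ℕ) * κ ≤ z ∧ z < nb + (m + p : ℕ) * κ + κ) := by
  rintro ⟨h3, h4⟩
  have hw : (0 : ℤ) ≤ κ := by positivity
  push_cast at *
  rcases lt_or_gt_of_ne h with h5 | h5
  · have : ((m : ℤ) + p' + 1) * κ ≤ (m + p) * κ := mul_le_mul_of_nonneg_right (by omega) hw
    linarith
  · have : ((m : ℤ) + p + 1) * κ ≤ (m + p') * κ := mul_le_mul_of_nonneg_right (by omega) hw
    linarith

theorem leaf_range {nb : ℤ} {m κ p : ℕ} (h : p < m) :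
    nb ≤ nb + (m + p : ℕ) * κ ∧ nb + (m + p : ℕ) * κ + κ ≤ nb + 2 * (m : ℕ) * κ := by
  have h1 : (0 : ℤ) ≤ (m + p : ℕ) * κ := by positivity
  have h2 : ((m : ℤ) + p + 1) * κ ≤ (2 * m) * κ :=
    mul_le_mul_of_nonneg_right (by omega) (by positivity)
  push_cast at *
  exact ⟨by linarith, by linarith⟩

/-- The leaf `p` of the merge tree at `nb` holds the list `l`. -/
def LeafAt (nb : ℤ) (m κ p : ℕ) (l : List (ℕ × ℤ)) (μ : RamMemory) : Prop :=
  ListAt (μ xWin) (μ xVal) (nb + (m + p : ℕ) * κ) κ l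

theorem LeafAt.of_same {nb : ℤ} {m κ p p' : ℕ} {l : List (ℕ × ℤ)} {μ' : RamMemory}
    (h : LeafAt nb m κ p' l μ) (hs : SameTrees μ μ' (nb + (m + p : ℕ) * κ) κ) (hp : p' ≠ p) :
    LeafAt nb m κ p' l μ' := ListAt.congr h fun z h1 h2 => hs z (leaf_sep hp h1 h2)

theorem leafP_runs_of_selected {nb : ℤ} {m κ p : ℕ} {l : List (ℕ × ℤ)} (hκ : κ ≤ Q)
    (hsel : Selected nb m κ μ) (hl : LeafIs p l μ) :
    Runs leafP μ (Q ^ 6) fun μ' => LeafAt nb m κ p l μ' ∧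
      SameTrees μ μ' (nb + (m + p : ℕ) * κ) κ := by
  obtain ⟨l1, cap, g, l2, l3, rfl⟩ := hl
  exact leafP_runs hκ hsel.1 hsel.2.1 hsel.2.2 l1 l2 l3

theorem unitLeavesP_runs (hD : D.OK I Q) (hst : D.StaticAt I μ) (hb : BoundsAt b μ) {i y : ℕ}
    (hi : i < n) (hy : y < D.V) (hi' : μ xBi 0 = i) (hy' : μ xYy 0 = y) {nb : ℤ}
    (hsel : Selected nb (2 * t) (2 ^ Nat.clog 2 k) μ) :
    Runs unitLeavesP μ (Q ^ 12 * t) fun μ' =>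
      (∀ p < 2 * t, LeafAt nb (2 * t) (2 ^ Nat.clog 2 k) p ((D.brick I b i).leaf (D.vl y) p) μ') ∧
      SameTrees μ μ' nb (2 * (2 * t : ℕ) * (2 ^ Nat.clog 2 k : ℕ)) := by
  have ht := hD.t_pos
  set κ := 2 ^ Nat.clog 2 k
  have hin : ∀ {μ₁ μ₂ : RamMemory} {p : ℕ}, p < 2 * t →
      SameTrees μ₁ μ₂ (nb + (2 * t + p : ℕ) * κ) κ → SameTrees μ₁ μ₂ nb (2 * (2 * t : ℕ) * κ) :=
    fun hp h => h.mono (leaf_range hp).1 (leaf_range hp).2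
  have := Runs.forX (Q := Q) (N := t) (e := 11) (f := 0) (X := 1) (Y := t) (i := xPq)
    (hi := .load xPar (.lit 3)) (body := posLeafP ;; leafP ;; negLeafP ;; leafP) (μ₀ := μ)
    (fun j μ' => (∀ p < j, LeafAt nb (2 * t) κ p ((D.brick I b i).leaf (D.vl y) p) μ' ∧
      LeafAt nb (2 * t) κ (t + p) ((D.brick I b i).leaf (D.vl y) (t + p)) μ') ∧
      SameTrees μ μ' nb (2 * (2 * t : ℕ) * κ)) le_rfl ht (by simp) ?_ ?_ ⟨by simp, .refl rfl rfl⟩ ?_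
  · refine this.mono (by simp) ?_
    rintro μ' - ⟨h1, h2⟩
    refine ⟨fun p hp => ?_, h2⟩
    by_cases c : p < t
    · exact (h1 p c).1
    · have := (h1 (p - t) (by omega)).2
      rwa [Nat.add_sub_cancel' (not_lt.mp c)] at this
  · intro μ' h'
    simp only [eval]
    rw [h'.eq xPar, hst.t_eq]
  · intro j μ' v h
    simpa [LeafAt, SameTrees] using h
  rintro q hq μ₁ hf₁ hq₁ ⟨h1, h2⟩
  have hst₁ := hst.congr (Agree.of_loop hf₁)
  have hb₁ := hb.congr (Agree.of_loop hf₁)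
  have hi₁ : μ₁ xBi 0 = i := by rw [hf₁.eq _, hi']
  have hy₁ : μ₁ xYy 0 = y := by rw [hf₁.eq _, hy']
  have sel₁ := hsel.congr (Agree.of_loop hf₁)
  rw [mul_one]
  refine Runs.seqQ (.block (posLeafP_run hst₁ hb₁ hy ⟨i, hi⟩ ⟨q, hq⟩ hi₁ hy₁ hq₁)) fun μ₂ hf₂ h₂ =>
      ?_
  have sel₂ := sel₁.congr hf₂.agree
  refine Runs.seqQ (.up (leafP_runs_of_selected hD.K_le sel₂ h₂)) ?_
  rintro μ₃ hf₃ ⟨a3, s3⟩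
  have e₃ : ∀ a ∈ [xBi, xYy, xPq], μ₃ a = μ₁ a := fun a ha => by
    rw [hf₃ a (by revert a; decide), hf₂ a (by revert a; decide)]
  have hst₃ := (hst₁.congr hf₂.agree).congr hf₃.agree
  have hb₃ := (hb₁.congr hf₂.agree).congr hf₃.agree
  refine Runs.seqQ (.block (negLeafP_run hst₃ hb₃ hy ⟨i, hi⟩ ⟨q, hq⟩
      (by rw [e₃ _ (by decide)]; exact hi₁)
      (by rw [e₃ _ (by decide), hy₁]) (by rw [e₃ _ (by decide)]; exact hq₁)))
    fun μ₄ hf₄ h₄ => ?_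
  have sel₄ := (sel₂.congr hf₃.agree).congr hf₄.agree
  refine ((leafP_runs_of_selected hD.K_le sel₄ h₄).up).post ?_
  rintro μ₅ hf₅ ⟨a5, s5⟩
  have s3' : SameTrees μ₁ μ₃ (nb + (2 * t + q : ℕ) * κ) κ :=
    (SameTrees.refl (hf₂.eq _) (hf₂.eq _)).trans s3
  have s5' : SameTrees μ₃ μ₅ (nb + (2 * t + (t + q) : ℕ) * κ) κ :=
    (SameTrees.refl (hf₄.eq _) (hf₄.eq _)).trans s5
  refine ⟨fun p hp => ?_, h2.trans ((hin (by omega) s3').trans (hin (by omega) s5'))⟩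
  rcases Nat.lt_succ_iff_lt_or_eq.mp hp with hp | rfl
  · exact ⟨((h1 p hp).1.of_same s3' (by omega)).of_same s5' (by omega),
      ((h1 p hp).2.of_same s3' (by omega)).of_same s5' (by omega)⟩
  · exact ⟨LeafAt.of_same a3 s5' (by omega), a5⟩

theorem unitTreesP_runs (hD : D.OK I Q) (hst : D.StaticAt I μ) (hb : BoundsAt b μ) :
    Runs unitTreesP μ (Q ^ 20 * (n * t)) fun μ' =>
      D.TreesAt n t k (fun i y => (D.brick I b i).leaf (D.vl y)) μ' ∧
        ∀ z < 0, μ' xWin z = μ xWin z := by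
  have hn := hD.n_pos
  have ht := hD.t_pos
  set κ := 2 ^ Nat.clog 2 k with hκ
  unfold unitTreesP
  have := Runs.forX (Q := Q) (N := n) (e := 19) (f := 0) (X := t) (Y := n) (i := xBi)
    (hi := .load xPar (.lit 0)) (body := forP xYy (rg xV) (selectP ;; unitLeavesP ;; buildP))
    (μ₀ := μ) (fun j μ' => (∀ i < j, ∀ y < D.V, TreeAt (μ' xWin) (μ' xVal) (D.treeAd t k i y)
      (2 * t) κ ((D.brick I b i).leaf (D.vl y))) ∧ ∀ z < 0, μ' xWin z = μ xWin z) ht hn (by simp) ?_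
          ?_ (by simp) ?_
  · exact this.mono (by simp) fun μ' _ h => h
  · intro μ' h'
    simp only [eval]
    rw [h'.eq xPar, hst.n_eq]
  · intro j μ' v h
    simpa using h
  rintro i hi μ₁ hf₁ hi₁ ⟨h1, h2⟩
  have hst₁ := hst.congr (Agree.of_loop hf₁)
  have hb₁ := hb.congr (Agree.of_loop hf₁)
  have := Runs.forX (Q := Q) (N := D.V) (e := 16) (f := 1) (X := t) (Y := 1) (i := xYy)
    (hi := rg xV) (body := selectP ;; unitLeavesP ;; buildP)
    (μ₀ := μ₁) (fun j μ' => (∀ i' y, y < D.V → (i' < i ∨ i' = i ∧ y < j) →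
      TreeAt (μ' xWin) (μ' xVal) (D.treeAd t k i' y) (2 * t) κ
        ((D.brick I b i').leaf (D.vl y))) ∧ ∀ z < 0, μ' xWin z = μ xWin z) ht le_rfl
            (by simpa using hD.V_le) ?_ ?_ ?_ ?_
  · refine Runs.upX (this.mono (T₂ := Q ^ 18 * t) (by simp) ?_)
    rintro μ' - ⟨g1, g2⟩
    exact ⟨fun i' hi' y hy => g1 i' y hy (by omega), g2⟩
  · intro μ' h'
    rw [eval, eval, h'.eq xV, hst₁.V_eq]
  · intro j μ' v h
    simpa using h
  · exact ⟨fun i' y hy h' => h1 i' (by omega) y hy, h2⟩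
  rintro y hy μ₂ hf₂ hy₂ ⟨g1, g2⟩
  have hst₂ := hst₁.congr (Agree.of_loop hf₂)
  have hb₂ := hb₁.congr (Agree.of_loop hf₂)
  have hi₂ : μ₂ xBi 0 = i := by rw [hf₂.eq _, hi₁]
  refine Runs.seqX ((selectP_runs hD hst₂ hi hy hi₂ hy₂).raise ht)
    fun μ₃ hf₃ sel₃ => ?_
  have hst₃ := hst₂.congr hf₃.agree
  have hb₃ := hb₂.congr hf₃.agree
  refine Runs.seqX ((unitLeavesP_runs hD hst₃ hb₃ hi hy (by rw [hf₃.eq _, hi₂])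
    (by rw [hf₃.eq _, hy₂]) sel₃).upX) ?_
  rintro μ₄ hf₄ ⟨l4, s4⟩
  have sel₄ := sel₃.congr hf₄.agree
  refine ((buildP_runs (Q := Q) hD.K_le (by omega) sel₄.1 sel₄.2.1 sel₄.2.2 l4).mono
    (T₂ := Q ^ 14 * t) ?_ fun _ _ h => h).post ?_
  · calc Q ^ 10 * (2 * t) ≤ Q ^ 10 * (Q * t) :=
        Nat.mul_le_mul_left _ (Nat.mul_le_mul_right _ (by have := hQ.out; omega))
      _ = Q ^ 11 * t := by ring
      _ ≤ Q ^ 14 * t := Nat.mul_le_mul_right _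
        (Nat.pow_le_pow_right (one_le_of_fact Q) (by norm_num))
  rintro μ₅ hf₅ ⟨T5, s5⟩
  have s : SameTrees μ₂ μ₅ (D.treeAd t k i y) (2 * (2 * t : ℕ) * κ) :=
    ((SameTrees.refl (hf₃.eq _) (hf₃.eq _)).trans s4).trans s5
  refine ⟨fun i' y' hy' h' => ?_, fun z hz => ?_⟩
  · by_cases e : i' = i ∧ y' = y
    · obtain ⟨rfl, rfl⟩ := e; exact T5
    · exact (g1 i' y' hy' (by omega)).congr fun z z1 z2 => s z (treeAd_sep D hy hy' e z1 z2)
  · rw [(s z fun h => by have := h.1; omega).1, g2 z hz]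

theorem tablesP_runs (hD : D.OK I Q) (hst : D.StaticAt I μ)
    (hT : D.TreesAt n t k (fun i y => (D.brick I b i).leaf (D.vl y)) μ) :
    Runs tablesP μ (Q ^ 21 * (n * t)) fun μ' => ∃ tab, TablesAt D n k tab μ' ∧
      ∀ i < n, TabOK (D.brick I b i) D.V₂ D.vl₂ (tab i) := by
  have hn := hD.n_pos
  have ht := hD.t_pos
  unfold tablesP
  have := Runs.forX (Q := Q) (N := n) (e := 20) (f := 0) (X := t) (Y := n) (i := xBi)
    (hi := .load xPar (.lit 0)) (body := brickTableP)
    (μ₀ := μ) (fun j μ' => ∃ tab, TablesAt D j k tab μ' ∧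
      ∀ i < j, TabOK (D.brick I b i) D.V₂ D.vl₂ (tab i)) ht hn (by simp) ?_ ?_
    ⟨fun _ _ => none, fun i hi => absurd hi (by omega), by simp⟩ ?_
  · exact this.mono (by simp) fun μ' _ h => h
  · intro μ' h'
    simp only [eval]
    rw [h'.eq xPar, hst.n_eq]
  · rintro j μ' v ⟨tab, h1, h2⟩
    exact ⟨tab, h1.congr fun a ha => RamMemory.write_of_ne _ _ _ (by revert a; decide), h2⟩
  rintro i hi μ₁ hf₁ hi₁ ⟨tab, h1, h2⟩
  have hst₁ := hst.congr (Agree.of_loop hf₁)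
  refine ((brickTableP_runs hD hst₁ hi hi₁ (b := b) fun y hy => ?_).raise ht).post ?_
  · rw [hf₁.eq xWin, hf₁.eq xVal]
    exact hT i hi y hy
  rintro μ₂ hf₂ ⟨tb, t1, t2, t3⟩
  refine ⟨Function.update tab i tb, h1.update t2 t3 (by omega), fun i' hi' => ?_⟩
  by_cases e : i' = i
  · rw [e, Function.update_self]; exact t1
  · rw [Function.update_of_ne e]; exact h2 i' (by omega)

theorem LeafAt.of_same_set {g g' p p' : ℕ} {l : List (ℕ × ℤ)} {μ' : RamMemory}
    (h : LeafAt (setAd n g') n 1 p' l μ)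
    (hs : SameTrees μ μ' (setAd n g + (n + p : ℕ) * (1 : ℕ)) (1 : ℕ)) (hp : p < n)
    (hp' : p' < n) (hne : ¬ (g' = g ∧ p' = p)) : LeafAt (setAd n g') n 1 p' l μ' := by
  by_cases e : g' = g
  · subst e; exact h.of_same hs fun h' => hne ⟨rfl, h'⟩
  · have r1 := leaf_range (nb := setAd n g') (κ := 1) hp'
    have r2 := leaf_range (nb := setAd n g) (κ := 1) hp
    exact ListAt.congr h fun z z1 z2 => hs z fun h' =>
      setAd_sep e (r1.1.trans z1) (z2.trans_le r1.2) ⟨r2.1.trans h'.1, h'.2.trans_le r2.2⟩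

theorem setLeavesP_runs (hD : D.OK I Q) (hst : D.StaticAt I μ) (htab : TablesAt D n k tab μ)
    (h0 : ∀ z < 0, μ xWin z = 0) :
    Runs setLeavesP μ (Q ^ 20 * (n * t)) fun μ' =>
      (∀ g < k ^ 2 * D.V₂, ∀ p < n, LeafAt (setAd n g) n 1 p (D.setLf I tab g p) μ') ∧
        ∀ z, 0 ≤ z → μ' xWin z = μ xWin z ∧ μ' xVal z = μ xVal z := by
  have hn := hD.n_pos
  have ht := hD.t_pos
  -- the leaves in round `y` for brick `i`
  set lf : ℕ → ℕ → ℕ → ℕ → List (ℕ × ℤ) := fun i y g p =>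
    if p < i ∨ p = i ∧ g % D.V₂ < y then D.setLf I tab g p else [] with hlf
  set Inv : ℕ → ℕ → RamMemory → Prop := fun i y μ' =>
    (∀ g < k ^ 2 * D.V₂, ∀ p < n, LeafAt (setAd n g) n 1 p (lf i y g p) μ') ∧
      ∀ z, 0 ≤ z → μ' xWin z = μ xWin z ∧ μ' xVal z = μ xVal z with hInv
  have hV : ∀ g < k ^ 2 * D.V₂, g % D.V₂ < D.V₂ := fun g hg =>
    Nat.mod_lt _ (Nat.pos_of_ne_zero fun h => by simp [h] at hg)
  have hw : ∀ i y j v μ', j ∈ [xBi, xYy] → Inv i y μ' → Inv i y (μ'.write j 0 v) := by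
    intro i y j v μ' hj h
    simp only [hInv, LeafAt] at h ⊢
    rwa [RamMemory.write_of_ne _ _ _ (by revert j; decide),
      RamMemory.write_of_ne _ _ _ (by revert j; decide)]
  unfold setLeavesP
  have := Runs.forX (Q := Q) (N := n) (e := 16) (f := 0) (X := t) (Y := n) (i := xBi)
    (hi := .load xPar (.lit 0)) (body := forP xYy (rg xVv) (setLeafP ;; leafP)) (μ₀ := μ)
    (fun j => Inv j 0) ht hn (by simp) ?_
    (fun j μ' v => hw j 0 _ v μ' (by decide)) ?_ ?_
  · refine Runs.upX (this.mono (T₂ := Q ^ 17 * (n * t)) (by simp) ?_)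
    rintro μ' - ⟨g1, g2⟩
    refine ⟨fun g hg p hp => ?_, g2⟩
    have := g1 g hg p hp
    simp only [hlf] at this
    rwa [if_pos (.inl hp)] at this
  · intro μ' h'
    simp only [eval]
    rw [h'.eq xPar, hst.n_eq]
  · refine ⟨fun g hg p hp => ?_, fun z _ => ⟨rfl, rfl⟩⟩
    simp only [hlf]
    rw [if_neg (by omega)]
    intro j hj
    obtain ⟨r1, r2⟩ := leaf_range (nb := setAd n g) (κ := 1) hp
    have hz := setAd_neg (n := n) (g := g) (z := setAd n g + (n + p : ℕ) * (1 : ℕ) + j)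
      ⟨by omega, by omega⟩
    exact h0 _ hz
  rintro i hi μ₁ hf₁ hi₁ h₁
  have hst₁ := hst.congr (Agree.of_loop hf₁)
  have htab₁ : TablesAt D n k tab μ₁ := htab.congr (Agree.of_loop hf₁)
  have := Runs.forX (Q := Q) (N := D.V₂) (e := 14) (f := 1) (X := t) (Y := 1) (i := xYy)
    (hi := rg xVv) (body := setLeafP ;; leafP) (μ₀ := μ₁) (fun j => Inv i j) ht le_rfl
        (by simpa using hD.V₂_le) ?_
    (fun j μ' v => hw i j _ v μ' (by decide)) h₁ ?_
  · refine this.mono (by simp) ?_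
    rintro μ' - ⟨g1, g2⟩
    refine ⟨fun g hg p hp => ?_, g2⟩
    have := g1 g hg p hp
    have hg' := hV g hg
    simp only [hlf] at this ⊢
    simpa only [show (p < i + 1 ∨ p = i + 1 ∧ g % D.V₂ < 0) ↔ (p < i ∨ p = i ∧ g % D.V₂ < D.V₂)
      by omega] using this
  · intro μ' h'
    rw [eval, eval, h'.eq xVv, hst₁.V₂_eq]
  rintro y hy μ₂ hf₂ hy₂ ⟨g1, g2⟩
  have hst₂ := hst₁.congr (Agree.of_loop hf₂)
  have htab₂ : TablesAt D n k tab μ₂ := htab₁.congr (Agree.of_loop hf₂)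
  have hi₂ : μ₂ xBi 0 = i := by rw [hf₂.eq _, hi₁]
  refine Runs.seqX ((setLeafP_runs hD hst₂ hi hy hi₂ hy₂ (htab₂ i hi y hy)).raise ht) ?_
  rintro μ₃ hf₃ ⟨sel, l3⟩
  refine ((leafP_runs_of_selected (one_le_of_fact Q) sel l3).raise ht).post ?_
  rintro μ₄ hf₄ ⟨l4, s4⟩
  set g₀ := I.setOf i * D.V₂ + y with hg₀
  have hdiv : g₀ / D.V₂ = I.setOf i := div_index hy
  have hmod : g₀ % D.V₂ = y := mod_index hy
  have s : SameTrees μ₂ μ₄ (setAd n g₀ + (n + i : ℕ) * (1 : ℕ)) (1 : ℕ) :=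
    (SameTrees.refl (hf₃.eq _) (hf₃.eq _)).trans s4
  refine ⟨fun g hg p hp => ?_, fun z hz => ?_⟩
  · by_cases e : g = g₀ ∧ p = i
    · obtain ⟨rfl, rfl⟩ := e
      have : lf p (y + 1) g₀ p = setLeaf I.setOf tab (I.setOf p) y p := by
        simp only [hlf, hmod, Setup.setLf, hdiv]
        rw [if_pos (.inr ⟨trivial, Nat.lt_succ_self y⟩)]
      rw [this]
      exact l4
    · have : lf i (y + 1) g p = lf i y g p := by
        simp only [hlf]
        by_cases c : p = i ∧ g % D.V₂ = y
        · have c' : g / D.V₂ ≠ I.setOf i := fun h => e ⟨by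
            rw [hg₀, ← h, ← c.2, Nat.div_add_mod'], c.1⟩
          have : D.setLf I tab g p = [] := by
            rw [Setup.setLf, setLeaf, c.1, if_neg (Ne.symm c')]
          rw [this, ite_self, ite_self]
        · simp only [show (p < i ∨ p = i ∧ g % D.V₂ < y + 1) ↔ (p < i ∨ p = i ∧ g % D.V₂ < y) by
            omega]
      rw [this]
      exact (g1 g hg p hp).of_same_set s hi hp e
  · obtain ⟨r1, r2⟩ := leaf_range (nb := setAd n g₀) (κ := 1) hi
    obtain ⟨e1, e2⟩ := s z fun h => by
      have := setAd_neg (n := n) (g := g₀) (z := z) ⟨by omega, by omega⟩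
      omega
    rw [e1, e2]
    exact g2 z hz

theorem setTreesP_runs (hD : D.OK I Q) (hst : D.StaticAt I μ) {lf : ℕ → ℕ → List (ℕ × ℤ)}
    (h : ∀ g < k ^ 2 * D.V₂, ∀ p < n, LeafAt (setAd n g) n 1 p (lf g p) μ) :
    Runs setTreesP μ (Q ^ 20 * (n * t)) fun μ' => SetTreesAt n (k ^ 2 * D.V₂) lf μ' ∧
        ∀ z, 0 ≤ z → μ' xWin z = μ xWin z ∧ μ' xVal z = μ xVal z := by
  have hn := hD.n_pos
  have hX : 1 ≤ n * t := Nat.mul_pos hn hD.t_pos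
  unfold setTreesP
  refine Runs.seqX ((Runs.mulP 1 (c := D.V₂) (N := k ^ 2) (by simp [hst.V₂_eq])
      (by simp [hst.kk_eq])
    (by simpa using hD.kk_le)).raise hX) fun μ₁ hf₁ h₁ => ?_
  have hst₁ := hst.congr hf₁.agree
  refine Runs.seqX (R' := fun μ' => μ' xNb 0 = 0 ∧ μ' xTm 0 = n ∧ μ' xTk 0 = 1)
    (.blockX hX (by simp [run, hst₁.n_eq])) ?_
  rintro μ₂ hf₂ ⟨b2, m2, k2⟩
  have hw₂ : μ₂ xWin = μ xWin := by rw [hf₂.eq _, hf₁.eq _]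
  have hv₂ : μ₂ xVal = μ xVal := by rw [hf₂.eq _, hf₁.eq _]
  have := Runs.forX (Q := Q) (N := k ^ 2 * D.V₂) (e := 12) (f := 2) (X := n) (Y := 1) (i := xCk)
    (hi := rg xGa) (body := setR xNb (rg xNb - rg xTm - rg xTm) ;; buildP) (μ₀ := μ₂)
    (fun j μ' => μ' xNb 0 = - ((j * (2 * n) : ℕ) : ℤ) ∧
      (∀ g < j, TreeAt (μ' xWin) (μ' xVal) (setAd n g) n 1 (lf g)) ∧
      (∀ g < k ^ 2 * D.V₂, j ≤ g → ∀ p < n, LeafAt (setAd n g) n 1 p (lf g p) μ') ∧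
      ∀ z, 0 ≤ z → μ' xWin z = μ xWin z ∧ μ' xVal z = μ xVal z) hn le_rfl ?_ ?_ ?_ ?_ ?_
  · refine this.mono ?_ fun _ _ h => ⟨h.2.1, h.2.2.2⟩
    rw [one_mul]
    exact Nat.mul_le_mul (Nat.pow_le_pow_right (one_le_of_fact Q) (by norm_num))
      (Nat.le_mul_of_pos_right _ hD.t_pos)
  · exact (Nat.mul_le_mul hD.kk_le hD.V₂_le).trans (by rw [mul_one, pow_two])
  · intro μ' h'
    rw [eval, eval, h'.eq xGa, hf₂.eq _, h₁]
    push_cast; ring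
  · intro j μ' v h
    simpa [LeafAt] using h
  · refine ⟨by simpa using b2, by simp, fun g hg _ => ?_,
        fun z _ => by rw [hw₂, hv₂]; exact ⟨rfl, rfl⟩⟩
    unfold LeafAt
    rw [hw₂, hv₂]
    exact h g hg
  rintro g hg μ₃ hf₃ - ⟨i1, i2, i3, i4⟩
  have m3 : μ₃ xTm 0 = n := by rw [hf₃.eq _, m2]
  have k3 : μ₃ xTk 0 = (1 : ℕ) := by rw [hf₃.eq _, k2]; rfl
  refine Runs.seqX (R' := fun μ' => μ' xNb 0 = setAd n g) (.blockX hn ?_) fun μ₄ hf₄ b4 => ?_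
  · simp [run, i1, m3, setAd]; ring
  have hw₄ : μ₄ xWin = μ₃ xWin := hf₄.eq _
  have hv₄ : μ₄ xVal = μ₃ xVal := hf₄.eq _
  refine ((buildP_runs (leaf := lf g) (one_le_of_fact Q) hn b4 (by rw [hf₄.eq _, m3])
    (by rw [hf₄.eq _, k3]) fun p hp => ?_).upX).post ?_
  · rw [hw₄, hv₄]
    exact i3 g hg le_rfl p hp
  rintro μ₅ hf₅ ⟨T5, s5⟩
  have s : SameTrees μ₃ μ₅ (setAd n g) (2 * n * (1 : ℕ)) := (SameTrees.refl hw₄ hv₄).trans s5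
  refine ⟨by rw [hf₅.eq _, b4]; rfl, fun g' hg' => ?_, fun g' hg' hle p hp => ?_,
    fun z hz => ?_⟩
  · rcases Nat.lt_succ_iff_lt_or_eq.mp hg' with hlt | rfl
    · exact (i2 g' hlt).congr fun z z1 z2 => s z (setAd_sep (by omega) z1 z2)
    · exact T5
  · obtain ⟨r1, r2⟩ := leaf_range (nb := setAd n g') (κ := 1) hp
    exact ListAt.congr (i3 g' hg' (by omega) p hp) fun z z1 z2 => s z
      (setAd_sep (by omega) (r1.trans z1) (z2.trans_le r2))
  · obtain ⟨e1, e2⟩ := s z fun h => by have := setAd_neg h; omega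
    rw [e1, e2]
    exact i4 z hz

/-- The initialization program shows a best step and establishes the invariant of the update
program. The bound `Δ` occurs only in the analysis. -/
theorem initP_runs (h : I.IsInput b μ) (hn : 1 ≤ n) (ht : 1 ≤ t) (hk : 1 ≤ k) {Δ : ℕ} (hΔ : 2 ≤ Δ)
    (hI : I.EntriesLe Δ) (hS : ∀ δ, 2 ≤ δ → δ ≤ Δ → SmallSizes r s k δ Q) :
    Runs initP μ (Q ^ 30 * (n * t)) fun μ' => (∃ x, I.IsBestStep b x ∧ μ'.Shows x) ∧
      ∃ D : Setup, D.OK I Q ∧ D.Ready I b μ' := by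
  have hX : 1 ≤ n * t := Nat.mul_pos hn ht
  have hb : BoundsAt b μ :=
    ⟨fun i q => by exact_mod_cast h.lo_eq i q, fun i q => by exact_mod_cast h.up_eq i q⟩
  unfold initP
  refine Runs.seqX ((staticP_runs h hn ht hΔ hI hS).upX) ?_
  rintro μ₁ hf₁ ⟨δ, d1, d2, d3, hst₁⟩
  have hD := (hS δ d1 d2).ok hn ht hk d3
  set D := setupOf r s k δ
  have hb₁ := hb.congr hf₁.agree
  refine Runs.seqX ((unitTreesP_runs hD hst₁ hb₁).upX) ?_
  rintro μ₂ hf₂ ⟨T2, neg2⟩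
  have hst₂ := hst₁.congr hf₂.agree
  have hb₂ := hb₁.congr hf₂.agree
  refine Runs.seqX ((tablesP_runs hD hst₂ T2).upX) ?_
  rintro μ₃ hf₃ ⟨tab, htab₃, hok⟩
  have hst₃ := hst₂.congr hf₃.agree
  have hb₃ := hb₂.congr hf₃.agree
  refine Runs.seqX ((setLeavesP_runs hD hst₃ htab₃ fun z hz => ?_).upX) ?_
  · rw [hf₃.eq _, neg2 z hz, hf₁.eq _]
    exact h.zero_eq _ (by norm_num) z
  rintro μ₄ hf₄ ⟨l4, pos4⟩
  have hst₄ := hst₃.congr hf₄.agree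
  have hb₄ := hb₃.congr hf₄.agree
  have htab₄ := htab₃.congr hf₄.agree
  refine Runs.seqX ((setTreesP_runs hD hst₄ l4).upX) ?_
  rintro μ₅ hf₅ ⟨T5, pos5⟩
  have hst₅ := hst₄.congr hf₅.agree
  have hb₅ := hb₄.congr hf₅.agree
  have htab₅ := htab₄.congr hf₅.agree
  refine ((finalP_runs hD hst₅ htab₅ hok T5 fun z => ?_).raise hX).post ?_
  · rw [hf₅.eq _, hf₄.eq _, hf₃.eq _, hf₂.eq _,
      hf₁.eq _]
    exact h.zero_eq _ (by norm_num) z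
  rintro μ₆ hf₆ ⟨hx, hv⟩
  have hw : μ₆ xWin = μ₅ xWin := hf₆.eq _
  have hl : μ₆ xVal = μ₅ xVal := hf₆.eq _
  refine ⟨hx, D, hD, hst₅.congr hf₆.agree, hb₅.congr hf₆.agree,
    fun i hi y hy => (T2 i hi y hy).congr fun z z1 z2 => ?_,
    ⟨tab, htab₅.congr hf₆.agree, hok, ?_⟩, hv⟩
  · have hz : 0 ≤ z := le_trans (by positivity) z1
    obtain ⟨e1, e2⟩ := pos5 z hz
    obtain ⟨e3, e4⟩ := pos4 z hz
    rw [hw, hl, e1, e2, e3, e4, hf₃.eq _, hf₃.eq _]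
    exact ⟨rfl, rfl⟩
  · unfold SetTreesAt
    rw [hw, hl]; exact T5

end Init

/-! ### The running time -/

/-- The number of codes for the bound `δ` on the entries. -/
def numCodes (r s k δ : ℕ) : ℕ :=
  (k ^ 3 + 1) * ((2 * (k ^ 3 * δ) + 1) ^ r * (2 * digitBound (r + s) k δ + 1) ^ s)

theorem prod_digitRange (r s R₁ R₂ : ℕ) :
    ∏ i ∈ Finset.range (r + s), (2 * digitRange r R₁ R₂ i + 1) =
      (2 * R₁ + 1) ^ r * (2 * R₂ + 1) ^ s := by
  rw [Finset.prod_range_add]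
  congr 1
  · rw [Finset.prod_congr rfl fun i hi => by
      rw [digitRange, if_pos (Finset.mem_range.mp hi)], Finset.prod_const, Finset.card_range]
  · rw [Finset.prod_congr rfl fun i _ => by
      rw [digitRange, if_neg (by omega)], Finset.prod_const, Finset.card_range]

theorem numCodes_mono (r s k : ℕ) {δ Δ : ℕ} (h : δ ≤ Δ) : numCodes r s k δ ≤ numCodes r s k Δ := by
  unfold numCodes digitBound
  gcongr

theorem two_pow_clog_le {k : ℕ} (hk : 1 ≤ k) : 2 ^ Nat.clog 2 k ≤ 2 * k := by
  rcases hk.lt_or_eq with h | rfl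
  · have := Nat.pow_pred_clog_lt_self one_lt_two h
    rw [← Nat.succ_pred_eq_of_pos (Nat.clog_pos one_lt_two h), pow_succ]
    omega
  · simp

theorem smallSizes_of_numCodes_le {r s k δ Q : ℕ} (hr : 1 ≤ r) (hs : 1 ≤ s) (hk : 1 ≤ k)
    (hδ : 2 ≤ δ) (hQ : 1024 * numCodes r s k δ ≤ Q) : SmallSizes r s k δ Q := by
  have hK : 1 ≤ k ^ 3 + 1 := by omega
  set R := 2 * (k ^ 3 * δ) + 1 with hR
  set W := 2 * digitBound (r + s) k δ + 1 with hW
  have hRr : 1 ≤ R ^ r := Nat.one_le_pow _ _ (by omega)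
  have hWs : 1 ≤ W ^ s := Nat.one_le_pow _ _ (by omega)
  have hN : numCodes r s k δ = (k ^ 3 + 1) * (R ^ r * W ^ s) := rfl
  rw [hN] at hQ
  have hRW : 1 ≤ R ^ r * W ^ s := Nat.mul_pos hRr hWs
  have h1 : k ^ 3 + 1 ≤ (k ^ 3 + 1) * (R ^ r * W ^ s) := Nat.le_mul_of_pos_right _ hRW
  have h2 : R ^ r * W ^ s ≤ (k ^ 3 + 1) * (R ^ r * W ^ s) := Nat.le_mul_of_pos_left _ hK
  have h3 : R ≤ R ^ r * W ^ s :=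
    (Nat.le_self_pow (by omega) R).trans (Nat.le_mul_of_pos_right _ hWs)
  have h4 : W ≤ R ^ r * W ^ s :=
    (Nat.le_self_pow (by omega) W).trans (Nat.le_mul_of_pos_left _ hRr)
  have hp : 1 ≤ (2 * δ + 1) ^ (r + s) := Nat.one_le_pow _ _ (by omega)
  have h5 : (2 * δ + 1) ^ (r + s) ≤ digitBound (r + s) k δ :=
    (Nat.le_mul_of_pos_right _ (Nat.succ_pos _)).trans (Nat.le_mul_of_pos_right _ (by omega))
  have h6 : Nat.clog 2 k + 1 ≤ digitBound (r + s) k δ :=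
    (Nat.le_mul_of_pos_left _ hp).trans (Nat.le_mul_of_pos_right _ (by omega))
  have h7 : r + s < (2 * δ + 1) ^ (r + s) := Nat.lt_pow_self (by omega)
  have h8 : 2 * δ + 1 ≤ (2 * δ + 1) ^ (r + s) := Nat.le_self_pow (by omega) _
  have h9 : k ≤ k ^ 3 := Nat.le_self_pow (by omega) k
  have h10 : 2 ^ Nat.clog 2 k ≤ 2 * k := two_pow_clog_le hk
  refine ⟨by omega, by omega, by omega, by omega, by omega, by omega, ?_, ?_, ?_, ?_, by omega⟩
  · unfold codeBase; omega
  · change List.length _ ≤ Q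
    rw [length_stateList, prod_digitRange, ← hR, ← hW]; omega
  · change List.length _ ≤ Q
    rw [length_stateList, prod_digitRange, ← hR]
    have : (k + 1) * (R ^ r * (2 * 0 + 1) ^ s) ≤ (k ^ 3 + 1) * (R ^ r * W ^ s) := by
      gcongr; omega
    omega
  · change List.length _ ≤ Q
    rw [length_stateList, prod_digitRange]
    simp only [mul_zero, zero_add, one_pow, mul_one]
    omega

/-- This turns powers of `log k` into a factor that does not depend on `k` and a linear one. -/
theorem pow_self_le (x : ℕ) {s : ℕ} (hs : 1 ≤ s) : x ^ s ≤ 2 ^ s ^ 2 * 2 ^ x := by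
  have h1 : x ≤ s * (x / s + 1) := (Nat.lt_mul_div_succ x hs).le
  calc x ^ s ≤ (2 ^ s * 2 ^ (x / s)) ^ s := by
        gcongr
        exact h1.trans (Nat.mul_le_mul Nat.lt_two_pow_self.le Nat.lt_two_pow_self)
    _ = 2 ^ s ^ 2 * 2 ^ (x / s * s) := by rw [mul_pow, ← pow_mul, ← pow_mul, sq]
    _ ≤ 2 ^ s ^ 2 * 2 ^ x := by
        gcongr
        · norm_num
        · exact Nat.div_mul_le_self x s

/-- The number of codes obeys the claimed bound. -/
theorem numCodes_le {r s k Δ : ℕ} (hr : 1 ≤ r) (hs : 1 ≤ s) (hk : 1 ≤ k) (hΔ : 2 ≤ Δ) :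
    1024 * numCodes r s k Δ ≤ k ^ (7 * r) * Δ ^ (20 * (r ^ 2 + s ^ 2)) := by
  have hΔ1 : 1 ≤ Δ := by omega
  have h3 : 3 ≤ Δ ^ 2 := by nlinarith
  have h5 : 2 * Δ + 1 ≤ Δ ^ 3 := by nlinarith [Nat.mul_le_mul hΔ hΔ, sq_nonneg Δ]
  have hk3 : 1 ≤ k ^ 3 := Nat.one_le_pow _ _ hk
  have e1 : k ^ 3 + 1 ≤ k ^ (3 * r) * Δ := by
    have : k ^ 3 ≤ k ^ (3 * r) := Nat.pow_le_pow_right hk (by omega)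
    nlinarith
  have e2 : (2 * (k ^ 3 * Δ) + 1) ^ r ≤ k ^ (3 * r) * Δ ^ (3 * r) := by
    calc (2 * (k ^ 3 * Δ) + 1) ^ r ≤ (k ^ 3 * Δ ^ 3) ^ r := by
          gcongr
          have := Nat.mul_pos hk3 hΔ1
          calc 2 * (k ^ 3 * Δ) + 1 ≤ 3 * (k ^ 3 * Δ) := by omega
            _ ≤ Δ ^ 2 * (k ^ 3 * Δ) := by gcongr
            _ = k ^ 3 * Δ ^ 3 := by ring
      _ = _ := by rw [mul_pow, ← pow_mul, ← pow_mul]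
  set x := Nat.clog 2 k + 1 with hx
  have ex : x ^ s ≤ Δ ^ s ^ 2 * (Δ ^ 2 * k ^ r) := by
    refine (pow_self_le x hs).trans ?_
    have h4 : 2 ^ x ≤ 2 ^ 2 * k := by
      rw [hx, pow_succ]; have := two_pow_clog_le hk; omega
    calc 2 ^ s ^ 2 * 2 ^ x ≤ 2 ^ s ^ 2 * (2 ^ 2 * k) := by gcongr
      _ ≤ Δ ^ s ^ 2 * (Δ ^ 2 * k ^ r) := by
        gcongr
        exact Nat.le_self_pow (by omega) k
  have e3 : (2 * digitBound (r + s) k Δ + 1) ^ s ≤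
      Δ ^ (3 * ((r + s) * s) + s ^ 2 + 3 * s + 2) * k ^ r := by
    have : 1 ≤ digitBound (r + s) k Δ :=
      Nat.mul_pos (Nat.mul_pos (Nat.pow_pos (by omega)) (by omega)) hΔ1
    calc (2 * digitBound (r + s) k Δ + 1) ^ s ≤ (Δ ^ 2 * ((Δ ^ 3) ^ (r + s) * x * Δ)) ^ s := by
          gcongr
          calc 2 * digitBound (r + s) k Δ + 1 ≤ 3 * digitBound (r + s) k Δ := by omega
            _ ≤ Δ ^ 2 * ((Δ ^ 3) ^ (r + s) * x * Δ) := by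
              unfold digitBound
              gcongr
      _ = Δ ^ (3 * ((r + s) * s) + 3 * s) * x ^ s := by ring_nf
      _ ≤ Δ ^ (3 * ((r + s) * s) + 3 * s) * (Δ ^ s ^ 2 * (Δ ^ 2 * k ^ r)) := by gcongr
      _ = _ := by ring
  calc 1024 * numCodes r s k Δ
      ≤ Δ ^ 10 * (k ^ (3 * r) * Δ * (k ^ (3 * r) * Δ ^ (3 * r) *
        (Δ ^ (3 * ((r + s) * s) + s ^ 2 + 3 * s + 2) * k ^ r))) := by
        unfold numCodes
        gcongr
        exact (by norm_num : 1024 ≤ 2 ^ 10).trans (Nat.pow_le_pow_left hΔ 10)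
    _ = k ^ (7 * r) * Δ ^ (13 + 3 * r + 3 * ((r + s) * s) + s ^ 2 + 3 * s) := by ring
    _ ≤ _ := by
        gcongr
        nlinarith [sq_nonneg ((r : ℤ) - s), two_mul_le_add_sq r s]

theorem mainTheorem4 :
    ∃ (init upd : RamProg) (C : ℕ),
      ∀ (n r s t k Δ : ℕ), 1 ≤ n → 1 ≤ r → 1 ≤ s → 1 ≤ t → 1 ≤ k → 2 ≤ Δ →
      ∀ (I : NFoldInstance n r s t k),
        (∀ i p q, |I.A i p q| ≤ (Δ : ℤ)) → (∀ i p q, |I.B i p q| ≤ (Δ : ℤ)) →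
      ∀ (b : StepBounds n t) (μ₀ : RamMemory), I.IsInput b μ₀ →
        ∃ (T : ℕ) (μ : RamMemory),
          RamExec init μ₀ T μ ∧
          T ≤ k ^ (C * r) * Δ ^ (C * (r ^ 2 + s ^ 2)) * (n * t) ∧
          (∃ x, I.IsBestStep b x ∧ μ.Shows x) ∧
          ∀ ws : List (BoundChange n t),
            I.Maintains upd (k ^ (C * r) * Δ ^ (C * (r ^ 2 + s ^ 2)) * (Nat.log 2 (n * t) + 1))
              b μ ws := by
  -- `600` is `20 * 30`: the exponent of `Δ` in `numCodes_le` times that of `Q` in the running time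
  refine ⟨initP, updP, 600, ?_⟩
  intro n r s t k Δ hn hr hs ht hk hΔ I hA hB b μ₀ hμ₀
  have hnt : 1 ≤ n * t := Nat.mul_pos hn ht
  have hV : 1 ≤ numCodes r s k Δ := Nat.mul_pos (Nat.succ_pos _)
    (Nat.mul_pos (Nat.pow_pos (Nat.succ_pos _)) (Nat.pow_pos (Nat.succ_pos _)))
  set Q := 1024 * numCodes r s k Δ with hQ
  have : Fact (1024 ≤ Q) := ⟨by omega⟩
  have hpow : ∀ e ≤ 30, Q ^ e ≤ k ^ (600 * r) * Δ ^ (600 * (r ^ 2 + s ^ 2)) := fun e he => by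
    calc Q ^ e ≤ Q ^ 30 := Nat.pow_le_pow_right (by omega) he
      _ ≤ (k ^ (7 * r) * Δ ^ (20 * (r ^ 2 + s ^ 2))) ^ 30 :=
        Nat.pow_le_pow_left (numCodes_le hr hs hk hΔ) 30
      _ = k ^ (7 * r * 30) * Δ ^ (20 * (r ^ 2 + s ^ 2) * 30) := by
        rw [mul_pow, ← pow_mul, ← pow_mul]
      _ ≤ _ := Nat.mul_le_mul (Nat.pow_le_pow_right hk (by omega))
        (Nat.pow_le_pow_right (by omega) (by omega))
  obtain ⟨T, μ, hexec, hT, hbest, D, hD, hready⟩ := initP_runs hμ₀ hn ht hk hΔ ⟨hA, hB⟩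
    (Q := Q) fun δ h2 h => smallSizes_of_numCodes_le hr hs hk h2
      (Nat.mul_le_mul_left _ (numCodes_mono r s k h))
  refine ⟨T, μ, hexec, hT.trans (Nat.mul_le_mul_right _ (hpow 30 le_rfl)), hbest, fun ws => ?_⟩
  exact maintains_of_ready hD (Nat.mul_le_mul_right _ (hpow 27 (by norm_num))) ws hready
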